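/- Let $G \rightrightarrows M$ be a Lie groupoid with source $s$, target $t$, unit $u$, inversion $i$, and let $A \Rightarrow M$ be its Lie algebroid: $A = \ker ds|_M$, with anchor $\rho_A = dt|_A$ and with the bracket $[-,-]_A$ on $\Gamma(A)$ induced by right invariant vector fields. Let $U : TM \to A$ be a vector bundle map, and let $\delta U = \overrightarrow U + \overleftarrow U$ be the $(1,1)$ tensor on $G$ given by $$\overrightarrow U_g = dR_g \circ U_{t(g)} \circ dt, \qquad \overleftarrow U_g = dL_g \circ di \circ U_{s(g)} \circ ds .$$ Linear $(1,1)$ tensors $T$ on the total space $A$, and $(1,1)$ tensors $T$ of internal degree $0$ on the graded manifold $A[1]$ (whose functions are the sections of $\Lambda A^*$), are encoded by triples $(\mathcal D, \ell, T^M)$, where $\ell : A \to A$ is a vector bundle map, $T^M$ is a $(1,1)$ tensor on $M$ and $\mathcal D : \Gamma(A) \to \Omega^1(M, A)$ is an additive operator with $\mathcal D(fa) = f\mathcal D(a) + df \otimes \ell(a) - \langle df, T^M\rangle \otimes a$. The triple is determined by the conditions that $T^M$ is the $M$-projection of $T$ and that, for all $a \in \Gamma(A)$, $$T a^\uparrow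 = \ell(a)^\uparrow, \qquad \mathcal L_{a^\uparrow} T = \mathcal D(a)^\uparrow .$$ Here $a^\uparrow$ is the vertical lift of $a$ (on $A[1]$: contraction with $a$). For a vector bundle map $B : TM \to A$, the tensor $B^\uparrow$ on $A$ sends a tangent vector $\xi$ to the vertical lift of $B(d\pi\, \xi)$, with $\pi : A \to M$ the projection; on $A[1]$, $B^\uparrow$ is the unique $(1,1)$ tensor of internal degree $-1$ with $B^\uparrow(X) = B(\sigma)^\uparrow$ for every degree $0$ vector field $X$ on $A[1]$ acting on $C^\infty(M)$ as $\sigma \in \mathfrak X(M)$. A $(1,1)$ tensor of internal degree $k$ on $A[1]$ is regarded as a graded endomorphism of the module of vector fields (graded derivations of $\Gamma(\Lambda A^*)$), with $T(\alpha X) = (-1)^{k|\alpha|}\alpha\, T(X)$ and $\mathcal L_Q T = [Q, T(-)] - (-1)^{|Q|k}\, T([Q,-])$. For a linear $(1,1)$ tensor $T$ on $A$, $T^{[1]}$ denotes the $(1,1)$ tensor of internal degree $0$ on $A[1]$ with the same triple. Let $d_A$ be the Lie algebroid De Rham differential, seen as a vector field of degree $1$ on $A[1]$, and let $\dot{(\delta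 U)}$ be the $(1,1)$ tensor on $A$ obtained by differentiating $\delta U$, i.e. the restriction of $d(\delta U) : TTG \to TTG$ to the Lie algebroid of the tangent groupoid $TG \rightrightarrows TM$, identified with $TA$ by the canonical flip of $TTG$. Then $\dot{(\delta U)}$ (on $A$) and $\mathcal L_{d_A} U^\uparrow$ (on $A[1]$) are well defined, and both correspond to the triple $$\mathcal D(a) = \mathcal L^A_a U, \qquad \ell = U \circ \rho_A, \qquad T^M = \rho_A \circ U \qquad (a \in \Gamma(A)),$$ where $(\mathcal L^A_a U)(X) = [a, UX]_A - U[\rho_A(a), X]$ for all $X \in \mathfrak X(M)$. Moreover $\mathcal L_{d_A} U^\uparrow$ is the only $(1,1)$ tensor of internal degree $0$ on $A[1]$ with the triple of $\dot{(\delta U)}$, that is, $$\dot{(\delta U)}{}^{[1]} = \mathcal L_{d_A} U^\uparrow .$$ -/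

import Mathlib

open scoped Manifold ContDiff Bundle
open Bundle
set_option linter.unusedSectionVars false
set_option linter.unusedSimpArgs false

noncomputable section

/-! ## Graded functions, vector fields and `(1,1)` tensors on `A[1]`, algebraically

Below `R` stands for `C^∞(M)` and `L` for the `C^∞(M)`-module `Γ(A)` of sections of a vector bundle
`A → M`. A graded function on `A[1]`, i.e. a section of `Λ A^*`, is a `C^∞(M)`-multilinear
alternating function of finitely many sections. All form degrees are collected in one function on
finite lists of sections: its restriction to the lists of length `k` is the component of degree `k`.
-/

namespace GradedForms

section Raw
variable {R L : Type*} [CommRing R]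

/-- Grade involution: multiplication by `(-1)^k` in degree `k`. -/
def inv (α : List L → R) : List L → R := fun l => (-1) ^ l.length * α l

/-- Contraction `ι_a` (insertion of `a` in the first slot). -/
def ins (a : L) (α : List L → R) : List L → R := fun l => α (a :: l)

/-- The wedge product, `(α ∧ β)(a₁, …, aₙ) = ∑ ± α(a_S) β(a_{S'})`, the sum over all splittings
(unshuffles) of the list with the sign of the unshuffle. It is written recursively as
`ι_a (α ∧ β) = ι_a α ∧ β + (-1)^{|α|} α ∧ ι_a β`; e.g. `(θ ∧ η)(a, b) = θ(a) η(b) - θ(b) η(a)`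
in degree one. -/
def wedge : (List L → R) → (List L → R) → List L → R
  | α, β, [] => α [] * β []
  | α, β, a :: l => wedge (ins a α) β l + wedge (inv α) (ins a β) l

theorem ins_inv (a : L) (α : List L → R) : ins a (inv α) = -inv (ins a α) := by
  funext l; simp [ins, inv, pow_succ]

theorem inv_inv (α : List L → R) : inv (inv α) = α := by
  funext l; simp [inv, ← mul_assoc, ← mul_pow]

theorem inv_add (α β : List L → R) : inv (α + β) = inv α + inv β := by
  funext l; simp [inv, mul_add]

theorem inv_smul (f : R) (α : List L → R) : inv (f • α) = f • inv α := by
  funext l; simp [inv]; ring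

theorem inv_neg (α : List L → R) : inv (-α) = -inv α := by
  funext l; simp [inv]

theorem wedge_add_left (α α' β : List L → R) :
    wedge (α + α') β = wedge α β + wedge α' β := by
  funext l
  induction l generalizing α α' β with
  | nil => simp [wedge, add_mul]
  | cons a l ih =>
    have h : ins a (α + α') = ins a α + ins a α' := rfl
    simp only [wedge, h, inv_add, ih, Pi.add_apply]; ring

theorem wedge_add_right (α β β' : List L → R) :
    wedge α (β + β') = wedge α β + wedge α β' := by
  funext l
  induction l generalizing α β β' with
  | nil => simp [wedge, mul_add]
  | cons a l ih =>
    have h : ins a (β + β') = ins a β + ins a β' := rfl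
    simp only [wedge, h, ih, Pi.add_apply]; ring

theorem wedge_smul_left (f : R) (α β : List L → R) :
    wedge (f • α) β = f • wedge α β := by
  funext l
  induction l generalizing α β with
  | nil => simp [wedge, mul_assoc]
  | cons a l ih =>
    have h : ins a (f • α) = f • ins a α := rfl
    simp only [wedge, h, inv_smul, ih, Pi.smul_apply, smul_eq_mul]; ring

theorem wedge_smul_right (f : R) (α β : List L → R) :
    wedge α (f • β) = f • wedge α β := by
  funext l
  induction l generalizing α β with
  | nil => simp [wedge]; ring
  | cons a l ih =>
    have h : ins a (f • β) = f • ins a β := rfl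
    simp only [wedge, h, ih, Pi.smul_apply, smul_eq_mul]; ring

theorem wedge_neg_left (α β : List L → R) : wedge (-α) β = -wedge α β := by
  have := wedge_smul_left (-1) α β; simpa using this

theorem wedge_neg_right (α β : List L → R) : wedge α (-β) = -wedge α β := by
  have := wedge_smul_right (-1) α β; simpa using this

theorem wedge_units_smul_left (s : ℤˣ) (α β : List L → R) :
    wedge (s • α) β = s • wedge α β := by
  rcases Int.units_eq_one_or s with h | h <;> simp [h, wedge_neg_left]

theorem wedge_units_smul_right (s : ℤˣ) (α β : List L → R) :
    wedge α (s • β) = s • wedge α β := by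
  rcases Int.units_eq_one_or s with h | h <;> simp [h, wedge_neg_right]

theorem wedge_zero_left (β : List L → R) : wedge 0 β = 0 := by
  have := wedge_smul_left 0 0 β; simpa using this

theorem wedge_zero_right (α : List L → R) : wedge α 0 = 0 := by
  have := wedge_smul_right 0 α 0; simpa using this

/-- A ring element as a function of degree `0`. -/
def constForm (f : R) : List L → R
  | [] => f
  | _ => 0

theorem ins_constForm (a : L) (f : R) : ins a (constForm f) = 0 := by
  funext l; simp [ins, constForm]

theorem inv_constForm (f : R) : inv (constForm f : List L → R) = constForm f := by
  funext l
  match l with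
  | [] => simp [inv, constForm]
  | _ :: _ => simp [inv, constForm]

theorem wedge_constForm (f : R) (β : List L → R) : wedge (constForm f) β = f • β := by
  funext l
  induction l generalizing β with
  | nil => simp [wedge, constForm]
  | cons a l ih => simp [wedge, ins_constForm, inv_constForm, wedge_zero_left, ih, ins]

theorem ins_wedge (a : L) (α β : List L → R) :
    ins a (wedge α β) = wedge (ins a α) β + wedge (inv α) (ins a β) := rfl

theorem inv_wedge (α β : List L → R) : inv (wedge α β) = wedge (inv α) (inv β) := by
  funext l
  induction l generalizing α β with
  | nil => simp [wedge, inv]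
  | cons a l ih =>
    have h1 := ih (ins a α) β
    have h2 := ih (inv α) (ins a β)
    simp only [wedge, ins_inv, wedge_neg_left, wedge_neg_right, Pi.neg_apply]
    rw [← h1, ← h2]
    simp only [inv, wedge, List.length_cons, pow_succ]
    ring

theorem wedge_assoc (α β γ : List L → R) :
    wedge (wedge α β) γ = wedge α (wedge β γ) := by
  funext l
  induction l generalizing α β γ with
  | nil => simp [wedge, mul_assoc]
  | cons a l ih =>
    simp only [wedge, ins_wedge, inv_wedge, wedge_add_left, wedge_add_right, Pi.add_apply, ih]
    ring

variable (k j : ℤ)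
/-- Homogeneity of degree `k` (not yet assuming that `α` is a form). -/
def HomogRaw (k : ℤ) (α : List L → R) : Prop := ∀ l : List L, (l.length : ℤ) ≠ k → α l = 0

theorem HomogRaw.ins {k : ℤ} {α : List L → R} (h : HomogRaw k α) (a : L) :
    HomogRaw (k - 1) (ins a α) := by
  intro l hl; apply h; simp; omega

theorem HomogRaw.inv {k : ℤ} {α : List L → R} (h : HomogRaw k α) :
    HomogRaw k (inv α) := by
  intro l hl; simp [GradedForms.inv, h l hl]

theorem HomogRaw.wedge {k j : ℤ} {α β : List L → R} (hα : HomogRaw k α) (hβ : HomogRaw j β) :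
    HomogRaw (k + j) (wedge α β) := by
  intro l
  induction l generalizing α β k j with
  | nil =>
    intro hl
    by_cases hk : k = 0
    · have : β [] = 0 := hβ [] (by simp at hl ⊢; omega)
      simp [GradedForms.wedge, this]
    · have : α [] = 0 := hα [] (by simp; omega)
      simp [GradedForms.wedge, this]
  | cons a l ih =>
    intro hl
    simp only [GradedForms.wedge]
    rw [ih (hα.ins a) hβ (by simp at hl; omega), ih hα.inv (hβ.ins a) (by simp at hl; omega)]
    simp

theorem inv_eq_of_homog {k : ℤ} {α : List L → R} (h : HomogRaw k α) :
    inv α = k.negOnePow • α := by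
  funext l
  by_cases hl : (l.length : ℤ) = k
  · subst hl
    rcases Nat.even_or_odd l.length with he | ho
    · have : ((l.length : ℕ) : ℤ).negOnePow = 1 := Int.negOnePow_even _ (by exact_mod_cast he)
      simp [inv, this, he.neg_one_pow]
    · have : ((l.length : ℕ) : ℤ).negOnePow = -1 := Int.negOnePow_odd _ (by exact_mod_cast ho)
      simp [inv, this, ho.neg_one_pow]
  · simp [inv, h l hl]

/-- Graded commutativity. -/
theorem wedge_comm {k j : ℤ} {α β : List L → R} (hα : HomogRaw k α) (hβ : HomogRaw j β) :
    wedge α β = (k * j).negOnePow • wedge β α := by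
  have key : ∀ (l : List L) (k j : ℤ) (α β : List L → R), HomogRaw k α → HomogRaw j β →
      wedge α β l = (k * j).negOnePow • wedge β α l := by
    intro l
    induction l with
    | nil =>
      intro k j α β hα hβ
      by_cases hk : k = 0
      · simp [wedge, hk, mul_comm]
      · have : α [] = 0 := hα [] (by simp; omega)
        simp [wedge, this]
    | cons a l ih =>
      intro k j α β hα hβ
      simp only [wedge]
      rw [inv_eq_of_homog hα, inv_eq_of_homog hβ, ih _ _ _ _ (hα.ins a) hβ]
      rw [wedge_units_smul_left, wedge_units_smul_left]
      simp only [Pi.smul_apply]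
      rw [ih _ _ _ _ hα (hβ.ins a)]
      have e1 : (k - 1) * j = k * j - j := by ring
      have e2 : k * (j - 1) = k * j - k := by ring
      rw [e1, e2, Int.negOnePow_sub, Int.negOnePow_sub]
      rcases Int.units_eq_one_or k.negOnePow with h | h <;>
      rcases Int.units_eq_one_or j.negOnePow with h' | h' <;>
      rcases Int.units_eq_one_or (k * j).negOnePow with h'' | h'' <;>
      simp [h, h', h''] <;> ring
  funext l; exact key l k j α β hα hβ

variable [AddCommGroup L] [Module R L]

/-- `α` is `R`-multilinear and alternating on the lists of each given length. -/
def IsForm (α : List L → R) : Prop :=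
  (∀ l₁ l₂ a b, α (l₁ ++ (a + b) :: l₂) = α (l₁ ++ a :: l₂) + α (l₁ ++ b :: l₂)) ∧
  (∀ l₁ l₂ (f : R) a, α (l₁ ++ (f • a) :: l₂) = f * α (l₁ ++ a :: l₂)) ∧
  (∀ l₁ l₂ a, α (l₁ ++ a :: a :: l₂) = 0)

theorem IsForm.ins {α : List L → R} (h : IsForm α) (a : L) : IsForm (ins a α) :=
  ⟨fun l₁ l₂ b c => h.1 (a :: l₁) l₂ b c, fun l₁ l₂ f b => h.2.1 (a :: l₁) l₂ f b,
    fun l₁ l₂ b => h.2.2 (a :: l₁) l₂ b⟩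

theorem IsForm.add {α β : List L → R} (h : IsForm α) (h' : IsForm β) : IsForm (α + β) := by
  refine ⟨fun l₁ l₂ b c => ?_, fun l₁ l₂ f b => ?_, fun l₁ l₂ b => ?_⟩
  · simp only [Pi.add_apply, h.1, h'.1]; ring
  · simp only [Pi.add_apply, h.2.1, h'.2.1]; ring
  · simp only [Pi.add_apply, h.2.2, h'.2.2, add_zero]

theorem IsForm.smul {α : List L → R} (h : IsForm α) (g : R) : IsForm (g • α) := by
  refine ⟨fun l₁ l₂ b c => ?_, fun l₁ l₂ f b => ?_, fun l₁ l₂ b => ?_⟩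
  · simp only [Pi.smul_apply, h.1, smul_eq_mul]; ring
  · simp only [Pi.smul_apply, h.2.1, smul_eq_mul]; ring
  · simp only [Pi.smul_apply, h.2.2, smul_zero]

theorem IsForm.zero : IsForm (0 : List L → R) := by
  refine ⟨fun _ _ _ _ => ?_, fun _ _ _ _ => ?_, fun _ _ _ => ?_⟩ <;> simp

theorem IsForm.ins_add {α : List L → R} (h : IsForm α) (a b : L) :
    GradedForms.ins (a + b) α = GradedForms.ins a α + GradedForms.ins b α :=
  funext fun l => h.1 [] l a b

theorem IsForm.ins_smul {α : List L → R} (h : IsForm α) (f : R) (a : L) :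
    GradedForms.ins (f • a) α = f • GradedForms.ins a α :=
  funext fun l => h.2.1 [] l f a

theorem IsForm.ins_ins {α : List L → R} (h : IsForm α) (a : L) :
    GradedForms.ins a (GradedForms.ins a α) = 0 :=
  funext fun l => h.2.2 [] l a

theorem IsForm.swap {α : List L → R} (h : IsForm α) (a b : L) (l : List L) :
    α (a :: b :: l) = - α (b :: a :: l) := by
  have h0 := h.2.2 [] l (a + b)
  have h1 := h.1 [] ((a + b) :: l) a b
  have h2 := h.1 [a] l a b
  have h3 := h.1 [b] l a b
  have h4 := h.2.2 [] l a
  have h5 := h.2.2 [] l b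
  simp only [List.nil_append, List.cons_append] at h0 h1 h2 h3 h4 h5
  linear_combination h0 - h1 - h2 - h3 - h4 - h5

/-- A criterion for being a form in terms of contractions. -/
theorem IsForm.of_ins {α : List L → R} (h : ∀ a, IsForm (GradedForms.ins a α))
    (h1 : ∀ a b, GradedForms.ins (a + b) α = GradedForms.ins a α + GradedForms.ins b α)
    (h2 : ∀ (f : R) a, GradedForms.ins (f • a) α = f • GradedForms.ins a α)
    (h3 : ∀ a, GradedForms.ins a (GradedForms.ins a α) = 0) : IsForm α := by
  refine ⟨fun l₁ l₂ a b => ?_, fun l₁ l₂ f a => ?_, fun l₁ l₂ a => ?_⟩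
  · cases l₁ with
    | nil => exact congrFun (h1 a b) l₂
    | cons c l => exact (h c).1 l l₂ a b
  · cases l₁ with
    | nil => exact congrFun (h2 f a) l₂
    | cons c l => exact (h c).2.1 l l₂ f a
  · cases l₁ with
    | nil => exact congrFun (h3 a) l₂
    | cons c l => exact (h c).2.2 l l₂ a

theorem IsForm.inv {α : List L → R} (h : IsForm α) : IsForm (inv α) := by
  refine ⟨fun l₁ l₂ b c => ?_, fun l₁ l₂ f b => ?_, fun l₁ l₂ b => ?_⟩
  · simp only [GradedForms.inv, h.1, List.length_append, List.length_cons]; ring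
  · simp only [GradedForms.inv, h.2.1, List.length_append, List.length_cons]; ring
  · simp only [GradedForms.inv, h.2.2, mul_zero]

theorem IsForm.wedge {α β : List L → R} (hα : IsForm α) (hβ : IsForm β) :
    IsForm (wedge α β) := by
  have key : ∀ (n : ℕ) (l₁ : List L), l₁.length = n → ∀ α β : List L → R, IsForm α → IsForm β →
     (∀ l₂ a b, GradedForms.wedge α β (l₁ ++ (a + b) :: l₂)
        = GradedForms.wedge α β (l₁ ++ a :: l₂) + GradedForms.wedge α β (l₁ ++ b :: l₂)) ∧
     (∀ l₂ (f : R) a, GradedForms.wedge α β (l₁ ++ (f • a) :: l₂)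
        = f * GradedForms.wedge α β (l₁ ++ a :: l₂)) ∧
     (∀ l₂ a, GradedForms.wedge α β (l₁ ++ a :: a :: l₂) = 0) := by
    intro n l₁ _
    induction l₁ generalizing n with
    | nil =>
      intro α β hα hβ
      refine ⟨fun l₂ a b => ?_, fun l₂ f a => ?_, fun l₂ a => ?_⟩
      · simp only [List.nil_append, GradedForms.wedge, hα.ins_add, hβ.ins_add, wedge_add_left,
          wedge_add_right, Pi.add_apply]; ring
      · simp only [List.nil_append, GradedForms.wedge, hα.ins_smul, hβ.ins_smul, wedge_smul_left,
          wedge_smul_right, Pi.smul_apply, smul_eq_mul]; ring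
      · simp only [List.nil_append, GradedForms.wedge, hα.ins_ins, hβ.ins_ins, wedge_zero_left,
          wedge_zero_right, ins_inv, wedge_neg_left, Pi.neg_apply, Pi.zero_apply]; ring
    | cons c l ih =>
      intro α β hα hβ
      obtain ⟨p1, p2, p3⟩ := ih _ rfl _ _ (hα.ins c) hβ
      obtain ⟨q1, q2, q3⟩ := ih _ rfl _ _ hα.inv (hβ.ins c)
      refine ⟨fun l₂ a b => ?_, fun l₂ f a => ?_, fun l₂ a => ?_⟩
      · simp only [List.cons_append, GradedForms.wedge, p1, q1]; ring
      · simp only [List.cons_append, GradedForms.wedge, p2, q2]; ring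
      · simp only [List.cons_append, GradedForms.wedge, p3, q3]; ring
  exact ⟨fun l₁ => (key _ l₁ rfl α β hα hβ).1, fun l₁ => (key _ l₁ rfl α β hα hβ).2.1,
    fun l₁ => (key _ l₁ rfl α β hα hβ).2.2⟩


end Raw

/-- A Lie-Rinehart structure on the pair `(R, L)`, as data: a Lie bracket and an anchor. -/
structure LieRinehart (R L : Type*) [CommRing R] [Algebra ℝ R] [AddCommGroup L] [Module R L]
    [Module ℝ L] where
  act : L →ₗ[R] Derivation ℝ R R
  br : L →ₗ[ℝ] L →ₗ[ℝ] L
  br_self : ∀ a, br a a = 0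
  jacobi : ∀ a b c, br a (br b c) = br (br a b) c + br b (br a c)
  leibniz : ∀ (a : L) (f : R) (b : L), br a (f • b) = f • br a b + act a f • b

section Cartan
variable {R L : Type*} [CommRing R] [Algebra ℝ R] [AddCommGroup L] [Module R L] [Module ℝ L]
  (P : LieRinehart R L)

theorem LieRinehart.br_swap (a b : L) : P.br a b = -P.br b a := by
  have h := P.br_self (a + b)
  simp only [map_add, LinearMap.add_apply, P.br_self, zero_add, add_zero] at h
  rw [add_comm] at h
  exact eq_neg_of_add_eq_zero_left h |>.trans rfl

theorem LieRinehart.br_smul_left (f : R) (a b : L) :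
    P.br (f • a) b = f • P.br a b - P.act b f • a := by
  rw [P.br_swap, P.leibniz, P.br_swap b a]; module

/-- The Lie derivative of a form along a section:
`(L_a α)(b₁, …, bₖ) = ρ(a)(α(b₁, …, bₖ)) - ∑ᵢ α(b₁, …, [a, bᵢ], …, bₖ)`. -/
def lieForm (a : L) : (List L → R) → List L → R
  | α, [] => P.act a (α [])
  | α, b :: l => lieForm a (ins b α) l - α (P.br a b :: l)

/-- The Chevalley-Eilenberg-De Rham differential, written recursively through
`ι_a d = L_a - d ι_a`. Thus `(d f)(a) = ρ(a) f`,
`(d θ)(a, b) = ρ(a)(θ(b)) - ρ(b)(θ(a)) - θ([a, b])`, and so on. -/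
def dForm : (List L → R) → List L → R
  | _, [] => 0
  | α, a :: l => lieForm P a α l - dForm (ins a α) l

/-- `b ↦ ρ(b) f`, as a raw one-form. -/
def diffFun (f : R) : List L → R
  | [b] => P.act b f
  | _ => 0

theorem ins_lieForm (a b : L) (α : List L → R) :
    ins b (lieForm P a α) = lieForm P a (ins b α) - ins (P.br a b) α := rfl

theorem ins_dForm (a : L) (α : List L → R) :
    ins a (dForm P α) = lieForm P a α - dForm P (ins a α) := rfl

theorem lieForm_add (a : L) (α β : List L → R) :
    lieForm P a (α + β) = lieForm P a α + lieForm P a β := by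
  funext l
  induction l generalizing α β with
  | nil => simp [lieForm]
  | cons b l ih =>
    have h : ins b (α + β) = ins b α + ins b β := rfl
    simp only [lieForm, h, ih, Pi.add_apply]; ring

theorem dForm_add (α β : List L → R) : dForm P (α + β) = dForm P α + dForm P β := by
  funext l
  induction l generalizing α β with
  | nil => simp [dForm]
  | cons b l ih =>
    have h : ins b (α + β) = ins b α + ins b β := rfl
    simp only [dForm, h, ih, lieForm_add, Pi.add_apply]; ring

theorem lieForm_mul (a : L) (f : R) (α : List L → R) :
    lieForm P a (f • α) = f • lieForm P a α + P.act a f • α := by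
  funext l
  induction l generalizing α with
  | nil => simp [lieForm]; ring
  | cons b l ih =>
    have h : ins b (f • α) = f • ins b α := rfl
    simp only [lieForm, h, ih, Pi.add_apply, Pi.smul_apply, smul_eq_mul, ins]; ring

theorem lieForm_smul (a : L) (r : ℝ) (α : List L → R) :
    lieForm P a (r • α) = r • lieForm P a α := by
  have h : r • α = algebraMap ℝ R r • α := by funext l; simp [Algebra.smul_def]
  rw [h, lieForm_mul]; funext l; simp [Algebra.smul_def]

theorem dForm_smul (r : ℝ) (α : List L → R) : dForm P (r • α) = r • dForm P α := by
  funext l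
  induction l generalizing α with
  | nil => simp [dForm]
  | cons b l ih =>
    have h : ins b (r • α) = r • ins b α := rfl
    simp only [dForm, h, ih, lieForm_smul, Pi.smul_apply, smul_sub]

theorem lieForm_neg (a : L) (α : List L → R) : lieForm P a (-α) = -lieForm P a α := by
  have := lieForm_smul P a (-1) α; simpa using this

theorem dForm_neg (α : List L → R) : dForm P (-α) = -dForm P α := by
  have := dForm_smul P (-1) α; simpa using this

theorem lieForm_zero (a : L) : lieForm P a 0 = 0 := by
  have := lieForm_smul P a 0 0; simpa using this

theorem dForm_zero : dForm P 0 = 0 := by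
  have := dForm_smul P 0 0; simpa using this

theorem lieForm_inv (a : L) (α : List L → R) : lieForm P a (inv α) = inv (lieForm P a α) := by
  funext l
  induction l generalizing α with
  | nil => simp [lieForm, inv]
  | cons b l ih =>
    have ih' := ih (ins b α)
    simp only [lieForm, ins_inv, lieForm_neg, Pi.neg_apply, ih']
    simp only [inv, lieForm, List.length_cons, pow_succ]; ring

theorem dForm_inv (α : List L → R) : dForm P (inv α) = -inv (dForm P α) := by
  funext l
  induction l generalizing α with
  | nil => simp [dForm, inv]
  | cons b l ih =>
    have ih' := ih (ins b α)
    simp only [dForm, ins_inv, lieForm_inv, dForm_neg, Pi.neg_apply, ih']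
    simp only [inv, dForm, List.length_cons, pow_succ]
    ring

theorem lieForm_wedge (a : L) (α β : List L → R) :
    lieForm P a (wedge α β) = wedge (lieForm P a α) β + wedge α (lieForm P a β) := by
  funext l
  induction l generalizing α β with
  | nil => simp [lieForm, wedge]; ring
  | cons b l ih =>
    simp only [lieForm, ins_wedge, lieForm_add, Pi.add_apply, ih, lieForm_inv, wedge, ins_lieForm]
    simp only [sub_eq_add_neg, wedge_add_left, wedge_add_right, wedge_neg_left, wedge_neg_right,
      Pi.add_apply, Pi.neg_apply]
    ring

theorem dForm_wedge (α β : List L → R) :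
    dForm P (wedge α β) = wedge (dForm P α) β + wedge (inv α) (dForm P β) := by
  funext l
  induction l generalizing α β with
  | nil => simp [dForm, wedge]
  | cons a l ih =>
    simp only [dForm, ins_wedge, dForm_add, Pi.add_apply, ih, lieForm_wedge, dForm_inv, wedge,
      ins_dForm, ins_inv, inv_inv]
    simp only [sub_eq_add_neg, wedge_add_left, wedge_add_right, wedge_neg_left, wedge_neg_right,
      Pi.add_apply, Pi.neg_apply]
    ring

theorem lieForm_add_left (a b : L) {α : List L → R} (hα : IsForm α) :
    lieForm P (a + b) α = lieForm P a α + lieForm P b α := by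
  funext l
  induction l generalizing α with
  | nil => simp [lieForm]
  | cons c l ih =>
    have h := hα.1 [] l (P.br a c) (P.br b c)
    simp only [List.nil_append] at h
    simp only [lieForm, ih (hα.ins c), map_add, LinearMap.add_apply, Pi.add_apply, h]; ring

theorem inv_diffFun (f : R) : inv (diffFun P f) = -diffFun P f := by
  funext l
  match l with
  | [] => simp [inv, diffFun]
  | [b] => simp [inv, diffFun]
  | _ :: _ :: _ => simp [inv, diffFun]

theorem ins_diffFun (c : L) (f : R) : ins c (diffFun P f) = constForm (P.act c f) := by
  funext l
  match l with
  | [] => simp [ins, diffFun, constForm]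
  | _ :: _ => simp [ins, diffFun, constForm]

theorem lieForm_smul_left (f : R) (a : L) {α : List L → R} (hα : IsForm α) :
    lieForm P (f • a) α = f • lieForm P a α + wedge (diffFun P f) (ins a α) := by
  funext l
  induction l generalizing α with
  | nil => simp [lieForm, wedge, diffFun]
  | cons c l ih =>
    have h := hα.1 [] l (f • P.br a c) (-(P.act c f) • a)
    have h1 := hα.2.1 [] l f (P.br a c)
    have h2 := hα.2.1 [] l (-(P.act c f)) a
    simp only [List.nil_append] at h h1 h2
    have e2 : wedge (ins c (diffFun P f)) (ins a α) l = P.act c f * α (a :: l) := by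
      rw [ins_diffFun, wedge_constForm]; rfl
    have e3 : ins c (ins a α) = - ins a (ins c α) := by
      funext l; exact hα.swap a c l
    simp only [lieForm, ih (hα.ins c), P.br_smul_left, sub_eq_add_neg, ← neg_smul, h, h1, h2,
      Pi.add_apply, Pi.smul_apply, smul_eq_mul, wedge, inv_diffFun, e2, e3, wedge_neg_left,
      wedge_neg_right, Pi.neg_apply, neg_neg]
    ring

theorem dForm_mul (f : R) (α : List L → R) :
    dForm P (f • α) = f • dForm P α + wedge (diffFun P f) α := by
  funext l
  induction l generalizing α with
  | nil => simp [dForm, wedge, diffFun]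
  | cons c l ih =>
    have h : ins c (f • α) = f • ins c α := rfl
    simp only [dForm, h, ih, lieForm_mul, wedge, ins_diffFun, wedge_constForm, inv_diffFun,
      wedge_neg_left, Pi.add_apply, Pi.smul_apply, Pi.neg_apply, smul_eq_mul]
    ring

theorem IsForm.lieForm {α : List L → R} (hα : IsForm α) (a : L) : IsForm (lieForm P a α) := by
  have key : ∀ (l₁ : List L) (α : List L → R), IsForm α →
     (∀ l₂ b c, GradedForms.lieForm P a α (l₁ ++ (b + c) :: l₂)
        = GradedForms.lieForm P a α (l₁ ++ b :: l₂)
          + GradedForms.lieForm P a α (l₁ ++ c :: l₂)) ∧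
     (∀ l₂ (f : R) b, GradedForms.lieForm P a α (l₁ ++ (f • b) :: l₂)
        = f * GradedForms.lieForm P a α (l₁ ++ b :: l₂)) ∧
     (∀ l₂ b, GradedForms.lieForm P a α (l₁ ++ b :: b :: l₂) = 0) := by
    intro l₁
    induction l₁ with
    | nil =>
      intro α hα
      refine ⟨fun l₂ b c => ?_, fun l₂ f b => ?_, fun l₂ b => ?_⟩
      · have h := hα.1 [] l₂ (P.br a b) (P.br a c)
        simp only [List.nil_append] at h
        simp only [List.nil_append, GradedForms.lieForm, hα.ins_add, lieForm_add, map_add,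
          Pi.add_apply, h]
        ring
      · have h := hα.1 [] l₂ (f • P.br a b) (P.act a f • b)
        have h1 := hα.2.1 [] l₂ f (P.br a b)
        have h2 := hα.2.1 [] l₂ (P.act a f) b
        simp only [List.nil_append] at h h1 h2
        simp only [List.nil_append, GradedForms.lieForm, hα.ins_smul, lieForm_mul, P.leibniz,
          Pi.add_apply, h, h1, h2, Pi.smul_apply, smul_eq_mul, GradedForms.ins]
        ring
      · have h := hα.swap (P.br a b) b l₂
        simp only [List.nil_append, GradedForms.lieForm, hα.ins_ins, lieForm_zero,
          GradedForms.ins, h, Pi.zero_apply]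
        ring
    | cons d l ih =>
      intro α hα
      obtain ⟨p1, p2, p3⟩ := ih _ (hα.ins d)
      refine ⟨fun l₂ b c => ?_, fun l₂ f b => ?_, fun l₂ b => ?_⟩
      · have h := hα.1 (P.br a d :: l) l₂ b c
        simp only [List.cons_append] at h
        simp only [List.cons_append, GradedForms.lieForm, p1, h]; ring
      · have h := hα.2.1 (P.br a d :: l) l₂ f b
        simp only [List.cons_append] at h
        simp only [List.cons_append, GradedForms.lieForm, p2, h]; ring
      · have h := hα.2.2 (P.br a d :: l) l₂ b
        simp only [List.cons_append] at h
        simp only [List.cons_append, GradedForms.lieForm, p3, h]; ring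
  exact ⟨fun l₁ => (key l₁ α hα).1, fun l₁ => (key l₁ α hα).2.1, fun l₁ => (key l₁ α hα).2.2⟩

theorem IsForm.dForm {α : List L → R} (hα : IsForm α) : IsForm (dForm P α) := by
  have key : ∀ (l₁ : List L) (α : List L → R), IsForm α →
     (∀ l₂ b c, GradedForms.dForm P α (l₁ ++ (b + c) :: l₂)
        = GradedForms.dForm P α (l₁ ++ b :: l₂) + GradedForms.dForm P α (l₁ ++ c :: l₂)) ∧
     (∀ l₂ (f : R) b, GradedForms.dForm P α (l₁ ++ (f • b) :: l₂)
        = f * GradedForms.dForm P α (l₁ ++ b :: l₂)) ∧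
     (∀ l₂ b, GradedForms.dForm P α (l₁ ++ b :: b :: l₂) = 0) := by
    intro l₁
    induction l₁ with
    | nil =>
      intro α hα
      refine ⟨fun l₂ b c => ?_, fun l₂ f b => ?_, fun l₂ b => ?_⟩
      · simp only [List.nil_append, GradedForms.dForm, lieForm_add_left P b c hα, hα.ins_add,
          dForm_add, Pi.add_apply]
        ring
      · simp only [List.nil_append, GradedForms.dForm, lieForm_smul_left P f b hα, hα.ins_smul,
          dForm_mul, Pi.add_apply, Pi.smul_apply, smul_eq_mul]
        ring
      · have h := hα.2.1 [] l₂ 0 b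
        simp only [List.nil_append, zero_smul, zero_mul] at h
        simp only [List.nil_append, GradedForms.dForm, GradedForms.lieForm, hα.ins_ins,
          dForm_zero, P.br_self, h, Pi.zero_apply]
        ring
    | cons d l ih =>
      intro α hα
      obtain ⟨p1, p2, p3⟩ := ih _ (hα.ins d)
      obtain ⟨q1, q2, q3⟩ := hα.lieForm P d
      refine ⟨fun l₂ b c => ?_, fun l₂ f b => ?_, fun l₂ b => ?_⟩
      · simp only [List.cons_append, GradedForms.dForm, p1, q1]; ring
      · simp only [List.cons_append, GradedForms.dForm, p2, q2]; ring
      · simp only [List.cons_append, GradedForms.dForm, p3, q3]; ring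
  exact ⟨fun l₁ => (key l₁ α hα).1, fun l₁ => (key l₁ α hα).2.1, fun l₁ => (key l₁ α hα).2.2⟩

theorem HomogRaw.lieForm {k : ℤ} {α : List L → R} (h : HomogRaw k α) (a : L) :
    HomogRaw k (lieForm P a α) := by
  intro l
  induction l generalizing α k with
  | nil => intro hl; simp [GradedForms.lieForm, h [] hl]
  | cons b l ih =>
    intro hl
    simp only [GradedForms.lieForm]
    rw [ih (h.ins b) (by simp at hl; omega), h _ (by simpa using hl), sub_zero]

theorem HomogRaw.dForm {k : ℤ} {α : List L → R} (h : HomogRaw k α) :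
    HomogRaw (k + 1) (dForm P α) := by
  intro l
  induction l generalizing α k with
  | nil => intro hl; simp [GradedForms.dForm]
  | cons b l ih =>
    intro hl
    simp only [GradedForms.dForm]
    rw [ih (h.ins b) (by simp at hl; omega),
      (h.lieForm P b) _ (by simp at hl; omega), sub_zero]

end Cartan

section Graded
variable (R L : Type*) [CommRing R] [Algebra ℝ R] [AddCommGroup L] [Module R L]

/-- The alternating `R`-multilinear forms. -/
def formSubmodule : Submodule R (List L → R) where
  carrier := {α | IsForm α}
  add_mem' := fun h h' => IsForm.add h h'
  zero_mem' := IsForm.zero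
  smul_mem' := fun g _ h => IsForm.smul h g

/-- The algebra of alternating `R`-multilinear forms on `L`: the functions on `A[1]`. -/
def Form : Type _ := ↥(formSubmodule R L)

instance : AddCommGroup (Form R L) := inferInstanceAs (AddCommGroup ↥(formSubmodule R L))

instance : Module R (Form R L) := inferInstanceAs (Module R ↥(formSubmodule R L))

instance : Module ℝ (Form R L) := inferInstanceAs (Module ℝ ↥(formSubmodule R L))

variable {R L}

instance : Mul (Form R L) := ⟨fun α β => ⟨wedge α.1 β.1, IsForm.wedge α.2 β.2⟩⟩

theorem Form.mul_val (α β : Form R L) : (α * β).1 = wedge α.1 β.1 := rfl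

/-- `α` is homogeneous of degree `k`. -/
def Form.Homog (k : ℤ) (α : Form R L) : Prop := ∀ l : List L, (l.length : ℤ) ≠ k → α.1 l = 0

/-- An element of `R` as a form of degree `0`. -/
def Form.const (f : R) : Form R L := ⟨constForm f, by
  refine IsForm.of_ins (fun a => ?_) (fun a b => ?_) (fun f a => ?_) (fun a => ?_) <;>
  simp only [ins_constForm, add_zero, smul_zero]
  · exact IsForm.zero
  · rfl⟩

theorem Form.mul_assoc (α β γ : Form R L) : α * β * γ = α * (β * γ) :=
  Subtype.ext (wedge_assoc _ _ _)

theorem Form.mul_add (α β γ : Form R L) : α * (β + γ) = α * β + α * γ :=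
  Subtype.ext (wedge_add_right _ _ _)

theorem Form.add_mul (α β γ : Form R L) : (α + β) * γ = α * γ + β * γ :=
  Subtype.ext (wedge_add_left _ _ _)

theorem Form.neg_mul (α β : Form R L) : -α * β = -(α * β) :=
  Subtype.ext (wedge_neg_left _ _)

theorem Form.mul_neg (α β : Form R L) : α * -β = -(α * β) :=
  Subtype.ext (wedge_neg_right _ _)

theorem Form.neg_val (α : Form R L) : (-α).1 = -α.1 := rfl

theorem Form.units_smul_val (s : ℤˣ) (α : Form R L) : (s • α).1 = s • α.1 := by
  rcases Int.units_eq_one_or s with h | h <;> simp [h, Form.neg_val]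

theorem Form.units_smul_mul (s : ℤˣ) (α β : Form R L) : (s • α) * β = s • (α * β) := by
  rcases Int.units_eq_one_or s with h | h <;> simp [h, Form.neg_mul]

theorem Form.mul_units_smul (s : ℤˣ) (α β : Form R L) : α * (s • β) = s • (α * β) := by
  rcases Int.units_eq_one_or s with h | h <;> simp [h, Form.mul_neg]

theorem Form.real_smul (r : ℝ) (α : Form R L) : (r • α).1 = algebraMap ℝ R r • α.1 := by
  change r • α.1 = _
  funext l; simp [Algebra.smul_def]

theorem Form.mul_real_smul (r : ℝ) (α β : Form R L) : α * (r • β) = r • (α * β) := by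
  apply Subtype.ext
  rw [Form.real_smul, Form.mul_val, Form.real_smul, wedge_smul_right]; rfl

theorem Form.real_smul_mul (r : ℝ) (α β : Form R L) : (r • α) * β = r • (α * β) := by
  apply Subtype.ext
  rw [Form.real_smul, Form.mul_val, Form.real_smul, wedge_smul_left]; rfl

theorem Form.mul_comm' {k j : ℤ} {α β : Form R L} (hα : α.Homog k) (hβ : β.Homog j) :
    α * β = (k * j).negOnePow • (β * α) := by
  apply Subtype.ext
  rw [Form.units_smul_val]
  exact wedge_comm hα hβ

theorem Form.Homog.mul {k j : ℤ} {α β : Form R L} (hα : α.Homog k) (hβ : β.Homog j) :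
    (α * β).Homog (k + j) := HomogRaw.wedge hα hβ

theorem Form.Homog.add {k : ℤ} {α β : Form R L} (hα : α.Homog k) (hβ : β.Homog k) :
    (α + β).Homog k := fun l hl => by
  change α.1 l + β.1 l = 0
  rw [hα l hl, hβ l hl, add_zero]

theorem Form.Homog.real_smul {k : ℤ} {α : Form R L} (hα : α.Homog k) (r : ℝ) :
    (r • α).Homog k := fun l hl => by
  change r • α.1 l = 0
  rw [hα l hl, smul_zero]

theorem Form.Homog.units_smul {k : ℤ} {α : Form R L} (hα : α.Homog k) (s : ℤˣ) :
    (s • α).Homog k := fun l hl => by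
  rw [Form.units_smul_val]
  change s • α.1 l = 0
  rw [hα l hl, smul_zero]

theorem Form.Homog.sub {k : ℤ} {α β : Form R L} (hα : α.Homog k) (hβ : β.Homog k) :
    (α - β).Homog k := fun l hl => by
  change α.1 l - β.1 l = 0
  rw [hα l hl, hβ l hl, sub_zero]

variable (R L) in
/-- Vector fields of degree `j` on `A[1]`: the graded derivations of degree `j` of the algebra of
forms, `X(αβ) = X(α)β + (-1)^{jk} αX(β)` for `α` of degree `k`. -/
def VF (j : ℤ) : Submodule ℝ (Module.End ℝ (Form R L)) where
  carrier := {X | (∀ (k : ℤ) (α : Form R L), α.Homog k → (X α).Homog (k + j)) ∧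
    ∀ (k : ℤ) (α β : Form R L), α.Homog k →
      X (α * β) = X α * β + (j * k).negOnePow • (α * X β)}
  add_mem' := by
    rintro X Y ⟨hX, hX'⟩ ⟨hY, hY'⟩
    refine ⟨fun k α h => (hX k α h).add (hY k α h), fun k α β h => ?_⟩
    simp only [LinearMap.add_apply, hX' k α β h, hY' k α β h, Form.add_mul, Form.mul_add, smul_add]
    abel
  zero_mem' := by
    refine ⟨fun k α h l _ => rfl, fun k α β h => ?_⟩
    have h1 : (0 : Form R L) * β = 0 := Subtype.ext (wedge_zero_left _)
    have h2 : α * (0 : Form R L) = 0 := Subtype.ext (wedge_zero_right _)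
    simp [h1, h2]
  smul_mem' := by
    rintro r X ⟨hX, hX'⟩
    refine ⟨fun k α h => (hX k α h).real_smul r, fun k α β h => ?_⟩
    simp only [LinearMap.smul_apply, hX' k α β h, Form.real_smul_mul, Form.mul_real_smul, smul_add]
    rw [smul_comm r]

/-- Multiplication by `α` from the left. -/
def mulEnd (α : Form R L) : Module.End ℝ (Form R L) where
  toFun := fun β => α * β
  map_add' := Form.mul_add α
  map_smul' := fun r β => Form.mul_real_smul r α β

/-- The module structure of vector fields over functions: `αX`. -/
def VF.fsmul {i j : ℤ} (α : Form R L) (hα : α.Homog i) (X : VF R L j) : VF R L (i + j) :=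
  ⟨mulEnd α * X.1, by
    refine ⟨fun k β h => ?_, fun k β γ h => ?_⟩
    · have := hα.mul (X.2.1 k β h)
      rwa [show i + (k + j) = k + (i + j) by ring] at this
    · change α * X.1 (β * γ) = α * X.1 β * γ + ((i + j) * k).negOnePow • (β * (α * X.1 γ))
      rw [X.2.2 k β γ h, Form.mul_add, Form.mul_units_smul, ← Form.mul_assoc, ← Form.mul_assoc,
        ← Form.mul_assoc, Form.mul_comm' hα h, Form.units_smul_mul, smul_smul,
        ← Int.negOnePow_add]
      congr 3; ring⟩

/-- The graded commutator `[X, Y] = XY - (-1)^{ij} YX`. -/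
def VF.bracket {i j : ℤ} (X : VF R L i) (Y : VF R L j) : VF R L (i + j) :=
  ⟨X.1 * Y.1 - (i * j).negOnePow • (Y.1 * X.1), by
    have sm : ∀ (s : ℤˣ) (Z : Module.End ℝ (Form R L)) (α : Form R L), (s • Z) α = s • Z α := by
      intro s Z α; rcases Int.units_eq_one_or s with h | h <;> simp [h]
    have sm' : ∀ (s : ℤˣ) (Z : Module.End ℝ (Form R L)) (α : Form R L), Z (s • α) = s • Z α := by
      intro s Z α; rcases Int.units_eq_one_or s with h | h <;> simp [h]
    refine ⟨fun k α h => ?_, fun k α β h => ?_⟩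
    · have h1 := X.2.1 _ _ (Y.2.1 k α h)
      have h2 := Y.2.1 _ _ (X.2.1 k α h)
      rw [show k + j + i = k + (i + j) by ring] at h1
      rw [show k + i + j = k + (i + j) by ring] at h2
      simp only [LinearMap.sub_apply, sm]
      exact h1.sub (h2.units_smul _)
    · simp only [LinearMap.sub_apply, sm, Module.End.mul_apply]
      rw [X.2.2 k α β h, Y.2.2 k α β h, map_add, map_add, sm', sm',
        X.2.2 _ _ _ (Y.2.1 k α h), X.2.2 _ _ _ h, Y.2.2 _ _ _ (X.2.1 k α h), Y.2.2 _ _ _ h]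
      have e1 : i * (k + j) = i * k + i * j := by ring
      have e2 : j * (k + i) = j * k + i * j := by ring
      have e3 : (i + j) * k = i * k + j * k := by ring
      rw [e1, e2, e3]
      simp only [Int.negOnePow_add]
      have sub_mul' : ∀ a b c : Form R L, (a - b) * c = a * c - b * c := fun a b c => by
        rw [sub_eq_add_neg, Form.add_mul, Form.neg_mul, sub_eq_add_neg]
      have mul_sub' : ∀ a b c : Form R L, a * (b - c) = a * b - a * c := fun a b c => by
        rw [sub_eq_add_neg, Form.mul_add, Form.mul_neg, sub_eq_add_neg]
      rw [sub_mul', mul_sub', Form.units_smul_mul, Form.mul_units_smul]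
      rcases Int.units_eq_one_or (i * k).negOnePow with h1 | h1 <;>
      rcases Int.units_eq_one_or (j * k).negOnePow with h2 | h2 <;>
      rcases Int.units_eq_one_or (i * j).negOnePow with h3 | h3 <;>
      simp [h1, h2, h3] <;> abel⟩


theorem VF.fsmul_coe {i j : ℤ} (α : Form R L) (hα : α.Homog i) (X : VF R L j) :
    (VF.fsmul α hα X : Module.End ℝ (Form R L)) = mulEnd α * X.1 := rfl

theorem VF.bracket_coe {i j : ℤ} (X : VF R L i) (Y : VF R L j) :
    (VF.bracket X Y : Module.End ℝ (Form R L))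
      = X.1 * Y.1 - (i * j).negOnePow • (Y.1 * X.1) := rfl

/-- The vertical lift `a^↑` of `a ∈ L`, a vector field of degree `-1` on `A[1]`: contraction with `a`. -/
def VF.ins (a : L) : VF R L (-1) :=
  ⟨{ toFun := fun α => ⟨GradedForms.ins a α.1, IsForm.ins α.2 a⟩
     map_add' := fun _ _ => rfl
     map_smul' := fun _ _ => rfl }, by
    refine ⟨fun k α h => HomogRaw.ins h a, fun k α β h => Subtype.ext ?_⟩
    have e : inv α.1 = ((-1) * k).negOnePow • α.1 := by
      rw [inv_eq_of_homog h, neg_one_mul, Int.negOnePow_neg]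
    change GradedForms.ins a (wedge α.1 β.1) = wedge (GradedForms.ins a α.1) β.1
      + (((-1) * k).negOnePow • (α * ⟨GradedForms.ins a β.1, IsForm.ins β.2 a⟩) : Form R L).1
    rw [Form.units_smul_val, ins_wedge, e, wedge_units_smul_left]; rfl⟩

/-- The homological vector field `d_A`. -/
def LieRinehart.d [Module ℝ L] (P : LieRinehart R L) : VF R L 1 :=
  ⟨{ toFun := fun α => ⟨dForm P α.1, IsForm.dForm P α.2⟩
     map_add' := fun α β => Subtype.ext (dForm_add P α.1 β.1)
     map_smul' := fun r α => Subtype.ext (dForm_smul P r α.1) }, by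
    refine ⟨fun k α h => HomogRaw.dForm P h, fun k α β h => Subtype.ext ?_⟩
    have e : inv α.1 = (1 * k).negOnePow • α.1 := by
      rw [inv_eq_of_homog h, one_mul]
    change dForm P (wedge α.1 β.1) = wedge (dForm P α.1) β.1
      + ((1 * k).negOnePow • (α * ⟨dForm P β.1, IsForm.dForm P β.2⟩) : Form R L).1
    rw [Form.units_smul_val, dForm_wedge, e, wedge_units_smul_left]; rfl⟩

variable (R L) in
/-- `(1,1)` tensors of internal degree `k` on `A[1]`, as graded endomorphisms of the module of vector
fields: maps `T` of degree `k` with `T(αX) = (-1)^{k|α|} α T(X)`. -/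
@[ext]
structure GradedTensor (k : ℤ) where
  toFun : ∀ j : ℤ, VF R L j →ₗ[ℝ] VF R L (j + k)
  map_fsmul : ∀ (i j : ℤ) (α : Form R L) (hα : α.Homog i) (X : VF R L j),
    (toFun (i + j) (VF.fsmul α hα X) : Module.End ℝ (Form R L))
      = (k * i).negOnePow • (mulEnd α * (toFun j X : Module.End ℝ (Form R L)))

theorem units_smul_comm' {N : Type*} [AddCommGroup N] [Module ℝ N] (s : ℤˣ) (r : ℝ) (Z : N) :
    s • r • Z = r • s • Z := by
  rcases Int.units_eq_one_or s with h | h <;> simp [h]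

theorem real_smul_sub' {N : Type*} [AddCommGroup N] [Module ℝ N] (r : ℝ) (Y Z : N) :
    r • (Y - Z) = r • Y - r • Z := smul_sub r Y Z

theorem units_smul_mem {N : Type*} [AddCommGroup N] [Module ℝ N] (S : Submodule ℝ N) (s : ℤˣ)
    {Z : N} (h : Z ∈ S) : s • Z ∈ S := by
  rcases Int.units_eq_one_or s with h' | h' <;> simp [h', h]

theorem map_units_smul_add {N N' : Type*} [AddCommGroup N] [Module ℝ N] [AddCommGroup N']
    [Module ℝ N'] (S : Submodule ℝ N) (S' : Submodule ℝ N') (T : S →ₗ[ℝ] S') (X Y₁ Y₂ : S)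
    (s : ℤˣ) (h : X.1 = Y₁.1 + s • Y₂.1) : (T X).1 = (T Y₁).1 + s • (T Y₂).1 := by
  rcases Int.units_eq_one_or s with hs | hs
  · subst hs
    have : X = Y₁ + Y₂ := Subtype.ext (by simpa using h)
    simp [this]
  · subst hs
    have : X = Y₁ - Y₂ := Subtype.ext (by simpa [sub_eq_add_neg] using h)
    simp [this, sub_eq_add_neg]

theorem VF.end_mul_mulEnd {q i : ℤ} (Q : VF R L q) (α : Form R L) (hα : α.Homog i) :
    Q.1 * mulEnd α = mulEnd (Q.1 α) + (q * i).negOnePow • (mulEnd α * Q.1) := by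
  ext1 β
  have sm : ∀ (s : ℤˣ) (Z : Module.End ℝ (Form R L)) (α : Form R L), (s • Z) α = s • Z α := by
    intro s Z α; rcases Int.units_eq_one_or s with h | h <;> simp [h]
  rw [LinearMap.add_apply, sm]
  exact Q.2.2 i α β hα

theorem VF.bracket_add {q j : ℤ} (Q : VF R L q) (X Y : VF R L j) :
    VF.bracket Q (X + Y) = VF.bracket Q X + VF.bracket Q Y := by
  apply Subtype.ext
  simp only [VF.bracket_coe, Submodule.coe_add, mul_add, add_mul, smul_add]; abel

theorem VF.bracket_smul {q j : ℤ} (Q : VF R L q) (r : ℝ) (X : VF R L j) :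
    VF.bracket Q (r • X) = r • VF.bracket Q X := by
  apply Subtype.ext
  simp only [VF.bracket_coe, Submodule.coe_smul, mul_smul_comm, smul_mul_assoc, real_smul_sub',
    units_smul_comm']

theorem toFun_congr {k : ℤ} (T : ∀ j : ℤ, VF R L j →ₗ[ℝ] VF R L (j + k)) {j j₁ j₂ : ℤ}
    (h₁ : j₁ = j) (h₂ : j₂ = j) (X : VF R L j) (Y₁ : VF R L j₁) (Y₂ : VF R L j₂) (s : ℤˣ)
    (h : X.1 = Y₁.1 + s • Y₂.1) : (T j X).1 = (T j₁ Y₁).1 + s • (T j₂ Y₂).1 := by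
  subst h₁ h₂
  exact map_units_smul_add _ _ _ _ _ _ _ h

theorem lie_sign_identity {B : Type*} [Ring B] (qi ki qk t : ℤˣ) (Q m n Y W : B)
    (hc : Q * m = n + qi • (m * Q)) :
    Q * (ki • (m * Y)) - (qi * t) • (ki • (m * Y) * Q)
      - qk • ((ki * qk) • (n * Y) + qi • ki • (m * W))
      = (qi * ki) • (m * (Q * Y - t • (Y * Q) - qk • W)) := by
  have hc' : n = Q * m - qi • (m * Q) := by rw [hc]; abel
  subst hc'
  rcases Int.units_eq_one_or qi with h1 | h1 <;> rcases Int.units_eq_one_or ki with h2 | h2 <;>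
  rcases Int.units_eq_one_or qk with h3 | h3 <;> rcases Int.units_eq_one_or t with h4 | h4 <;>
  simp [h1, h2, h3, h4, sub_mul, add_mul, mul_sub, mul_add, mul_assoc] <;> abel

theorem bracket_sign_identity {B : Type*} [Ring B] (s t : ℤˣ) (a b x y : B) :
    (b + s • (a * y)) * x - (s * t) • (a * x * y) = b * x + s • (a * (y * x - t • (x * y))) := by
  rcases Int.units_eq_one_or s with h1 | h1 <;> rcases Int.units_eq_one_or t with h2 | h2 <;>
  simp [h1, h2, add_mul, mul_sub, mul_add, mul_assoc] <;> abel

/-- The Lie derivative `L_Q T = [Q, T]` of a `(1,1)` tensor along a vector field: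
`(L_Q T)(X) = [Q, T X] - (-1)^{qk} T [Q, X]`. -/
def GradedTensor.lie {q k : ℤ} (T : GradedTensor R L k) (Q : VF R L q) :
    GradedTensor R L (q + k) where
  toFun := fun j =>
    { toFun := fun X => ⟨(VF.bracket Q (T.toFun j X)).1
          - (q * k).negOnePow • (T.toFun (q + j) (VF.bracket Q X)).1, by
        have h1 : _ ∈ VF R L (q + (j + k)) := (VF.bracket Q (T.toFun j X)).2
        have h2 : _ ∈ VF R L (q + j + k) := (T.toFun (q + j) (VF.bracket Q X)).2
        have e1 : j + (q + k) = q + (j + k) := by ring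
        have e2 : q + (j + k) = q + j + k := by ring
        rw [e1]
        refine Submodule.sub_mem _ h1 (units_smul_mem _ _ ?_)
        rw [e2]; exact h2⟩
      map_add' := fun X Y => by
        apply Subtype.ext
        simp only [VF.bracket_add, map_add, VF.bracket_coe, Submodule.coe_add, mul_add, add_mul,
          smul_add]
        abel
      map_smul' := fun r X => by
        apply Subtype.ext
        simp only [VF.bracket_smul, map_smul, VF.bracket_coe, Submodule.coe_smul, mul_smul_comm,
          smul_mul_assoc, real_smul_sub', units_smul_comm', RingHom.id_apply] }
  map_fsmul := by
    intro i j α hα X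
    have hQα : (Q.1 α).Homog (i + q) := Q.2.1 i α hα
    have hb : (VF.bracket Q (VF.fsmul α hα X)).1 = (VF.fsmul (Q.1 α) hQα X).1
        + (q * i).negOnePow • (VF.fsmul α hα (VF.bracket Q X)).1 := by
      simp only [VF.bracket_coe, VF.fsmul_coe, ← mul_assoc, VF.end_mul_mulEnd Q α hα]
      rw [show q * (i + j) = q * i + q * j by ring, Int.negOnePow_add]
      exact bracket_sign_identity _ _ _ _ _ _
    have hT := toFun_congr T.toFun (by ring : i + q + j = q + (i + j))
      (by ring : i + (q + j) = q + (i + j)) _ _ _ _ hb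
    rw [T.map_fsmul, T.map_fsmul] at hT
    simp only [LinearMap.coe_mk, AddHom.coe_mk]
    rw [hT]
    simp only [VF.bracket_coe, T.map_fsmul]
    rw [show q * (i + j + k) = q * i + q * (j + k) by ring, Int.negOnePow_add,
      show k * (i + q) = k * i + q * k by ring, Int.negOnePow_add,
      show (q + k) * i = q * i + k * i by ring, Int.negOnePow_add]
    have hc := VF.end_mul_mulEnd Q α hα
    exact lie_sign_identity _ _ _ _ _ _ _ _ _ hc

end Graded
end GradedForms

section Bundles

variable {EB : Type*} [NormedAddCommGroup EB] [NormedSpace ℝ EB] {HB : Type*} [TopologicalSpace HB]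
  (IB : ModelWithCorners ℝ EB HB) {B : Type*} [TopologicalSpace B] [ChartedSpace HB B]
  (F : Type*) [NormedAddCommGroup F] [NormedSpace ℝ F]
  (V : B → Type*) [TopologicalSpace (TotalSpace F V)] [∀ x, TopologicalSpace (V x)]
  [FiberBundle F V] [∀ x, AddCommGroup (V x)] [∀ x, Module ℝ (V x)] [VectorBundle ℝ F V]
  (F' : Type*) [NormedAddCommGroup F'] [NormedSpace ℝ F']
  (V' : B → Type*) [TopologicalSpace (TotalSpace F' V')] [∀ x, TopologicalSpace (V' x)]
  [FiberBundle F' V'] [∀ x, AddCommGroup (V' x)] [∀ x, Module ℝ (V' x)] [VectorBundle ℝ F' V']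
  (F'' : Type*) [NormedAddCommGroup F''] [NormedSpace ℝ F'']
  (V'' : B → Type*) [TopologicalSpace (TotalSpace F'' V'')] [∀ x, TopologicalSpace (V'' x)]
  [FiberBundle F'' V''] [∀ x, AddCommGroup (V'' x)] [∀ x, Module ℝ (V'' x)]
  [VectorBundle ℝ F'' V'']

/-- The `C^∞(B)`-module structure on the smooth sections of a vector bundle. -/
instance sectionModule : Module C^∞⟮IB, B; ℝ⟯ Cₛ^∞⟮IB; F, V⟯ where
  smul f a := ⟨fun x => f x • a x, f.contMDiff.smul_section a.contMDiff⟩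
  one_smul a := by ext x; exact one_smul ℝ (a x)
  mul_smul f g a := by ext x; exact mul_smul (f x) (g x) (a x)
  smul_zero f := by ext x; exact smul_zero (f x)
  smul_add f a b := by ext x; exact smul_add (f x) (a x) (b x)
  add_smul f g a := by ext x; exact add_smul (f x) (g x) (a x)
  zero_smul a := by ext x; exact zero_smul ℝ (a x)

/-- A smooth vector bundle map `V → V'` covering the identity of `B`. -/
@[ext]
structure BundleMap where
  toFun : ∀ x, V x →ₗ[ℝ] V' x
  smooth : ContMDiff (IB.prod 𝓘(ℝ, F)) (IB.prod 𝓘(ℝ, F')) ∞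
    (fun p : TotalSpace F V => (⟨p.proj, toFun p.proj p.2⟩ : TotalSpace F' V'))

variable {IB F V F' V' F'' V''}

instance : CoeFun (BundleMap IB F V F' V') (fun _ => ∀ x, V x →ₗ[ℝ] V' x) := ⟨BundleMap.toFun⟩

/-- Composition of vector bundle maps. -/
def BundleMap.comp (Ψ : BundleMap IB F' V' F'' V'') (Φ : BundleMap IB F V F' V') :
    BundleMap IB F V F'' V'' where
  toFun x := Ψ x ∘ₗ Φ x
  smooth := Ψ.smooth.comp Φ.smooth

/-- A vector bundle map applied to a section. -/
def BundleMap.onSection (Φ : BundleMap IB F V F' V') (a : Cₛ^∞⟮IB; F, V⟯) : Cₛ^∞⟮IB; F', V'⟯ :=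
  ⟨fun x => Φ x (a x), Φ.smooth.comp a.contMDiff⟩

variable (IB B) in
/-- Smooth `(1,1)` tensors on a manifold, as endomorphisms of the tangent bundle. -/
abbrev Tensor11 [IsManifold IB ∞ B] : Type _ :=
  BundleMap IB EB (TangentSpace IB : B → Type _) EB (TangentSpace IB : B → Type _)

variable (IB B) in
/-- Smooth vector fields. -/
abbrev VectorFields [IsManifold IB ∞ B] : Type _ :=
  Cₛ^∞⟮IB; EB, (TangentSpace IB : B → Type _)⟯

/-- The derivative `df(v)` of a function in the direction of a tangent vector. -/
def dirDeriv (f : C^∞⟮IB, B; ℝ⟯) (x : B) (v : TangentSpace IB x) : ℝ := mfderiv IB 𝓘(ℝ, ℝ) f x v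

theorem contMDiff_deriv [IsManifold IB ∞ B] (X : VectorFields IB B) (f : C^∞⟮IB, B; ℝ⟯) :
    ContMDiff IB 𝓘(ℝ, ℝ) ∞ (fun x => dirDeriv f x (X x)) := by
  have h1 : ContMDiff IB.tangent 𝓘(ℝ, ℝ).tangent ∞ (tangentMap IB 𝓘(ℝ, ℝ) f) :=
    f.contMDiff.contMDiff_tangentMap (by simp)
  exact (contMDiff_snd_tangentBundle_modelSpace ℝ 𝓘(ℝ, ℝ)).comp (h1.comp X.contMDiff)

/-- The derivation `f ↦ X(f)` of `C^∞(B)`. -/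
def derivationOf [IsManifold IB ∞ B] (X : VectorFields IB B) :
    Derivation ℝ C^∞⟮IB, B; ℝ⟯ C^∞⟮IB, B; ℝ⟯ :=
  Derivation.mk'
    { toFun := fun f => ⟨fun x => dirDeriv f x (X x), contMDiff_deriv X f⟩
      map_add' := fun f g => by
        ext x
        have hf := f.contMDiff.mdifferentiable (by simp) x
        have hg := g.contMDiff.mdifferentiable (by simp) x
        exact congrArg (fun D => D (X x)) (hf.hasMFDerivAt.add hg.hasMFDerivAt).mfderiv
      map_smul' := fun r f => by
        ext x
        have hf := f.contMDiff.mdifferentiable (by simp) x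
        exact congrArg (fun D => D (X x)) (hf.hasMFDerivAt.const_smul r).mfderiv }
    (fun f g => by
        ext x
        have hf := f.contMDiff.mdifferentiable (by simp) x
        have hg := g.contMDiff.mdifferentiable (by simp) x
        exact congrArg (fun D => D (X x)) (hf.hasMFDerivAt.mul hg.hasMFDerivAt).mfderiv)

end Bundles

section LieAlgebroid

variable (EM : Type*) [NormedAddCommGroup EM] [NormedSpace ℝ EM]
  (M : Type*) [TopologicalSpace M] [ChartedSpace EM M] [IsManifold 𝓘(ℝ, EM) ∞ M]
  (F : Type*) [NormedAddCommGroup F] [NormedSpace ℝ F]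
  (A : M → Type*) [TopologicalSpace (TotalSpace F A)] [∀ x, TopologicalSpace (A x)]
  [FiberBundle F A] [∀ x, AddCommGroup (A x)] [∀ x, Module ℝ (A x)] [VectorBundle ℝ F A]

/-- A Lie algebroid structure on the vector bundle `A → M`: an anchor `A → TM` and a Lie bracket on
`Γ(A)` with the Leibniz rule `[a, f b] = f [a, b] + ρ(a)(f) b`. -/
structure LieAlgebroid where
  bracket : Cₛ^∞⟮𝓘(ℝ, EM); F, A⟯ →ₗ[ℝ] Cₛ^∞⟮𝓘(ℝ, EM); F, A⟯ →ₗ[ℝ] Cₛ^∞⟮𝓘(ℝ, EM); F, A⟯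
  anchor : BundleMap 𝓘(ℝ, EM) F A EM (TangentSpace 𝓘(ℝ, EM) : M → Type _)
  bracket_self : ∀ a, bracket a a = 0
  jacobi : ∀ a b c, bracket a (bracket b c) = bracket (bracket a b) c + bracket b (bracket a c)
  leibniz : ∀ (a b : Cₛ^∞⟮𝓘(ℝ, EM); F, A⟯) (f : C^∞⟮𝓘(ℝ, EM), M; ℝ⟯),
    bracket a (f • b) = f • bracket a b + derivationOf (anchor.onSection a) f • b

variable {EM M F A}

/-- The Lie-Rinehart structure on `(C^∞(M), Γ(A))` of a Lie algebroid. -/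
def LieAlgebroid.toLieRinehart (𝒜 : LieAlgebroid EM M F A) :
    GradedForms.LieRinehart C^∞⟮𝓘(ℝ, EM), M; ℝ⟯ Cₛ^∞⟮𝓘(ℝ, EM); F, A⟯ where
  act :=
    { toFun := fun a => derivationOf (𝒜.anchor.onSection a)
      map_add' := fun a b => by
        ext f x
        have : 𝒜.anchor x ((a + b) x) = 𝒜.anchor x (a x) + 𝒜.anchor x (b x) :=
          (𝒜.anchor x).map_add _ _
        exact (congrArg (mfderiv 𝓘(ℝ, EM) 𝓘(ℝ, ℝ) f x) this).trans (map_add _ _ _)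
      map_smul' := fun g a => by
        ext f x
        have : 𝒜.anchor x ((g • a) x) = g x • 𝒜.anchor x (a x) :=
          (𝒜.anchor x).map_smul _ _
        exact (congrArg (mfderiv 𝓘(ℝ, EM) 𝓘(ℝ, ℝ) f x) this).trans (map_smul _ _ _) }
  br := 𝒜.bracket
  br_self := 𝒜.bracket_self
  jacobi := 𝒜.jacobi
  leibniz := fun a f b => 𝒜.leibniz a b f

end LieAlgebroid

section Groupoid

variable (EM : Type*) [NormedAddCommGroup EM] [NormedSpace ℝ EM]
  (M : Type*) [TopologicalSpace M] [ChartedSpace EM M]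
  (EG : Type*) [NormedAddCommGroup EG] [NormedSpace ℝ EG]
  (G : Type*) [TopologicalSpace G] [ChartedSpace EG G]

/-- A Lie groupoid `G ⇉ M`. The value `mul g h` is only relevant for composable arrows, `s g = t h`;
smoothness of the multiplication is smoothness on the submanifold `G^(2)` of `G × G`.
`G` need not be Hausdorff. -/
structure LieGroupoid where
  s : G → M
  t : G → M
  u : M → G
  inv : G → G
  mul : G → G → G
  s_u : ∀ x, s (u x) = x
  t_u : ∀ x, t (u x) = x
  s_mul : ∀ g h, s g = t h → s (mul g h) = s h
  t_mul : ∀ g h, s g = t h → t (mul g h) = t g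
  mul_assoc : ∀ g h k, s g = t h → s h = t k → mul (mul g h) k = mul g (mul h k)
  u_mul : ∀ g, mul (u (t g)) g = g
  mul_u : ∀ g, mul g (u (s g)) = g
  s_inv : ∀ g, s (inv g) = t g
  t_inv : ∀ g, t (inv g) = s g
  inv_mul : ∀ g, mul (inv g) g = u (s g)
  mul_inv : ∀ g, mul g (inv g) = u (t g)
  smooth_s : ContMDiff 𝓘(ℝ, EG) 𝓘(ℝ, EM) ∞ s
  smooth_t : ContMDiff 𝓘(ℝ, EG) 𝓘(ℝ, EM) ∞ t
  smooth_u : ContMDiff 𝓘(ℝ, EM) 𝓘(ℝ, EG) ∞ u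
  smooth_inv : ContMDiff 𝓘(ℝ, EG) 𝓘(ℝ, EG) ∞ inv
  submersion_s : ∀ g, Function.Surjective (mfderiv 𝓘(ℝ, EG) 𝓘(ℝ, EM) s g)
  submersion_t : ∀ g, Function.Surjective (mfderiv 𝓘(ℝ, EG) 𝓘(ℝ, EM) t g)
  smooth_mul : ContMDiffOn (𝓘(ℝ, EG).prod 𝓘(ℝ, EG)) 𝓘(ℝ, EG) ∞
    (fun p : G × G => mul p.1 p.2) {p | s p.1 = t p.2}

variable {EM M EG G}
variable [IsManifold 𝓘(ℝ, EM) ∞ M] [IsManifold 𝓘(ℝ, EG) ∞ G]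

/-- The differential at the unit `u (t g)` of the right translation `R_g : s⁻¹(t g) → G`, `h ↦ h g`.
Only its values on vectors tangent to the `s`-fibre are meaningful (and used). -/
def LieGroupoid.dR (𝒢 : LieGroupoid EM M EG G) (g : G) :
    TangentSpace 𝓘(ℝ, EG) (𝒢.u (𝒢.t g)) →ₗ[ℝ] TangentSpace 𝓘(ℝ, EG) g :=
  (mfderivWithin 𝓘(ℝ, EG) 𝓘(ℝ, EG) (fun h : G => 𝒢.mul h g) {h | 𝒢.s h = 𝒢.t g}
    (𝒢.u (𝒢.t g))).toLinearMap

/-- The differential at the unit `u (s g)` of the left translation `L_g : t⁻¹(s g) → G`, `h ↦ g h`.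
Only its values on vectors tangent to the `t`-fibre are meaningful (and used). -/
def LieGroupoid.dL (𝒢 : LieGroupoid EM M EG G) (g : G) :
    TangentSpace 𝓘(ℝ, EG) (𝒢.u (𝒢.s g)) →ₗ[ℝ] TangentSpace 𝓘(ℝ, EG) g :=
  (mfderivWithin 𝓘(ℝ, EG) 𝓘(ℝ, EG) (fun h : G => 𝒢.mul g h) {h | 𝒢.s g = 𝒢.t h}
    (𝒢.u (𝒢.s g))).toLinearMap

/-- The differential of the inversion at the unit `u x`. -/
def LieGroupoid.dinv (𝒢 : LieGroupoid EM M EG G) (x : M) :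
    TangentSpace 𝓘(ℝ, EG) (𝒢.u x) →ₗ[ℝ] TangentSpace 𝓘(ℝ, EG) (𝒢.u x) :=
  (mfderiv 𝓘(ℝ, EG) 𝓘(ℝ, EG) 𝒢.inv (𝒢.u x)).toLinearMap

variable 
  {F : Type*} [NormedAddCommGroup F] [NormedSpace ℝ F]
  {A : M → Type*} [TopologicalSpace (TotalSpace F A)] [∀ x, TopologicalSpace (A x)]
  [FiberBundle F A] [∀ x, AddCommGroup (A x)] [∀ x, Module ℝ (A x)] [VectorBundle ℝ F A]

/-- The Lie algebroid `A` is the Lie algebroid of the Lie groupoid `G`: its underlying bundle is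
identified by `ι` with the bundle `ker ds|_M`, the anchor is `dt`, and the bracket is the one for which
`a ↦ (right invariant vector field g ↦ dR_g (a (t g)))` preserves brackets. -/
structure LieGroupoid.Algebroid (𝒢 : LieGroupoid EM M EG G) (𝒜 : LieAlgebroid EM M F A) where
  ι : ∀ x, A x →ₗ[ℝ] TangentSpace 𝓘(ℝ, EG) (𝒢.u x)
  smooth : ContMDiff (𝓘(ℝ, EM).prod 𝓘(ℝ, F)) 𝓘(ℝ, EG).tangent ∞
    (fun p : TotalSpace F A => (⟨𝒢.u p.proj, ι p.proj p.2⟩ : TangentBundle 𝓘(ℝ, EG) G))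
  injective : ∀ x, Function.Injective (ι x)
  range : ∀ x, Set.range (ι x) = {v | mfderiv 𝓘(ℝ, EG) 𝓘(ℝ, EM) 𝒢.s (𝒢.u x) v = 0}
  anchor : ∀ x (v : A x), (𝒜.anchor x v : EM) = mfderiv 𝓘(ℝ, EG) 𝓘(ℝ, EM) 𝒢.t (𝒢.u x) (ι x v)
  bracket : ∀ (a b : Cₛ^∞⟮𝓘(ℝ, EM); F, A⟯) (g : G),
    𝒢.dR g (ι (𝒢.t g) (𝒜.bracket a b (𝒢.t g))) =
      VectorField.mlieBracket 𝓘(ℝ, EG) (fun h => 𝒢.dR h (ι (𝒢.t h) (a (𝒢.t h))))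
        (fun h => 𝒢.dR h (ι (𝒢.t h) (b (𝒢.t h)))) g

variable {𝒢 : LieGroupoid EM M EG G} {𝒜 : LieAlgebroid EM M F A}

/-- The right invariant lift `U→_g = dR_g ∘ U_{t g} ∘ dt`. -/
def LieGroupoid.Algebroid.rightLift (Φ : 𝒢.Algebroid 𝒜)
    (U : BundleMap 𝓘(ℝ, EM) EM (TangentSpace 𝓘(ℝ, EM) : M → Type _) F A) (g : G) :
    TangentSpace 𝓘(ℝ, EG) g →ₗ[ℝ] TangentSpace 𝓘(ℝ, EG) g :=
  𝒢.dR g ∘ₗ Φ.ι (𝒢.t g) ∘ₗ U (𝒢.t g) ∘ₗ (mfderiv 𝓘(ℝ, EG) 𝓘(ℝ, EM) 𝒢.t g).toLinearMap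

/-- The left invariant lift `U←_g = dL_g ∘ di ∘ U_{s g} ∘ ds`. -/
def LieGroupoid.Algebroid.leftLift (Φ : 𝒢.Algebroid 𝒜)
    (U : BundleMap 𝓘(ℝ, EM) EM (TangentSpace 𝓘(ℝ, EM) : M → Type _) F A) (g : G) :
    TangentSpace 𝓘(ℝ, EG) g →ₗ[ℝ] TangentSpace 𝓘(ℝ, EG) g :=
  𝒢.dL g ∘ₗ 𝒢.dinv (𝒢.s g) ∘ₗ Φ.ι (𝒢.s g) ∘ₗ U (𝒢.s g) ∘ₗ
    (mfderiv 𝓘(ℝ, EG) 𝓘(ℝ, EM) 𝒢.s g).toLinearMap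

/-- The `(1,1)` tensor `δU = U→ + U←` on `G`. -/
def LieGroupoid.Algebroid.delta (Φ : 𝒢.Algebroid 𝒜)
    (U : BundleMap 𝓘(ℝ, EM) EM (TangentSpace 𝓘(ℝ, EM) : M → Type _) F A) (g : G) :
    TangentSpace 𝓘(ℝ, EG) g →ₗ[ℝ] TangentSpace 𝓘(ℝ, EG) g :=
  Φ.rightLift U g + Φ.leftLift U g

end Groupoid

section Tensors

variable {EM : Type*} [NormedAddCommGroup EM] [NormedSpace ℝ EM]
  {M : Type*} [TopologicalSpace M] [ChartedSpace EM M] [IsManifold 𝓘(ℝ, EM) ∞ M]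
  {EG : Type*} [NormedAddCommGroup EG] [NormedSpace ℝ EG]
  {G : Type*} [TopologicalSpace G] [ChartedSpace EG G] [IsManifold 𝓘(ℝ, EG) ∞ G]
  {F : Type*} [NormedAddCommGroup F] [NormedSpace ℝ F]
  {A : M → Type*} [TopologicalSpace (TotalSpace F A)] [∀ x, TopologicalSpace (A x)]
  [FiberBundle F A] [∀ x, AddCommGroup (A x)] [∀ x, Module ℝ (A x)] [VectorBundle ℝ F A]

variable (EM M F A) in
/-- Triples `(𝒟, ℓ, T^M)` where `ℓ : A → A` is a bundle map, `T^M` is a `(1,1)` tensor on `M` and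
`𝒟 : Γ(A) → Ω¹(M, A)` is additive with
`𝒟(f a) = f 𝒟(a) + df ⊗ ℓ(a) - ⟨df, T^M⟩ ⊗ a`. (Taking `f` constant, `𝒟` is `ℝ`-linear.) -/
structure LinearTriple where
  D : Cₛ^∞⟮𝓘(ℝ, EM); F, A⟯ → BundleMap 𝓘(ℝ, EM) EM (TangentSpace 𝓘(ℝ, EM) : M → Type _) F A
  ℓ : BundleMap 𝓘(ℝ, EM) F A F A
  TM : Tensor11 𝓘(ℝ, EM) M
  D_add : ∀ (a b : Cₛ^∞⟮𝓘(ℝ, EM); F, A⟯) (x : M) (v : TangentSpace 𝓘(ℝ, EM) x),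
    D (a + b) x v = D a x v + D b x v
  leibniz : ∀ (f : C^∞⟮𝓘(ℝ, EM), M; ℝ⟯) (a : Cₛ^∞⟮𝓘(ℝ, EM); F, A⟯) (x : M)
    (v : TangentSpace 𝓘(ℝ, EM) x),
    D (f • a) x v = f x • D a x v + dirDeriv f x v • ℓ x (a x)
      - dirDeriv f x (TM x v) • a x

/-- The vertical lift of `b ∈ A_x` to `p ∈ A_x`: the velocity of `τ ↦ p + τ b` at `τ = 0`. -/
def verticalLift (p : TotalSpace F A) (b : A p.proj) :
    TangentSpace (𝓘(ℝ, EM).prod 𝓘(ℝ, F)) p :=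
  mfderiv 𝓘(ℝ, ℝ) (𝓘(ℝ, EM).prod 𝓘(ℝ, F))
    (fun τ : ℝ => (⟨p.proj, p.2 + τ • b⟩ : TotalSpace F A)) 0 (1 : ℝ)

/-- The differential of the projection `π : A → M`. -/
def projDeriv (p : TotalSpace F A) :
    TangentSpace (𝓘(ℝ, EM).prod 𝓘(ℝ, F)) p →ₗ[ℝ] TangentSpace 𝓘(ℝ, EM) p.proj :=
  (mfderiv (𝓘(ℝ, EM).prod 𝓘(ℝ, F)) 𝓘(ℝ, EM) (TotalSpace.proj : TotalSpace F A → M) p).toLinearMap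

/-- Fibrewise multiplication by `r`. -/
def fiberScale (r : ℝ) (p : TotalSpace F A) : TotalSpace F A := ⟨p.proj, r • p.2⟩

variable [ContMDiffVectorBundle ∞ F A 𝓘(ℝ, EM)]

/-- `T` is a linear `(1,1)` tensor on the total space `A` (i.e. `h_r^* T = T` for the fibrewise
multiplications `h_r`, `r ≠ 0`), and it corresponds to the triple `τ = (𝒟, ℓ, T^M)`: its
`M`-projection is `T^M`, `T a^↑ = ℓ(a)^↑` and `L_{a^↑} T = 𝒟(a)^↑`. Here
`(L_X T)(Y) = [X, T Y] - T [X, Y]`, and, for `B : TM → A`, the core tensor `B^↑` sends a tangent vector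
`ξ` of `A` to the vertical lift of `B(dπ ξ)`. -/
structure HasTriple (T : Tensor11 (𝓘(ℝ, EM).prod 𝓘(ℝ, F)) (TotalSpace F A))
    (τ : LinearTriple EM M F A) : Prop where
  linear : ∀ (r : ℝ), r ≠ 0 → ∀ (p : TotalSpace F A)
    (ξ : TangentSpace (𝓘(ℝ, EM).prod 𝓘(ℝ, F)) p),
    T (fiberScale r p) (mfderiv (𝓘(ℝ, EM).prod 𝓘(ℝ, F)) (𝓘(ℝ, EM).prod 𝓘(ℝ, F))
        (fiberScale r : TotalSpace F A → TotalSpace F A) p ξ)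
      = mfderiv (𝓘(ℝ, EM).prod 𝓘(ℝ, F)) (𝓘(ℝ, EM).prod 𝓘(ℝ, F))
        (fiberScale r : TotalSpace F A → TotalSpace F A) p (T p ξ)
  proj : ∀ (p : TotalSpace F A) (ξ : TangentSpace (𝓘(ℝ, EM).prod 𝓘(ℝ, F)) p),
    projDeriv p (T p ξ) = τ.TM p.proj (projDeriv p ξ)
  vertical : ∀ (a : Cₛ^∞⟮𝓘(ℝ, EM); F, A⟯) (p : TotalSpace F A),
    T p (verticalLift p (a p.proj)) = verticalLift p (τ.ℓ p.proj (a p.proj))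
  lie : ∀ (a : Cₛ^∞⟮𝓘(ℝ, EM); F, A⟯)
    (Y : VectorFields (𝓘(ℝ, EM).prod 𝓘(ℝ, F)) (TotalSpace F A)) (p : TotalSpace F A),
    VectorField.mlieBracket (𝓘(ℝ, EM).prod 𝓘(ℝ, F))
        (fun q => verticalLift q (a q.proj)) (fun q => T q (Y q)) p
      - T p (VectorField.mlieBracket (𝓘(ℝ, EM).prod 𝓘(ℝ, F))
        (fun q => verticalLift q (a q.proj)) (fun q => Y q) p)
      = verticalLift p (τ.D a p.proj (projDeriv p (Y p)))

/-- The canonical flip of the double tangent bundle `TTG`. The tangent space of `G` at `x` is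
coordinatized by the preferred chart at `x`, and that of `TG` at a vector based at `x` by the induced
chart of `TG`; in these coordinates the flip is `(x, v; w, z) ↦ (x, w; v, z)`. -/
def canonicalFlip (ξ : TangentBundle 𝓘(ℝ, EG).tangent (TangentBundle 𝓘(ℝ, EG) G)) :
    TangentBundle 𝓘(ℝ, EG).tangent (TangentBundle 𝓘(ℝ, EG) G) :=
  let w : EG × EG := ξ.2
  ⟨⟨ξ.1.1, (w.1 : EG)⟩, ((ξ.1.2 : EG), (w.2 : EG))⟩

variable {𝒢 : LieGroupoid EM M EG G} {𝒜 : LieAlgebroid EM M F A}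

/-- The inclusion `A ≅ ker ds|_M ⊆ TG`. -/
def LieGroupoid.Algebroid.toTangent (Φ : 𝒢.Algebroid 𝒜) (p : TotalSpace F A) :
    TangentBundle 𝓘(ℝ, EG) G := ⟨𝒢.u p.proj, Φ.ι p.proj p.2⟩

/-- A `(1,1)` tensor on `G` as a map `TG → TG`. -/
def tensorMap (T : ∀ g : G, TangentSpace 𝓘(ℝ, EG) g →ₗ[ℝ] TangentSpace 𝓘(ℝ, EG) g)
    (w : TangentBundle 𝓘(ℝ, EG) G) : TangentBundle 𝓘(ℝ, EG) G := ⟨w.1, T w.1 w.2⟩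

/-- The `(1,1)` tensor `T'` on `A` is obtained from the (multiplicative) `(1,1)` tensor `T` on `G` by
differentiation: `T' : TA → TA` is the restriction of `dT : TTG → TTG` to the Lie algebroid of the tangent
groupoid `TG ⇉ TM`, which is identified with `TA` by the canonical flip of `TTG`. -/
def LieGroupoid.Algebroid.IsDerivative (Φ : 𝒢.Algebroid 𝒜)
    (T : ∀ g : G, TangentSpace 𝓘(ℝ, EG) g →ₗ[ℝ] TangentSpace 𝓘(ℝ, EG) g)
    (T' : Tensor11 (𝓘(ℝ, EM).prod 𝓘(ℝ, F)) (TotalSpace F A)) : Prop :=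
  ∀ (p : TotalSpace F A) (ξ : TangentSpace (𝓘(ℝ, EM).prod 𝓘(ℝ, F)) p),
    tangentMap (𝓘(ℝ, EM).prod 𝓘(ℝ, F)) 𝓘(ℝ, EG).tangent Φ.toTangent ⟨p, T' p ξ⟩ =
      canonicalFlip (tangentMap 𝓘(ℝ, EG).tangent 𝓘(ℝ, EG).tangent (tensorMap T)
        (canonicalFlip
          (tangentMap (𝓘(ℝ, EM).prod 𝓘(ℝ, F)) 𝓘(ℝ, EG).tangent Φ.toTangent ⟨p, ξ⟩)))

end Tensors

section Shifted

variable {EM : Type*} [NormedAddCommGroup EM] [NormedSpace ℝ EM]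
  {M : Type*} [TopologicalSpace M] [ChartedSpace EM M] [IsManifold 𝓘(ℝ, EM) ∞ M]
  {F : Type*} [NormedAddCommGroup F] [NormedSpace ℝ F]
  {A : M → Type*} [TopologicalSpace (TotalSpace F A)] [∀ x, TopologicalSpace (A x)]
  [FiberBundle F A] [∀ x, AddCommGroup (A x)] [∀ x, Module ℝ (A x)] [VectorBundle ℝ F A]

open GradedForms

variable (EM M F A) in
/-- The functions on `A[1]`. -/
abbrev ShiftedFun : Type _ := Form C^∞⟮𝓘(ℝ, EM), M; ℝ⟯ Cₛ^∞⟮𝓘(ℝ, EM); F, A⟯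

variable (EM M F A) in
/-- The vector fields of degree `j` on `A[1]`. -/
abbrev ShiftedVF (j : ℤ) := VF C^∞⟮𝓘(ℝ, EM), M; ℝ⟯ Cₛ^∞⟮𝓘(ℝ, EM); F, A⟯ j

variable (EM M F A) in
/-- The `(1,1)` tensors of internal degree `k` on `A[1]`. -/
abbrev ShiftedTensor (k : ℤ) : Type _ :=
  GradedTensor C^∞⟮𝓘(ℝ, EM), M; ℝ⟯ Cₛ^∞⟮𝓘(ℝ, EM); F, A⟯ k

/-- The operator `X` acts on `C^∞(M)` as the vector field `σ`. For `X = X_D` the vector field of degree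
`0` on `A[1]` given by a derivation `D` of `A`, this says that `σ` is the symbol of `D`. -/
def HasSymbol (X : Module.End ℝ (ShiftedFun EM M F A)) (σ : VectorFields 𝓘(ℝ, EM) M) : Prop :=
  ∀ f : C^∞⟮𝓘(ℝ, EM), M; ℝ⟯, X (Form.const f) = Form.const (derivationOf σ f)

/-- `V = U^↑`: the `(1,1)` tensor of internal degree `-1` on `A[1]` determined by
`U^↑(X) = U(σ)^↑` for the vector fields `X` of degree `0` with symbol `σ`. -/
def IsCoreLift (U : BundleMap 𝓘(ℝ, EM) EM (TangentSpace 𝓘(ℝ, EM) : M → Type _) F A)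
    (V : ShiftedTensor EM M F A (-1)) : Prop :=
  ∀ (X : ShiftedVF EM M F A 0) (σ : VectorFields 𝓘(ℝ, EM) M), HasSymbol X.1 σ →
    (V.toFun 0 X).1 = (VF.ins (U.onSection σ)).1

/-- The `(1,1)` tensor `S` of internal degree `0` on `A[1]` corresponds to the triple
`τ = (𝒟, ℓ, T^M)`: its `M`-projection is `T^M`, `S a^↑ = ℓ(a)^↑` and `L_{a^↑} S = 𝒟(a)^↑`. -/
structure HasShiftedTriple (S : ShiftedTensor EM M F A 0) (τ : LinearTriple EM M F A) : Prop where
  proj : ∀ (X : ShiftedVF EM M F A 0) (σ : VectorFields 𝓘(ℝ, EM) M), HasSymbol X.1 σ →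
    HasSymbol (S.toFun 0 X).1 (τ.TM.onSection σ)
  vertical : ∀ a : Cₛ^∞⟮𝓘(ℝ, EM); F, A⟯,
    (S.toFun (-1) (VF.ins a)).1 = (VF.ins (τ.ℓ.onSection a)).1
  lie : ∀ a : Cₛ^∞⟮𝓘(ℝ, EM); F, A⟯, IsCoreLift (τ.D a) (S.lie (VF.ins a))

variable [ContMDiffVectorBundle ∞ F A 𝓘(ℝ, EM)]

/-- `S = T^[1]`: the linear `(1,1)` tensor `T` on `A` and the `(1,1)` tensor `S` of internal degree `0`
on `A[1]` correspond to the same triple. -/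
def IsShift (T : Tensor11 (𝓘(ℝ, EM).prod 𝓘(ℝ, F)) (TotalSpace F A))
    (S : ShiftedTensor EM M F A 0) : Prop :=
  ∃ τ : LinearTriple EM M F A, HasTriple T τ ∧ HasShiftedTriple S τ

end Shifted

end

noncomputable section

namespace GradedForms

section Basic
variable {R L : Type*} [CommRing R] [AddCommGroup L] [Module R L]

theorem IsForm.eq_zero_of_cons_append {α : List L → R} (h : IsForm α) (a : L) (s u : List L) :
    α (a :: (s ++ a :: u)) = 0 := by
  induction s generalizing α with
  | nil => exact h.2.2 [] u a
  | cons b s ih =>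
    rw [List.cons_append, h.swap a b, neg_eq_zero]
    exact ih (h.ins b)

theorem IsForm.eq_zero_of_not_nodup {α : List L → R} (h : IsForm α) {l : List L}
    (hl : ¬ l.Nodup) : α l = 0 := by
  induction l generalizing α with
  | nil => simp at hl
  | cons a t ih =>
    by_cases ha : a ∈ t
    · obtain ⟨s, u, rfl⟩ := List.append_of_mem ha
      exact h.eq_zero_of_cons_append a s u
    · exact ih (h.ins a) (fun hn => hl (List.nodup_cons.2 ⟨ha, hn⟩))

theorem IsForm.map_sum_append {α : List L → R} (h : IsForm α) {κ : Type*} (s : Finset κ)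
    (f : κ → R) (a : κ → L) (l₁ l₂ : List L) :
    α (l₁ ++ (∑ i ∈ s, f i • a i) :: l₂) = ∑ i ∈ s, f i * α (l₁ ++ a i :: l₂) := by
  classical
  induction s using Finset.induction_on with
  | empty => simpa using h.2.1 l₁ l₂ 0 0
  | insert i s hi ih => rw [Finset.sum_insert hi, Finset.sum_insert hi, h.1, h.2.1, ih]

/-- A linear functional as a form of degree one. -/
def oneFun (θ : L →ₗ[R] R) : List L → R
  | [b] => θ b
  | _ => 0

theorem ins_oneFun (c : L) (θ : L →ₗ[R] R) : ins c (oneFun θ) = constForm (θ c) := by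
  funext l
  match l with
  | [] => rfl
  | _ :: _ => rfl

theorem inv_oneFun (θ : L →ₗ[R] R) : inv (oneFun θ) = -oneFun θ := by
  funext l
  match l with
  | [] => simp [inv, oneFun]
  | [b] => simp [inv, oneFun]
  | _ :: _ :: _ => simp [inv, oneFun]

theorem isForm_constForm (f : R) : IsForm (constForm f : List L → R) := by
  refine IsForm.of_ins (fun a => ?_) (fun a b => ?_) (fun f a => ?_) (fun a => ?_) <;>
  simp only [ins_constForm, add_zero, smul_zero]
  · exact IsForm.zero
  · rfl

theorem constForm_add (f g : R) :
    (constForm (f + g) : List L → R) = constForm f + constForm g := by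
  funext l
  match l with
  | [] => rfl
  | _ :: _ => simp [constForm]

theorem constForm_mul (f g : R) :
    (constForm (f * g) : List L → R) = f • constForm g := by
  funext l
  match l with
  | [] => rfl
  | _ :: _ => simp [constForm]

theorem isForm_oneFun (θ : L →ₗ[R] R) : IsForm (oneFun θ) := by
  refine IsForm.of_ins (fun a => ?_) (fun a b => ?_) (fun f a => ?_) (fun a => ?_)
  · rw [ins_oneFun]; exact isForm_constForm _
  · rw [ins_oneFun, ins_oneFun, ins_oneFun, map_add, constForm_add]
  · rw [ins_oneFun, ins_oneFun, map_smul, smul_eq_mul, constForm_mul]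
  · rw [ins_oneFun, ins_constForm]

/-- The Euler identity `∑ εᵢ ∧ ι_{eᵢ} α = k φ α` in degree `k`, if `∑ εᵢ(a) eᵢ = φ a`. -/
theorem euler_raw {n : ℕ} {φ : R} {e : Fin n → L} {ε : Fin n → L →ₗ[R] R}
    (hf : ∀ a, φ • a = ∑ i, ε i a • e i) {α : List L → R} (hα : IsForm α) (l : List L) :
    ∑ i, wedge (oneFun (ε i)) (ins (e i) α) l = (l.length : R) * (φ * α l) := by
  induction l generalizing α with
  | nil => simp [wedge, oneFun]
  | cons b l ih =>
    have h1 : ∀ i, ins b (ins (e i) α) = - ins (e i) (ins b α) := fun i => by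
      funext l; exact hα.swap (e i) b l
    simp only [wedge, ins_oneFun, wedge_constForm, inv_oneFun, wedge_neg_left, h1,
      wedge_neg_right, neg_neg, Finset.sum_add_distrib, ih (hα.ins b), Pi.smul_apply, smul_eq_mul]
    have h2 := hα.map_sum_append Finset.univ (fun i => ε i b) e [] l
    rw [← hf b] at h2
    have h3 := hα.2.1 [] l φ b
    simp only [List.nil_append] at h2 h3
    rw [h3] at h2
    simp only [ins, List.length_cons, Nat.cast_add, Nat.cast_one]
    rw [← h2]; ring

theorem pow_mul_form_eq_zero {n : ℕ} {φ : R} {e : Fin n → L} {ε : Fin n → L →ₗ[R] R}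
    (hf : ∀ a, φ • a = ∑ i, ε i a • e i) {α : List L → R} (hα : IsForm α) (l : List L)
    (I : List (Fin n)) (hl : n < I.length + l.length) :
    φ ^ l.length * α (I.map e ++ l) = 0 := by
  induction l generalizing I with
  | nil =>
    simp only [List.length_nil, add_zero, List.append_nil] at hl ⊢
    rw [hα.eq_zero_of_not_nodup, mul_zero]
    intro hn
    have := (List.Nodup.of_map _ hn).length_le_card
    simp at this; omega
  | cons b l ih =>
    have h2 := hα.map_sum_append Finset.univ (fun i => ε i b) e (I.map e) l
    rw [← hf b, hα.2.1] at h2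
    rw [List.length_cons, pow_succ, mul_assoc, h2, Finset.mul_sum]
    refine Finset.sum_eq_zero fun i _ => ?_
    have := ih (I ++ [i]) (by simp at hl ⊢; omega)
    simp only [List.map_append, List.map_cons, List.map_nil, List.append_assoc,
      List.singleton_append] at this
    rw [mul_left_comm, this, mul_zero]

end Basic

section FormApi
variable {R L : Type*} [CommRing R] [Algebra ℝ R] [AddCommGroup L] [Module R L]

theorem Form.ext {α β : Form R L} (h : ∀ l, α.1 l = β.1 l) : α = β := Subtype.ext (funext h)

theorem Form.smul_val (f : R) (α : Form R L) : (f • α).1 = f • α.1 := rfl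
theorem Form.rsmul_val (r : ℝ) (α : Form R L) : (r • α).1 = r • α.1 := rfl

theorem Form.sum_val {κ : Type*} (s : Finset κ) (α : κ → Form R L) (l : List L) :
    (∑ i ∈ s, α i).1 l = ∑ i ∈ s, (α i).1 l := by
  classical
  induction s using Finset.induction_on with
  | empty => rfl
  | insert i s hi ih => rw [Finset.sum_insert hi, Finset.sum_insert hi, ← ih]; rfl

theorem Form.const_mul (f : R) (α : Form R L) : Form.const f * α = f • α :=
  Subtype.ext (wedge_constForm f α.1)

theorem Form.const_homog (f : R) : (Form.const f : Form R L).Homog 0 := by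
  intro l hl
  match l with
  | [] => simp at hl
  | _ :: _ => rfl

theorem wedge_constForm_right (f : R) (α : List L → R) : wedge α (constForm f) = f • α := by
  funext l
  induction l generalizing α with
  | nil => simp [wedge, constForm, mul_comm]
  | cons a l ih => simp [wedge, ins_constForm, wedge_zero_right, ih, ins]

theorem Form.mul_const (f : R) (α : Form R L) : α * Form.const f = f • α :=
  Subtype.ext (wedge_constForm_right f α.1)

theorem Form.const_mul_const (f g : R) :
    (Form.const (f * g) : Form R L) = f • Form.const g := Subtype.ext (constForm_mul f g)

theorem Form.const_add (f g : R) :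
    (Form.const (f + g) : Form R L) = Form.const f + Form.const g :=
  Subtype.ext (constForm_add f g)

theorem Form.const_zero : (Form.const 0 : Form R L) = 0 := by
  apply Form.ext; intro l
  match l with
  | [] => rfl
  | _ :: _ => rfl

theorem Form.const_rsmul (r : ℝ) (f : R) :
    (Form.const (r • f) : Form R L) = r • Form.const f := by
  apply Form.ext; intro l
  match l with
  | [] => rfl
  | _ :: _ => exact (smul_zero r).symm

theorem Form.const_sum {κ : Type*} (s : Finset κ) (f : κ → R) :
    (Form.const (∑ i ∈ s, f i) : Form R L) = ∑ i ∈ s, Form.const (f i) := by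
  classical
  induction s using Finset.induction_on with
  | empty => exact Form.const_zero
  | insert i s hi ih => rw [Finset.sum_insert hi, Finset.sum_insert hi, Form.const_add, ih]

theorem Form.smul_mul (f : R) (α β : Form R L) : (f • α) * β = f • (α * β) :=
  Subtype.ext (wedge_smul_left f α.1 β.1)

theorem Form.mul_smul' (f : R) (α β : Form R L) : α * (f • β) = f • (α * β) :=
  Subtype.ext (wedge_smul_right f α.1 β.1)

theorem Form.zero_mul' (β : Form R L) : (0 : Form R L) * β = 0 := Subtype.ext (wedge_zero_left _)

theorem Form.mul_zero' (β : Form R L) : β * (0 : Form R L) = 0 := Subtype.ext (wedge_zero_right _)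

theorem Form.sum_mul' {κ : Type*} (s : Finset κ) (α : κ → Form R L) (β : Form R L) :
    (∑ i ∈ s, α i) * β = ∑ i ∈ s, α i * β := by
  classical
  induction s using Finset.induction_on with
  | empty => exact Form.zero_mul' β
  | insert i s hi ih => rw [Finset.sum_insert hi, Finset.sum_insert hi, Form.add_mul, ih]

theorem Form.Homog.eq_zero {k : ℤ} (hk : k < 0) {α : Form R L} (h : α.Homog k) : α = 0 :=
  Form.ext fun l => h l (by omega)

theorem Form.Homog.eq_const {α : Form R L} (h : α.Homog 0) : α = Form.const (α.1 []) := by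
  apply Form.ext; intro l
  match l with
  | [] => rfl
  | a :: l => exact h _ (by simp; omega)

/-- A linear functional as a form of degree one. -/
def oneForm (θ : L →ₗ[R] R) : Form R L := ⟨oneFun θ, isForm_oneFun θ⟩

theorem oneForm_homog (θ : L →ₗ[R] R) : (oneForm θ).Homog 1 := by
  intro l hl
  match l with
  | [] => rfl
  | [b] => simp at hl
  | _ :: _ :: _ => rfl

theorem ins_oneForm (a : L) (θ : L →ₗ[R] R) : (VF.ins a).1 (oneForm θ) = Form.const (θ a) :=
  Subtype.ext (ins_oneFun a θ)

theorem ins_const (a : L) (f : R) : (VF.ins a).1 (Form.const f) = 0 :=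
  Subtype.ext (ins_constForm a f)

/-- The component of degree `k` of a form. -/
def Form.comp (k : ℕ) (α : Form R L) : Form R L := by
  classical
  refine ⟨fun l => if l.length = k then α.1 l else 0, fun l₁ l₂ a b => ?_, fun l₁ l₂ f a => ?_,
    fun l₁ l₂ a => ?_⟩
  · simp only [List.length_append, List.length_cons]; split_ifs
    · exact α.2.1 l₁ l₂ a b
    · simp
  · simp only [List.length_append, List.length_cons]; split_ifs
    · exact α.2.2.1 l₁ l₂ f a
    · simp
  · simp only [List.length_append, List.length_cons]; split_ifs
    · exact α.2.2.2 l₁ l₂ a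
    · rfl

theorem Form.comp_homog (k : ℕ) (α : Form R L) : (α.comp k).Homog k := by
  intro l hl
  simp only [Form.comp]
  rw [if_neg (by exact_mod_cast hl)]

theorem Form.eq_sum_comp (N : ℕ) (α : Form R L) (h : ∀ l : List L, N < l.length → α.1 l = 0) :
    α = ∑ k ∈ Finset.range (N + 1), α.comp k := by
  apply Form.ext; intro l
  rw [Form.sum_val]
  simp only [Form.comp, Finset.sum_ite_eq, Finset.mem_range]
  split_ifs with hl
  · rfl
  · exact h l (by omega)

theorem euler {n : ℕ} {φ : R} {e : Fin n → L} {ε : Fin n → L →ₗ[R] R}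
    (hf : ∀ a, φ • a = ∑ i, ε i a • e i) {k : ℤ} {α : Form R L} (hα : α.Homog k) :
    ∑ i, oneForm (ε i) * (VF.ins (e i)).1 α = (k : ℝ) • (φ • α) := by
  apply Form.ext; intro l
  rw [Form.sum_val]
  refine (euler_raw hf α.2 l).trans ?_
  rw [Form.rsmul_val, Form.smul_val]
  by_cases hl : (l.length : ℤ) = k
  · subst hl
    simp [Algebra.smul_def]
  · simp [show α.1 l = 0 from hα l hl]

theorem units_smul_apply (s : ℤˣ) (Z : Module.End ℝ (Form R L)) (α : Form R L) :
    (s • Z) α = s • Z α := by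
  rcases Int.units_eq_one_or s with h | h <;> simp [h]

theorem VF.leibniz {j : ℤ} (X : VF R L j) {k : ℤ} {α : Form R L} (hα : α.Homog k)
    (β : Form R L) : X.1 (α * β) = X.1 α * β + (j * k).negOnePow • (α * X.1 β) := X.2.2 k α β hα

theorem VF.map_smul {j : ℤ} (X : VF R L j) (f : R) (α : Form R L) :
    X.1 (f • α) = X.1 (Form.const f) * α + f • X.1 α := by
  rw [← Form.const_mul, VF.leibniz X (Form.const_homog f), mul_zero, Int.negOnePow_zero, one_smul,
    Form.const_mul]

/-- The components of `f ↦ X(f)` are derivations. -/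
def VF.der {j : ℤ} (X : VF R L j) (l : List L) : Derivation ℝ R R :=
  Derivation.mk'
    { toFun := fun f => (X.1 (Form.const f)).1 l
      map_add' := fun f g => by rw [Form.const_add, map_add]; rfl
      map_smul' := fun r f => by rw [Form.const_rsmul, _root_.map_smul]; rfl }
    (fun f g => by
      change (X.1 (Form.const (f * g))).1 l = _
      rw [Form.const_mul_const, VF.map_smul X, Form.mul_const, add_comm]; rfl)

theorem VF.homog {j k : ℤ} (X : VF R L j) {α : Form R L} (hα : α.Homog k) :
    (X.1 α).Homog (k + j) := X.2.1 k α hα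

theorem VF.homog_const {j : ℤ} (X : VF R L j) (f : R) : (X.1 (Form.const f)).Homog j := by
  have := VF.homog X (Form.const_homog f); rwa [zero_add] at this

theorem VF.mem_congr {j j' : ℤ} (h : j = j') {Z : Module.End ℝ (Form R L)} (hZ : Z ∈ VF R L j) :
    Z ∈ VF R L j' := h ▸ hZ

/-- The multiple `f X` of a vector field by a function of degree `0`. -/
def VF.rsmul {j : ℤ} (f : R) (X : VF R L j) : VF R L j :=
  ⟨mulEnd (Form.const f) * X.1,
    VF.mem_congr (zero_add j) (VF.fsmul (Form.const f) (Form.const_homog f) X).2⟩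

theorem VF.rsmul_apply {j : ℤ} (f : R) (X : VF R L j) (α : Form R L) :
    (VF.rsmul f X).1 α = f • X.1 α := Form.const_mul f _

theorem GradedTensor.toFun_val_congr {k : ℤ} (T : GradedTensor R L k) {j j' : ℤ} (h : j = j')
    {X : VF R L j} {Y : VF R L j'} (hXY : X.1 = Y.1) : (T.toFun j X).1 = (T.toFun j' Y).1 := by
  subst h
  rw [Subtype.ext hXY]

theorem GradedTensor.toFun_of_eq_fsmul {k : ℤ} (T : GradedTensor R L k) {i j J : ℤ}
    (h : J = i + j) {Z : VF R L J} {α : Form R L} (hα : α.Homog i) {X : VF R L j}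
    (hZ : Z.1 = mulEnd α * X.1) :
    (T.toFun J Z).1 = (k * i).negOnePow • (mulEnd α * (T.toFun j X).1) := by
  rw [← T.map_fsmul i j α hα X]
  exact T.toFun_val_congr h hZ

theorem GradedTensor.toFun_rsmul {k j : ℤ} (T : GradedTensor R L k) (f : R) (X : VF R L j) :
    (T.toFun j (VF.rsmul f X)).1 = (VF.rsmul f (T.toFun j X)).1 := by
  rw [T.toFun_of_eq_fsmul (zero_add j).symm (Form.const_homog f) rfl, mul_zero,
    Int.negOnePow_zero, one_smul]; rfl

end FormApi

end GradedForms

end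

noncomputable section

namespace GradedForms

section CovariantDerivative
variable {R L : Type*} [CommRing R] [Algebra ℝ R] [AddCommGroup L] [Module R L]
  (δ : Derivation ℝ R R) (N : L →+ L)

/-- The action on forms of an operator `N` on sections, with symbol `δ`:
`(δ α)(b₁, …, bₖ) = δ(α(b₁, …, bₖ)) - ∑ᵢ α(b₁, …, N bᵢ, …, bₖ)`. -/
def covForm : (List L → R) → List L → R
  | α, [] => δ (α [])
  | α, b :: l => covForm (ins b α) l - α (N b :: l)

theorem ins_covForm (b : L) (α : List L → R) :
    ins b (covForm δ N α) = covForm δ N (ins b α) - ins (N b) α := rfl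

theorem covForm_add (α β : List L → R) :
    covForm δ N (α + β) = covForm δ N α + covForm δ N β := by
  funext l
  induction l generalizing α β with
  | nil => simp [covForm]
  | cons b l ih =>
    have h : ins b (α + β) = ins b α + ins b β := rfl
    simp only [covForm, h, ih, Pi.add_apply]; ring

theorem covForm_mul (f : R) (α : List L → R) :
    covForm δ N (f • α) = f • covForm δ N α + δ f • α := by
  funext l
  induction l generalizing α with
  | nil => simp [covForm]; ring
  | cons b l ih =>
    have h : ins b (f • α) = f • ins b α := rfl
    simp only [covForm, h, ih, Pi.add_apply, Pi.smul_apply, smul_eq_mul, ins]; ring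

theorem covForm_smul (r : ℝ) (α : List L → R) :
    covForm δ N (r • α) = r • covForm δ N α := by
  have h : r • α = algebraMap ℝ R r • α := by funext l; simp [Algebra.smul_def]
  rw [h, covForm_mul]; funext l; simp [Algebra.smul_def]

theorem covForm_neg (α : List L → R) : covForm δ N (-α) = -covForm δ N α := by
  have := covForm_smul δ N (-1) α; simpa using this

theorem covForm_zero : covForm δ N 0 = 0 := by
  have := covForm_smul δ N 0 0; simpa using this

theorem covForm_inv (α : List L → R) : covForm δ N (inv α) = inv (covForm δ N α) := by
  funext l
  induction l generalizing α with
  | nil => simp [covForm, inv]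
  | cons b l ih =>
    have ih' := ih (ins b α)
    simp only [covForm, ins_inv, covForm_neg, Pi.neg_apply, ih']
    simp only [inv, covForm, List.length_cons, pow_succ]; ring

theorem covForm_wedge (α β : List L → R) :
    covForm δ N (wedge α β) = wedge (covForm δ N α) β + wedge α (covForm δ N β) := by
  funext l
  induction l generalizing α β with
  | nil => simp [covForm, wedge]; ring
  | cons b l ih =>
    simp only [covForm, ins_wedge, covForm_add, Pi.add_apply, ih, covForm_inv, wedge, ins_covForm]
    simp only [sub_eq_add_neg, wedge_add_left, wedge_add_right, wedge_neg_left, wedge_neg_right,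
      Pi.add_apply, Pi.neg_apply]
    ring

theorem HomogRaw.covForm {k : ℤ} {α : List L → R} (h : HomogRaw k α) :
    HomogRaw k (covForm δ N α) := by
  intro l
  induction l generalizing α k with
  | nil => intro hl; simp [GradedForms.covForm, h [] hl]
  | cons b l ih =>
    intro hl
    simp only [GradedForms.covForm]
    rw [ih (h.ins b) (by simp at hl; omega), h _ (by simpa using hl), sub_zero]

theorem IsForm.covForm (hN : ∀ (f : R) a, N (f • a) = f • N a + δ f • a) {α : List L → R}
    (hα : IsForm α) : IsForm (covForm δ N α) := by
  have key : ∀ (l₁ : List L) (α : List L → R), IsForm α →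
     (∀ l₂ b c, GradedForms.covForm δ N α (l₁ ++ (b + c) :: l₂)
        = GradedForms.covForm δ N α (l₁ ++ b :: l₂)
          + GradedForms.covForm δ N α (l₁ ++ c :: l₂)) ∧
     (∀ l₂ (f : R) b, GradedForms.covForm δ N α (l₁ ++ (f • b) :: l₂)
        = f * GradedForms.covForm δ N α (l₁ ++ b :: l₂)) ∧
     (∀ l₂ b, GradedForms.covForm δ N α (l₁ ++ b :: b :: l₂) = 0) := by
    intro l₁
    induction l₁ with
    | nil =>
      intro α hα
      refine ⟨fun l₂ b c => ?_, fun l₂ f b => ?_, fun l₂ b => ?_⟩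
      · have h := hα.1 [] l₂ (N b) (N c)
        simp only [List.nil_append] at h
        simp only [List.nil_append, GradedForms.covForm, hα.ins_add, covForm_add, map_add,
          Pi.add_apply, h]
        ring
      · have h := hα.1 [] l₂ (f • N b) (δ f • b)
        have h1 := hα.2.1 [] l₂ f (N b)
        have h2 := hα.2.1 [] l₂ (δ f) b
        simp only [List.nil_append] at h h1 h2
        simp only [List.nil_append, GradedForms.covForm, hα.ins_smul, covForm_mul, hN,
          Pi.add_apply, h, h1, h2, Pi.smul_apply, smul_eq_mul, GradedForms.ins]
        ring
      · have h := hα.swap (N b) b l₂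
        simp only [List.nil_append, GradedForms.covForm, hα.ins_ins, covForm_zero,
          GradedForms.ins, h, Pi.zero_apply]
        ring
    | cons d l ih =>
      intro α hα
      obtain ⟨p1, p2, p3⟩ := ih _ (hα.ins d)
      refine ⟨fun l₂ b c => ?_, fun l₂ f b => ?_, fun l₂ b => ?_⟩
      · have h := hα.1 (N d :: l) l₂ b c
        simp only [List.cons_append] at h
        simp only [List.cons_append, GradedForms.covForm, p1, h]; ring
      · have h := hα.2.1 (N d :: l) l₂ f b
        simp only [List.cons_append] at h
        simp only [List.cons_append, GradedForms.covForm, p2, h]; ring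
      · have h := hα.2.2 (N d :: l) l₂ b
        simp only [List.cons_append] at h
        simp only [List.cons_append, GradedForms.covForm, p3, h]; ring
  exact ⟨fun l₁ => (key l₁ α hα).1, fun l₁ => (key l₁ α hα).2.1, fun l₁ => (key l₁ α hα).2.2⟩

/-- The vector field of degree `0` given by an operator with symbol `δ`. -/
def VF.cov (hN : ∀ (f : R) a, N (f • a) = f • N a + δ f • a) : VF R L 0 :=
  ⟨{ toFun := fun α => ⟨covForm δ N α.1, IsForm.covForm δ N hN α.2⟩
     map_add' := fun α β => Subtype.ext (covForm_add δ N α.1 β.1)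
     map_smul' := fun r α => Subtype.ext (covForm_smul δ N r α.1) }, by
    refine ⟨fun k α h => ?_, fun k α β _ => Subtype.ext ?_⟩
    · rw [add_zero]; exact HomogRaw.covForm δ N h
    · rw [zero_mul, Int.negOnePow_zero, one_smul]
      exact covForm_wedge δ N α.1 β.1⟩

theorem VF.cov_const (hN : ∀ (f : R) a, N (f • a) = f • N a + δ f • a) (f : R) :
    (VF.cov δ N hN).1 (Form.const f) = Form.const (δ f) := by
  apply Form.ext; intro l
  change covForm δ N (constForm f) l = constForm (δ f) l
  induction l with
  | nil => rfl
  | cons b l ih => simp [covForm, ins_constForm, covForm_zero, constForm]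

end CovariantDerivative

section Local
variable {R L 𝔛 : Type*} [CommRing R] [Algebra ℝ R] [AddCommGroup L] [Module R L]
  [AddCommGroup 𝔛] [Module R 𝔛]

/-- Localized frames of `L` and localized coordinates: `φ` is a cut-off function, `eᵢ`, `εⁱ` are
dual frames and `gᵢ`, `vᵢ` are coordinates with the dual vector fields, up to the factor `φ`. -/
structure LocalCoords (L : Type*) [AddCommGroup L] [Module R L]
    (act : 𝔛 →ₗ[R] Derivation ℝ R R) (n m : ℕ) where
  φ : R
  e : Fin n → L
  ε : Fin n → L →ₗ[R] R
  frame : ∀ a, φ • a = ∑ i, ε i a • e i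
  g : Fin m → R
  v : Fin m → 𝔛
  coord : ∀ (D : Derivation ℝ R R) (f : R), φ * D f = ∑ i, act (v i) f * D (g i)

/-- A family of localized frames and coordinates whose cut-off functions detect and glue functions. -/
structure CoordCover (L : Type*) [AddCommGroup L] [Module R L]
    (act : 𝔛 →ₗ[R] Derivation ℝ R R) (n m : ℕ) (κ : Type*) where
  C : κ → LocalCoords L act n m
  sep : ∀ (r : ℕ) (f : R), (∀ c, (C c).φ ^ r * f = 0) → f = 0
  glue : ∀ F : κ → R, (∀ c c', (C c).φ * F c' = (C c').φ * F c) → ∃ f, ∀ c, (C c).φ * f = F c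
  act_injective : Function.Injective act

variable {act : 𝔛 →ₗ[R] Derivation ℝ R R} {n m : ℕ} {κ : Type*} (𝒞 : CoordCover L act n m κ)

end Local
end GradedForms

end

noncomputable section

namespace GradedForms

section Local
variable {R L 𝔛 : Type*} [CommRing R] [Algebra ℝ R] [AddCommGroup L] [Module R L]
  [AddCommGroup 𝔛] [Module R 𝔛]
variable {act : 𝔛 →ₗ[R] Derivation ℝ R R} {n m : ℕ} {κ : Type*} (𝒞 : CoordCover L act n m κ)

include 𝒞 in
theorem CoordCover.form_sep (r : ℕ) {α : Form R L} (h : ∀ c, (𝒞.C c).φ ^ r • α = 0) : α = 0 :=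
  Form.ext fun l => 𝒞.sep r _ fun c => congrFun (congrArg Subtype.val (h c)) l

include 𝒞 in
theorem CoordCover.form_ext {α β : Form R L} (h : ∀ c, (𝒞.C c).φ • α = (𝒞.C c).φ • β) : α = β :=
  sub_eq_zero.1 (𝒞.form_sep 1 fun c => by rw [pow_one, smul_sub, h, sub_self])

include 𝒞 in
theorem CoordCover.end_sep (r : ℕ) {Z : Module.End ℝ (Form R L)}
    (h : ∀ c α, (𝒞.C c).φ ^ r • Z α = 0) : Z = 0 :=
  LinearMap.ext fun α => 𝒞.form_sep r fun c => h c α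

include 𝒞 in
theorem CoordCover.form_eq_zero (α : Form R L) {l : List L} (hl : n < l.length) : α.1 l = 0 :=
  𝒞.sep l.length _ fun c => pow_mul_form_eq_zero (𝒞.C c).frame α.2 l [] (by simpa using hl)

include 𝒞 in
/-- A vector field which annihilates the functions of degree `0` and `1` is zero. -/
theorem CoordCover.vf_eq_zero {j : ℤ} (X : VF R L j) (h0 : ∀ f, X.1 (Form.const f) = 0)
    (h1 : ∀ θ, X.1 (oneForm θ) = 0) : X.1 = 0 := by
  have key : ∀ (k : ℕ) (α : Form R L), α.Homog k → X.1 α = 0 := by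
    intro k
    induction k with
    | zero => intro α hα; rw [Form.Homog.eq_const hα, h0]
    | succ k ih =>
      intro α hα
      refine 𝒞.form_sep 1 fun c => ?_
      have h2 := congrArg X.1 (euler (𝒞.C c).frame hα)
      rw [map_sum, map_smul, VF.map_smul, h0, Form.zero_mul', zero_add] at h2
      rw [Finset.sum_eq_zero] at h2
      · rw [pow_one]
        refine (smul_eq_zero.1 h2.symm).resolve_left ?_
        exact_mod_cast Nat.succ_ne_zero k
      · intro i _
        have h3 := VF.homog (VF.ins ((𝒞.C c).e i)) hα
        rw [VF.leibniz X (oneForm_homog _), h1, Form.zero_mul', ih _ (by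
          convert h3 using 1; push_cast; ring), Form.mul_zero', smul_zero, add_zero]
  refine LinearMap.ext fun α => ?_
  rw [Form.eq_sum_comp n α fun l hl => 𝒞.form_eq_zero α hl, map_sum]
  exact Finset.sum_eq_zero fun k _ => key k _ (α.comp_homog k)

include 𝒞 in
theorem CoordCover.vf_ext {j : ℤ} {X Y : VF R L j}
    (h0 : ∀ f, X.1 (Form.const f) = Y.1 (Form.const f))
    (h1 : ∀ θ, X.1 (oneForm θ) = Y.1 (oneForm θ)) : X = Y := by
  have := 𝒞.vf_eq_zero (X - Y) (fun f => by simp [h0]) (fun θ => by simp [h1])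
  exact sub_eq_zero.1 (Subtype.ext this)

include 𝒞 in
theorem CoordCover.vf_eq_zero_of_lt {j : ℤ} (hj : j < -1) (X : VF R L j) : X = 0 :=
  Subtype.ext (𝒞.vf_eq_zero X (fun f => (VF.homog_const X f).eq_zero (by omega))
    fun θ => (VF.homog X (oneForm_homog θ)).eq_zero (by omega))

theorem VF.const_eq_zero_of_neg {j : ℤ} (hj : j < 0) (X : VF R L j) (f : R) :
    X.1 (Form.const f) = 0 := (VF.homog_const X f).eq_zero hj

/-- The multiple `α X` of a vector field by a homogeneous function, in a given total degree. -/
def VF.fsmulTo {i j J : ℤ} (h : i + j = J) (α : Form R L) (hα : α.Homog i) (X : VF R L j) :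
    VF R L J := ⟨mulEnd α * X.1, VF.mem_congr h (VF.fsmul α hα X).2⟩

theorem VF.fsmulTo_apply {i j J : ℤ} (h : i + j = J) (α : Form R L) (hα : α.Homog i)
    (X : VF R L j) (β : Form R L) : (VF.fsmulTo h α hα X).1 β = α * X.1 β := rfl

theorem VF.sum_apply {κ : Type*} {j : ℤ} (s : Finset κ) (X : κ → VF R L j) (α : Form R L) :
    (∑ i ∈ s, X i).1 α = ∑ i ∈ s, (X i).1 α := by
  rw [AddSubmonoidClass.coe_finsetSum, LinearMap.sum_apply]

theorem GradedTensor.toFun_fsmulTo {k : ℤ} (T : GradedTensor R L k) {i j J : ℤ} (h : i + j = J)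
    {α : Form R L} (hα : α.Homog i) (X : VF R L j) :
    (T.toFun J (VF.fsmulTo h α hα X)).1 = (k * i).negOnePow • (mulEnd α * (T.toFun j X).1) :=
  T.toFun_of_eq_fsmul h.symm hα rfl

theorem LocalCoords.oneForm_eq (c : LocalCoords L act n m) (θ : L →ₗ[R] R) :
    c.φ • oneForm θ = ∑ i, θ (c.e i) • oneForm (c.ε i) := by
  apply Form.ext; intro l
  rw [Form.sum_val, Form.smul_val]
  match l with
  | [] => simp only [Form.smul_val]; simp [oneForm, oneFun]
  | [b] =>
    have := congrArg θ (c.frame b)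
    simp only [map_sum, map_smul, smul_eq_mul] at this
    simp only [Form.smul_val, oneForm, oneFun, Pi.smul_apply, smul_eq_mul, this]
    exact Finset.sum_congr rfl fun i _ => mul_comm _ _
  | _ :: _ :: _ => simp only [Form.smul_val]; simp [oneForm, oneFun]

theorem VF.smul_of_const_eq_zero {j : ℤ} (X : VF R L j) (h0 : ∀ f, X.1 (Form.const f) = 0) (f : R)
    (α : Form R L) : X.1 (f • α) = f • X.1 α := by
  rw [VF.map_smul, h0, Form.zero_mul', zero_add]

/-- A vector field vanishing on `R` is locally a combination of contractions. -/
theorem CoordCover.vertical_eq {j : ℤ} (X : VF R L j) (h0 : ∀ f, X.1 (Form.const f) = 0) (c : κ) :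
    VF.rsmul (𝒞.C c).φ X = ∑ i, VF.fsmulTo (by ring) (X.1 (oneForm ((𝒞.C c).ε i)))
      (VF.homog X (oneForm_homog _)) (VF.ins ((𝒞.C c).e i)) := by
  refine 𝒞.vf_ext (fun f => ?_) fun θ => ?_
  · rw [VF.sum_apply, VF.rsmul_apply, h0, smul_zero]
    refine (Finset.sum_eq_zero fun i _ => ?_).symm
    rw [VF.fsmulTo_apply, ins_const, Form.mul_zero']
  · rw [VF.sum_apply, VF.rsmul_apply, ← VF.smul_of_const_eq_zero X h0, LocalCoords.oneForm_eq,
      map_sum]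
    refine Finset.sum_congr rfl fun i _ => ?_
    rw [VF.fsmulTo_apply, ins_oneForm, Form.mul_const, VF.smul_of_const_eq_zero X h0]

theorem LocalCoords.const_eq (c : LocalCoords L act n m) {j : ℤ} (X : VF R L j) (f : R) :
    c.φ • X.1 (Form.const f) = ∑ i, act (c.v i) f • X.1 (Form.const (c.g i)) := by
  apply Form.ext; intro l
  rw [Form.sum_val]
  exact c.coord (VF.der X l) f

/-- A vector field of degree `0` with symbol `φ δ`. -/
def LocalCoords.lift (c : LocalCoords L act n m) (δ : Derivation ℝ R R) : VF R L 0 :=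
  VF.cov (c.φ • δ)
    { toFun := fun a => ∑ i, δ (c.ε i a) • c.e i
      map_zero' := by simp
      map_add' := fun a b => by simp [add_smul, Finset.sum_add_distrib] } (fun f a => by
    simp only [AddMonoidHom.coe_mk, ZeroHom.coe_mk, map_smul, smul_eq_mul, Derivation.leibniz,
      add_smul, Finset.sum_add_distrib, Finset.smul_sum, Derivation.coe_smul, Pi.smul_apply]
    rw [mul_comm c.φ, mul_smul, c.frame, Finset.smul_sum]
    congr 1
    · exact Finset.sum_congr rfl fun i _ => mul_smul _ _ _
    · exact Finset.sum_congr rfl fun i _ => by rw [← mul_smul, mul_comm])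

theorem LocalCoords.lift_const (c : LocalCoords L act n m) (δ : Derivation ℝ R R) (f : R) :
    (c.lift δ).1 (Form.const f) = Form.const (c.φ * δ f) := VF.cov_const _ _ _ f

include 𝒞 in
/-- A tensor is determined by its values on the contractions and the vector fields of degree `0`. -/
theorem CoordCover.tensor_ext {k : ℤ} {S T : GradedTensor R L k}
    (h1 : ∀ a, (S.toFun (-1) (VF.ins a)).1 = (T.toFun (-1) (VF.ins a)).1)
    (h0 : ∀ X, (S.toFun 0 X).1 = (T.toFun 0 X).1) : S = T := by
  apply GradedTensor.ext
  funext j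
  refine LinearMap.ext fun X => Subtype.ext ?_
  rw [← sub_eq_zero]
  refine 𝒞.end_sep 3 fun c α => ?_
  set W : VF R L j := VF.rsmul (𝒞.C c).φ (VF.rsmul (𝒞.C c).φ X)
    - ∑ i, VF.fsmulTo (add_zero j) (X.1 (Form.const ((𝒞.C c).g i))) (VF.homog_const X _)
      ((𝒞.C c).lift (act ((𝒞.C c).v i))) with hW
  have hW0 : ∀ f, W.1 (Form.const f) = 0 := by
    intro f
    rw [hW]
    simp only [Submodule.coe_sub, LinearMap.sub_apply, VF.rsmul_apply, VF.sum_apply,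
      VF.fsmulTo_apply, LocalCoords.lift_const, LocalCoords.const_eq, Form.mul_const]
    rw [Finset.smul_sum, sub_eq_zero]
    exact Finset.sum_congr rfl fun i _ => (mul_smul _ _ _).symm
  have hv := 𝒞.vertical_eq W hW0 c
  have hX : VF.rsmul (𝒞.C c).φ (VF.rsmul (𝒞.C c).φ X) = W +
    ∑ i, VF.fsmulTo (add_zero j) (X.1 (Form.const ((𝒞.C c).g i))) (VF.homog_const X _)
      ((𝒞.C c).lift (act ((𝒞.C c).v i))) := by rw [hW]; abel
  have key : ∀ T : GradedTensor R L k, (𝒞.C c).φ ^ 3 • (T.toFun j X).1 α =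
      (T.toFun j (VF.rsmul (𝒞.C c).φ W)).1 α + (𝒞.C c).φ •
      (T.toFun j (∑ i, VF.fsmulTo (add_zero j) (X.1 (Form.const ((𝒞.C c).g i)))
      (VF.homog_const X _) ((𝒞.C c).lift (act ((𝒞.C c).v i))))).1 α := by
    intro T
    rw [GradedTensor.toFun_rsmul, VF.rsmul_apply, ← smul_add, ← LinearMap.add_apply,
      ← Submodule.coe_add, ← map_add, ← hX, GradedTensor.toFun_rsmul, VF.rsmul_apply,
      GradedTensor.toFun_rsmul, VF.rsmul_apply, smul_smul, smul_smul]
    congr 1; ring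
  rw [LinearMap.sub_apply, smul_sub, key S, key T, hv, sub_eq_zero]
  simp only [map_sum, VF.sum_apply, GradedTensor.toFun_fsmulTo, h1, h0]

end Local
end GradedForms

end

noncomputable section

namespace GradedForms

section Core
variable {R L 𝔛 : Type*} [CommRing R] [Algebra ℝ R] [AddCommGroup L] [Module R L]
  [AddCommGroup 𝔛] [Module R 𝔛]
variable {act : 𝔛 →ₗ[R] Derivation ℝ R R} {n m : ℕ} {κ : Type*} (𝒞 : CoordCover L act n m κ)

theorem derivation_sum_apply {ν : Type*} (s : Finset ν) (D : ν → Derivation ℝ R R) (f : R) :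
    (∑ i ∈ s, D i) f = ∑ i ∈ s, D i f := by
  rw [← Finset.sum_apply]
  exact congrFun (map_sum (Derivation.coeFnAddMonoidHom (R := ℝ) (A := R) (M := R)) D s) f

theorem CoordCover.form_glue (F : κ → Form R L)
    (hF : ∀ c c', (𝒞.C c).φ • F c' = (𝒞.C c').φ • F c) :
    ∃ α : Form R L, ∀ c, (𝒞.C c).φ • α = F c := by
  have h := fun l => 𝒞.glue (fun c => (F c).1 l)
    (fun c c' => congrFun (congrArg Subtype.val (hF c c')) l)
  choose f hf using h
  refine ⟨⟨f, fun l₁ l₂ a b => ?_, fun l₁ l₂ r a => ?_, fun l₁ l₂ a => ?_⟩,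
    fun c => Form.ext fun l => hf l c⟩
  · rw [← sub_eq_zero]
    refine 𝒞.sep 1 _ fun c => ?_
    rw [pow_one, mul_sub, mul_add, hf, hf, hf, (F c).2.1, sub_self]
  · rw [← sub_eq_zero]
    refine 𝒞.sep 1 _ fun c => ?_
    rw [pow_one, mul_sub, mul_left_comm, hf, hf, (F c).2.2.1, sub_self]
  · refine 𝒞.sep 1 _ fun c => ?_
    rw [pow_one, hf, (F c).2.2.2]

theorem Form.smul_units_smul (f : R) (s : ℤˣ) (α : Form R L) : f • s • α = s • f • α := by
  rcases Int.units_eq_one_or s with h | h <;> simp [h]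

theorem CoordCover.vf_glue {j : ℤ} (E : κ → VF R L j)
    (hE : ∀ c c' α, (𝒞.C c).φ • (E c').1 α = (𝒞.C c').φ • (E c).1 α) :
    ∃ X : VF R L j, ∀ c α, (𝒞.C c).φ • X.1 α = (E c).1 α := by
  have h := fun α => 𝒞.form_glue (fun c => (E c).1 α) (fun c c' => hE c c' α)
  choose X hX using h
  refine ⟨⟨{ toFun := X, map_add' := fun α β => ?_, map_smul' := fun r α => ?_ },
    fun k α hα => ?_, fun k α β hα => ?_⟩, fun c α => hX α c⟩
  · refine 𝒞.form_ext fun c => ?_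
    rw [smul_add, hX, hX, hX, map_add]
  · refine 𝒞.form_ext fun c => Form.ext fun l => ?_
    have h1 := congrFun (congrArg Subtype.val (hX (r • α) c)) l
    have h2 := congrFun (congrArg Subtype.val (hX α c)) l
    rw [_root_.map_smul] at h1
    refine h1.trans ?_
    change r • ((E c).1 α).1 l = (𝒞.C c).φ * (r • (X α).1 l)
    rw [← h2, mul_smul_comm]; rfl
  · intro l hl
    refine 𝒞.sep 1 _ fun c => ?_
    rw [pow_one]
    exact (congrFun (congrArg Subtype.val (hX α c)) l).trans (VF.homog (E c) hα l hl)
  · refine 𝒞.form_ext fun c => ?_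
    change (𝒞.C c).φ • X (α * β) = (𝒞.C c).φ • (X α * β + (j * k).negOnePow • (α * X β))
    rw [smul_add, hX, VF.leibniz (E c) hα, Form.smul_units_smul, ← Form.smul_mul, hX,
      ← Form.mul_smul', hX]

/-- Contraction of a fixed form, as a linear map. -/
def insLin (α : Form R L) : L →ₗ[R] Form R L where
  toFun a := (VF.ins a).1 α
  map_add' a b := Subtype.ext (IsForm.ins_add α.2 a b)
  map_smul' f a := Subtype.ext (IsForm.ins_smul α.2 f a)

theorem ins_sum_smul {ν : Type*} (s : Finset ν) (f : ν → R) (a : ν → L) (α : Form R L) :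
    (VF.ins (∑ i ∈ s, f i • a i)).1 α = ∑ i ∈ s, f i • (VF.ins (a i)).1 α := by
  change insLin α _ = _
  rw [map_sum]
  exact Finset.sum_congr rfl fun i _ => map_smul (insLin α) _ _

theorem ins_ins_comm (a b : L) (α : Form R L) :
    (VF.ins a).1 ((VF.ins b).1 α) = -(VF.ins b).1 ((VF.ins a).1 α) :=
  Form.ext fun l => α.2.swap b a l

variable (U : 𝔛 →ₗ[R] L)

/-- The value of the core lift of `U` on a vector field, localized by the factor `φ`. -/
def LocalCoords.core (c : LocalCoords L act n m) {j : ℤ} (X : VF R L j) : VF R L (j + -1) :=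
  ⟨j.negOnePow • (∑ i, VF.fsmulTo (J := j + -1) rfl (X.1 (Form.const (c.g i)))
    (VF.homog_const X _) (VF.ins (U (c.v i)))).1, units_smul_mem _ _ (Subtype.property _)⟩

theorem LocalCoords.core_apply (c : LocalCoords L act n m) {j : ℤ} (X : VF R L j) (α : Form R L) :
    (c.core U X).1 α = j.negOnePow • ∑ i, X.1 (Form.const (c.g i)) * (VF.ins (U (c.v i))).1 α := by
  change (j.negOnePow • (∑ i, VF.fsmulTo (J := j + -1) rfl (X.1 (Form.const (c.g i)))
    (VF.homog_const X _) (VF.ins (U (c.v i)))).1) α = _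
  rw [units_smul_apply, VF.sum_apply]; rfl

theorem CoordCover.smul_eq_sum (c : κ) (σ : 𝔛) :
    (𝒞.C c).φ • σ = ∑ i, act σ ((𝒞.C c).g i) • (𝒞.C c).v i := by
  apply 𝒞.act_injective
  ext f
  rw [map_smul, map_sum, Derivation.smul_apply, smul_eq_mul, (𝒞.C c).coord,
    derivation_sum_apply]
  refine Finset.sum_congr rfl fun i _ => ?_
  rw [map_smul, Derivation.smul_apply, smul_eq_mul, mul_comm]

theorem CoordCover.core_compat (c c' : κ) {j : ℤ} (X : VF R L j) (α : Form R L) :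
    (𝒞.C c).φ • ((𝒞.C c').core U X).1 α = (𝒞.C c').φ • ((𝒞.C c).core U X).1 α := by
  rw [LocalCoords.core_apply, LocalCoords.core_apply, Form.smul_units_smul, Form.smul_units_smul]
  congr 1
  simp only [Finset.smul_sum, ← Form.smul_mul, (𝒞.C c).const_eq, Form.sum_mul']
  rw [Finset.sum_comm]
  refine Finset.sum_congr rfl fun i _ => ?_
  have h : (𝒞.C c').φ • (VF.ins (U ((𝒞.C c).v i))).1 α =
      ∑ k, act ((𝒞.C c).v i) ((𝒞.C c').g k) • (VF.ins (U ((𝒞.C c').v k))).1 α := by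
    rw [← ins_sum_smul]
    have := congrArg (fun σ => insLin α (U σ)) (𝒞.smul_eq_sum c' ((𝒞.C c).v i))
    simp only [map_smul, map_sum] at this
    rw [ins_sum_smul]
    exact this
  rw [Form.smul_mul, ← Form.mul_smul', h]
  have : ∀ (β : Form R L) (γ : Fin m → Form R L), β * ∑ k, γ k = ∑ k, β * γ k := fun β γ =>
    map_sum (mulEnd β) γ Finset.univ
  rw [this]
  exact Finset.sum_congr rfl fun k _ => by rw [Form.smul_mul, Form.mul_smul']

/-- The value of the core lift of `U` on a vector field. -/
def CoordCover.coreVal {j : ℤ} (X : VF R L j) : VF R L (j + -1) :=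
  (𝒞.vf_glue (fun c => (𝒞.C c).core U X) fun c c' α => 𝒞.core_compat U c c' X α).choose

theorem CoordCover.coreVal_apply {j : ℤ} (X : VF R L j) (c : κ) (α : Form R L) :
    (𝒞.C c).φ • (𝒞.coreVal U X).1 α =
      j.negOnePow • ∑ i, X.1 (Form.const ((𝒞.C c).g i)) * (VF.ins (U ((𝒞.C c).v i))).1 α := by
  rw [← LocalCoords.core_apply]
  exact (𝒞.vf_glue (fun c => (𝒞.C c).core U X)
    fun c c' α => 𝒞.core_compat U c c' X α).choose_spec c α

/-- The core lift `U^↑`. -/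
def CoordCover.core : GradedTensor R L (-1) where
  toFun j :=
    { toFun := fun X => 𝒞.coreVal U X
      map_add' := fun X Y => Subtype.ext <| LinearMap.ext fun α => 𝒞.form_ext fun c => by
        rw [Submodule.coe_add, LinearMap.add_apply, smul_add, coreVal_apply, coreVal_apply,
          coreVal_apply, ← smul_add, ← Finset.sum_add_distrib]
        simp only [Submodule.coe_add, LinearMap.add_apply, Form.add_mul]
      map_smul' := fun r X => Subtype.ext <| LinearMap.ext fun α => 𝒞.form_ext fun c => by
        have h : ∀ β : Form R L, (𝒞.C c).φ • r • β = r • (𝒞.C c).φ • β := fun β => by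
          rw [← Form.const_mul, ← Form.const_mul, Form.mul_real_smul]
        rw [RingHom.id_apply, Submodule.coe_smul, LinearMap.smul_apply, h, coreVal_apply,
          coreVal_apply, ← units_smul_comm', Finset.smul_sum (r := r)]
        simp only [Submodule.coe_smul, LinearMap.smul_apply, Form.real_smul_mul] }
  map_fsmul i j α hα X := LinearMap.ext fun β => 𝒞.form_ext fun c => by
    change (𝒞.C c).φ • (𝒞.coreVal U (VF.fsmul α hα X)).1 β =
      (𝒞.C c).φ • (((-1) * i).negOnePow • (mulEnd α * (𝒞.coreVal U X).1)) β
    rw [coreVal_apply, units_smul_apply, Form.smul_units_smul]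
    change _ = _ • (𝒞.C c).φ • (α * (𝒞.coreVal U X).1 β)
    rw [← Form.mul_smul', coreVal_apply, Form.mul_units_smul, smul_smul, ← Int.negOnePow_add]
    have hs : ((-1) * i + j).negOnePow = (i + j).negOnePow := by
      rw [neg_one_mul, Int.negOnePow_add, Int.negOnePow_neg, Int.negOnePow_add]
    rw [hs]
    congr 1
    change _ = mulEnd α _
    rw [map_sum]
    exact Finset.sum_congr rfl fun k _ => Form.mul_assoc _ _ _

theorem CoordCover.core_apply {j : ℤ} (X : VF R L j) (c : κ) (α : Form R L) :
    (𝒞.C c).φ • ((𝒞.core U).toFun j X).1 α =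
      j.negOnePow • ∑ i, X.1 (Form.const ((𝒞.C c).g i)) * (VF.ins (U ((𝒞.C c).v i))).1 α :=
  𝒞.coreVal_apply U X c α

variable (act) in
/-- `V` is the core lift of `U`. -/
def IsCore (U : 𝔛 →ₗ[R] L) (V : GradedTensor R L (-1)) : Prop :=
  ∀ (X : VF R L 0) (σ : 𝔛), (∀ f, X.1 (Form.const f) = Form.const (act σ f)) →
    (V.toFun 0 X).1 = (VF.ins (U σ)).1

theorem CoordCover.isCore_core : IsCore act U (𝒞.core U) := by
  intro X σ hX
  refine LinearMap.ext fun α => 𝒞.form_ext fun c => ?_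
  rw [core_apply, Int.negOnePow_zero, one_smul]
  simp only [hX, Form.const_mul]
  have := congrArg (fun σ => insLin α (U σ)) (𝒞.smul_eq_sum c σ)
  simp only [map_smul, map_sum] at this
  exact this.symm

theorem CoordCover.rsmul_symbol (X : VF R L 0) (c : κ) (f : R) :
    (VF.rsmul (𝒞.C c).φ X).1 (Form.const f) =
      Form.const (act (∑ i, (X.1 (Form.const ((𝒞.C c).g i))).1 [] • (𝒞.C c).v i) f) := by
  rw [VF.rsmul_apply, LocalCoords.const_eq, map_sum, derivation_sum_apply,
    Form.const_sum]
  refine Finset.sum_congr rfl fun i _ => ?_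
  rw [map_smul, Derivation.smul_apply, smul_eq_mul, mul_comm, Form.const_mul_const]
  rw [← (VF.homog_const X _).eq_const]

include 𝒞 in
/-- Equality of tensors on vector fields of degree `0` may be tested on those with a symbol. -/
theorem CoordCover.tensor_zero_ext {k : ℤ} {S T : GradedTensor R L k}
    (h : ∀ (X : VF R L 0) (σ : 𝔛), (∀ f, X.1 (Form.const f) = Form.const (act σ f)) →
      (S.toFun 0 X).1 = (T.toFun 0 X).1) (X : VF R L 0) :
    (S.toFun 0 X).1 = (T.toFun 0 X).1 := by
  refine LinearMap.ext fun α => 𝒞.form_ext fun c => ?_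
  have := h (VF.rsmul (𝒞.C c).φ X) _ (𝒞.rsmul_symbol X c)
  rw [S.toFun_rsmul, T.toFun_rsmul] at this
  have h2 := congrArg (fun Z : Module.End ℝ (Form R L) => Z α) this
  simpa only [VF.rsmul_apply] using h2

variable {U}

theorem CoordCover.eq_core {V : GradedTensor R L (-1)} (hV : IsCore act U V) : V = 𝒞.core U := by
  refine 𝒞.tensor_ext (fun a => ?_) (𝒞.tensor_zero_ext fun X σ hX => ?_)
  · rw [𝒞.vf_eq_zero_of_lt (by norm_num) (V.toFun (-1) (VF.ins a)),
      𝒞.vf_eq_zero_of_lt (by norm_num) ((𝒞.core U).toFun (-1) (VF.ins a))]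
  · rw [hV X σ hX, 𝒞.isCore_core U X σ hX]

end Core
end GradedForms

end

noncomputable section

namespace GradedForms

section CartanCalculus
variable {R L 𝔛 : Type*} [CommRing R] [Algebra ℝ R] [AddCommGroup L] [Module R L] [Module ℝ L]
  [AddCommGroup 𝔛] [Module R 𝔛]
variable {act : 𝔛 →ₗ[R] Derivation ℝ R R} {n m : ℕ} {κ : Type*} (𝒞 : CoordCover L act n m κ)
  (P : LieRinehart R L) (U : 𝔛 →ₗ[R] L)

theorem LieRinehart.ins_d_const (a : L) (f : R) :
    (VF.ins a).1 (P.d.1 (Form.const f)) = Form.const (P.act a f) := by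
  apply Subtype.ext
  change ins a (dForm P (constForm f)) = constForm (P.act a f)
  rw [ins_dForm, ins_constForm, dForm_zero, sub_zero]
  funext l
  induction l with
  | nil => rfl
  | cons b l ih => simp [lieForm, ins_constForm, lieForm_zero, constForm]

theorem LieRinehart.ins_lie (a b : L) :
    (VF.ins a).1 * ((VF.ins b).1 * P.d.1 + P.d.1 * (VF.ins b).1)
      - ((VF.ins b).1 * P.d.1 + P.d.1 * (VF.ins b).1) * (VF.ins a).1
      = (VF.ins (P.br a b)).1 := by
  have hL : ∀ (b : L) (α : Form R L),
      ((((VF.ins b).1 * P.d.1 + P.d.1 * (VF.ins b).1 : Module.End ℝ (Form R L))) α).1 = lieForm P b α.1 := by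
    intro b α
    change ins b (dForm P α.1) + dForm P (ins b α.1) = _
    rw [ins_dForm]; abel
  refine LinearMap.ext fun α => Subtype.ext ?_
  change ins a (((VF.ins b).1 * P.d.1 + P.d.1 * (VF.ins b).1 : Module.End ℝ (Form R L)) α).1
    - ((((VF.ins b).1 * P.d.1 + P.d.1 * (VF.ins b).1 : Module.End ℝ (Form R L))) ((VF.ins a).1 α)).1 = ins (P.br a b) α.1
  rw [hL, hL, ins_lieForm]
  change lieForm P b (ins a α.1) - _ - lieForm P b (ins a α.1) = _
  rw [P.br_swap b a]
  have := IsForm.ins_smul α.2 (-1) (P.br a b)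
  simp only [neg_smul, one_smul] at this
  rw [this]; abel

variable {U}

theorem CoordCover.core_const {j : ℤ} (X : VF R L j) (f : R) :
    ((𝒞.core U).toFun j X).1 (Form.const f) = 0 := by
  refine 𝒞.form_sep 1 fun c => ?_
  rw [pow_one, core_apply, Finset.sum_eq_zero, smul_zero]
  intro i _
  rw [ins_const, Form.mul_zero']

/-- The core lift is invariant under contractions, on vector fields of degree one. -/
theorem CoordCover.ins_core_comm {j : ℤ} (hj : j = 1) (Y : VF R L j) (a : L) :
    (VF.ins a).1 * ((𝒞.core U).toFun j Y).1 - ((𝒞.core U).toFun j Y).1 * (VF.ins a).1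
      = -((𝒞.core U).toFun (-1 + j) (VF.bracket (VF.ins a) Y)).1 := by
  subst hj
  have e1 : (-1 + 1 : ℤ).negOnePow = 1 := rfl
  have e2 : (-1 * 1 : ℤ).negOnePow = -1 := rfl
  have e3 : (1 : ℤ).negOnePow = -1 := rfl
  refine LinearMap.ext fun α => 𝒞.form_ext fun c => ?_
  have h1 : ∀ β : Form R L, (𝒞.C c).φ • (VF.ins a).1 β = (VF.ins a).1 ((𝒞.C c).φ • β) :=
    fun β => rfl
  simp only [LinearMap.sub_apply, LinearMap.neg_apply, smul_sub, smul_neg, Module.End.mul_apply,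
    h1, core_apply, e1, e3, one_smul, Units.neg_smul, one_smul, map_neg, map_sum]
  simp only [← Finset.sum_neg_distrib, ← Finset.sum_sub_distrib]
  refine Finset.sum_congr rfl fun i _ => ?_
  rw [VF.leibniz (VF.ins a) (VF.homog_const Y _), e2, VF.bracket_coe, e2, Units.neg_smul, one_smul,
    Units.neg_smul, one_smul, LinearMap.sub_apply, LinearMap.neg_apply, Module.End.mul_apply,
    Module.End.mul_apply, ins_const, map_zero, neg_zero, sub_zero, ins_ins_comm a, Form.mul_neg]
  abel

variable {P} {ρ : L →ₗ[R] 𝔛} {V : GradedTensor R L (-1)}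

include 𝒞 in
theorem CoordCover.lie_symbol (hV : IsCore act U V) (hρ : ∀ a, act (ρ a) = P.act a)
    (X : VF R L 0) (σ : 𝔛) (hX : ∀ f, X.1 (Form.const f) = Form.const (act σ f)) (f : R) :
    ((V.lie P.d).toFun 0 X).1 (Form.const f) = Form.const (act (ρ (U σ)) f) := by
  have e1 : (1 * (0 + -1) : ℤ).negOnePow = -1 := rfl
  have e2 : (1 * -1 : ℤ).negOnePow = -1 := rfl
  change ((VF.bracket P.d (V.toFun 0 X)).1 - (1 * -1 : ℤ).negOnePow •
    (V.toFun (1 + 0) (VF.bracket P.d X)).1) (Form.const f) = _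
  rw [VF.bracket_coe, e1, e2, hV X σ hX, 𝒞.eq_core hV, LinearMap.sub_apply, units_smul_apply,
    core_const, smul_zero, sub_zero, LinearMap.sub_apply, units_smul_apply, Units.neg_smul,
    one_smul, sub_neg_eq_add, Module.End.mul_apply, Module.End.mul_apply, ins_const, map_zero,
    zero_add, LieRinehart.ins_d_const, hρ]

include 𝒞 in
theorem CoordCover.lie_vertical (hV : IsCore act U V) (hρ : ∀ a, act (ρ a) = P.act a) (a : L) :
    ((V.lie P.d).toFun (-1) (VF.ins a)).1 = (VF.ins (U (ρ a))).1 := by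
  have e2 : (1 * -1 : ℤ).negOnePow = -1 := rfl
  change (VF.bracket P.d (V.toFun (-1) (VF.ins a))).1 - (1 * -1 : ℤ).negOnePow •
    (V.toFun (1 + -1) (VF.bracket P.d (VF.ins a))).1 = _
  rw [𝒞.vf_eq_zero_of_lt (by norm_num) (V.toFun (-1) (VF.ins a)), VF.bracket_coe, e2,
    Units.neg_smul, one_smul, sub_neg_eq_add]
  have h : (V.toFun (1 + -1) (VF.bracket P.d (VF.ins a))).1 = (VF.ins (U (ρ a))).1 := by
    refine hV _ _ fun f => ?_
    change (VF.bracket P.d (VF.ins a)).1 (Form.const f) = _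
    rw [VF.bracket_coe, e2, Units.neg_smul, one_smul, sub_neg_eq_add, LinearMap.add_apply,
      Module.End.mul_apply, Module.End.mul_apply, ins_const, map_zero, zero_add,
      LieRinehart.ins_d_const, hρ]
  rw [h]; simp

include 𝒞 in
theorem CoordCover.lie_lie (hV : IsCore act U V) (a : L)
    (X : VF R L 0) (σ b : 𝔛) (hX : ∀ f, X.1 (Form.const f) = Form.const (act σ f))
    (hb : ∀ f, act b f = P.act a (act σ f) - act σ (P.act a f)) :
    (((V.lie P.d).lie (VF.ins a)).toFun 0 X).1 = (VF.ins (P.br a (U σ) - U b)).1 := by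
  have e1 : (1 * (0 + -1) : ℤ).negOnePow = -1 := rfl
  have e2 : (1 * -1 : ℤ).negOnePow = -1 := rfl
  have e3 : (-1 * (0 + (1 + -1)) : ℤ).negOnePow = 1 := rfl
  have e4 : (-1 * (1 + -1) : ℤ).negOnePow = 1 := rfl
  have e5 : (-1 * 0 : ℤ).negOnePow = 1 := rfl
  have e6 : (1 * 0 : ℤ).negOnePow = 1 := rfl
  have e7 : (-1 * (1 + 0) : ℤ).negOnePow = -1 := rfl
  have e8 : (1 * (-1 + 0) : ℤ).negOnePow = -1 := rfl
  have e9 : (1 * (-1 + 0 + -1) : ℤ).negOnePow = 1 := rfl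
  have hT : ((V.lie P.d).toFun 0 X).1 = P.d.1 * (VF.ins (U σ)).1 + (VF.ins (U σ)).1 * P.d.1
      + (V.toFun (1 + 0) (VF.bracket P.d X)).1 := by
    change (VF.bracket P.d (V.toFun 0 X)).1 - (1 * -1 : ℤ).negOnePow •
      (V.toFun (1 + 0) (VF.bracket P.d X)).1 = _
    rw [VF.bracket_coe, e1, e2, hV X σ hX]
    simp only [Units.neg_smul, one_smul, sub_neg_eq_add]
  have hT2 : ((V.lie P.d).toFun (-1 + 0) (VF.bracket (VF.ins a) X)).1
      = (V.toFun (1 + (-1 + 0)) (VF.bracket P.d (VF.bracket (VF.ins a) X))).1 := by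
    change (VF.bracket P.d (V.toFun (-1 + 0) (VF.bracket (VF.ins a) X))).1
      - (1 * -1 : ℤ).negOnePow •
      (V.toFun (1 + (-1 + 0)) (VF.bracket P.d (VF.bracket (VF.ins a) X))).1 = _
    rw [𝒞.vf_eq_zero_of_lt (by norm_num) (V.toFun (-1 + 0) (VF.bracket (VF.ins a) X)),
      VF.bracket_coe, e2]
    simp
  have h1 := 𝒞.ins_core_comm (U := U) (by norm_num) (VF.bracket P.d X) a
  rw [← 𝒞.eq_core hV] at h1
  have hsum : (V.toFun (1 + (-1 + 0)) (VF.bracket P.d (VF.bracket (VF.ins a) X))).1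
      + (V.toFun (-1 + (1 + 0)) (VF.bracket (VF.ins a) (VF.bracket P.d X))).1
      = (VF.ins (U b)).1 := by
    let Y₁ : VF R L 0 := VF.bracket P.d (VF.bracket (VF.ins a) X)
    let Y₂ : VF R L 0 := VF.bracket (VF.ins a) (VF.bracket P.d X)
    have h := hV (Y₁ + Y₂) b fun f => by
      have hY : (Y₁ + Y₂).1 = ((VF.ins a).1 * P.d.1 + P.d.1 * (VF.ins a).1) * X.1
          - X.1 * ((VF.ins a).1 * P.d.1 + P.d.1 * (VF.ins a).1) := by
        change (VF.bracket P.d (VF.bracket (VF.ins a) X)).1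
          + (VF.bracket (VF.ins a) (VF.bracket P.d X)).1 = _
        simp only [VF.bracket_coe, e5, e6, e7, e8, one_smul, Units.neg_smul]
        noncomm_ring
      have hL : ∀ g : R, ((VF.ins a).1 * P.d.1 + P.d.1 * (VF.ins a).1 : Module.End ℝ (Form R L)) (Form.const g)
          = Form.const (P.act a g) := fun g => by
        rw [LinearMap.add_apply, Module.End.mul_apply, Module.End.mul_apply, ins_const, map_zero,
          add_zero, LieRinehart.ins_d_const]
      rw [hY, LinearMap.sub_apply, Module.End.mul_apply, Module.End.mul_apply, hL, hX, hX, hL, hb]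
      apply Form.ext; intro l
      match l with
      | [] => rfl
      | _ :: _ => exact sub_zero _
    rw [← h, map_add]; rfl
  change (VF.bracket (VF.ins a) ((V.lie P.d).toFun 0 X)).1 - (-1 * (1 + -1) : ℤ).negOnePow •
    ((V.lie P.d).toFun (-1 + 0) (VF.bracket (VF.ins a) X)).1 = _
  rw [hT2, VF.bracket_coe, e3, e4, one_smul, one_smul, hT]
  have h3 := P.ins_lie a (U σ)
  have h4 : (VF.ins (R := R) (P.br a (U σ) - U b)).1 = (VF.ins (P.br a (U σ))).1 - (VF.ins (U b)).1 :=
    LinearMap.ext fun α => map_sub (insLin α) _ _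
  rw [h4, ← h3, ← hsum, mul_add (VF.ins a).1, add_mul _ _ (VF.ins a).1]
  have h5 : (V.toFun (-1 + (1 + 0)) (VF.bracket (VF.ins a) (VF.bracket P.d X))).1 =
    -((VF.ins a).1 * (V.toFun (1 + 0) (VF.bracket P.d X)).1
    - (V.toFun (1 + 0) (VF.bracket P.d X)).1 * (VF.ins a).1) := by rw [h1, neg_neg]
  rw [h5]
  noncomm_ring

include 𝒞 in
/-- A tensor of internal degree `0` is determined by its symbol, its values on contractions and its
Lie derivatives along contractions. -/
theorem CoordCover.tensor_ext_of_triple {S T : GradedTensor R L 0} {TM : 𝔛 → 𝔛}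
    {B : L → 𝔛 →ₗ[R] L}
    (hS : ∀ (X : VF R L 0) (σ : 𝔛), (∀ f, X.1 (Form.const f) = Form.const (act σ f)) →
      ∀ f, (S.toFun 0 X).1 (Form.const f) = Form.const (act (TM σ) f))
    (hT : ∀ (X : VF R L 0) (σ : 𝔛), (∀ f, X.1 (Form.const f) = Form.const (act σ f)) →
      ∀ f, (T.toFun 0 X).1 (Form.const f) = Form.const (act (TM σ) f))
    (h1 : ∀ a, (S.toFun (-1) (VF.ins a)).1 = (T.toFun (-1) (VF.ins a)).1)
    (hS' : ∀ a, IsCore act (B a) (S.lie (VF.ins a)))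
    (hT' : ∀ a, IsCore act (B a) (T.lie (VF.ins a))) : S = T := by
  have hneg : ∀ Z : VF R L (-1), (S.toFun (-1) Z).1 = (T.toFun (-1) Z).1 := by
    intro Z
    refine LinearMap.ext fun α => 𝒞.form_ext fun c => ?_
    have hv := 𝒞.vertical_eq Z (VF.const_eq_zero_of_neg (by norm_num) Z) c
    have key : ∀ S : GradedTensor R L 0, (𝒞.C c).φ • (S.toFun (-1) Z).1 α =
        (S.toFun (-1) (VF.rsmul (𝒞.C c).φ Z)).1 α := fun S => by
      rw [GradedTensor.toFun_rsmul, VF.rsmul_apply]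
    rw [key S, key T, hv]
    simp only [map_sum, VF.sum_apply, GradedTensor.toFun_fsmulTo, h1]
  refine 𝒞.tensor_ext h1 (𝒞.tensor_zero_ext fun X σ hX => ?_)
  have e1 : (-1 * (0 + 0) : ℤ).negOnePow = 1 := rfl
  have e2 : (-1 * 0 : ℤ).negOnePow = 1 := rfl
  have hc : ∀ a, (VF.ins a).1 * (S.toFun 0 X).1 - (S.toFun 0 X).1 * (VF.ins a).1
      = (VF.ins a).1 * (T.toFun 0 X).1 - (T.toFun 0 X).1 * (VF.ins a).1 := by
    intro a
    have h2 : (VF.bracket (VF.ins a) (S.toFun 0 X)).1 - (-1 * 0 : ℤ).negOnePow •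
      (S.toFun (-1 + 0) (VF.bracket (VF.ins a) X)).1 =
      (VF.bracket (VF.ins a) (T.toFun 0 X)).1 - (-1 * 0 : ℤ).negOnePow •
      (T.toFun (-1 + 0) (VF.bracket (VF.ins a) X)).1 :=
      (hS' a X σ hX).trans (hT' a X σ hX).symm
    have h3 : (S.toFun (-1 + 0) (VF.bracket (VF.ins a) X)).1 =
      (T.toFun (-1 + 0) (VF.bracket (VF.ins a) X)).1 := hneg (VF.bracket (VF.ins a) X)
    rw [VF.bracket_coe, VF.bracket_coe, e1, e2, h3] at h2
    simpa using h2
  refine congrArg Subtype.val (𝒞.vf_ext (X := S.toFun 0 X) (Y := T.toFun 0 X) (fun f => ?_)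
    fun θ => ?_)
  · rw [hS X σ hX, hT X σ hX]
  · apply Form.ext; intro l
    match l with
    | [] =>
      rw [VF.homog (S.toFun 0 X) (oneForm_homog θ) _ (by simp),
        VF.homog (T.toFun 0 X) (oneForm_homog θ) _ (by simp)]
    | a :: l =>
      have h2 := congrArg (fun Z : Module.End ℝ (Form R L) => (Z (oneForm θ)).1 l) (hc a)
      have h4 : ∀ S : GradedTensor R L 0, (((VF.ins a).1 * (S.toFun 0 X).1
          - (S.toFun 0 X).1 * (VF.ins a).1 : Module.End ℝ (Form R L)) (oneForm θ)).1 l = ((S.toFun 0 X).1 (oneForm θ)).1 (a :: l)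
          - ((S.toFun 0 X).1 (Form.const (θ a))).1 l := fun S => by
        rw [LinearMap.sub_apply, Module.End.mul_apply, Module.End.mul_apply, ins_oneForm]; rfl
      have h2 := (h4 S).symm.trans (h2.trans (h4 T))
      rw [hS X σ hX, hT X σ hX] at h2
      exact sub_left_injective h2

end CartanCalculus
end GradedForms

end

noncomputable section

open scoped Topology

section Hadamard
variable {E : Type*} [NormedAddCommGroup E] [NormedSpace ℝ E] [FiniteDimensional ℝ E]

/-- Hadamard's lemma. -/
theorem exists_hadamard {F : E → ℝ} (hF : ContDiff ℝ ∞ F) (e₀ : E) :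
    ∃ K : E → E →L[ℝ] ℝ, ContDiff ℝ ∞ K ∧ K e₀ = fderiv ℝ F e₀ ∧
      ∀ e, F e = F e₀ + K e (e - e₀) := by
  have hF' : ContDiff ℝ ∞ (fderiv ℝ F) := hF.fderiv_right (by simp)
  let ψ : ContDiffBump (0 : ℝ) := ⟨1, 2, one_pos, one_lt_two⟩
  let f : ℝ → ℝ := (Set.Ioc (0 : ℝ) 1).indicator fun _ => 1
  let g : E → ℝ → (E →L[ℝ] ℝ) := fun e x => ψ x • fderiv ℝ F (e₀ + (-x) • (e - e₀))
  let K : E → E →L[ℝ] ℝ := fun e =>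
    (MeasureTheory.convolution f (g e) (ContinuousLinearMap.lsmul ℝ ℝ) MeasureTheory.volume) 0
  have hK : ∀ e, K e = ∫ t in (0 : ℝ)..1, fderiv ℝ F (e₀ + t • (e - e₀)) := by
    intro e
    rw [intervalIntegral.integral_of_le zero_le_one,
      ← MeasureTheory.integral_indicator measurableSet_Ioc]
    refine MeasureTheory.integral_congr_ae (Filter.Eventually.of_forall fun t => ?_)
    by_cases ht : t ∈ Set.Ioc (0 : ℝ) 1
    · have : ψ (-t) = 1 := ψ.one_of_mem_closedBall (by
        simp only [Metric.mem_closedBall, dist_zero_right, norm_neg, Real.norm_eq_abs, ψ]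
        rw [abs_of_pos ht.1]; exact ht.2)
      simp [f, g, ht, this]
    · simp [f, ht]
  refine ⟨K, ?_, ?_, fun e => ?_⟩
  · have := MeasureTheory.contDiffOn_convolution_right_with_param_comp (n := ⊤)
      (μ := MeasureTheory.volume) (ContinuousLinearMap.lsmul ℝ ℝ : ℝ →L[ℝ] (E →L[ℝ] ℝ) →L[ℝ] _)
      (s := Set.univ) (v := fun _ : E => (0 : ℝ)) contDiffOn_const (f := f) (g := g)
      (k := Metric.closedBall 0 2) isOpen_univ (isCompact_closedBall _ _)
      (fun e x _ hx => by
        have : ψ x = 0 := ψ.zero_of_le_dist (by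
          simp only [Metric.mem_closedBall, not_le] at hx; exact hx.le)
        simp [g, this])
      ((MeasureTheory.locallyIntegrable_const (1 : ℝ)).indicator measurableSet_Ioc) ?_
    · exact contDiffOn_univ.1 this
    · refine ContDiff.contDiffOn ?_
      change ContDiff ℝ ∞ fun p : E × ℝ => ψ p.2 • fderiv ℝ F (e₀ + (-p.2) • (p.1 - e₀))
      have h1 : ContDiff ℝ ∞ fun p : E × ℝ => ψ p.2 := ψ.contDiff.comp contDiff_snd
      have h2 : ContDiff ℝ ∞ fun p : E × ℝ => e₀ + (-p.2) • (p.1 - e₀) :=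
        contDiff_const.add (contDiff_snd.neg.smul (contDiff_fst.sub contDiff_const))
      exact h1.smul (hF'.comp h2)
  · rw [hK]; simp
  · rw [hK]
    have hline : ∀ t : ℝ, HasDerivAt (fun t : ℝ => F (e₀ + t • (e - e₀)))
        (fderiv ℝ F (e₀ + t • (e - e₀)) (e - e₀)) t := by
      intro t
      have h1 : HasDerivAt (fun t : ℝ => e₀ + t • (e - e₀)) (e - e₀) t := by
        simpa using ((hasDerivAt_id t).smul_const (e - e₀)).const_add e₀
      exact ((hF.differentiable (by simp)) _).hasFDerivAt.comp_hasDerivAt t h1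
    have hc : Continuous fun t : ℝ => fderiv ℝ F (e₀ + t • (e - e₀)) :=
      hF'.continuous.comp (by fun_prop)
    have h2 := intervalIntegral.integral_eq_sub_of_hasDerivAt (fun t _ => hline t)
      ((hc.clm_apply continuous_const).intervalIntegrable 0 1)
    rw [ContinuousLinearMap.intervalIntegral_apply (hc.intervalIntegrable 0 1), h2]
    simp

end Hadamard

section Cutoff
variable {E : Type*} [NormedAddCommGroup E] [NormedSpace ℝ E] [FiniteDimensional ℝ E]
  {H : Type*} [TopologicalSpace H] (I : ModelWithCorners ℝ E H)
  {B : Type*} [TopologicalSpace B] [T2Space B] [ChartedSpace H B] [IsManifold I ∞ B]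

theorem exists_cutoff (x : B) {u : Set B} (hu : u ∈ 𝓝 x) :
    ∃ χ : C^∞⟮I, B; ℝ⟯, (∀ᶠ y in 𝓝 x, χ y = 1) ∧ tsupport χ ⊆ u := by
  obtain ⟨f, -, hf⟩ := (SmoothBumpFunction.nhds_basis_tsupport (I := I) x).mem_iff.1 hu
  exact ⟨⟨f, f.contMDiff⟩, f.eventuallyEq_one, hf⟩

variable {I}

theorem contMDiffMap_sum_apply {ν : Type*} (s : Finset ν) (f : ν → C^∞⟮I, B; ℝ⟯) (x : B) :
    (∑ i ∈ s, f i) x = ∑ i ∈ s, f i x := by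
  classical
  induction s using Finset.induction_on with
  | empty => rfl
  | insert i s hi ih => rw [Finset.sum_insert hi, Finset.sum_insert hi, ← ih]; rfl

theorem contMDiff_cutoff_mul {χ : C^∞⟮I, B; ℝ⟯} {u : Set B} (hu : IsOpen u) (h : tsupport χ ⊆ u)
    {V : Type*} [NormedAddCommGroup V] [NormedSpace ℝ V]
    {f : B → V} (hf : ContMDiffOn I 𝓘(ℝ, V) ∞ f u) :
    ContMDiff I 𝓘(ℝ, V) ∞ fun x => χ x • f x := by
  refine contMDiff_of_tsupport fun x hx => ?_
  have hxu : x ∈ u := h (tsupport_smul_subset_left χ f hx)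
  exact (χ.contMDiff x).smul (hf.contMDiffAt (hu.mem_nhds hxu))

theorem pointDerivation_eq_zero {x : B} {D : C^∞⟮I, B; ℝ⟯ →ₗ[ℝ] ℝ}
    (hD : ∀ f g, D (f * g) = f x * D g + g x * D f) {f : C^∞⟮I, B; ℝ⟯}
    (hf : ∀ᶠ y in 𝓝 x, f y = 0) : D f = 0 := by
  obtain ⟨χ, h1, h2⟩ := exists_cutoff I x hf
  have h : χ * f = 0 := by
    ext y
    change χ y * f y = 0
    by_cases hy : y ∈ tsupport χ
    · rw [h2 hy, mul_zero]
    · rw [image_eq_zero_of_notMem_tsupport hy, zero_mul]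
  have h3 := hD χ f
  rw [h, map_zero, hf.self_of_nhds, h1.self_of_nhds] at h3
  simpa using h3.symm

end Cutoff

section PointDerivation
variable {E : Type*} [NormedAddCommGroup E] [NormedSpace ℝ E] [FiniteDimensional ℝ E]
  {B : Type*} [TopologicalSpace B] [T2Space B] [ChartedSpace E B] [IsManifold 𝓘(ℝ, E) ∞ B]

/-- A derivation at a point is a combination of partial derivatives. -/
theorem pointDerivation_eq_sum {ν : Type*} [Fintype ν] (b : Module.Basis ν ℝ E) {x₀ x : B}
    (hx : x ∈ (chartAt E x₀).source)
    {D : C^∞⟮𝓘(ℝ, E), B; ℝ⟯ →ₗ[ℝ] ℝ} (hD : ∀ f g, D (f * g) = f x * D g + g x * D f)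
    {g : ν → C^∞⟮𝓘(ℝ, E), B; ℝ⟯}
    (hg : ∀ i, ∀ᶠ y in 𝓝 x, g i y = b.coord i (extChartAt 𝓘(ℝ, E) x₀ y))
    (f : C^∞⟮𝓘(ℝ, E), B; ℝ⟯) :
    D f = ∑ i, dirDeriv f x ((trivializationAt E (TangentSpace 𝓘(ℝ, E) : B → Type _) x₀).symm x (b i))
      * D (g i) := by
  set χ := extChartAt 𝓘(ℝ, E) x₀ with hχ
  have hxs : x ∈ χ.source := by rw [hχ, extChartAt_source]; exact hx
  have htarget : χ.target ∈ 𝓝 (χ x) := extChartAt_target_mem_nhds' (χ.map_source hxs)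
  obtain ⟨ψ, hψ1, hψ2⟩ := exists_cutoff 𝓘(ℝ, E) (χ x) htarget
  have hFs : ContMDiff 𝓘(ℝ, E) 𝓘(ℝ, ℝ) ∞ fun e => ψ e • f (χ.symm e) :=
    contMDiff_cutoff_mul (isOpen_extChartAt_target x₀) hψ2
      (f.contMDiff.comp_contMDiffOn (contMDiffOn_extChartAt_symm x₀))
  obtain ⟨K, hK1, hK2, hK3⟩ := exists_hadamard hFs.contDiff (χ x)
  obtain ⟨lam, hl1, hl2⟩ := exists_cutoff 𝓘(ℝ, E) x (extChartAt_source_mem_nhds' hxs)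
  have hk : ∀ i, ContMDiff 𝓘(ℝ, E) 𝓘(ℝ, ℝ) ∞ fun y => lam y • K (χ y) (b i) := fun i =>
    contMDiff_cutoff_mul (isOpen_extChartAt_source x₀) hl2
      (((hK1.clm_apply contDiff_const).contMDiff (f := fun e => K e (b i))).comp_contMDiffOn
        (by rw [extChartAt_source]; exact contMDiffOn_extChartAt))
  let k : ν → C^∞⟮𝓘(ℝ, E), B; ℝ⟯ := fun i => ⟨_, hk i⟩
  have hD1 : D 1 = 0 := by
    have := hD 1 1
    simp only [mul_one] at this
    change D 1 = 1 * D 1 + 1 * D 1 at this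
    linarith
  have hDc : ∀ r : ℝ, D (r • 1) = 0 := fun r => by rw [map_smul, hD1, smul_zero]
  have hlocal : ∀ᶠ y in 𝓝 x, f y = ψ (χ y) • f (χ.symm (χ y)) := by
    have hcont : ContinuousAt χ x := continuousAt_extChartAt' hxs
    filter_upwards [hcont.eventually hψ1, extChartAt_source_mem_nhds' hxs] with y hy hy'
    rw [hy, one_smul, χ.left_inv hy']
  have hzero : D (f - f x • 1 - ∑ i, (g i - g i x • 1) * k i) = 0 := by
    refine pointDerivation_eq_zero hD ?_
    filter_upwards [hlocal, hl1, Filter.eventually_all.2 hg] with y h1 h2 h3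
    have e1 : (f - f x • 1 - ∑ i, (g i - g i x • 1) * k i : C^∞⟮𝓘(ℝ, E), B; ℝ⟯) y
        = f y - f x - ∑ i, (g i y - g i x) * k i y := by
      have : (∑ i, (g i - g i x • 1) * k i : C^∞⟮𝓘(ℝ, E), B; ℝ⟯) y
          = ∑ i, (g i y - g i x) * k i y := by
        rw [contMDiffMap_sum_apply]
        refine Finset.sum_congr rfl fun i _ => ?_
        change (g i y - g i x * 1) * k i y = _
        rw [mul_one]
      change f y - f x * 1 - _ = _
      rw [this, mul_one]
    rw [e1]
    have e2 : ∀ i, k i y = K (χ y) (b i) := fun i => by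
      change lam y • K (χ y) (b i) = _; rw [h2, one_smul]
    have e3 : f y - f x = K (χ y) (χ y - χ x) := by
      have := hK3 (χ y)
      rw [← h1] at this
      have h4 := hlocal.self_of_nhds
      rw [← h4] at this
      linarith
    rw [e3]
    have e4 : χ y - χ x = ∑ i, (g i y - g i x) • b i := by
      conv_lhs => rw [← b.sum_repr (χ y - χ x)]
      refine Finset.sum_congr rfl fun i _ => ?_
      rw [h3 i, (hg i).self_of_nhds, ← map_sub]; rfl
    rw [e4, map_sum]
    simp [e2]
  have hkey : D f = ∑ i, k i x * D (g i) := by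
    rw [map_sub, map_sub, map_sum, hDc, sub_zero, sub_eq_zero] at hzero
    rw [hzero]
    refine Finset.sum_congr rfl fun i _ => ?_
    rw [hD, map_sub, hDc, sub_zero]
    change (g i x - g i x * 1) * _ + _ = _
    ring
  rw [hkey]
  refine Finset.sum_congr rfl fun i _ => ?_
  congr 1
  have hk1 : k i x = fderiv ℝ (fun e => ψ e • f (χ.symm e)) (χ x) (b i) := by
    change lam x • K (χ x) (b i) = _
    rw [hl1.self_of_nhds, one_smul, hK2]
  have hm : HasMFDerivAt 𝓘(ℝ, E) 𝓘(ℝ, ℝ) f x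
      ((fderiv ℝ (fun e => ψ e • f (χ.symm e)) (χ x)).comp (mfderiv 𝓘(ℝ, E) 𝓘(ℝ, E) χ x)) := by
    have h1 : HasMFDerivAt 𝓘(ℝ, E) 𝓘(ℝ, ℝ) (fun e => ψ e • f (χ.symm e)) (χ x) _ :=
      ((hFs.contDiff.differentiable (by simp)) (χ x)).hasFDerivAt.hasMFDerivAt
    exact (h1.comp x (mdifferentiableAt_extChartAt hx).hasMFDerivAt).congr_of_eventuallyEq hlocal
  rw [hk1, dirDeriv, hm.mfderiv]
  rw [← TangentBundle.continuousLinearMapAt_trivializationAt hx]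
  have h := Trivialization.continuousLinearMapAt_symmL (R := ℝ)
    (trivializationAt E (TangentSpace 𝓘(ℝ, E) : B → Type _) x₀) (b := x) (by simpa using hx) (b i)
  rw [Trivialization.symmL_apply _ (by simpa using hx)] at h
  exact congrArg (fderiv ℝ (fun e => ψ e • f (χ.symm e)) (χ x)) h.symm

end PointDerivation

end

noncomputable section

open scoped Topology

section Sections
variable {EB : Type*} [NormedAddCommGroup EB] [NormedSpace ℝ EB] [FiniteDimensional ℝ EB]
  {HB : Type*} [TopologicalSpace HB]
  {IB : ModelWithCorners ℝ EB HB} {B : Type*} [TopologicalSpace B] [T2Space B] [ChartedSpace HB B]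
  [IsManifold IB ∞ B]
  {F : Type*} [NormedAddCommGroup F] [NormedSpace ℝ F] [FiniteDimensional ℝ F]
  {V : B → Type*} [TopologicalSpace (TotalSpace F V)] [∀ x, TopologicalSpace (V x)]
  [FiberBundle F V] [∀ x, AddCommGroup (V x)] [∀ x, Module ℝ (V x)] [VectorBundle ℝ F V]
  [ContMDiffVectorBundle ∞ F V IB]
  {F' : Type*} [NormedAddCommGroup F'] [NormedSpace ℝ F']
  {V' : B → Type*} [TopologicalSpace (TotalSpace F' V')] [∀ x, TopologicalSpace (V' x)]
  [FiberBundle F' V'] [∀ x, AddCommGroup (V' x)] [∀ x, Module ℝ (V' x)] [VectorBundle ℝ F' V']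
  [ContMDiffVectorBundle ∞ F' V' IB]

variable (V) in
/-- The section which is `χ • w` in a local trivialization. -/
def cutSection (x₀ : B) (χ : C^∞⟮IB, B; ℝ⟯) (hχ : tsupport χ ⊆ (trivializationAt F V x₀).baseSet)
    (w : F) : Cₛ^∞⟮IB; F, V⟯ where
  toFun x := χ x • (trivializationAt F V x₀).symm x w
  contMDiff_toFun := by
    refine ContMDiffOn.smul_section_of_tsupport (u := (trivializationAt F V x₀).baseSet)
      (ψ := χ) (s := fun x => (trivializationAt F V x₀).symm x w)
      χ.contMDiff.contMDiffOn (trivializationAt F V x₀).open_baseSet hχ ?_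
    rw [Trivialization.contMDiffOn_section_baseSet_iff]
    refine (contMDiffOn_const (c := w)).congr fun x hx => ?_
    rw [Trivialization.apply_mk_symm _ hx]

theorem contMDiffAt_trivializationAt_snd {x₀ x : B} (hx : x ∈ (trivializationAt F V x₀).baseSet)
    (a : Cₛ^∞⟮IB; F, V⟯) :
    ContMDiffAt IB 𝓘(ℝ, F) ∞ (fun x => (trivializationAt F V x₀ ⟨x, a x⟩).2) x :=
  ((trivializationAt F V x₀).contMDiffAt_section_iff hx).1 a.contMDiff.contMDiffAt

/-- A coordinate of sections in a local trivialization, multiplied by a cutoff function. -/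
def cutCoord (x₀ : B) (χ : C^∞⟮IB, B; ℝ⟯) (hχ : tsupport χ ⊆ (trivializationAt F V x₀).baseSet)
    (l : F →L[ℝ] ℝ) : Cₛ^∞⟮IB; F, V⟯ →ₗ[C^∞⟮IB, B; ℝ⟯] C^∞⟮IB, B; ℝ⟯ where
  toFun a := ⟨fun x => χ x • l (trivializationAt F V x₀ ⟨x, a x⟩).2, by
    refine contMDiff_cutoff_mul (trivializationAt F V x₀).open_baseSet hχ fun x hx => ?_
    exact (l.contMDiff.contMDiffAt.comp x (contMDiffAt_trivializationAt_snd hx a)).contMDiffWithinAt⟩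
  map_add' a b := by
    ext x
    change χ x • l (trivializationAt F V x₀ ⟨x, a x + b x⟩).2
      = χ x • l (trivializationAt F V x₀ ⟨x, a x⟩).2 + χ x • l (trivializationAt F V x₀ ⟨x, b x⟩).2
    by_cases hx : x ∈ (trivializationAt F V x₀).baseSet
    · rw [((trivializationAt F V x₀).linear ℝ hx).map_add, map_add, smul_add]
    · rw [image_eq_zero_of_notMem_tsupport fun h => hx (hχ h)]; simp
  map_smul' f a := by
    ext x
    change χ x • l (trivializationAt F V x₀ ⟨x, f x • a x⟩).2
      = f x * (χ x • l (trivializationAt F V x₀ ⟨x, a x⟩).2)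
    by_cases hx : x ∈ (trivializationAt F V x₀).baseSet
    · rw [((trivializationAt F V x₀).linear ℝ hx).map_smul, map_smul]
      simp only [smul_eq_mul]; ring
    · rw [image_eq_zero_of_notMem_tsupport fun h => hx (hχ h)]; simp

/-- Every vector extends to a section which is constant in a local trivialization near its base
point. -/
theorem exists_section_eventually (x₀ : B) (w : F) :
    ∃ a : Cₛ^∞⟮IB; F, V⟯, ∀ᶠ x in 𝓝 x₀, a x = (trivializationAt F V x₀).symm x w := by
  obtain ⟨χ, h1, h2⟩ := exists_cutoff IB x₀
    ((trivializationAt F V x₀).open_baseSet.mem_nhds (mem_baseSet_trivializationAt F V x₀))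
  refine ⟨cutSection V x₀ χ h2 w, h1.mono fun x hx => ?_⟩
  change χ x • (trivializationAt F V x₀).symm x w = _
  rw [hx, one_smul]

theorem exists_section_apply_eq (x₀ : B) (v : V x₀) : ∃ a : Cₛ^∞⟮IB; F, V⟯, a x₀ = v := by
  obtain ⟨a, ha⟩ := exists_section_eventually (IB := IB) (V := V) x₀
    (trivializationAt F V x₀ ⟨x₀, v⟩).2
  refine ⟨a, ha.self_of_nhds.trans ?_⟩
  rw [Trivialization.symm_apply_apply_mk _ (mem_baseSet_trivializationAt F V x₀)]

/-- A family of linear maps is a smooth bundle map if it is smooth on the members of a frame. -/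
theorem contMDiffAt_bundleMap_of_frame {T : ∀ x, V x →ₗ[ℝ] V' x} {ν : Type*} [Fintype ν]
    (b : Module.Basis ν ℝ F) (p₀ : TotalSpace F V)
    (h : ∀ i, ContMDiffAt IB (IB.prod 𝓘(ℝ, F')) ∞
      (fun x => (⟨x, T x ((trivializationAt F V p₀.proj).symm x (b i))⟩ : TotalSpace F' V')) p₀.proj) :
    ContMDiffAt (IB.prod 𝓘(ℝ, F)) (IB.prod 𝓘(ℝ, F')) ∞
      (fun p : TotalSpace F V => (⟨p.proj, T p.proj p.2⟩ : TotalSpace F' V')) p₀ := by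
  set x₀ := p₀.proj with hx₀
  set e := trivializationAt F V x₀ with he
  set e' := trivializationAt F' V' x₀ with he'
  have hproj : ContMDiffAt (IB.prod 𝓘(ℝ, F)) IB ∞ (TotalSpace.proj : TotalSpace F V → B) p₀ :=
    (contMDiff_proj V).contMDiffAt
  rw [contMDiffAt_totalSpace]
  refine ⟨hproj, ?_⟩
  change ContMDiffAt _ _ _ (fun p : TotalSpace F V => (e' ⟨p.proj, T p.proj p.2⟩).2) p₀
  have hcoord : ContMDiffAt (IB.prod 𝓘(ℝ, F)) 𝓘(ℝ, F) ∞ (fun p : TotalSpace F V => (e p).2) p₀ :=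
    (contMDiffAt_totalSpace.1 (contMDiffAt_id (I := IB.prod 𝓘(ℝ, F)) (x := p₀))).2
  have hsum : ContMDiffAt (IB.prod 𝓘(ℝ, F)) 𝓘(ℝ, F') ∞ (fun p : TotalSpace F V =>
      ∑ i, b.coord i (e p).2 • (e' ⟨p.proj, T p.proj (e.symm p.proj (b i))⟩).2) p₀ := by
    refine ContMDiffAt.sum fun i _ => ?_
    have h1 : ContMDiffAt (IB.prod 𝓘(ℝ, F)) 𝓘(ℝ, ℝ) ∞
        (fun p : TotalSpace F V => b.coord i (e p).2) p₀ :=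
      ((b.coord i).toContinuousLinearMap.contMDiff.contMDiffAt).comp p₀ hcoord
    have h2 : ContMDiffAt (IB.prod 𝓘(ℝ, F)) 𝓘(ℝ, F') ∞
        (fun p : TotalSpace F V => (e' ⟨p.proj, T p.proj (e.symm p.proj (b i))⟩).2) p₀ :=
      ContMDiffAt.comp (f := (TotalSpace.proj : TotalSpace F V → B)) p₀
        (contMDiffAt_totalSpace.1 (h i)).2 hproj
    exact h1.smul h2
  refine hsum.congr_of_eventuallyEq ?_
  have hev : ∀ᶠ p : TotalSpace F V in 𝓝 p₀, p.proj ∈ e.baseSet ∩ e'.baseSet :=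
    hproj.continuousAt.eventually_mem ((e.open_baseSet.inter e'.open_baseSet).mem_nhds
      ⟨mem_baseSet_trivializationAt F V x₀, mem_baseSet_trivializationAt F' V' x₀⟩)
  filter_upwards [hev] with p hp
  have h1 : p.2 = ∑ i, b.coord i (e p).2 • e.symm p.proj (b i) := by
    have : e.symmL ℝ p.proj (e p).2 = p.2 := by
      rw [Trivialization.symmL_apply _ hp.1]
      exact Trivialization.symm_apply_apply_mk _ hp.1 p.2
    rw [← this]
    conv_lhs => rw [← b.sum_repr (e p).2, map_sum]
    refine Finset.sum_congr rfl fun i _ => ?_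
    rw [map_smul, Trivialization.symmL_apply _ hp.1]; rfl
  conv_lhs => rw [h1]
  rw [map_sum]
  have hlin := (e'.linear ℝ hp.2)
  let L : V' p.proj →ₗ[ℝ] F' := hlin.mk' _
  change L (∑ i, _) = ∑ i, _ • L _
  rw [map_sum]
  simp only [map_smul]

end Sections

end

noncomputable section

open scoped Topology

section Coords
variable {EM : Type*} [NormedAddCommGroup EM] [NormedSpace ℝ EM] [FiniteDimensional ℝ EM]
  {M : Type*} [TopologicalSpace M] [T2Space M] [ChartedSpace EM M] [IsManifold 𝓘(ℝ, EM) ∞ M]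
  {F : Type*} [NormedAddCommGroup F] [NormedSpace ℝ F] [FiniteDimensional ℝ F]
  {A : M → Type*} [TopologicalSpace (TotalSpace F A)] [∀ x, TopologicalSpace (A x)]
  [FiberBundle F A] [∀ x, AddCommGroup (A x)] [∀ x, Module ℝ (A x)] [VectorBundle ℝ F A]
  [ContMDiffVectorBundle ∞ F A 𝓘(ℝ, EM)]

variable (EM M) in
/-- The action of vector fields on functions. -/
def vectorFieldAct : VectorFields 𝓘(ℝ, EM) M →ₗ[C^∞⟮𝓘(ℝ, EM), M; ℝ⟯]
    Derivation ℝ C^∞⟮𝓘(ℝ, EM), M; ℝ⟯ C^∞⟮𝓘(ℝ, EM), M; ℝ⟯ where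
  toFun := derivationOf
  map_add' X Y := by
    ext f x
    exact map_add (mfderiv 𝓘(ℝ, EM) 𝓘(ℝ, ℝ) f x) (X x) (Y x)
  map_smul' g X := by
    ext f x
    exact map_smul (mfderiv 𝓘(ℝ, EM) 𝓘(ℝ, ℝ) f x) (g x) (X x)

theorem dirDeriv_smul (f : C^∞⟮𝓘(ℝ, EM), M; ℝ⟯) (x : M) (r : ℝ) (v : TangentSpace 𝓘(ℝ, EM) x) :
    dirDeriv f x (r • v) = r * dirDeriv f x v := map_smul (mfderiv 𝓘(ℝ, EM) 𝓘(ℝ, ℝ) f x) r v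

theorem contMDiffSection_sum_apply {ν : Type*} (s : Finset ν) (f : ν → Cₛ^∞⟮𝓘(ℝ, EM); F, A⟯)
    (x : M) : (∑ i ∈ s, f i) x = ∑ i ∈ s, f i x := by
  classical
  induction s using Finset.induction_on with
  | empty => rfl
  | insert i s hi ih => rw [Finset.sum_insert hi, Finset.sum_insert hi, ← ih]; rfl

theorem eq_sum_coord_trivializationAt {ν : Type*} [Fintype ν] (b : Module.Basis ν ℝ F) {x₀ x : M}
    (hx : x ∈ (trivializationAt F A x₀).baseSet) (v : A x) :
    v = ∑ i, b.coord i (trivializationAt F A x₀ ⟨x, v⟩).2 •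
      (trivializationAt F A x₀).symm x (b i) := by
  set e := trivializationAt F A x₀
  have : e.symmL ℝ x (e ⟨x, v⟩).2 = v := by
    rw [Trivialization.symmL_apply _ hx]
    exact Trivialization.symm_apply_apply_mk _ hx v
  conv_lhs => rw [← this, ← b.sum_repr (e ⟨x, v⟩).2, map_sum]
  refine Finset.sum_congr rfl fun i _ => ?_
  rw [map_smul, Trivialization.symmL_apply _ hx]; rfl

open GradedForms

theorem exists_localCoords {ν μ : ℕ} (b : Module.Basis (Fin ν) ℝ F) (β : Module.Basis (Fin μ) ℝ EM)
    (c : M) :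
    ∃ C : LocalCoords Cₛ^∞⟮𝓘(ℝ, EM); F, A⟯ (vectorFieldAct EM M) ν μ, C.φ c = 1 ∧
      ∀ i, ∀ᶠ y in 𝓝 c, C.g i y = β.coord i (extChartAt 𝓘(ℝ, EM) c y) := by
  have hO : (chartAt EM c).source ∩ (trivializationAt F A c).baseSet ∈ 𝓝 c :=
    Filter.inter_mem (chart_source_mem_nhds EM c)
      ((trivializationAt F A c).open_baseSet.mem_nhds (mem_baseSet_trivializationAt F A c))
  obtain ⟨χ, h1, h2⟩ := exists_cutoff 𝓘(ℝ, EM) c hO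
  obtain ⟨W, hW1, hW2, hcW⟩ := eventually_nhds_iff.1 h1
  obtain ⟨ψ, h3, h4⟩ := exists_cutoff 𝓘(ℝ, EM) c (hW2.mem_nhds hcW)
  have hWO : ∀ y ∈ W, y ∈ (chartAt EM c).source ∩ (trivializationAt F A c).baseSet := fun y hy =>
    h2 (subset_tsupport _ (by simp [hW1 y hy]))
  have hψ1 : tsupport ψ ⊆ (trivializationAt F A c).baseSet := fun y hy => (hWO y (h4 hy)).2
  have hψ2 : tsupport ψ ⊆ (trivializationAt EM (TangentSpace 𝓘(ℝ, EM) : M → Type _) c).baseSet :=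
    fun y hy => by simpa using (hWO y (h4 hy)).1
  have hg : ∀ i, ContMDiff 𝓘(ℝ, EM) 𝓘(ℝ, ℝ) ∞
      fun y => χ y • β.coord i (extChartAt 𝓘(ℝ, EM) c y) := fun i =>
    contMDiff_cutoff_mul (chartAt EM c).open_source (fun y hy => (h2 hy).1)
      ((β.coord i).toContinuousLinearMap.contMDiff.comp_contMDiffOn contMDiffOn_extChartAt)
  let g : Fin μ → C^∞⟮𝓘(ℝ, EM), M; ℝ⟯ := fun i => ⟨_, hg i⟩
  have hgev : ∀ y ∈ W, ∀ i, ∀ᶠ z in 𝓝 y, g i z = β.coord i (extChartAt 𝓘(ℝ, EM) c z) :=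
    fun y hy i => by
      filter_upwards [hW2.mem_nhds hy] with z hz
      change χ z • β.coord i (extChartAt 𝓘(ℝ, EM) c z) = _
      rw [hW1 z hz, one_smul]
  refine ⟨{ φ := ψ * ψ
            e := fun i => cutSection A c ψ hψ1 (b i)
            ε := fun i => cutCoord c ψ hψ1 (b.coord i).toContinuousLinearMap
            frame := fun a => ?_
            g := g
            v := fun i => ψ • cutSection (TangentSpace 𝓘(ℝ, EM) : M → Type _) c ψ hψ2 (β i)
            coord := fun D f => ?_ }, ?_, hgev c hcW⟩
  · ext x
    rw [contMDiffSection_sum_apply]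
    change (ψ x * ψ x) • a x = ∑ i, (ψ x • b.coord i (trivializationAt F A c ⟨x, a x⟩).2) •
      ψ x • (trivializationAt F A c).symm x (b i)
    by_cases hx : x ∈ tsupport ψ
    · conv_lhs => rw [eq_sum_coord_trivializationAt b (hψ1 hx) (a x)]
      rw [Finset.smul_sum]
      refine Finset.sum_congr rfl fun i _ => ?_
      simp only [smul_smul, smul_eq_mul]
      congr 1; ring
    · simp [image_eq_zero_of_notMem_tsupport hx]
  · ext x
    rw [contMDiffMap_sum_apply]
    change ψ x * ψ x * D f x = ∑ i, dirDeriv f x (ψ x • ψ x •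
      (trivializationAt EM (TangentSpace 𝓘(ℝ, EM) : M → Type _) c).symm x (β i)) * D (g i) x
    by_cases hx : x ∈ tsupport ψ
    · have := pointDerivation_eq_sum β (x₀ := c) (hWO x (h4 hx)).1
        (D := { toFun := fun f => D f x
                map_add' := fun f g => by rw [map_add]; rfl
                map_smul' := fun r f => by rw [D.map_smul]; rfl })
        (fun f g => by
          change D (f * g) x = f x * D g x + g x * D f x
          rw [D.leibniz]; rfl) (hgev x (h4 hx)) f
      change D f x = ∑ i, _ * D (g i) x at this
      rw [this, Finset.mul_sum]
      refine Finset.sum_congr rfl fun i _ => ?_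
      rw [dirDeriv_smul, dirDeriv_smul]; ring
    · simp only [dirDeriv_smul, image_eq_zero_of_notMem_tsupport hx, zero_mul,
        Finset.sum_const_zero]
  · change ψ c * ψ c = 1
    rw [h3.self_of_nhds, one_mul]

theorem eq_of_dirDeriv_eq {x : M} {v w : TangentSpace 𝓘(ℝ, EM) x}
    (h : ∀ f : C^∞⟮𝓘(ℝ, EM), M; ℝ⟯, dirDeriv f x v = dirDeriv f x w) : v = w := by
  let β := Module.finBasis ℝ EM
  obtain ⟨χ, h1, h2⟩ := exists_cutoff 𝓘(ℝ, EM) x (chart_source_mem_nhds EM x)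
  have hg : ∀ i, ContMDiff 𝓘(ℝ, EM) 𝓘(ℝ, ℝ) ∞
      fun y => χ y • β.coord i (extChartAt 𝓘(ℝ, EM) x y) := fun i =>
    contMDiff_cutoff_mul (chartAt EM x).open_source h2
      ((β.coord i).toContinuousLinearMap.contMDiff.comp_contMDiffOn contMDiffOn_extChartAt)
  refine β.ext_elem (M := EM) fun i => ?_
  have hd : ∀ u : TangentSpace 𝓘(ℝ, EM) x, dirDeriv (⟨_, hg i⟩ : C^∞⟮𝓘(ℝ, EM), M; ℝ⟯) x u
      = β.coord i u := by
    intro u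
    have h3 : HasMFDerivAt 𝓘(ℝ, EM) 𝓘(ℝ, ℝ) (fun y => β.coord i (extChartAt 𝓘(ℝ, EM) x y)) x
        ((β.coord i).toContinuousLinearMap.comp (mfderiv 𝓘(ℝ, EM) 𝓘(ℝ, EM) (extChartAt 𝓘(ℝ, EM) x) x)) :=
      ((β.coord i).toContinuousLinearMap.hasMFDerivAt).comp x
        (mdifferentiableAt_extChartAt (mem_chart_source EM x)).hasMFDerivAt
    have h4 := (h3.congr_of_eventuallyEq (f₁ := fun y => χ y • β.coord i (extChartAt 𝓘(ℝ, EM) x y))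
      (h1.mono fun y hy => by simp only [hy, one_smul])).mfderiv
    unfold dirDeriv
    refine (congrArg (fun L => L u) h4).trans ?_
    rw [mfderiv_extChartAt_self]; rfl
  have := h ⟨_, hg i⟩
  rw [hd, hd] at this
  exact this

theorem vectorFieldAct_injective : Function.Injective (vectorFieldAct EM M) := by
  intro X Y h
  ext x
  exact eq_of_dirDeriv_eq fun f => congrArg (fun D => D f x) h

variable (EM M F A) in
theorem exists_coordCover : Nonempty (CoordCover Cₛ^∞⟮𝓘(ℝ, EM); F, A⟯ (vectorFieldAct EM M)
    (Module.finrank ℝ F) (Module.finrank ℝ EM) M) := by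
  choose C hC _ using exists_localCoords (M := M) (A := A) (Module.finBasis ℝ F)
    (Module.finBasis ℝ EM)
  refine ⟨⟨C, fun r f hf => ?_, fun f hf => ?_, vectorFieldAct_injective⟩⟩
  · ext x
    have := congrArg (fun g => g x) (hf x)
    have h2 : ∀ r : ℕ, ((C x).φ ^ r) x = ((C x).φ x) ^ r := fun r => by
      induction r with
      | zero => rfl
      | succ r ih => rw [pow_succ, pow_succ, ← ih]; rfl
    change ((C x).φ ^ r) x * f x = 0 at this
    rw [h2, hC, one_pow, one_mul] at this
    exact this
  · have hloc : ∀ c x, (C c).φ x * f x x = f c x := fun c x => by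
      have := congrArg (fun g => g x) (hf c x)
      change (C c).φ x * f x x = (C x).φ x * f c x at this
      rw [this, hC, one_mul]
    refine ⟨⟨fun x => f x x, fun c => ?_⟩, fun c => by ext x; exact hloc c x⟩
    have hne : ∀ᶠ x in 𝓝 c, (C c).φ x ≠ 0 :=
      ((C c).φ.contMDiff.continuous.continuousAt).eventually_ne (by rw [hC]; exact one_ne_zero)
    have : ContMDiffAt 𝓘(ℝ, EM) 𝓘(ℝ, ℝ) ∞ (fun x => f c x / (C c).φ x) c :=
      (f c).contMDiff.contMDiffAt.div₀ (C c).φ.contMDiff.contMDiffAt (by rw [hC]; exact one_ne_zero)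
    refine this.congr_of_eventuallyEq (hne.mono fun x hx => ?_)
    change f x x = f c x / _
    rw [← hloc c x, mul_div_cancel_left₀ _ hx]

/-- A bundle map as a map of sections. -/
def BundleMap.sectionMap {F' : Type*} [NormedAddCommGroup F'] [NormedSpace ℝ F']
    {A' : M → Type*} [TopologicalSpace (TotalSpace F' A')] [∀ x, TopologicalSpace (A' x)]
    [FiberBundle F' A'] [∀ x, AddCommGroup (A' x)] [∀ x, Module ℝ (A' x)] [VectorBundle ℝ F' A']
    (Ψ : BundleMap 𝓘(ℝ, EM) F A F' A') :
    Cₛ^∞⟮𝓘(ℝ, EM); F, A⟯ →ₗ[C^∞⟮𝓘(ℝ, EM), M; ℝ⟯] Cₛ^∞⟮𝓘(ℝ, EM); F', A'⟯ where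
  toFun := Ψ.onSection
  map_add' a b := by ext x; exact map_add (Ψ x) (a x) (b x)
  map_smul' f a := by ext x; exact map_smul (Ψ x) (f x) (a x)

theorem isCoreLift_iff {U : BundleMap 𝓘(ℝ, EM) EM (TangentSpace 𝓘(ℝ, EM) : M → Type _) F A}
    {V : ShiftedTensor EM M F A (-1)} :
    IsCoreLift U V ↔ IsCore (vectorFieldAct EM M) U.sectionMap V := Iff.rfl

theorem existsUnique_isCoreLift
    (U : BundleMap 𝓘(ℝ, EM) EM (TangentSpace 𝓘(ℝ, EM) : M → Type _) F A) :
    ∃! V : ShiftedTensor EM M F A (-1), IsCoreLift U V := by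
  obtain ⟨𝒞⟩ := exists_coordCover EM M F A
  exact ⟨𝒞.core U.sectionMap, 𝒞.isCore_core _, fun V hV => 𝒞.eq_core hV⟩

end Coords

end

noncomputable section

open scoped Topology
open VectorField

section ChartRep
variable {E : Type*} [NormedAddCommGroup E] [NormedSpace ℝ E]
  {H : Type*} [TopologicalSpace H] (I : ModelWithCorners ℝ E H) [I.Boundaryless]
  {B : Type*} [TopologicalSpace B] [ChartedSpace H B] [IsManifold I ∞ B]

/-- The representation of a vector field in the preferred chart at `x₀`. -/
def chartRep (x₀ : B) (V : ∀ x : B, TangentSpace I x) (e : E) : E :=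
  mfderiv I 𝓘(ℝ, E) (extChartAt I x₀) ((extChartAt I x₀).symm e) (V ((extChartAt I x₀).symm e))

variable {I}

theorem eventually_mem_target (x₀ : B) :
    ∀ᶠ e in 𝓝 (extChartAt I x₀ x₀), e ∈ (extChartAt I x₀).target :=
  extChartAt_target_mem_nhds x₀

theorem contDiffAt_extChartAt_symm {V : Type*} [NormedAddCommGroup V] [NormedSpace ℝ V] {x₀ : B}
    {f : B → V} (hf : ContMDiffAt I 𝓘(ℝ, V) ∞ f x₀) :
    ContDiffAt ℝ ∞ (fun e => f ((extChartAt I x₀).symm e)) (extChartAt I x₀ x₀) := by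
  have h := (contMDiffOn_extChartAt_symm (I := I) (n := ∞) x₀).contMDiffAt
    (extChartAt_target_mem_nhds x₀)
  exact (ContMDiffAt.comp_of_eq hf h (extChartAt_to_inv x₀)).contDiffAt

theorem mfderiv_eq_fderiv_comp {V : Type*} [NormedAddCommGroup V] [NormedSpace ℝ V] {x₀ y : B}
    (hy : y ∈ (extChartAt I x₀).source) {f : B → V} (hf : MDifferentiableAt I 𝓘(ℝ, V) f y)
    (v : TangentSpace I y) :
    mfderiv I 𝓘(ℝ, V) f y v = fderiv ℝ (fun e => f ((extChartAt I x₀).symm e)) (extChartAt I x₀ y)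
      (mfderiv I 𝓘(ℝ, E) (extChartAt I x₀) y v) := by
  have h1 : MDifferentiableAt 𝓘(ℝ, E) 𝓘(ℝ, V) (fun e => f ((extChartAt I x₀).symm e))
      (extChartAt I x₀ y) := by
    have h := ((contMDiffOn_extChartAt_symm (I := I) (n := ∞) x₀).contMDiffAt
      (extChartAt_target_mem_nhds' ((extChartAt I x₀).map_source hy))).mdifferentiableAt (by simp)
    have hf' : MDifferentiableAt I 𝓘(ℝ, V) f ((extChartAt I x₀).symm (extChartAt I x₀ y)) := by
      rwa [(extChartAt I x₀).left_inv hy]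
    exact MDifferentiableAt.comp (f := (extChartAt I x₀).symm) _ hf' h
  have h2 := mdifferentiableAt_extChartAt (I := I) (x := x₀) (y := y)
    (by rwa [← extChartAt_source I])
  have h3 : f =ᶠ[𝓝 y] (fun e => f ((extChartAt I x₀).symm e)) ∘ extChartAt I x₀ := by
    filter_upwards [extChartAt_source_mem_nhds' hy] with z hz
    simp only [Function.comp_apply, (extChartAt I x₀).left_inv hz]
  rw [h3.mfderiv_eq, mfderiv_comp _ h1 h2, mfderiv_eq_fderiv]
  rfl

theorem chartRep_extChartAt {x₀ y : B} (hy : y ∈ (extChartAt I x₀).source)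
    (V : ∀ x : B, TangentSpace I x) :
    chartRep I x₀ V (extChartAt I x₀ y) = mfderiv I 𝓘(ℝ, E) (extChartAt I x₀) y (V y) := by
  unfold chartRep; rw [(extChartAt I x₀).left_inv hy]

theorem chartRep_self (x₀ : B) (V : ∀ x : B, TangentSpace I x) :
    chartRep I x₀ V (extChartAt I x₀ x₀) = V x₀ := by
  rw [chartRep_extChartAt (mem_extChartAt_source x₀), mfderiv_extChartAt_self]; rfl

theorem mfderiv_extChartAt_apply {x₀ y : B} (hy : y ∈ (extChartAt I x₀).source)
    (v : TangentSpace I y) : mfderiv I 𝓘(ℝ, E) (extChartAt I x₀) y v =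
      (trivializationAt E (TangentSpace I : B → Type _) x₀ ⟨y, v⟩).2 := by
  rw [extChartAt_source] at hy
  rw [← TangentBundle.continuousLinearMapAt_trivializationAt hy]
  exact Trivialization.continuousLinearMapAt_apply_of_mem ℝ
    (trivializationAt E (TangentSpace I : B → Type _) x₀) (by simpa using hy) v

theorem contDiffAt_chartRep {x₀ : B} {V : ∀ x : B, TangentSpace I x}
    (hV : ContMDiffAt I I.tangent ∞ (fun x => (⟨x, V x⟩ : TangentBundle I B)) x₀) :
    ContDiffAt ℝ ∞ (chartRep I x₀ V) (extChartAt I x₀ x₀) := by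
  have h := contDiffAt_extChartAt_symm (contMDiffAt_totalSpace.1 hV).2
  refine h.congr_of_eventuallyEq ?_
  filter_upwards [eventually_mem_target x₀] with e he
  exact mfderiv_extChartAt_apply ((extChartAt I x₀).map_target he) _

/-- The Lie bracket in a chart. -/
theorem mlieBracket_eq_lieBracket (x₀ : B) (V W : ∀ x : B, TangentSpace I x) :
    mlieBracket I V W x₀ =
      lieBracket ℝ (chartRep I x₀ V) (chartRep I x₀ W) (extChartAt I x₀ x₀) := by
  have key : ∀ V : ∀ x : B, TangentSpace I x,
      mpullbackWithin 𝓘(ℝ, E) I (extChartAt I x₀).symm V (Set.range I)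
        =ᶠ[𝓝 (extChartAt I x₀ x₀)] chartRep I x₀ V := by
    intro V
    filter_upwards [eventually_mem_target x₀] with e he
    rw [mpullbackWithin_apply, ContinuousLinearMap.inverse_eq
      (mfderivWithin_extChartAt_symm_comp_mfderiv_extChartAt he)
      (mfderiv_extChartAt_comp_mfderivWithin_extChartAt_symm he)]
    rfl
  have hs : (extChartAt I x₀).symm ⁻¹' Set.univ ∩ Set.range I = Set.univ := by
    rw [I.range_eq_univ, Set.preimage_univ, Set.univ_inter]
  have h2 : lieBracketWithin ℝ
      (mpullbackWithin 𝓘(ℝ, E) I (extChartAt I x₀).symm V (Set.range I))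
      (mpullbackWithin 𝓘(ℝ, E) I (extChartAt I x₀).symm W (Set.range I))
      ((extChartAt I x₀).symm ⁻¹' Set.univ ∩ Set.range I) (extChartAt I x₀ x₀)
      = lieBracket ℝ (chartRep I x₀ V) (chartRep I x₀ W) (extChartAt I x₀ x₀) := by
    have h : ∀ V' W' V'' W'' : E → E, V' =ᶠ[𝓝 (extChartAt I x₀ x₀)] V'' →
        W' =ᶠ[𝓝 (extChartAt I x₀ x₀)] W'' →
        lieBracketWithin ℝ V' W' ((extChartAt I x₀).symm ⁻¹' Set.univ ∩ Set.range I)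
          (extChartAt I x₀ x₀) = lieBracket ℝ V'' W'' (extChartAt I x₀ x₀) := by
      intro V' W' V'' W'' hV hW
      rw [hs, lieBracketWithin_univ]
      exact hV.lieBracket_vectorField_eq hW
    exact h _ _ _ _ (key V) (key W)
  have h3 : ∀ w : E, (mfderiv I 𝓘(ℝ, E) (extChartAt I x₀) x₀).inverse w = w := by
    intro w
    rw [mfderiv_extChartAt_self]
    exact congrArg (fun L : E →L[ℝ] E => L w) ContinuousLinearMap.inverse_id
  exact (congrArg _ h2).trans (h3 _)

theorem dirDeriv_mlieBracket [CompleteSpace E] (f : C^∞⟮I, B; ℝ⟯) (X Y : VectorFields I B) (x : B) :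
    dirDeriv f x (mlieBracket I X Y x) =
      dirDeriv (derivationOf Y f) x (X x) - dirDeriv (derivationOf X f) x (Y x) := by
  have hd : ∀ (f : C^∞⟮I, B; ℝ⟯) y, MDifferentiableAt I 𝓘(ℝ, ℝ) f y :=
    fun f y => f.contMDiff.mdifferentiableAt (by simp)
  have hx := mem_extChartAt_source (I := I) x
  have h1 : ∀ Y : VectorFields I B, (fun e => derivationOf Y f ((extChartAt I x).symm e))
      =ᶠ[𝓝 (extChartAt I x x)] fun e =>
        fderiv ℝ (fun e => f ((extChartAt I x).symm e)) e (chartRep I x Y e) := by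
    intro Y
    filter_upwards [eventually_mem_target x] with e he
    have := mfderiv_eq_fderiv_comp ((extChartAt I x).map_target he) (hd f _)
      (Y ((extChartAt I x).symm e))
    rw [(extChartAt I x).right_inv he] at this
    exact this
  have h2 : ∀ X Y : VectorFields I B, dirDeriv (derivationOf Y f) x (X x) =
      fderiv ℝ (fun e => fderiv ℝ (fun e => f ((extChartAt I x).symm e)) e (chartRep I x Y e))
        (extChartAt I x x) (chartRep I x X (extChartAt I x x)) := by
    intro X Y
    rw [← (h1 Y).fderiv_eq, chartRep_extChartAt hx]
    exact mfderiv_eq_fderiv_comp hx (hd _ _) _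
  have hf : ContDiffAt ℝ ∞ (fun e => f ((extChartAt I x).symm e)) (extChartAt I x x) :=
    contDiffAt_extChartAt_symm (V := ℝ) f.contMDiff.contMDiffAt
  have h4 := fderiv_apply_lieBracket hf (by rw [minSmoothness_of_isRCLikeNormedField]; exact WithTop.coe_le_coe.2 le_top)
    ((contDiffAt_chartRep Y.contMDiff.contMDiffAt).differentiableAt (by simp))
    ((contDiffAt_chartRep X.contMDiff.contMDiffAt).differentiableAt (by simp))
  rw [h2, h2]
  refine Eq.trans ?_ h4
  rw [← mlieBracket_eq_lieBracket x (X : ∀ x : B, TangentSpace I x) Y]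
  refine (mfderiv_eq_fderiv_comp hx (hd f x) (mlieBracket I X Y x)).trans ?_
  rw [mfderiv_extChartAt_self]
  rfl

/-- The Lie bracket of smooth vector fields. -/
def VectorFields.lieBracket [CompleteSpace E] (X Y : VectorFields I B) : VectorFields I B where
  toFun := mlieBracket I X Y
  contMDiff_toFun := by
    have : IsManifold I (((⊤ : ℕ∞) : WithTop ℕ∞) + 1) B := by
      have : (((⊤ : ℕ∞) : WithTop ℕ∞) + 1) = ∞ := rfl
      rw [this]; infer_instance
    have : IsManifold I (minSmoothness ℝ 2) B := by
      rw [minSmoothness_of_isRCLikeNormedField]; infer_instance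
    have : IsManifold I (minSmoothness ℝ 3) B := by
      rw [minSmoothness_of_isRCLikeNormedField]; infer_instance
    exact ContDiff.mlieBracket_vectorField (m := ⊤) (n := ⊤) X.contMDiff Y.contMDiff
      (by rw [minSmoothness_of_isRCLikeNormedField]; exact le_refl _)

end ChartRep

end

noncomputable section

open scoped Topology
open VectorField GradedForms

section LieAlgebroidTriple
variable {EM : Type*} [NormedAddCommGroup EM] [NormedSpace ℝ EM] [FiniteDimensional ℝ EM]
  {M : Type*} [TopologicalSpace M] [T2Space M] [ChartedSpace EM M] [IsManifold 𝓘(ℝ, EM) ∞ M]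
  {F : Type*} [NormedAddCommGroup F] [NormedSpace ℝ F] [FiniteDimensional ℝ F]
  {A : M → Type*} [TopologicalSpace (TotalSpace F A)] [∀ x, TopologicalSpace (A x)]
  [FiberBundle F A] [∀ x, AddCommGroup (A x)] [∀ x, Module ℝ (A x)] [VectorBundle ℝ F A]
  [ContMDiffVectorBundle ∞ F A 𝓘(ℝ, EM)]

local notation "R∞" => C^∞⟮𝓘(ℝ, EM), M; ℝ⟯
local notation "Γ∞" => Cₛ^∞⟮𝓘(ℝ, EM); F, A⟯

/-- A `C^∞(M)`-linear operator on sections acts pointwise. -/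
theorem linear_apply_eq_zero (N : VectorFields 𝓘(ℝ, EM) M →ₗ[R∞] Γ∞)
    {X : VectorFields 𝓘(ℝ, EM) M} {x : M} (hX : X x = 0) : N X x = 0 := by
  obtain ⟨C, hC, -⟩ := exists_localCoords (A := A) (Module.finBasis ℝ F) (Module.finBasis ℝ EM) x
  have h1 : C.φ • X = ∑ i, vectorFieldAct EM M X (C.g i) • C.v i := by
    apply vectorFieldAct_injective
    ext1 f
    rw [map_smul, map_sum, Derivation.smul_apply, smul_eq_mul, C.coord, derivation_sum_apply]
    refine Finset.sum_congr rfl fun i _ => ?_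
    rw [map_smul, Derivation.smul_apply, smul_eq_mul, mul_comm]
  have h2 := congrArg (fun a : Γ∞ => a x) (congrArg N h1)
  simp only [map_smul, map_sum] at h2
  rw [contMDiffSection_sum_apply] at h2
  change C.φ x • N X x = ∑ i, dirDeriv (C.g i) x (X x) • N (C.v i) x at h2
  rw [hC, one_smul] at h2
  rw [h2]
  refine Finset.sum_eq_zero fun i _ => ?_
  rw [hX, dirDeriv, map_zero]
  exact zero_smul ℝ _

theorem linear_apply_congr (N : VectorFields 𝓘(ℝ, EM) M →ₗ[R∞] Γ∞)
    {X Y : VectorFields 𝓘(ℝ, EM) M} {x : M} (h : X x = Y x) : N X x = N Y x := by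
  have : N (X - Y) x = 0 := linear_apply_eq_zero N (sub_eq_zero.2 h)
  rw [map_sub] at this
  exact sub_eq_zero.1 this

/-- An extension of a tangent vector to a vector field. -/
def extendVector {x : M} (v : TangentSpace 𝓘(ℝ, EM) x) : VectorFields 𝓘(ℝ, EM) M :=
  (exists_section_apply_eq (V := (TangentSpace 𝓘(ℝ, EM) : M → Type _)) x v).choose

theorem extendVector_apply {x : M} (v : TangentSpace 𝓘(ℝ, EM) x) : extendVector v x = v :=
  (exists_section_apply_eq (V := (TangentSpace 𝓘(ℝ, EM) : M → Type _)) x v).choose_spec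

/-- The value at `x` of a `C^∞(M)`-linear operator from vector fields to sections. -/
def linearAt (N : VectorFields 𝓘(ℝ, EM) M →ₗ[R∞] Γ∞) (x : M) : TangentSpace 𝓘(ℝ, EM) x →ₗ[ℝ] A x where
  toFun := fun v => N (extendVector v) x
  map_add' := fun v w => by
    refine (linear_apply_congr N (Y := extendVector v + extendVector w) ?_).trans
      (congrArg (fun a : Γ∞ => a x) (map_add N _ _))
    change _ = extendVector v x + extendVector w x
    simp only [extendVector_apply]
  map_smul' := fun r v => by
    have h := linear_apply_congr N (X := extendVector (r • v))
      (Y := (ContMDiffMap.const r : R∞) • extendVector v) (x := x) (by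
        change _ = r • extendVector v x
        simp only [extendVector_apply])
    rw [map_smul] at h
    exact h

/-- The bundle map of a `C^∞(M)`-linear operator from vector fields to sections. -/
def bundleMapOfLinear (N : VectorFields 𝓘(ℝ, EM) M →ₗ[R∞] Γ∞) :
    BundleMap 𝓘(ℝ, EM) EM (TangentSpace 𝓘(ℝ, EM) : M → Type _) F A where
  toFun := linearAt N
  smooth := fun p => by
    refine contMDiffAt_bundleMap_of_frame (T := linearAt N) (Module.finBasis ℝ EM) p fun i => ?_
    obtain ⟨X, hX⟩ := exists_section_eventually (IB := 𝓘(ℝ, EM))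
      (V := (TangentSpace 𝓘(ℝ, EM) : M → Type _)) p.proj (Module.finBasis ℝ EM i)
    refine (N X).contMDiff.contMDiffAt.congr_of_eventuallyEq (hX.mono fun x hx => ?_)
    change TotalSpace.mk' F x (N (extendVector _) x) = TotalSpace.mk' F x (N X x)
    rw [linear_apply_congr N (Y := X)]
    rw [extendVector_apply, hx]

theorem bundleMapOfLinear_apply (N : VectorFields 𝓘(ℝ, EM) M →ₗ[R∞] Γ∞)
    (X : VectorFields 𝓘(ℝ, EM) M) (x : M) : bundleMapOfLinear N x (X x) = N X x :=
  linear_apply_congr N (extendVector_apply _)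

theorem vectorFieldAct_lieBracket (X Y : VectorFields 𝓘(ℝ, EM) M) (f : R∞) :
    vectorFieldAct EM M (X.lieBracket Y) f = vectorFieldAct EM M X (vectorFieldAct EM M Y f)
      - vectorFieldAct EM M Y (vectorFieldAct EM M X f) := by
  ext x
  exact dirDeriv_mlieBracket f X Y x

theorem VectorFields.lieBracket_add_right (X Y Z : VectorFields 𝓘(ℝ, EM) M) :
    X.lieBracket (Y + Z) = X.lieBracket Y + X.lieBracket Z := by
  apply vectorFieldAct_injective
  ext1 f
  simp only [map_add, vectorFieldAct_lieBracket, Derivation.add_apply]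
  abel

theorem VectorFields.lieBracket_add_left (X Y Z : VectorFields 𝓘(ℝ, EM) M) :
    (X + Y).lieBracket Z = X.lieBracket Z + Y.lieBracket Z := by
  apply vectorFieldAct_injective
  ext1 f
  simp only [map_add, vectorFieldAct_lieBracket, Derivation.add_apply]
  abel

theorem VectorFields.lieBracket_smul_right (X Y : VectorFields 𝓘(ℝ, EM) M) (g : R∞) :
    X.lieBracket (g • Y) = g • X.lieBracket Y + vectorFieldAct EM M X g • Y := by
  apply vectorFieldAct_injective
  ext1 f
  simp only [map_add, map_smul, vectorFieldAct_lieBracket, Derivation.add_apply,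
    Derivation.smul_apply, Derivation.leibniz, smul_eq_mul]
  ring

theorem VectorFields.lieBracket_smul_left (X Y : VectorFields 𝓘(ℝ, EM) M) (g : R∞) :
    (g • X).lieBracket Y = g • X.lieBracket Y - vectorFieldAct EM M Y g • X := by
  apply vectorFieldAct_injective
  ext1 f
  simp only [map_sub, map_smul, vectorFieldAct_lieBracket, Derivation.sub_apply,
    Derivation.smul_apply, Derivation.leibniz, smul_eq_mul]
  ring

variable (𝒜 : LieAlgebroid EM M F A)
  (U : BundleMap 𝓘(ℝ, EM) EM (TangentSpace 𝓘(ℝ, EM) : M → Type _) F A)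

/-- The Lie derivative `L^A_a U`, as an operator on vector fields. -/
def lieOperator (a : Γ∞) : VectorFields 𝓘(ℝ, EM) M →ₗ[R∞] Γ∞ where
  toFun X := 𝒜.bracket a (U.sectionMap X) - U.sectionMap (VectorFields.lieBracket (𝒜.anchor.onSection a) X)
  map_add' X Y := by
    simp only [map_add, VectorFields.lieBracket_add_right]; abel
  map_smul' f X := by
    rw [VectorFields.lieBracket_smul_right, map_add, map_smul U.sectionMap, map_smul U.sectionMap,
      map_smul U.sectionMap, 𝒜.leibniz, RingHom.id_apply, smul_sub]
    change _ + derivationOf (𝒜.anchor.onSection a) f • _ - (_ +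
      derivationOf (𝒜.anchor.onSection a) f • _) = _
    abel

/-- The triple `(L^A U, U ∘ ρ, ρ ∘ U)`. -/
def lieTriple : LinearTriple EM M F A where
  D a := bundleMapOfLinear (lieOperator 𝒜 U a)
  ℓ := U.comp 𝒜.anchor
  TM := 𝒜.anchor.comp U
  D_add a b x v := by
    have h : lieOperator 𝒜 U (a + b) (extendVector v)
        = lieOperator 𝒜 U a (extendVector v) + lieOperator 𝒜 U b (extendVector v) := by
      change 𝒜.bracket (a + b) _ - U.sectionMap (VectorFields.lieBracket (𝒜.anchor.sectionMap (a + b)) _) = _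
      rw [map_add 𝒜.bracket, map_add 𝒜.anchor.sectionMap, VectorFields.lieBracket_add_left, map_add, LinearMap.add_apply]
      exact add_sub_add_comm _ _ _ _
    exact congrArg (fun a : Γ∞ => a x) h
  leibniz f a x v := by
    set X := extendVector v
    have hX : X x = v := extendVector_apply v
    have h : lieOperator 𝒜 U (f • a) X
        = f • lieOperator 𝒜 U a X + vectorFieldAct EM M X f • U.sectionMap (𝒜.anchor.sectionMap a)
          - vectorFieldAct EM M (𝒜.anchor.sectionMap (U.sectionMap X)) f • a := by
      change 𝒜.toLieRinehart.br (f • a) _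
        - U.sectionMap (VectorFields.lieBracket (𝒜.anchor.sectionMap (f • a)) _) = _
      rw [map_smul 𝒜.anchor.sectionMap, VectorFields.lieBracket_smul_left, map_sub, map_smul U.sectionMap,
        map_smul U.sectionMap, LieRinehart.br_smul_left]
      change f • 𝒜.bracket a (U.sectionMap X) -
        vectorFieldAct EM M (𝒜.anchor.sectionMap (U.sectionMap X)) f • a - _ =
        f • (𝒜.bracket a (U.sectionMap X)
          - U.sectionMap (VectorFields.lieBracket (𝒜.anchor.sectionMap a) X)) + _ - _
      rw [smul_sub]
      abel
    have h2 := congrArg (fun a : Γ∞ => a x) h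
    change _ = f x • lieOperator 𝒜 U a X x + dirDeriv f x (X x) • U x (𝒜.anchor x (a x))
      - dirDeriv f x (𝒜.anchor x (U x (X x))) • a x at h2
    rw [hX] at h2
    exact h2

theorem lieTriple_D (a : Γ∞) (X : VectorFields 𝓘(ℝ, EM) M) (x : M) :
    (lieTriple 𝒜 U).D a x (X x) = 𝒜.bracket a (U.onSection X) x
      - U x (mlieBracket 𝓘(ℝ, EM) (𝒜.anchor.onSection a) X x) :=
  bundleMapOfLinear_apply _ X x

variable {𝒜 U}

theorem hasShiftedTriple_lie {V : ShiftedTensor EM M F A (-1)} (hV : IsCoreLift U V) :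
    HasShiftedTriple (V.lie 𝒜.toLieRinehart.d) (lieTriple 𝒜 U) := by
  obtain ⟨𝒞⟩ := exists_coordCover EM M F A
  have hV' := isCoreLift_iff.1 hV
  have hρ : ∀ a, vectorFieldAct EM M (𝒜.anchor.sectionMap a) = 𝒜.toLieRinehart.act a :=
    fun a => rfl
  refine ⟨fun X σ hX f => 𝒞.lie_symbol hV' hρ X σ hX f, fun a => 𝒞.lie_vertical hV' hρ a,
    fun a X σ hX => ?_⟩
  have hb : ∀ f : R∞, vectorFieldAct EM M (VectorFields.lieBracket (𝒜.anchor.sectionMap a) σ) f =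
      𝒜.toLieRinehart.act a (vectorFieldAct EM M σ f)
        - vectorFieldAct EM M σ (𝒜.toLieRinehart.act a f) := fun f => by
    rw [vectorFieldAct_lieBracket, hρ]
  refine (𝒞.lie_lie hV' a X σ _ hX hb).trans ?_
  congr 2
  ext x
  exact (lieTriple_D 𝒜 U a σ x).symm

theorem HasShiftedTriple.ext {S T : ShiftedTensor EM M F A 0} {τ : LinearTriple EM M F A}
    (hS : HasShiftedTriple S τ) (hT : HasShiftedTriple T τ) : S = T := by
  obtain ⟨𝒞⟩ := exists_coordCover EM M F A
  exact 𝒞.tensor_ext_of_triple (TM := τ.TM.onSection) (B := fun a => (τ.D a).sectionMap)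
    (fun X σ hX => hS.proj X σ hX) (fun X σ hX => hT.proj X σ hX)
    (fun a => (hS.vertical a).trans (hT.vertical a).symm) (fun a => hS.lie a) (fun a => hT.lie a)

end LieAlgebroidTriple

end

noncomputable section

open scoped Topology
open VectorField

section TotalSpaceTangent
variable {EM : Type*} [NormedAddCommGroup EM] [NormedSpace ℝ EM]
  {M : Type*} [TopologicalSpace M] [ChartedSpace EM M] [IsManifold 𝓘(ℝ, EM) ∞ M]
  {F : Type*} [NormedAddCommGroup F] [NormedSpace ℝ F]
  {A : M → Type*} [TopologicalSpace (TotalSpace F A)] [∀ x, TopologicalSpace (A x)]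
  [FiberBundle F A] [∀ x, AddCommGroup (A x)] [∀ x, Module ℝ (A x)] [VectorBundle ℝ F A]
  [ContMDiffVectorBundle ∞ F A 𝓘(ℝ, EM)]

local notation "Γ∞" => Cₛ^∞⟮𝓘(ℝ, EM); F, A⟯
local notation "IA" => ModelWithCorners.prod 𝓘(ℝ, EM) 𝓘(ℝ, F)

theorem t2Space_totalSpace [T2Space M] : T2Space (TotalSpace F A) := by
  refine ⟨fun p q hpq => ?_⟩
  by_cases h : p.proj = q.proj
  · set e := trivializationAt F A p.proj
    have hp : p ∈ e.source := e.mem_source.2 (mem_baseSet_trivializationAt F A p.proj)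
    have hq : q ∈ e.source := e.mem_source.2 (h ▸ mem_baseSet_trivializationAt F A p.proj)
    obtain ⟨u, v, hu, hv, hpu, hqv, huv⟩ := t2_separation (fun h => hpq (e.injOn hp hq h))
    exact ⟨e.source ∩ e ⁻¹' u, e.source ∩ e ⁻¹' v,
      e.toOpenPartialHomeomorph.isOpen_inter_preimage hu,
      e.toOpenPartialHomeomorph.isOpen_inter_preimage hv, ⟨hp, hpu⟩, ⟨hq, hqv⟩,
      (huv.preimage e).mono Set.inter_subset_right Set.inter_subset_right⟩
  · obtain ⟨u, v, hu, hv, hpu, hqv, huv⟩ := t2_separation h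
    have hc : Continuous (TotalSpace.proj : TotalSpace F A → M) := FiberBundle.continuous_proj F A
    exact ⟨_, _, hu.preimage hc, hv.preimage hc, hpu, hqv, huv.preimage _⟩

/-- The differential of a section, as a map `M → A`. -/
def sectionDeriv (c : Γ∞) (x : M) :
    TangentSpace 𝓘(ℝ, EM) x →L[ℝ] TangentSpace IA (⟨x, c x⟩ : TotalSpace F A) :=
  mfderiv 𝓘(ℝ, EM) IA (fun y => (⟨y, c y⟩ : TotalSpace F A)) x

/-- The differential of the fibre coordinate in the trivialization at `x₀`. -/
def fiberDeriv (x₀ : M) (p : TotalSpace F A) : TangentSpace IA p →L[ℝ] F :=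
  mfderiv IA 𝓘(ℝ, F) (fun q : TotalSpace F A => (trivializationAt F A x₀ q).2) p

theorem contMDiffAt_trivializationAt_totalSpace {x₀ : M} {p : TotalSpace F A}
    (hp : p.proj ∈ (trivializationAt F A x₀).baseSet) :
    ContMDiffAt IA 𝓘(ℝ, F) ∞ (fun q : TotalSpace F A => (trivializationAt F A x₀ q).2) p := by
  have h := Trivialization.contMDiffOn (IB := 𝓘(ℝ, EM)) (n := ∞) (trivializationAt F A x₀)
  have h2 := h.contMDiffAt ((trivializationAt F A x₀).open_source.mem_nhds
    ((trivializationAt F A x₀).mem_source.2 hp))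
  exact contMDiffAt_snd.comp p h2

theorem mdifferentiableAt_mk_section (c : Γ∞) (x : M) :
    MDifferentiableAt 𝓘(ℝ, EM) IA (fun y => (⟨y, c y⟩ : TotalSpace F A)) x :=
  c.contMDiff.mdifferentiableAt (by simp)

theorem projDeriv_sectionDeriv (c : Γ∞) (x : M) (X : TangentSpace 𝓘(ℝ, EM) x) :
    projDeriv (⟨x, c x⟩ : TotalSpace F A) (sectionDeriv c x X) = X := by
  have h := mfderiv_comp x (I' := IA) (g := (TotalSpace.proj : TotalSpace F A → M))
    ((contMDiff_proj A (n := ∞)).mdifferentiableAt (by simp)) (mdifferentiableAt_mk_section c x)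
  have h2 : mfderiv 𝓘(ℝ, EM) 𝓘(ℝ, EM)
      ((TotalSpace.proj : TotalSpace F A → M) ∘ fun y => (⟨y, c y⟩ : TotalSpace F A)) x
      = ContinuousLinearMap.id ℝ _ := mfderiv_id
  rw [h2] at h
  exact (congrArg (fun L => L X) h).symm

theorem fiberDeriv_sectionDeriv {x₀ : M} (c : Γ∞) {x : M}
    (hx : x ∈ (trivializationAt F A x₀).baseSet) (X : TangentSpace 𝓘(ℝ, EM) x) :
    fiberDeriv x₀ (⟨x, c x⟩ : TotalSpace F A) (sectionDeriv c x X) =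
      mfderiv 𝓘(ℝ, EM) 𝓘(ℝ, F) (fun y => (trivializationAt F A x₀ ⟨y, c y⟩).2) x X := by
  have h := mfderiv_comp x (I' := IA)
    (g := fun q : TotalSpace F A => (trivializationAt F A x₀ q).2)
    ((contMDiffAt_trivializationAt_totalSpace (p := ⟨x, c x⟩) hx).mdifferentiableAt (by simp))
    (mdifferentiableAt_mk_section c x)
  exact (congrArg (fun L => L X) h).symm

/-- The line through `p` in the direction `b`. -/
def fiberLine (p : TotalSpace F A) (b : A p.proj) (τ : ℝ) : TotalSpace F A := ⟨p.proj, p.2 + τ • b⟩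

theorem trivializationAt_fiberLine {x₀ : M} {p : TotalSpace F A}
    (hp : p.proj ∈ (trivializationAt F A x₀).baseSet) (b : A p.proj) (τ : ℝ) :
    (trivializationAt F A x₀ (fiberLine p b τ)).2 =
      (trivializationAt F A x₀ p).2 + τ • (trivializationAt F A x₀ ⟨p.proj, b⟩).2 := by
  have h := (trivializationAt F A x₀).linear ℝ hp
  change (trivializationAt F A x₀ ⟨p.proj, p.2 + τ • b⟩).2 = _
  rw [h.map_add, h.map_smul]

theorem contMDiff_fiberLine (p : TotalSpace F A) (b : A p.proj) :
    ContMDiff 𝓘(ℝ, ℝ) IA ∞ (fiberLine p b) := by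
  intro τ
  rw [contMDiffAt_totalSpace]
  refine ⟨contMDiffAt_const, ?_⟩
  have h : ContDiff ℝ ∞ fun τ : ℝ => (trivializationAt F A p.proj p).2 +
      τ • (trivializationAt F A p.proj ⟨p.proj, b⟩).2 :=
    contDiff_const.add (contDiff_id.smul contDiff_const)
  refine h.contMDiff.contMDiffAt.congr_of_eventuallyEq (Filter.Eventually.of_forall fun τ' => ?_)
  exact trivializationAt_fiberLine (mem_baseSet_trivializationAt F A p.proj) b τ'

theorem mfderiv_fiberLine (p : TotalSpace F A) (b : A p.proj) (hp : fiberLine p b 0 = p) {E' : Type*}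
    [NormedAddCommGroup E'] [NormedSpace ℝ E'] {f : TotalSpace F A → E'}
    (hf : MDifferentiableAt IA 𝓘(ℝ, E') f p) :
    mfderiv IA 𝓘(ℝ, E') f p (verticalLift (EM := EM) p b) = deriv (fun τ => f (fiberLine p b τ)) 0 := by
  have h := mfderiv_comp (0 : ℝ) (I' := IA) (g := f) (f := fiberLine p b) (by rwa [hp])
    ((contMDiff_fiberLine p b).mdifferentiableAt (by simp))
  rw [mfderiv_eq_fderiv] at h
  have h2 := congrArg (fun L : ℝ →L[ℝ] E' => L 1) h
  refine Eq.trans ?_ h2.symm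
  have key : ∀ q : TotalSpace F A, (hq : q = p) → ∀ v : EM × F,
      (mfderiv IA 𝓘(ℝ, E') f q : EM × F →L[ℝ] E') v = (mfderiv IA 𝓘(ℝ, E') f p : EM × F →L[ℝ] E') v := by
    rintro q rfl v; rfl
  exact (key _ hp _).symm

theorem fiberLine_zero (p : TotalSpace F A) (b : A p.proj) : fiberLine p b 0 = p := by
  unfold fiberLine; rw [zero_smul, add_zero]

theorem fiberDeriv_verticalLift {x₀ : M} {p : TotalSpace F A}
    (hp : p.proj ∈ (trivializationAt F A x₀).baseSet) (b : A p.proj) :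
    fiberDeriv x₀ p (verticalLift (EM := EM) p b) = (trivializationAt F A x₀ ⟨p.proj, b⟩).2 := by
  refine (mfderiv_fiberLine p b (fiberLine_zero p b)
    ((contMDiffAt_trivializationAt_totalSpace hp).mdifferentiableAt (by simp))).trans ?_
  simp only [trivializationAt_fiberLine hp]
  have h : HasDerivAt (fun τ : ℝ => (trivializationAt F A x₀ p).2 +
      τ • (trivializationAt F A x₀ ⟨p.proj, b⟩).2) ((1 : ℝ) • (trivializationAt F A x₀ ⟨p.proj, b⟩).2) 0 :=
    ((hasDerivAt_id (0 : ℝ)).smul_const _).const_add _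
  rw [h.deriv, one_smul]

theorem projDeriv_verticalLift (p : TotalSpace F A) (b : A p.proj) :
    projDeriv p (verticalLift (EM := EM) p b) = 0 := by
  have h := mfderiv_comp (0 : ℝ) (I' := IA) (g := (TotalSpace.proj : TotalSpace F A → M))
    (f := fiberLine p b) ((contMDiff_proj A (n := ∞)).mdifferentiableAt (by simp))
    ((contMDiff_fiberLine p b).mdifferentiableAt (by simp))
  have h2 : mfderiv 𝓘(ℝ, ℝ) 𝓘(ℝ, EM)
      ((TotalSpace.proj : TotalSpace F A → M) ∘ fiberLine p b) 0 = 0 := mfderiv_const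
  rw [h2] at h
  have h3 := congrArg (fun L : ℝ →L[ℝ] EM => L 1) h
  refine Eq.trans ?_ h3.symm
  have key : ∀ q : TotalSpace F A, (hq : q = p) → ∀ v : EM × F,
      (mfderiv IA 𝓘(ℝ, EM) (TotalSpace.proj : TotalSpace F A → M) q : EM × F →L[ℝ] EM) v
        = (mfderiv IA 𝓘(ℝ, EM) (TotalSpace.proj : TotalSpace F A → M) p : EM × F →L[ℝ] EM) v := by
    rintro q rfl v; rfl
  exact (key _ (fiberLine_zero p b) _).symm

theorem mfderiv_extChartAt_totalSpace (p : TotalSpace F A) {q : TotalSpace F A}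
    (hq : q ∈ (extChartAt IA p).source) (ξ : TangentSpace IA q) :
    mfderiv IA 𝓘(ℝ, EM × F) (extChartAt IA p) q ξ =
      (mfderiv 𝓘(ℝ, EM) 𝓘(ℝ, EM) (extChartAt 𝓘(ℝ, EM) p.proj) q.proj (projDeriv q ξ),
        fiberDeriv p.proj q ξ) := by
  rw [FiberBundle.extChartAt] at hq
  have hq1 : q.proj ∈ (trivializationAt F A p.proj).baseSet :=
    (trivializationAt F A p.proj).mem_source.1 hq.1
  have hq2 : q.proj ∈ (extChartAt 𝓘(ℝ, EM) p.proj).source := by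
    have := hq.2.1
    simpa [(trivializationAt F A p.proj).coe_fst hq.1] using this
  have h1 : HasMFDerivAt IA 𝓘(ℝ, EM) (extChartAt 𝓘(ℝ, EM) p.proj ∘ (TotalSpace.proj : TotalSpace F A → M))
      q _ :=
    (mdifferentiableAt_extChartAt (by rwa [← extChartAt_source 𝓘(ℝ, EM)])).hasMFDerivAt.comp q
      ((contMDiff_proj A (n := ∞)).mdifferentiableAt (by simp)).hasMFDerivAt
  have h2 : HasMFDerivAt IA 𝓘(ℝ, F) (fun q : TotalSpace F A => (trivializationAt F A p.proj q).2) q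
      (fiberDeriv p.proj q) :=
    ((contMDiffAt_trivializationAt_totalSpace hq1).mdifferentiableAt (by simp)).hasMFDerivAt
  have h3 := (show HasMFDerivAt IA 𝓘(ℝ, EM × F) _ q (ContinuousLinearMap.prod _ _) from
    ⟨h1.1.prodMk h2.1, h1.2.prodMk h2.2⟩).congr_of_eventuallyEq (f₁ := extChartAt IA p) (by
    have : ∀ᶠ z : TotalSpace F A in 𝓝 q, z ∈ (trivializationAt F A p.proj).source :=
      (trivializationAt F A p.proj).open_source.mem_nhds hq.1
    filter_upwards [this] with z hz
    rw [FiberBundle.extChartAt]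
    change (extChartAt 𝓘(ℝ, EM) p.proj (trivializationAt F A p.proj z).1, _) = _
    rw [(trivializationAt F A p.proj).coe_fst hz]; rfl)
  rw [h3.mfderiv]
  rfl

theorem mem_extChartAt_totalSpace_source {p q : TotalSpace F A}
    (hq1 : q.proj ∈ (trivializationAt F A p.proj).baseSet)
    (hq2 : q.proj ∈ (extChartAt 𝓘(ℝ, EM) p.proj).source) : q ∈ (extChartAt IA p).source := by
  have hq : q ∈ (trivializationAt F A p.proj).source :=
    (trivializationAt F A p.proj).mem_source.2 hq1
  rw [FiberBundle.extChartAt]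
  refine ⟨hq, ?_, trivial⟩
  change (trivializationAt F A p.proj q).1 ∈ _
  rwa [(trivializationAt F A p.proj).coe_fst hq]

theorem tangent_totalSpace_ext {x₀ : M} {q : TotalSpace F A}
    (hq1 : q.proj ∈ (trivializationAt F A x₀).baseSet)
    (hq2 : q.proj ∈ (extChartAt 𝓘(ℝ, EM) x₀).source) {ξ η : TangentSpace IA q}
    (h1 : projDeriv q ξ = projDeriv q η) (h2 : fiberDeriv x₀ q ξ = fiberDeriv x₀ q η) : ξ = η := by
  have hq := mem_extChartAt_totalSpace_source (F := F) (A := A) (p := ⟨x₀, 0⟩) (q := q) hq1 hq2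
  have hinj := (isInvertible_mfderiv_extChartAt hq).injective
  apply hinj
  rw [mfderiv_extChartAt_totalSpace _ hq, mfderiv_extChartAt_totalSpace _ hq]
  simp only [h1, h2]
  rfl

end TotalSpaceTangent

end

noncomputable section

open scoped Topology
open VectorField

section Adapted
variable {EM : Type*} [NormedAddCommGroup EM] [NormedSpace ℝ EM]
  {M : Type*} [TopologicalSpace M] [ChartedSpace EM M] [IsManifold 𝓘(ℝ, EM) ∞ M]
  {F : Type*} [NormedAddCommGroup F] [NormedSpace ℝ F]
  {A : M → Type*} [TopologicalSpace (TotalSpace F A)] [∀ x, TopologicalSpace (A x)]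
  [FiberBundle F A] [∀ x, AddCommGroup (A x)] [∀ x, Module ℝ (A x)] [VectorBundle ℝ F A]
  [ContMDiffVectorBundle ∞ F A 𝓘(ℝ, EM)]

local notation "Γ∞" => Cₛ^∞⟮𝓘(ℝ, EM); F, A⟯
local notation "IA" => ModelWithCorners.prod 𝓘(ℝ, EM) 𝓘(ℝ, F)

theorem LinearTriple.D_smul (τ : LinearTriple EM M F A) (r : ℝ) (a : Γ∞) (x : M)
    (v : TangentSpace 𝓘(ℝ, EM) x) : τ.D (r • a) x v = r • τ.D a x v := by
  have h := τ.leibniz (ContMDiffMap.const r) a x v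
  have h0 : ∀ w : TangentSpace 𝓘(ℝ, EM) x,
      dirDeriv (ContMDiffMap.const r : C^∞⟮𝓘(ℝ, EM), M; ℝ⟯) x w = 0 := fun w =>
    congrArg (fun L => L w) (mfderiv_const (I := 𝓘(ℝ, EM)) (I' := 𝓘(ℝ, ℝ)) (c := r) (x := x))
  rw [h0, h0, zero_smul, zero_smul, add_zero, sub_zero] at h
  exact h

/-- `a ↦ 𝒟(a)(v)`. -/
def LinearTriple.DAt (τ : LinearTriple EM M F A) (x : M) (v : TangentSpace 𝓘(ℝ, EM) x) :
    Γ∞ →ₗ[ℝ] A x where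
  toFun a := τ.D a x v
  map_add' a b := τ.D_add a b x v
  map_smul' r a := τ.D_smul r a x v

/-- A section in the trivialization at `x₀`. -/
def sectionCoord (x₀ : M) (c : Γ∞) (y : M) : F := (trivializationAt F A x₀ ⟨y, c y⟩).2

theorem mdifferentiableAt_sectionCoord {x₀ x : M} (hx : x ∈ (trivializationAt F A x₀).baseSet)
    (c : Γ∞) : MDifferentiableAt 𝓘(ℝ, EM) 𝓘(ℝ, F) (sectionCoord x₀ c) x :=
  (((trivializationAt F A x₀).contMDiffAt_section_iff hx).1 c.contMDiff.contMDiffAt).mdifferentiableAt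
    (by simp)

/-- The derivative of a section in the trivialization at `x₀`. -/
def sectionCoordDeriv (x₀ : M) (c : Γ∞) (x : M) : TangentSpace 𝓘(ℝ, EM) x →L[ℝ] F :=
  mfderiv 𝓘(ℝ, EM) 𝓘(ℝ, F) (sectionCoord x₀ c) x

theorem sectionCoordDeriv_add_smul {x₀ x : M} (hx : x ∈ (trivializationAt F A x₀).baseSet)
    (c a : Γ∞) (r : ℝ) (X : TangentSpace 𝓘(ℝ, EM) x) :
    sectionCoordDeriv x₀ (c + r • a) x X =
      sectionCoordDeriv x₀ c x X + r • sectionCoordDeriv x₀ a x X := by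
  have hev : sectionCoord x₀ (c + r • a) =ᶠ[𝓝 x] sectionCoord x₀ c + r • sectionCoord x₀ a := by
    filter_upwards [(trivializationAt F A x₀).open_baseSet.mem_nhds hx] with y hy
    have h := (trivializationAt F A x₀).linear ℝ hy
    change (trivializationAt F A x₀ ⟨y, c y + r • a y⟩).2 = _
    rw [h.map_add, h.map_smul]; rfl
  have h2 := ((mdifferentiableAt_sectionCoord hx c).hasMFDerivAt.add
    ((mdifferentiableAt_sectionCoord hx a).hasMFDerivAt.const_smul r)).congr_of_eventuallyEq hev
  exact congrArg (fun L => L X) h2.mfderiv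

theorem sectionCoordDeriv_smul {x₀ x : M} (hx : x ∈ (trivializationAt F A x₀).baseSet)
    (a : Γ∞) (r : ℝ) (X : TangentSpace 𝓘(ℝ, EM) x) :
    sectionCoordDeriv x₀ (r • a) x X = r • sectionCoordDeriv x₀ a x X := by
  have h1 := sectionCoordDeriv_add_smul hx a a (r - 1) X
  have h2 : a + (r - 1) • a = r • a := by rw [sub_smul, one_smul, add_sub_cancel]
  rw [h2, sub_smul, one_smul, add_sub_cancel] at h1
  exact h1


/-- `K(dc(X) + b^↑) = dc(K^M X) + (𝒟(c) X + ℓ b)^↑` for all sections `c`. -/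
def IsAdapted (K : ∀ p : TotalSpace F A, TangentSpace IA p →ₗ[ℝ] TangentSpace IA p)
    (τ : LinearTriple EM M F A) : Prop :=
  ∀ (c : Γ∞) (x : M) (X : TangentSpace 𝓘(ℝ, EM) x) (b : A x),
    K ⟨x, c x⟩ (sectionDeriv c x X + verticalLift (EM := EM) (⟨x, c x⟩ : TotalSpace F A) b) =
      sectionDeriv c x (τ.TM x X) +
        verticalLift (EM := EM) (⟨x, c x⟩ : TotalSpace F A) (τ.D c x X + τ.ℓ x b)

theorem fiberDeriv_decomp {x₀ : M} {q : TotalSpace F A}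
    (hq1 : q.proj ∈ (trivializationAt F A x₀).baseSet) (c : Γ∞) (ξ : TangentSpace IA q) :
    ∃ b : A q.proj, fiberDeriv (EM := EM) x₀ q ξ = sectionCoordDeriv x₀ c q.proj (projDeriv (EM := EM) q ξ)
      + (trivializationAt F A x₀ ⟨q.proj, b⟩).2 := by
  refine ⟨(trivializationAt F A x₀).symm q.proj
    (fiberDeriv (EM := EM) x₀ q ξ - sectionCoordDeriv x₀ c q.proj (projDeriv (EM := EM) q ξ)), ?_⟩
  rw [Trivialization.apply_mk_symm _ hq1, add_sub_cancel]

theorem eq_sectionDeriv_add_verticalLift {x₀ x : M} {c : Γ∞}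
    (hx1 : x ∈ (trivializationAt F A x₀).baseSet)
    (hx2 : x ∈ (extChartAt 𝓘(ℝ, EM) x₀).source)
    {ξ : TangentSpace IA (⟨x, c x⟩ : TotalSpace F A)} {b : A x}
    (hb : fiberDeriv (EM := EM) x₀ (⟨x, c x⟩ : TotalSpace F A) ξ =
      sectionCoordDeriv x₀ c x (projDeriv (EM := EM) _ ξ) + (trivializationAt F A x₀ ⟨x, b⟩).2) :
    ξ = sectionDeriv c x (projDeriv (EM := EM) _ ξ) + verticalLift (EM := EM) (⟨x, c x⟩ : TotalSpace F A) b := by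
  refine tangent_totalSpace_ext (x₀ := x₀) hx1 hx2 ?_ ?_
  · rw [map_add, projDeriv_sectionDeriv, projDeriv_verticalLift, add_zero]
  · rw [map_add, fiberDeriv_sectionDeriv c hx1, fiberDeriv_verticalLift hx1, hb]; rfl

/-- Adapted tensors in coordinates. -/
theorem IsAdapted.coords {K : ∀ p : TotalSpace F A, TangentSpace IA p →ₗ[ℝ] TangentSpace IA p}
    {τ : LinearTriple EM M F A} (hT : IsAdapted K τ) {x₀ x : M} {v : A x}
    (hx1 : x ∈ (trivializationAt F A x₀).baseSet)
    (hx2 : x ∈ (extChartAt 𝓘(ℝ, EM) x₀).source) {c : Γ∞} (hc : c x = v)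
    {ξ : TangentSpace IA (⟨x, v⟩ : TotalSpace F A)} {X : TangentSpace 𝓘(ℝ, EM) x} {b : A x}
    (hX : projDeriv (EM := EM) (⟨x, v⟩ : TotalSpace F A) ξ = X)
    (hb : fiberDeriv (EM := EM) x₀ (⟨x, v⟩ : TotalSpace F A) ξ =
      sectionCoordDeriv x₀ c x X + (trivializationAt F A x₀ ⟨x, b⟩).2) :
    projDeriv (EM := EM) (⟨x, v⟩ : TotalSpace F A) (K ⟨x, v⟩ ξ) = τ.TM x X ∧
    fiberDeriv (EM := EM) x₀ (⟨x, v⟩ : TotalSpace F A) (K ⟨x, v⟩ ξ) =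
      sectionCoordDeriv x₀ c x (τ.TM x X)
        + (trivializationAt F A x₀ ⟨x, τ.D c x X + τ.ℓ x b⟩).2 := by
  subst hc hX
  have h := eq_sectionDeriv_add_verticalLift hx1 hx2 hb
  have h2 : K ⟨x, c x⟩ ξ = _ := (congrArg (K ⟨x, c x⟩) h).trans (hT c x _ b)
  rw [h2]
  constructor
  · rw [map_add, projDeriv_sectionDeriv, projDeriv_verticalLift, add_zero]
  · rw [map_add, fiberDeriv_sectionDeriv c hx1, fiberDeriv_verticalLift hx1]; rfl

theorem contMDiff_fiberScale (r : ℝ) : ContMDiff IA IA ∞ (fiberScale r : TotalSpace F A → _) := by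
  intro p
  rw [contMDiffAt_totalSpace]
  refine ⟨(contMDiff_proj A).contMDiffAt, ?_⟩
  have h : ContMDiffAt IA 𝓘(ℝ, F) ∞
      (fun q : TotalSpace F A => r • (trivializationAt F A p.proj q).2) p :=
    (contMDiffAt_const (I' := 𝓘(ℝ, ℝ))).smul (contMDiffAt_trivializationAt_totalSpace
      (mem_baseSet_trivializationAt F A p.proj))
  refine h.congr_of_eventuallyEq ?_
  have : ∀ᶠ z : TotalSpace F A in 𝓝 p, z ∈ (trivializationAt F A p.proj).source :=
    (trivializationAt F A p.proj).open_source.mem_nhds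
      (Trivialization.mem_source _ |>.2 (mem_baseSet_trivializationAt F A p.proj))
  filter_upwards [this] with z hz
  exact ((trivializationAt F A p.proj).linear ℝ
    ((trivializationAt F A p.proj).mem_source.1 hz)).map_smul r z.2

theorem projDeriv_fiberScale (r : ℝ) (p : TotalSpace F A) (ξ : TangentSpace IA p) :
    projDeriv (EM := EM) (fiberScale r p) (mfderiv IA IA (fiberScale r : TotalSpace F A → _) p ξ)
      = projDeriv (EM := EM) p ξ := by
  have h := mfderiv_comp p (I' := IA) (g := (TotalSpace.proj : TotalSpace F A → M))
    ((contMDiff_proj A (n := ∞)).mdifferentiableAt (by simp))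
    ((contMDiff_fiberScale r (A := A)).mdifferentiableAt (by simp))
  exact (congrArg (fun L => L ξ) h).symm

theorem fiberDeriv_fiberScale {x₀ : M} (r : ℝ) {p : TotalSpace F A}
    (hp : p.proj ∈ (trivializationAt F A x₀).baseSet) (ξ : TangentSpace IA p) :
    fiberDeriv (EM := EM) x₀ (fiberScale r p) (mfderiv IA IA (fiberScale r : TotalSpace F A → _) p ξ)
      = r • fiberDeriv (EM := EM) x₀ p ξ := by
  have h := mfderiv_comp p (I' := IA)
    (g := fun q : TotalSpace F A => (trivializationAt F A x₀ q).2) (f := fiberScale r)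
    ((contMDiffAt_trivializationAt_totalSpace (p := fiberScale r p) hp).mdifferentiableAt (by simp))
    ((contMDiff_fiberScale r (A := A)).mdifferentiableAt (by simp))
  refine (congrArg (fun L => L ξ) h).symm.trans ?_
  have hev : ((fun q : TotalSpace F A => (trivializationAt F A x₀ q).2) ∘ fiberScale r)
      =ᶠ[𝓝 p] r • fun q : TotalSpace F A => (trivializationAt F A x₀ q).2 := by
    have : ∀ᶠ z : TotalSpace F A in 𝓝 p, z ∈ (trivializationAt F A x₀).source :=
      (trivializationAt F A x₀).open_source.mem_nhds (Trivialization.mem_source _ |>.2 hp)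
    filter_upwards [this] with z hz
    exact ((trivializationAt F A x₀).linear ℝ
      ((trivializationAt F A x₀).mem_source.1 hz)).map_smul r z.2
  have h2 := (((contMDiffAt_trivializationAt_totalSpace (EM := EM) hp).mdifferentiableAt
    (by simp)).hasMFDerivAt.const_smul r).congr_of_eventuallyEq hev
  exact congrArg (fun L => L ξ) h2.mfderiv

theorem IsAdapted.linear [FiniteDimensional ℝ EM] [FiniteDimensional ℝ F] [T2Space M]
    {K : ∀ p : TotalSpace F A, TangentSpace IA p →ₗ[ℝ] TangentSpace IA p}
    {τ : LinearTriple EM M F A} (hT : IsAdapted K τ) (r : ℝ) (p : TotalSpace F A) (ξ : TangentSpace IA p) :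
    K (fiberScale r p) (mfderiv IA IA (fiberScale r : TotalSpace F A → TotalSpace F A) p ξ)
      = mfderiv IA IA (fiberScale r : TotalSpace F A → TotalSpace F A) p (K p ξ) := by
  obtain ⟨x, v⟩ := p
  have hp1 := mem_baseSet_trivializationAt F A x
  have hp2 := mem_extChartAt_source (I := 𝓘(ℝ, EM)) x
  obtain ⟨c, hc⟩ := exists_section_apply_eq (IB := 𝓘(ℝ, EM)) (F := F) x v
  obtain ⟨b, hb⟩ := fiberDeriv_decomp hp1 c ξ
  have hlin := (trivializationAt F A x).linear ℝ hp1
  obtain ⟨h1, h2⟩ := hT.coords hp1 hp2 hc rfl hb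
  obtain ⟨h3, h4⟩ := hT.coords (v := r • v) (c := r • c)
    (ξ := mfderiv IA IA (fiberScale r : TotalSpace F A → TotalSpace F A) ⟨x, v⟩ ξ) (b := r • b)
    hp1 hp2 (congrArg (r • ·) hc) (projDeriv_fiberScale r ⟨x, v⟩ ξ) (by
      refine (fiberDeriv_fiberScale r (p := ⟨x, v⟩) hp1 ξ).trans ?_
      rw [hb, smul_add, sectionCoordDeriv_smul hp1]
      exact congrArg _ (hlin.map_smul r b).symm)
  refine tangent_totalSpace_ext (x₀ := x) (q := ⟨x, r • v⟩) hp1 hp2 ?_ ?_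
  · exact h3.trans (h1.symm.trans (projDeriv_fiberScale r ⟨x, v⟩ _).symm)
  · refine h4.trans (Eq.trans ?_ (fiberDeriv_fiberScale r (p := ⟨x, v⟩) hp1 _).symm)
    rw [h2, sectionCoordDeriv_smul hp1, smul_add, τ.D_smul, map_smul, ← smul_add]
    exact congrArg _ (hlin.map_smul r _)

end Adapted

end

noncomputable section

open scoped Topology
open VectorField

section AdaptedSmooth
variable {EM : Type*} [NormedAddCommGroup EM] [NormedSpace ℝ EM] [FiniteDimensional ℝ EM]
  {M : Type*} [TopologicalSpace M] [T2Space M] [ChartedSpace EM M] [IsManifold 𝓘(ℝ, EM) ∞ M]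
  {F : Type*} [NormedAddCommGroup F] [NormedSpace ℝ F] [FiniteDimensional ℝ F]
  {A : M → Type*} [TopologicalSpace (TotalSpace F A)] [∀ x, TopologicalSpace (A x)]
  [FiberBundle F A] [∀ x, AddCommGroup (A x)] [∀ x, Module ℝ (A x)] [VectorBundle ℝ F A]
  [ContMDiffVectorBundle ∞ F A 𝓘(ℝ, EM)]

local notation "Γ∞" => Cₛ^∞⟮𝓘(ℝ, EM); F, A⟯
local notation "IA" => ModelWithCorners.prod 𝓘(ℝ, EM) 𝓘(ℝ, F)

omit [FiniteDimensional ℝ EM] [FiniteDimensional ℝ F] [T2Space M] in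
theorem sectionCoordDeriv_eq_zero {x₀ x : M} {c : Γ∞} {w : F}
    (h : ∀ᶠ y in 𝓝 x, c y = (trivializationAt F A x₀).symm y w)
    (hx : x ∈ (trivializationAt F A x₀).baseSet) : sectionCoordDeriv x₀ c x = 0 := by
  have hev : sectionCoord x₀ c =ᶠ[𝓝 x] fun _ => w := by
    filter_upwards [h, (trivializationAt F A x₀).open_baseSet.mem_nhds hx] with y hy hy2
    change (trivializationAt F A x₀ ⟨y, c y⟩).2 = w
    rw [hy, Trivialization.apply_mk_symm _ hy2]
  exact hev.mfderiv_eq.trans mfderiv_const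

/-- Sections which are constant in the trivialization near `x₀`. -/
theorem exists_frameSection (x₀ : M) : ∃ c : F →ₗ[ℝ] Γ∞, ∀ᶠ x in 𝓝 x₀, ∀ w,
    c w x = (trivializationAt F A x₀).symm x w ∧ sectionCoordDeriv x₀ (c w) x = 0 := by
  let f := Module.finBasis ℝ F
  choose E hE using fun k => exists_section_eventually (IB := 𝓘(ℝ, EM)) (V := A) x₀ (f k)
  let c : F →ₗ[ℝ] Γ∞ := f.constr ℝ E
  have h1 : ∀ᶠ x in 𝓝 x₀, ∀ w, c w x = (trivializationAt F A x₀).symm x w := by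
    filter_upwards [Filter.eventually_all.2 hE,
      (trivializationAt F A x₀).open_baseSet.mem_nhds (mem_baseSet_trivializationAt F A x₀)]
      with x hx hx2 w
    rw [Module.Basis.constr_apply_fintype, contMDiffSection_sum_apply]
    conv_rhs => rw [← f.sum_repr w]
    rw [← Trivialization.symmL_apply (R := ℝ) _ hx2, map_sum]
    refine Finset.sum_congr rfl fun k _ => ?_
    rw [map_smul, Trivialization.symmL_apply _ hx2, ← hx k]; rfl
  refine ⟨c, ?_⟩
  filter_upwards [h1, h1.eventually_nhds,
    (trivializationAt F A x₀).open_baseSet.mem_nhds (mem_baseSet_trivializationAt F A x₀)]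
    with x hx hx2 hx3 w
  exact ⟨hx w, sectionCoordDeriv_eq_zero (hx2.mono fun y hy => hy w) hx3⟩

omit [FiniteDimensional ℝ EM] [FiniteDimensional ℝ F] [T2Space M] in
theorem IsAdapted.coords_frame
    {K : ∀ p : TotalSpace F A, TangentSpace IA p →ₗ[ℝ] TangentSpace IA p}
    {τ : LinearTriple EM M F A} (hT : IsAdapted K τ) {x₀ x : M} {v : A x}
    (hx1 : x ∈ (trivializationAt F A x₀).baseSet)
    (hx2 : x ∈ (extChartAt 𝓘(ℝ, EM) x₀).source) {c : F →ₗ[ℝ] Γ∞}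
    (hc : ∀ w, c w x = (trivializationAt F A x₀).symm x w ∧ sectionCoordDeriv x₀ (c w) x = 0)
    {ξ : TangentSpace IA (⟨x, v⟩ : TotalSpace F A)} {X : TangentSpace 𝓘(ℝ, EM) x} {b : A x}
    (hX : projDeriv (EM := EM) (⟨x, v⟩ : TotalSpace F A) ξ = X)
    (hb : fiberDeriv (EM := EM) x₀ (⟨x, v⟩ : TotalSpace F A) ξ =
      (trivializationAt F A x₀ ⟨x, b⟩).2) :
    projDeriv (EM := EM) (⟨x, v⟩ : TotalSpace F A) (K ⟨x, v⟩ ξ) = τ.TM x X ∧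
    fiberDeriv (EM := EM) x₀ (⟨x, v⟩ : TotalSpace F A) (K ⟨x, v⟩ ξ) =
      (trivializationAt F A x₀ ⟨x, τ.D (c (trivializationAt F A x₀ ⟨x, v⟩).2) x X⟩).2 +
        (trivializationAt F A x₀ ⟨x, τ.ℓ x b⟩).2 := by
  obtain ⟨h1, h2⟩ := hc (trivializationAt F A x₀ ⟨x, v⟩).2
  rw [Trivialization.symm_apply_apply_mk _ hx1] at h1
  have h := hT.coords hx1 hx2 h1 hX (b := b) (by rw [hb, h2]; simp)
  refine ⟨h.1, h.2.trans ?_⟩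
  rw [h2]
  refine (zero_add _).trans ?_
  exact ((trivializationAt F A x₀).linear ℝ hx1).map_add _ _

theorem IsAdapted.contMDiff
    {K : ∀ p : TotalSpace F A, TangentSpace IA p →ₗ[ℝ] TangentSpace IA p}
    {τ : LinearTriple EM M F A} (hT : IsAdapted K τ) :
    ContMDiff (IA).tangent (IA).tangent ∞
      (fun p : TangentBundle IA (TotalSpace F A) =>
        (⟨p.proj, K p.proj p.2⟩ : TangentBundle IA (TotalSpace F A))) := by
  have : T2Space (TotalSpace F A) := t2Space_totalSpace
  intro P
  refine contMDiffAt_bundleMap_of_frame (IB := IA) (T := K) (Module.finBasis ℝ (EM × F)) P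
    fun i => ?_
  generalize (Module.finBasis ℝ (EM × F)) i = W
  obtain ⟨p, -⟩ := P
  change ContMDiffAt _ _ _ _ p
  obtain ⟨x₀, v₀⟩ := p
  obtain ⟨c, hc⟩ := exists_frameSection (EM := EM) (F := F) (A := A) x₀
  obtain ⟨X, hX⟩ := exists_section_eventually (IB := 𝓘(ℝ, EM))
    (V := (TangentSpace 𝓘(ℝ, EM) : M → Type _)) x₀ W.1
  let b : Γ∞ := c W.2
  rw [contMDiffAt_totalSpace]
  refine ⟨contMDiffAt_id, ?_⟩
  let f := Module.finBasis ℝ F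
  have hx1 := mem_baseSet_trivializationAt F A x₀
  have hproj : ContMDiffAt IA 𝓘(ℝ, EM) ∞ (TotalSpace.proj : TotalSpace F A → M) ⟨x₀, v₀⟩ :=
    (contMDiff_proj A).contMDiffAt
  have hS : ∀ s : Γ∞, ContMDiffAt IA 𝓘(ℝ, F) ∞ (fun q : TotalSpace F A =>
      (trivializationAt F A x₀ ⟨q.proj, s q.proj⟩).2) ⟨x₀, v₀⟩ := fun s =>
    ContMDiffAt.comp (f := (TotalSpace.proj : TotalSpace F A → M)) _
      (contMDiffAt_trivializationAt_snd (x := x₀) hx1 s) hproj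
  have h1 : ContMDiffAt IA 𝓘(ℝ, EM) ∞ (fun q : TotalSpace F A =>
      (trivializationAt EM (TangentSpace 𝓘(ℝ, EM) : M → Type _) x₀
        ⟨q.proj, τ.TM q.proj (X q.proj)⟩).2) ⟨x₀, v₀⟩ :=
    ContMDiffAt.comp (f := (TotalSpace.proj : TotalSpace F A → M)) _
      (contMDiffAt_trivializationAt_snd (x := x₀)
        (mem_baseSet_trivializationAt _ _ _) (τ.TM.onSection X)) hproj
  have h2 : ContMDiffAt IA 𝓘(ℝ, F) ∞ (fun q : TotalSpace F A =>
      (∑ k, f.coord k (trivializationAt F A x₀ q).2 •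
        (trivializationAt F A x₀ ⟨q.proj, τ.D (c (f k)) q.proj (X q.proj)⟩).2) +
        (trivializationAt F A x₀ ⟨q.proj, τ.ℓ q.proj (b q.proj)⟩).2) ⟨x₀, v₀⟩ := by
    refine (ContMDiffAt.sum fun k _ => ?_).add (hS (τ.ℓ.onSection b))
    have h3 : ContMDiffAt IA 𝓘(ℝ, ℝ) ∞
        (fun q : TotalSpace F A => f.coord k (trivializationAt F A x₀ q).2) ⟨x₀, v₀⟩ :=
      ((f.coord k).toContinuousLinearMap.contMDiff.contMDiffAt).comp _
        (contMDiffAt_trivializationAt_totalSpace hx1)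
    exact h3.smul (hS ((τ.D (c (f k))).onSection X))
  refine (h1.prodMk_space h2).congr_of_eventuallyEq ?_
  filter_upwards [hproj.continuousAt.eventually hc, hproj.continuousAt.eventually hX,
    hproj.continuousAt.eventually_mem ((trivializationAt F A x₀).open_baseSet.mem_nhds hx1),
    hproj.continuousAt.eventually_mem (extChartAt_source_mem_nhds (I := 𝓘(ℝ, EM)) x₀)]
    with q hq1 hq2 hq3 hq4
  obtain ⟨x, v⟩ := q
  change (∀ w, c w x = _ ∧ sectionCoordDeriv x₀ (c w) x = 0) at hq1
  change X x = _ at hq2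
  change x ∈ _ at hq3 hq4
  have hq : (⟨x, v⟩ : TotalSpace F A) ∈ (extChartAt IA (⟨x₀, v₀⟩ : TotalSpace F A)).source :=
    mem_extChartAt_totalSpace_source (p := ⟨x₀, v₀⟩) (q := ⟨x, v⟩) hq3 hq4
  have hqt : (⟨x, v⟩ : TotalSpace F A) ∈ (trivializationAt (EM × F)
      (TangentSpace IA : TotalSpace F A → Type _) ⟨x₀, v₀⟩).baseSet := by
    rw [extChartAt_source] at hq; simpa using hq
  have hxt : x ∈ (trivializationAt EM (TangentSpace 𝓘(ℝ, EM) : M → Type _) x₀).baseSet := by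
    rw [extChartAt_source] at hq4; simpa using hq4
  set ξ : TangentSpace IA (⟨x, v⟩ : TotalSpace F A) := (trivializationAt (EM × F)
      (TangentSpace IA : TotalSpace F A → Type _) ⟨x₀, v₀⟩).symm ⟨x, v⟩ W with hξ
  have hW : mfderiv IA 𝓘(ℝ, EM × F) (extChartAt IA (⟨x₀, v₀⟩ : TotalSpace F A)) ⟨x, v⟩ ξ = W := by
    rw [mfderiv_extChartAt_apply hq, hξ, Trivialization.apply_mk_symm _ hqt]
  rw [mfderiv_extChartAt_totalSpace _ hq] at hW
  have hW1 := congrArg Prod.fst hW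
  have hW2 : fiberDeriv x₀ ⟨x, v⟩ ξ = W.2 := congrArg Prod.snd hW
  have hξX : projDeriv (EM := EM) (⟨x, v⟩ : TotalSpace F A) ξ = X x := by
    have h3 : (trivializationAt EM (TangentSpace 𝓘(ℝ, EM) : M → Type _) x₀
      ⟨x, projDeriv (EM := EM) (⟨x, v⟩ : TotalSpace F A) ξ⟩).2 = W.1 :=
      (mfderiv_extChartAt_apply hq4 _).symm.trans hW1
    rw [hq2, ← h3, Trivialization.symm_apply_apply_mk _ hxt]
  obtain ⟨h4, h5⟩ := hT.coords_frame hq3 hq4 hq1 hξX (b := b x) (by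
    rw [hW2, (hq1 W.2).1, Trivialization.apply_mk_symm _ hq3])
  refine (mfderiv_extChartAt_apply hq _).symm.trans ?_
  rw [mfderiv_extChartAt_totalSpace _ hq]
  refine Prod.ext ?_ ?_
  · refine (mfderiv_extChartAt_apply hq4 _).trans ?_
    change (trivializationAt EM _ x₀ ⟨x, projDeriv (⟨x, v⟩ : TotalSpace F A) (K ⟨x, v⟩ ξ)⟩).2 = _
    rw [h4]
  · refine h5.trans (congrArg (· + _) ?_)
    have hlin := (trivializationAt F A x₀).linear ℝ hq3
    let L := hlin.mk' _
    change L (τ.DAt x (X x) (c _)) = ∑ k, _ • L (τ.DAt x (X x) (c (f k)))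
    conv_lhs => rw [← f.sum_repr (trivializationAt F A x₀ ⟨x, v⟩).2, map_sum, map_sum, map_sum]
    refine Finset.sum_congr rfl fun k _ => ?_
    rw [map_smul, map_smul, map_smul]; rfl

omit [FiniteDimensional ℝ EM] [FiniteDimensional ℝ F] [T2Space M] in
theorem extChartAt_fiberLine (p : TotalSpace F A) (b : A p.proj) (r : ℝ) :
    fiberLine p b r ∈ (extChartAt IA p).source ∧
    extChartAt IA p (fiberLine p b r) = extChartAt IA p p +
      r • ((0 : EM), (trivializationAt F A p.proj ⟨p.proj, b⟩).2) := by
  have hx := mem_baseSet_trivializationAt F A p.proj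
  refine ⟨mem_extChartAt_totalSpace_source (q := fiberLine p b r) hx
    (mem_extChartAt_source (I := 𝓘(ℝ, EM)) p.proj), ?_⟩
  rw [FiberBundle.extChartAt]
  refine Prod.ext ?_ ?_
  · change extChartAt 𝓘(ℝ, EM) p.proj (trivializationAt F A p.proj (fiberLine p b r)).1 =
      extChartAt 𝓘(ℝ, EM) p.proj (trivializationAt F A p.proj p).1 + r • (0 : EM)
    rw [smul_zero, add_zero, (trivializationAt F A p.proj).coe_fst' (x := fiberLine p b r) hx,
      (trivializationAt F A p.proj).coe_fst' hx]
    rfl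
  · exact trivializationAt_fiberLine hx b r

omit [FiniteDimensional ℝ EM] [FiniteDimensional ℝ F] [T2Space M] in
theorem chartRep_fiberLine (p : TotalSpace F A) (b : A p.proj) (r : ℝ)
    (V : ∀ q : TotalSpace F A, TangentSpace IA q) :
    chartRep IA p V (extChartAt IA p p +
      r • ((0 : EM), (trivializationAt F A p.proj ⟨p.proj, b⟩).2)) =
    ((projDeriv (fiberLine p b r) (V (fiberLine p b r)) : EM),
      fiberDeriv p.proj (fiberLine p b r) (V (fiberLine p b r))) := by
  obtain ⟨h1, h2⟩ := extChartAt_fiberLine (EM := EM) p b r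
  rw [← h2, chartRep_extChartAt h1, mfderiv_extChartAt_totalSpace _ h1]
  refine Prod.ext ?_ rfl
  exact congrArg (fun L : EM →L[ℝ] EM => L (projDeriv (fiberLine p b r) (V (fiberLine p b r))))
    (mfderiv_extChartAt_self (I := 𝓘(ℝ, EM)) (x := p.proj))

omit [FiniteDimensional ℝ EM] [FiniteDimensional ℝ F] [T2Space M] in
/-- The derivative of a vector field along a fibre, in a chart. -/
theorem fderiv_chartRep_vertical (p : TotalSpace F A) (b : A p.proj)
    {V : ∀ q : TotalSpace F A, TangentSpace IA q}
    (hV : DifferentiableAt ℝ (chartRep IA p V) (extChartAt IA p p)) :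
    HasDerivAt (fun r : ℝ => (((projDeriv (fiberLine p b r) (V (fiberLine p b r)) : EM),
      (fiberDeriv p.proj (fiberLine p b r) (V (fiberLine p b r)) : F)) : EM × F))
      (fderiv ℝ (chartRep IA p V) (extChartAt IA p p)
        ((0 : EM), (trivializationAt F A p.proj ⟨p.proj, b⟩).2)) 0 := by
  have h : HasDerivAt (fun r : ℝ => extChartAt IA p p +
      r • ((0 : EM), (trivializationAt F A p.proj ⟨p.proj, b⟩).2))
      ((1 : ℝ) • ((0 : EM), (trivializationAt F A p.proj ⟨p.proj, b⟩).2)) 0 :=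
    ((hasDerivAt_id (0 : ℝ)).smul_const _).const_add _
  rw [one_smul] at h
  have h0 : extChartAt IA p p = extChartAt IA p p +
      (0 : ℝ) • ((0 : EM), (trivializationAt F A p.proj ⟨p.proj, b⟩).2) := by
    rw [zero_smul, add_zero]
  have h2 := HasFDerivAt.comp_hasDerivAt (0 : ℝ) (by rw [← h0]; exact hV.hasFDerivAt) h
  refine h2.congr_of_eventuallyEq (Filter.Eventually.of_forall fun r => ?_)
  exact (chartRep_fiberLine p b r V).symm

omit [FiniteDimensional ℝ EM] [FiniteDimensional ℝ F] [T2Space M] in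
theorem chartRep_verticalLift (p : TotalSpace F A) (a : Γ∞) :
    chartRep IA p (fun q => verticalLift (EM := EM) q (a q.proj)) =ᶠ[𝓝 (extChartAt IA p p)]
      fun z => ((0 : EM), sectionCoord p.proj a ((extChartAt 𝓘(ℝ, EM) p.proj).symm z.1)) := by
  filter_upwards [eventually_mem_target (I := IA) p] with z hz
  set q := (extChartAt IA p).symm z with hq
  have hqs : q ∈ (extChartAt IA p).source := (extChartAt IA p).map_target hz
  have hz2 : z = extChartAt IA p q := ((extChartAt IA p).right_inv hz).symm
  have hqs' := hqs
  rw [FiberBundle.extChartAt] at hqs'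
  have hq1 : q.proj ∈ (trivializationAt F A p.proj).baseSet :=
    (trivializationAt F A p.proj).mem_source.1 hqs'.1
  have hq2 : q.proj ∈ (extChartAt 𝓘(ℝ, EM) p.proj).source := by
    have := hqs'.2.1
    simpa [(trivializationAt F A p.proj).coe_fst hqs'.1] using this
  have hz1 : z.1 = extChartAt 𝓘(ℝ, EM) p.proj q.proj := by
    rw [hz2, FiberBundle.extChartAt]
    change extChartAt 𝓘(ℝ, EM) p.proj (trivializationAt F A p.proj q).1 = _
    rw [(trivializationAt F A p.proj).coe_fst hqs'.1]
  rw [hz1, (extChartAt 𝓘(ℝ, EM) p.proj).left_inv hq2, hz2, chartRep_extChartAt hqs,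
    mfderiv_extChartAt_totalSpace _ hqs, projDeriv_verticalLift, fiberDeriv_verticalLift hq1, map_zero]
  rfl

omit [FiniteDimensional ℝ EM] [FiniteDimensional ℝ F] [T2Space M] in
theorem fderiv_chartRep_verticalLift (p : TotalSpace F A) (a : Γ∞) (w : EM × F) :
    fderiv ℝ (chartRep IA p (fun q => verticalLift (EM := EM) q (a q.proj))) (extChartAt IA p p) w =
      ((0 : EM), sectionCoordDeriv p.proj a p.proj w.1) := by
  have hx := mem_baseSet_trivializationAt F A p.proj
  have h1 := mfderiv_eq_fderiv_comp (I := 𝓘(ℝ, EM)) (mem_extChartAt_source p.proj)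
    (mdifferentiableAt_sectionCoord hx a) w.1
  have h2 : extChartAt IA p p =
      ((extChartAt 𝓘(ℝ, EM) p.proj p.proj, (trivializationAt F A p.proj p).2) : EM × F) := by
    rw [FiberBundle.extChartAt]
    change ((extChartAt 𝓘(ℝ, EM) p.proj (trivializationAt F A p.proj p).1, _) : EM × F) = _
    rw [(trivializationAt F A p.proj).coe_fst' hx]; rfl
  have hd : DifferentiableAt ℝ (fun e => sectionCoord p.proj a ((extChartAt 𝓘(ℝ, EM) p.proj).symm e))
      (extChartAt 𝓘(ℝ, EM) p.proj p.proj) :=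
    (contDiffAt_extChartAt_symm (((trivializationAt F A p.proj).contMDiffAt_section_iff hx).1
      a.contMDiff.contMDiffAt)).differentiableAt (by simp)
  rw [(chartRep_verticalLift p a).fderiv_eq]
  have h3 : HasFDerivAt (fun z : EM × F =>
      ((0 : EM), sectionCoord p.proj a ((extChartAt 𝓘(ℝ, EM) p.proj).symm z.1))) _ (extChartAt IA p p) :=
    (hasFDerivAt_const (0 : EM) _).prodMk
      (HasFDerivAt.comp (f := (Prod.fst : EM × F → EM))
        (g := fun e => sectionCoord p.proj a ((extChartAt 𝓘(ℝ, EM) p.proj).symm e))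
        (extChartAt IA p p) (by rw [h2]; exact hd.hasFDerivAt) hasFDerivAt_fst)
  rw [h3.fderiv]
  refine Prod.ext rfl ?_
  refine Eq.trans ?_ h1.symm
  rw [mfderiv_extChartAt_self]
  rfl

end AdaptedSmooth

end

noncomputable section

open scoped Topology
open VectorField

section AdaptedTriple
variable {EM : Type*} [NormedAddCommGroup EM] [NormedSpace ℝ EM] [FiniteDimensional ℝ EM]
  {M : Type*} [TopologicalSpace M] [T2Space M] [ChartedSpace EM M] [IsManifold 𝓘(ℝ, EM) ∞ M]
  {F : Type*} [NormedAddCommGroup F] [NormedSpace ℝ F] [FiniteDimensional ℝ F]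
  {A : M → Type*} [TopologicalSpace (TotalSpace F A)] [∀ x, TopologicalSpace (A x)]
  [FiberBundle F A] [∀ x, AddCommGroup (A x)] [∀ x, Module ℝ (A x)] [VectorBundle ℝ F A]
  [ContMDiffVectorBundle ∞ F A 𝓘(ℝ, EM)]

local notation "Γ∞" => Cₛ^∞⟮𝓘(ℝ, EM); F, A⟯
local notation "IA" => ModelWithCorners.prod 𝓘(ℝ, EM) 𝓘(ℝ, F)

omit [FiniteDimensional ℝ EM] [FiniteDimensional ℝ F] [T2Space M] in
theorem eq_projDeriv_fiberDeriv (p : TotalSpace F A) (ξ : TangentSpace IA p) :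
    (ξ : EM × F) = ((projDeriv p ξ : EM), fiberDeriv p.proj p ξ) := by
  have hp := mem_extChartAt_source (I := IA) p
  have h := mfderiv_extChartAt_totalSpace p hp ξ
  have h2 : mfderiv IA 𝓘(ℝ, EM × F) (extChartAt IA p) p ξ = ξ :=
    congrArg (fun L : EM × F →L[ℝ] EM × F => L ξ) (mfderiv_extChartAt_self (I := IA) (x := p))
  refine h2.symm.trans (h.trans (Prod.ext ?_ rfl))
  exact congrArg (fun L : EM →L[ℝ] EM => L (projDeriv p ξ))
    (mfderiv_extChartAt_self (I := 𝓘(ℝ, EM)) (x := p.proj))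

omit [FiniteDimensional ℝ F] in
theorem hasDerivAt_linear_bilinear {TM : EM →ₗ[ℝ] EM} {N : F →ₗ[ℝ] EM →ₗ[ℝ] F} {L : F →ₗ[ℝ] F}
    [FiniteDimensional ℝ F] {Y : ℝ → EM × F} {Y' : EM × F} (hY : HasDerivAt Y Y' 0) (w α : F) :
    HasDerivAt (fun r : ℝ => (TM (Y r).1, N (w + r • α) (Y r).1 + L (Y r).2))
      (TM Y'.1, N w Y'.1 + N α (Y 0).1 + L Y'.2) 0 := by
  have h1 : HasDerivAt (fun r => (Y r).1) Y'.1 0 := (hasFDerivAt_fst (p := Y 0)).comp_hasDerivAt (0 : ℝ) hY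
  have h2 : HasDerivAt (fun r => (Y r).2) Y'.2 0 := (hasFDerivAt_snd (p := Y 0)).comp_hasDerivAt (0 : ℝ) hY
  have h3 : HasDerivAt (fun r => N w (Y r).1) (N w Y'.1) 0 :=
    (N w).toContinuousLinearMap.hasFDerivAt.comp_hasDerivAt (0 : ℝ) h1
  have h4 : HasDerivAt (fun r => N α (Y r).1) (N α Y'.1) 0 :=
    (N α).toContinuousLinearMap.hasFDerivAt.comp_hasDerivAt (0 : ℝ) h1
  have h5 : HasDerivAt (fun r => L (Y r).2) (L Y'.2) 0 :=
    L.toContinuousLinearMap.hasFDerivAt.comp_hasDerivAt (0 : ℝ) h2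
  have h6 : HasDerivAt (fun r => TM (Y r).1) (TM Y'.1) 0 :=
    TM.toContinuousLinearMap.hasFDerivAt.comp_hasDerivAt (0 : ℝ) h1
  have h7 := (h3.add ((hasDerivAt_id (0 : ℝ)).smul h4)).add h5
  refine h6.prodMk ?_
  refine (h7.congr_deriv ?_).congr_of_eventuallyEq (Filter.Eventually.of_forall fun r => ?_)
  · simp
  · simp

theorem IsAdapted.lie {T : Tensor11 IA (TotalSpace F A)} {τ : LinearTriple EM M F A}
    (hT : IsAdapted T.toFun τ) (a : Γ∞) (Y : VectorFields IA (TotalSpace F A))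
    (p : TotalSpace F A) :
    mlieBracket IA (fun q => verticalLift q (a q.proj)) (fun q => T q (Y q)) p
      - T p (mlieBracket IA (fun q => verticalLift q (a q.proj)) (fun q => Y q) p)
      = verticalLift p (τ.D a p.proj (projDeriv p (Y p))) := by
  obtain ⟨x, v⟩ := p
  have hx1 := mem_baseSet_trivializationAt F A x
  have hx2 := mem_extChartAt_source (I := 𝓘(ℝ, EM)) x
  obtain ⟨c, hc'⟩ := exists_frameSection (EM := EM) (F := F) (A := A) x
  have hc := hc'.self_of_nhds
  have hlin := (trivializationAt F A x).linear ℝ hx1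
  let e : A x →ₗ[ℝ] F := hlin.mk' _
  let TM : EM →ₗ[ℝ] EM := τ.TM x
  let N : F →ₗ[ℝ] EM →ₗ[ℝ] F :=
    { toFun := fun w => e ∘ₗ τ.D (c w) x
      map_add' := fun w w' => LinearMap.ext fun X => by
        change e (τ.DAt x X (c (w + w'))) = e (τ.DAt x X (c w)) + e (τ.DAt x X (c w'))
        rw [map_add, map_add, map_add]
      map_smul' := fun r w => LinearMap.ext fun X => by
        change e (τ.DAt x X (c (r • w))) = r • e (τ.DAt x X (c w))
        rw [map_smul, map_smul, map_smul] }
  let L : F →ₗ[ℝ] F := e ∘ₗ τ.ℓ x ∘ₗ ((trivializationAt F A x).symmL ℝ x).toLinearMap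
  have hL : ∀ b, L (e b) = e (τ.ℓ x b) := fun b => by
    change e (τ.ℓ x ((trivializationAt F A x).symmL ℝ x (e b))) = _
    rw [Trivialization.symmL_apply _ hx1]
    exact congrArg (fun z => e (τ.ℓ x z)) (Trivialization.symm_apply_apply_mk _ hx1 b)
  have hK : ∀ (v : A x) (ξ : TangentSpace IA (⟨x, v⟩ : TotalSpace F A)),
      (projDeriv (EM := EM) (⟨x, v⟩ : TotalSpace F A) (T ⟨x, v⟩ ξ) : EM) =
        TM (projDeriv (EM := EM) (⟨x, v⟩ : TotalSpace F A) ξ) ∧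
      fiberDeriv (EM := EM) x (⟨x, v⟩ : TotalSpace F A) (T ⟨x, v⟩ ξ) =
        N (e v) (projDeriv (EM := EM) (⟨x, v⟩ : TotalSpace F A) ξ) +
          L (fiberDeriv (EM := EM) x (⟨x, v⟩ : TotalSpace F A) ξ) := fun v ξ => by
    have h : fiberDeriv (EM := EM) x (⟨x, v⟩ : TotalSpace F A) ξ =
        e ((trivializationAt F A x).symm x (fiberDeriv (EM := EM) x (⟨x, v⟩ : TotalSpace F A) ξ)) :=
      (congrArg Prod.snd (Trivialization.apply_mk_symm _ hx1 _)).symm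
    obtain ⟨h1, h2⟩ := hT.coords_frame hx1 hx2 hc rfl h
    refine ⟨h1, h2.trans ?_⟩
    conv_rhs => rw [h, hL]
    rfl
  set V : ∀ q : TotalSpace F A, TangentSpace IA q := fun q => verticalLift q (a q.proj) with hV
  set p : TotalSpace F A := ⟨x, v⟩ with hp
  set z := extChartAt IA p p with hz
  have hY : DifferentiableAt ℝ (chartRep IA p Y) z :=
    (contDiffAt_chartRep Y.contMDiff.contMDiffAt).differentiableAt (by simp)
  have hTY : DifferentiableAt ℝ (chartRep IA p fun q => T q (Y q)) z :=
    (contDiffAt_chartRep (T.onSection Y).contMDiff.contMDiffAt).differentiableAt (by simp)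
  have hV0 : chartRep IA p V z = ((0 : EM), e (a x)) := by
    refine (chartRep_self p V).trans ((eq_projDeriv_fiberDeriv p (V p)).trans (Prod.ext ?_ ?_))
    · exact projDeriv_verticalLift p (a x)
    · exact fiberDeriv_verticalLift (p := p) hx1 (a x)
  have dY := fderiv_chartRep_vertical p (a x) hY
  have dTY := fderiv_chartRep_vertical p (a x) hTY
  set Y' : EM × F := fderiv ℝ (chartRep IA p Y) z
    ((0 : EM), (trivializationAt F A p.proj ⟨p.proj, a x⟩).2) with hY'
  have dTY2 := hasDerivAt_linear_bilinear (TM := TM) (N := N) (L := L) dY (e v) (e (a x))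
  have hd := dTY.unique (dTY2.congr_of_eventuallyEq (Filter.Eventually.of_forall fun r => by
    obtain ⟨h1, h2⟩ := hK (v + r • a x) (Y (fiberLine p (a x) r))
    refine Prod.ext h1 (h2.trans ?_)
    rw [map_add, map_smul]; rfl))
  have hb : ∀ W : ∀ q : TotalSpace F A, TangentSpace IA q, (mlieBracket IA V W p : EM × F) =
      fderiv ℝ (chartRep IA p W) z ((0 : EM), e (a x)) -
        ((0 : EM), sectionCoordDeriv x a x (projDeriv p (W p))) := fun W => by
    rw [mlieBracket_eq_lieBracket, lieBracket_eq]
    change fderiv ℝ (chartRep IA p W) z (chartRep IA p V z) -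
      fderiv ℝ (chartRep IA p V) z (chartRep IA p W z) = _
    rw [hV0]
    refine congrArg (fderiv ℝ (chartRep IA p W) z ((0 : EM), e (a x)) - ·) ?_
    refine (fderiv_chartRep_verticalLift p a _).trans ?_
    exact congrArg (fun ξ : EM × F => ((0 : EM), sectionCoordDeriv x a x ξ.1))
      ((chartRep_self p W).trans (eq_projDeriv_fiberDeriv p (W p)))
  have hDa : ∀ X : TangentSpace 𝓘(ℝ, EM) x, e (τ.D a x X) =
      N (e (a x)) X + L (sectionCoordDeriv x a x X) - sectionCoordDeriv x a x (τ.TM x X) := by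
    intro X
    have h := hT.coords hx1 hx2 (c := a) rfl (b := 0) (projDeriv_sectionDeriv a x X)
      ((fiberDeriv_sectionDeriv a hx1 X).trans (by
        rw [show (trivializationAt F A x ⟨x, (0 : A x)⟩).2 = e 0 from rfl, map_zero, add_zero]; rfl))
    have h2 := (hK (a x) (sectionDeriv a x X)).2
    rw [projDeriv_sectionDeriv, fiberDeriv_sectionDeriv a hx1] at h2
    have h3 := h.2.symm.trans h2
    rw [map_zero, add_zero] at h3
    rw [eq_sub_iff_add_eq, add_comm]
    exact h3
  have hzero : ∀ q, q = p → (projDeriv q (Y q) : EM) = projDeriv p (Y p) := by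
    rintro q rfl; rfl
  have b1 := hb fun q => T q (Y q)
  have b2 := hb Y
  set ξ₁ : TangentSpace IA p := mlieBracket IA V (fun q => T q (Y q)) p
  set ξ₂ : TangentSpace IA p := mlieBracket IA V Y p
  have b1 := (eq_projDeriv_fiberDeriv p ξ₁).symm.trans (b1.trans (congrArg (· - _) hd))
  have b2 := (eq_projDeriv_fiberDeriv p ξ₂).symm.trans b2
  have b11 : (projDeriv p ξ₁ : EM) = TM Y'.1 := (congrArg Prod.fst b1).trans (sub_zero _)
  have b12 : fiberDeriv x p ξ₁ = N (e v) Y'.1 +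
      N (e (a x)) (projDeriv (fiberLine p (a x) 0) (Y (fiberLine p (a x) 0))) + L Y'.2 -
      sectionCoordDeriv x a x (projDeriv p (T p (Y p))) := congrArg Prod.snd b1
  have b21 : (projDeriv p ξ₂ : EM) = Y'.1 := (congrArg Prod.fst b2).trans (sub_zero _)
  have b22 : fiberDeriv x p ξ₂ = Y'.2 - sectionCoordDeriv x a x (projDeriv p (Y p)) :=
    congrArg Prod.snd b2
  refine tangent_totalSpace_ext (x₀ := x) (q := p) hx1 hx2 ?_ ?_
  · rw [map_sub, projDeriv_verticalLift]
    refine sub_eq_zero.2 (b11.trans (Eq.trans ?_ (hK v ξ₂).1.symm))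
    exact congrArg TM b21.symm
  · rw [map_sub]
    refine Eq.trans ?_ (fiberDeriv_verticalLift (p := p) hx1 _).symm
    change _ = e (τ.D a x (projDeriv p (Y p)))
    rw [hDa]
    refine (congrArg₂ (fun s t : F => s - t) b12 (hK v ξ₂).2).trans ?_
    have h1 := (hK v (Y p)).1
    rw [show (projDeriv (⟨x, v⟩ : TotalSpace F A) ξ₂ : EM) = Y'.1 from b21,
      show fiberDeriv x (⟨x, v⟩ : TotalSpace F A) ξ₂ =
        Y'.2 - sectionCoordDeriv x a x (projDeriv p (Y p)) from b22, map_sub L]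
    rw [hzero _ (fiberLine_zero p (a x))]
    rw [show projDeriv p (T p (Y p)) = τ.TM x (projDeriv p (Y p)) from h1]
    abel

theorem IsAdapted.hasTriple {T : Tensor11 IA (TotalSpace F A)} {τ : LinearTriple EM M F A}
    (hT : IsAdapted T.toFun τ) : HasTriple T τ where
  linear r _ p ξ := hT.linear r p ξ
  proj p ξ := by
    obtain ⟨x, v⟩ := p
    obtain ⟨c, hc⟩ := exists_frameSection (EM := EM) (F := F) (A := A) x
    have hx1 := mem_baseSet_trivializationAt F A x
    exact (hT.coords_frame hx1 (mem_extChartAt_source x) hc.self_of_nhds rfl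
      (congrArg Prod.snd (Trivialization.apply_mk_symm _ hx1 _)).symm).1
  vertical a p := by
    obtain ⟨x, v⟩ := p
    obtain ⟨c, hc⟩ := exists_section_apply_eq (IB := 𝓘(ℝ, EM)) (F := F) x v
    subst hc
    have h := hT c x 0 (a x)
    have h0 : τ.D c x 0 = 0 := map_zero _
    have h1 : τ.TM x 0 = 0 := map_zero _
    rw [h0, h1, map_zero, zero_add, zero_add, zero_add] at h
    exact h
  lie := hT.lie

theorem verticalLift_injective (p : TotalSpace F A) :
    Function.Injective (verticalLift (EM := EM) p) := by
  intro b b' h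
  have hx := mem_baseSet_trivializationAt F A p.proj
  have h1 := congrArg (fiberDeriv p.proj p) h
  rw [fiberDeriv_verticalLift hx, fiberDeriv_verticalLift hx] at h1
  have h2 := congrArg ((trivializationAt F A p.proj).symm p.proj) h1
  rwa [Trivialization.symm_apply_apply_mk _ hx, Trivialization.symm_apply_apply_mk _ hx] at h2

theorem BundleMap.ext' {EB : Type*} [NormedAddCommGroup EB] [NormedSpace ℝ EB]
    {HB : Type*} [TopologicalSpace HB] {IB : ModelWithCorners ℝ EB HB}
    {B : Type*} [TopologicalSpace B] [ChartedSpace HB B]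
    {F : Type*} [NormedAddCommGroup F] [NormedSpace ℝ F]
    {V : B → Type*} [TopologicalSpace (TotalSpace F V)] [∀ x, TopologicalSpace (V x)]
    [FiberBundle F V] [∀ x, AddCommGroup (V x)] [∀ x, Module ℝ (V x)]
    {F' : Type*} [NormedAddCommGroup F'] [NormedSpace ℝ F']
    {V' : B → Type*} [TopologicalSpace (TotalSpace F' V')] [∀ x, TopologicalSpace (V' x)]
    [FiberBundle F' V'] [∀ x, AddCommGroup (V' x)] [∀ x, Module ℝ (V' x)]
    {S T : BundleMap IB F V F' V'} (h : ∀ x v, S x v = T x v) : S = T := by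
  cases S; cases T
  congr
  exact funext fun x => LinearMap.ext (h x)

theorem HasTriple.triple_unique {T : Tensor11 IA (TotalSpace F A)} {τ τ' : LinearTriple EM M F A}
    (h : HasTriple T τ) (h' : HasTriple T τ') : τ = τ' := by
  have hproj : ∀ (x : M) (X : TangentSpace 𝓘(ℝ, EM) x),
      ∃ ξ : TangentSpace IA (⟨x, 0⟩ : TotalSpace F A), projDeriv (⟨x, 0⟩ : TotalSpace F A) ξ = X :=
    fun x X => by
      let W : EM → EM × F := fun X => (X, 0)
      exact ⟨W X, (congrArg Prod.fst
        (eq_projDeriv_fiberDeriv (⟨x, 0⟩ : TotalSpace F A) (W X))).symm⟩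
  have hTM : τ.TM = τ'.TM := BundleMap.ext' fun x X => by
    obtain ⟨ξ, rfl⟩ := hproj x X
    exact (h.proj _ ξ).symm.trans (h'.proj _ ξ)
  have hℓ : τ.ℓ = τ'.ℓ := BundleMap.ext' fun x v => by
    obtain ⟨c, rfl⟩ := exists_section_apply_eq (IB := 𝓘(ℝ, EM)) (F := F) (V := A) x v
    exact verticalLift_injective (⟨x, 0⟩ : TotalSpace F A)
      ((h.vertical c ⟨x, 0⟩).symm.trans (h'.vertical c ⟨x, 0⟩))
  have hD : τ.D = τ'.D := funext fun a => BundleMap.ext' fun x X => by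
    have : T2Space (TotalSpace F A) := t2Space_totalSpace
    obtain ⟨ξ, rfl⟩ := hproj x X
    obtain ⟨Y, rfl⟩ := exists_section_apply_eq (IB := IA) (F := EM × F)
      (V := (TangentSpace IA : TotalSpace F A → Type _)) (⟨x, 0⟩ : TotalSpace F A) ξ
    exact verticalLift_injective (⟨x, 0⟩ : TotalSpace F A)
      ((h.lie a Y ⟨x, 0⟩).symm.trans (h'.lie a Y ⟨x, 0⟩))
  cases τ; cases τ'
  congr

theorem isShift_iff {𝒜 : LieAlgebroid EM M F A}
    {U : BundleMap 𝓘(ℝ, EM) EM (TangentSpace 𝓘(ℝ, EM) : M → Type _) F A}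
    {T : Tensor11 IA (TotalSpace F A)} (hT : HasTriple T (lieTriple 𝒜 U))
    {V : ShiftedTensor EM M F A (-1)} (hV : IsCoreLift U V) (S : ShiftedTensor EM M F A 0) :
    IsShift T S ↔ S = V.lie 𝒜.toLieRinehart.d := by
  constructor
  · rintro ⟨τ, h1, h2⟩
    rw [h1.triple_unique hT] at h2
    exact HasShiftedTriple.ext h2 (hasShiftedTriple_lie hV)
  · rintro rfl
    exact ⟨_, hT, hasShiftedTriple_lie hV⟩

end AdaptedTriple

end

noncomputable section

open scoped Topology

section Submersion
variable {E : Type*} [NormedAddCommGroup E] [NormedSpace ℝ E] [FiniteDimensional ℝ E]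
  {E' : Type*} [NormedAddCommGroup E'] [NormedSpace ℝ E'] [FiniteDimensional ℝ E']
  {N : Type*} [TopologicalSpace N] [ChartedSpace E N] [IsManifold 𝓘(ℝ, E) ∞ N]
  {B : Type*} [TopologicalSpace B] [ChartedSpace E' B] [IsManifold 𝓘(ℝ, E') ∞ B]

/-- A submersion of normed spaces has local sections `c` through all points, in the form
`S (e + R (c (e, m))) = m`. -/
theorem exists_local_correction {S : E → E'} {e₀ : E} (hS : ContDiffAt ℝ ∞ S e₀)
    (hsurj : Function.Surjective (fderiv ℝ S e₀)) :
    ∃ (R : E' →L[ℝ] E) (c : E × E' → E'), ContDiffAt ℝ ∞ c (e₀, S e₀) ∧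
      (∀ᶠ p : E × E' in 𝓝 (e₀, S e₀), S (p.1 + R (c p)) = p.2) ∧ ∀ᶠ e in 𝓝 e₀, c (e, S e) = 0 := by
  obtain ⟨R₀, hR₀⟩ := (fderiv ℝ S e₀).toLinearMap.exists_rightInverse_of_surjective
    (LinearMap.range_eq_top.2 hsurj)
  let R : E' →L[ℝ] E := R₀.toContinuousLinearMap
  have hR : ∀ y, fderiv ℝ S e₀ (R y) = y := fun y => congrArg (fun L => L y) hR₀
  let H : E × E' → E × E' := fun p => (p.1, S (p.1 + R p.2))
  let D : (E × E') ≃L[ℝ] (E × E') := ContinuousLinearEquiv.equivOfInverse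
    ((ContinuousLinearMap.fst ℝ E E').prod
      ((fderiv ℝ S e₀).comp (ContinuousLinearMap.fst ℝ E E') + ContinuousLinearMap.snd ℝ E E'))
    ((ContinuousLinearMap.fst ℝ E E').prod
      (ContinuousLinearMap.snd ℝ E E' - (fderiv ℝ S e₀).comp (ContinuousLinearMap.fst ℝ E E')))
    (fun p => by ext <;> simp) (fun p => by ext <;> simp)
  have hin : ContDiffAt ℝ ∞ (fun p : E × E' => p.1 + R p.2) (e₀, (0 : E')) :=
    (contDiff_fst.add (R.contDiff.comp contDiff_snd)).contDiffAt
  have h0 : (e₀, (0 : E')).1 + R (e₀, (0 : E')).2 = e₀ := by simp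
  have hH : ContDiffAt ℝ ∞ H (e₀, (0 : E')) :=
    contDiff_fst.contDiffAt.prodMk (ContDiffAt.comp (g := S) (e₀, (0 : E')) (by rwa [h0]) hin)
  have hin' : HasFDerivAt (fun p : E × E' => p.1 + R p.2)
      (ContinuousLinearMap.fst ℝ E E' + R.comp (ContinuousLinearMap.snd ℝ E E')) (e₀, (0 : E')) :=
    hasFDerivAt_fst.add (R.hasFDerivAt.comp _ hasFDerivAt_snd)
  have hSd : HasFDerivAt S (fderiv ℝ S e₀) ((e₀, (0 : E')).1 + R (e₀, (0 : E')).2) := by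
    rw [h0]; exact (hS.differentiableAt (by simp)).hasFDerivAt
  have hD : HasFDerivAt H (D : E × E' →L[ℝ] E × E') (e₀, (0 : E')) := by
    refine (hasFDerivAt_fst.prodMk (HasFDerivAt.comp (g := S) (e₀, (0 : E')) hSd hin')).congr_fderiv ?_
    ext p <;> simp [D, hR]
  have hn : (∞ : WithTop ℕ∞) ≠ 0 := by simp
  have hH0 : H (e₀, 0) = (e₀, S e₀) := by simp [H]
  have hstrict := hH.hasStrictFDerivAt' hD hn
  have hinv := hH.to_localInverse hD hn
  have hr := hstrict.eventually_right_inverse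
  have hl := hstrict.eventually_left_inverse
  rw [hH0] at hinv hr
  refine ⟨R, fun p => (hH.localInverse hD hn p).2, contDiff_snd.contDiffAt.comp _ hinv, ?_, ?_⟩
  · filter_upwards [hr] with p hp
    have h1 := congrArg Prod.fst hp
    have h2 := congrArg Prod.snd hp
    change (hH.localInverse hD hn p).1 = p.1 at h1
    change S ((hH.localInverse hD hn p).1 + R (hH.localInverse hD hn p).2) = p.2 at h2
    rwa [h1] at h2
  · have hc : Filter.Tendsto (fun e : E => (e, (0 : E'))) (𝓝 e₀) (𝓝 (e₀, 0)) :=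
      (Continuous.prodMk_left (0 : E')).tendsto e₀
    filter_upwards [hc.eventually hl] with e he
    have h1 : H (e, 0) = (e, S e) := by simp [H]
    rw [h1] at he
    exact congrArg Prod.snd he

/-- Along a submersion `f`, points can be moved smoothly to prescribed nearby fibres. -/
theorem exists_fiber_retraction {f : N → B} (hf : ContMDiff 𝓘(ℝ, E) 𝓘(ℝ, E') ∞ f) (g₀ : N)
    (hsurj : Function.Surjective (mfderiv 𝓘(ℝ, E) 𝓘(ℝ, E') f g₀)) :
    ∃ r : B × N → N, ContMDiffAt (𝓘(ℝ, E').prod 𝓘(ℝ, E)) 𝓘(ℝ, E) ∞ r (f g₀, g₀) ∧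
      (∀ᶠ p in 𝓝 (f g₀, g₀), f (r p) = p.1) ∧ ∀ᶠ h in 𝓝 g₀, r (f h, h) = h := by
  let φ := extChartAt 𝓘(ℝ, E) g₀
  let ψ := extChartAt 𝓘(ℝ, E') (f g₀)
  let S : E → E' := fun e => ψ (f (φ.symm e))
  have hS : ContDiffAt ℝ ∞ S (φ g₀) := by
    have h := (contMDiffAt_iff.1 (hf g₀)).2
    rw [ModelWithCorners.range_eq_univ, contDiffWithinAt_univ] at h
    exact h
  have hsurj' : Function.Surjective (fderiv ℝ S (φ g₀)) := by
    have h := (hf.mdifferentiableAt (x := g₀) (by simp)).mfderiv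
    rw [ModelWithCorners.range_eq_univ, fderivWithin_univ] at h
    rw [h] at hsurj
    exact hsurj
  obtain ⟨R, c, hc, hc1, hc2⟩ := exists_local_correction hS hsurj'
  have hS0 : S (φ g₀) = ψ (f g₀) := congrArg (fun z => ψ (f z)) (extChartAt_to_inv g₀)
  rw [hS0] at hc hc1
  let w : B × N → E × E' := fun p => (φ p.2, ψ p.1)
  have hφ : ContMDiffAt 𝓘(ℝ, E) 𝓘(ℝ, E) ∞ φ g₀ := contMDiffAt_extChartAt
  have hψ : ContMDiffAt 𝓘(ℝ, E') 𝓘(ℝ, E') ∞ ψ (f g₀) := contMDiffAt_extChartAt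
  have hw : ContMDiffAt (𝓘(ℝ, E').prod 𝓘(ℝ, E)) 𝓘(ℝ, E × E') ∞ w (f g₀, g₀) :=
    (ContMDiffAt.comp (f := Prod.snd) (f g₀, g₀) hφ contMDiffAt_snd).prodMk_space
      (ContMDiffAt.comp (f := Prod.fst) (f g₀, g₀) hψ contMDiffAt_fst)
  have hcw : ContMDiffAt (𝓘(ℝ, E').prod 𝓘(ℝ, E)) 𝓘(ℝ, E') ∞ (fun p => c (w p)) (f g₀, g₀) :=
    ContMDiffAt.comp (g := c) (f := w) (f g₀, g₀) hc.contMDiffAt hw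
  have hv : ContMDiffAt (𝓘(ℝ, E').prod 𝓘(ℝ, E)) 𝓘(ℝ, E) ∞
      (fun p : B × N => φ p.2 + R (c (w p))) (f g₀, g₀) :=
    (ContMDiffAt.comp (f := Prod.snd) (f g₀, g₀) hφ contMDiffAt_snd).add
      (R.contMDiff.contMDiffAt.comp (f g₀, g₀) hcw)
  have hc0 : c (φ g₀, ψ (f g₀)) = 0 := by
    have := hc2.self_of_nhds; rwa [hS0] at this
  have hv0 : φ g₀ + R (c (w (f g₀, g₀))) = φ g₀ := by
    change φ g₀ + R (c (φ g₀, ψ (f g₀))) = φ g₀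
    rw [hc0, map_zero, add_zero]
  have hr : ContMDiffAt (𝓘(ℝ, E').prod 𝓘(ℝ, E)) 𝓘(ℝ, E) ∞
      (fun p : B × N => φ.symm (φ p.2 + R (c (w p)))) (f g₀, g₀) :=
    ContMDiffAt.comp_of_eq (g := φ.symm) ((contMDiffOn_extChartAt_symm g₀).contMDiffAt
      (extChartAt_target_mem_nhds g₀)) hv hv0
  refine ⟨_, hr, ?_, ?_⟩
  · have hr0 : φ.symm (φ g₀ + R (c (w (f g₀, g₀)))) = g₀ := by
      rw [hv0]; exact extChartAt_to_inv g₀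
    have hfr : ContinuousAt (fun p : B × N => f (φ.symm (φ p.2 + R (c (w p))))) (f g₀, g₀) :=
      ContinuousAt.comp (g := f) hf.continuous.continuousAt hr.continuousAt
    have h1 := hfr.eventually_mem (s := ψ.source) (by
      rw [show f (φ.symm (φ (f g₀, g₀).2 + R (c (w (f g₀, g₀))))) = f g₀ from congrArg f hr0]
      exact extChartAt_source_mem_nhds (f g₀))
    have h2 : ∀ᶠ p : B × N in 𝓝 (f g₀, g₀), p.1 ∈ ψ.source :=
      continuousAt_fst.eventually_mem (extChartAt_source_mem_nhds (I := 𝓘(ℝ, E')) (f g₀))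
    filter_upwards [h1, h2, hw.continuousAt.eventually hc1] with p hp1 hp2 hp3
    exact ψ.injOn hp1 hp2 hp3
  · have h1 : ∀ᶠ h in 𝓝 g₀, h ∈ φ.source := extChartAt_source_mem_nhds (I := 𝓘(ℝ, E)) g₀
    filter_upwards [h1, hφ.continuousAt.eventually hc2] with h hh hc
    have h2 : w (f h, h) = (φ h, S (φ h)) := by
      change (φ h, ψ (f h)) = (φ h, ψ (f (φ.symm (φ h))))
      rw [φ.left_inv hh]
    change φ.symm (φ h + R (c (w (f h, h)))) = h
    rw [h2, hc, map_zero, add_zero, φ.left_inv hh]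

end Submersion

end

noncomputable section

open scoped Topology

section ChainRule
variable {E : Type*} [NormedAddCommGroup E] [NormedSpace ℝ E]
  {E' : Type*} [NormedAddCommGroup E'] [NormedSpace ℝ E']
  {E'' : Type*} [NormedAddCommGroup E''] [NormedSpace ℝ E'']
  {H : Type*} [TopologicalSpace H] {I : ModelWithCorners ℝ E H}
  {H' : Type*} [TopologicalSpace H'] {I' : ModelWithCorners ℝ E' H'}
  {H'' : Type*} [TopologicalSpace H''] {I'' : ModelWithCorners ℝ E'' H''}
  {N : Type*} [TopologicalSpace N] [ChartedSpace H N]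
  {N' : Type*} [TopologicalSpace N'] [ChartedSpace H' N']
  {N'' : Type*} [TopologicalSpace N''] [ChartedSpace H'' N'']

theorem mfderiv_comp_apply_eq {g : N' → N''} {f : N → N'} {x : N} {y : N'}
    (hg : MDifferentiableAt I' I'' g y) (hf : MDifferentiableAt I I' f x) (hy : f x = y) (v : E) :
    (mfderiv I I'' (fun z => g (f z)) x : E →L[ℝ] E'') v =
      (mfderiv I' I'' g y : E' →L[ℝ] E'') ((mfderiv I I' f x : E →L[ℝ] E') v) := by
  subst hy
  exact congrArg (fun L : E →L[ℝ] E'' => L v) (mfderiv_comp x hg hf)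

theorem mdifferentiableAt_comp_eq {g : N' → N''} {f : N → N'} {x : N} {y : N'}
    (hg : MDifferentiableAt I' I'' g y) (hf : MDifferentiableAt I I' f x) (hy : f x = y) :
    MDifferentiableAt I I'' (fun z => g (f z)) x := by
  subst hy
  exact hg.comp x hf

/-- The chain rule for a function `g` which is differentiable along a set `s`. -/
theorem hasMFDerivAt_comp_mfderivWithin {g : N' → N''} {s : Set N'} {f : N → N'} {x : N} {y : N'}
    (hg : MDifferentiableWithinAt I' I'' g s y) (hf : MDifferentiableAt I I' f x) (hy : f x = y)
    (hs : ∀ᶠ z in 𝓝 x, f z ∈ s) :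
    MDifferentiableAt I I'' (fun z => g (f z)) x ∧
    ∀ v : E, (mfderiv I I'' (fun z => g (f z)) x : E →L[ℝ] E'') v =
      (mfderivWithin I' I'' g s y : E' →L[ℝ] E'') ((mfderiv I I' f x : E →L[ℝ] E') v) := by
  subst hy
  have h := (hg.hasMFDerivWithinAt.comp x (s := f ⁻¹' s) hf.hasMFDerivAt.hasMFDerivWithinAt
    (Set.Subset.refl _)).hasMFDerivAt hs
  exact ⟨h.mdifferentiableAt, fun v => congrArg (fun L : E →L[ℝ] E'' => L v) h.mfderiv⟩

theorem mfderiv_congr_apply {f f' : N → N'} {x : N} (h : f =ᶠ[𝓝 x] f') (v : E) :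
    (mfderiv I I' f x : E →L[ℝ] E') v = (mfderiv I I' f' x : E →L[ℝ] E') v := by
  have h2 : ∀ (L : E →L[ℝ] E'), HasMFDerivAt I I' f x L ↔ HasMFDerivAt I I' f' x L :=
    fun L => ⟨fun hL => hL.congr_of_eventuallyEq h.symm, fun hL => hL.congr_of_eventuallyEq h⟩
  by_cases hf : MDifferentiableAt I I' f' x
  · exact congrArg (fun L : E →L[ℝ] E' => L v) ((h2 _).2 hf.hasMFDerivAt).mfderiv
  · have hf' : ¬ MDifferentiableAt I I' f x := fun h3 => hf ((h2 _).1 h3.hasMFDerivAt).mdifferentiableAt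
    rw [mfderiv_zero_of_not_mdifferentiableAt hf, mfderiv_zero_of_not_mdifferentiableAt hf']
    rfl

end ChainRule

section UnitRetraction
variable {EM : Type*} [NormedAddCommGroup EM] [NormedSpace ℝ EM]
  {M : Type*} [TopologicalSpace M] [ChartedSpace EM M]
  {EG : Type*} [NormedAddCommGroup EG] [NormedSpace ℝ EG]
  {G : Type*} [TopologicalSpace G] [ChartedSpace EG G]

/-- Near `u x` the map `r` moves arrows to prescribed nearby `s`-fibres. -/
structure LieGroupoid.UnitRetraction (𝒢 : LieGroupoid EM M EG G) (x : M) (r : M × G → G) : Prop where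
  mdifferentiableAt : MDifferentiableAt (𝓘(ℝ, EM).prod 𝓘(ℝ, EG)) 𝓘(ℝ, EG) r (x, 𝒢.u x)
  s_eq : ∀ᶠ p in 𝓝 (x, 𝒢.u x), 𝒢.s (r p) = p.1
  eq_self : ∀ᶠ h in 𝓝 (𝒢.u x), r (𝒢.s h, h) = h

variable (𝒢 : LieGroupoid EM M EG G)

theorem LieGroupoid.exists_unitRetraction [FiniteDimensional ℝ EM] [FiniteDimensional ℝ EG]
    [IsManifold 𝓘(ℝ, EM) ∞ M] [IsManifold 𝓘(ℝ, EG) ∞ G] (x : M) :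
    ∃ r, ContMDiffAt (𝓘(ℝ, EM).prod 𝓘(ℝ, EG)) 𝓘(ℝ, EG) ∞ r (x, 𝒢.u x) ∧
      ∀ᶠ y in 𝓝 x, 𝒢.UnitRetraction y r := by
  obtain ⟨r, h1, h2, h3⟩ := exists_fiber_retraction 𝒢.smooth_s (𝒢.u x) (𝒢.submersion_s _)
  rw [𝒢.s_u] at h1 h2
  have hu : ContinuousAt 𝒢.u x := 𝒢.smooth_u.continuous.continuousAt
  have hpair : ContinuousAt (fun y => (y, 𝒢.u y)) x := continuousAt_id.prodMk hu
  have : IsManifold 𝓘(ℝ, EM) 1 M := .of_le (n := ∞) (by exact_mod_cast le_top)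
  have : IsManifold 𝓘(ℝ, EG) 1 G := .of_le (n := ∞) (by exact_mod_cast le_top)
  have h4 : ContMDiffAt (𝓘(ℝ, EM).prod 𝓘(ℝ, EG)) 𝓘(ℝ, EG) 1 r (x, 𝒢.u x) :=
    h1.of_le (by exact_mod_cast le_top)
  refine ⟨r, h1, ?_⟩
  filter_upwards [hpair.eventually ((contMDiffAt_iff_contMDiffAt_nhds (by simp)).1 h4), hpair.eventually h2.eventually_nhds,
    hu.eventually h3.eventually_nhds] with y hy1 hy2 hy3
  exact ⟨hy1.mdifferentiableAt (by simp), hy2, hy3⟩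

variable {𝒢}

theorem LieGroupoid.inv_u (x : M) : 𝒢.inv (𝒢.u x) = 𝒢.u x := by
  have h1 := 𝒢.mul_u (𝒢.inv (𝒢.u x))
  rw [𝒢.s_inv, 𝒢.t_u] at h1
  have h2 := 𝒢.inv_mul (𝒢.u x)
  rw [h1, 𝒢.s_u] at h2
  exact h2

theorem LieGroupoid.inv_inv (g : G) : 𝒢.inv (𝒢.inv g) = g := by
  have h1 : 𝒢.mul (𝒢.inv (𝒢.inv g)) (𝒢.mul (𝒢.inv g) g) = 𝒢.inv (𝒢.inv g) := by
    rw [𝒢.inv_mul]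
    have := 𝒢.mul_u (𝒢.inv (𝒢.inv g))
    rwa [𝒢.s_inv, 𝒢.t_inv] at this
  rw [← 𝒢.mul_assoc _ _ _ (by rw [𝒢.s_inv]) (𝒢.s_inv g), 𝒢.inv_mul, 𝒢.s_inv, 𝒢.u_mul] at h1
  exact h1.symm

theorem LieGroupoid.eq_inv_of_mul_eq_u {g h : G} (hgh : 𝒢.s g = 𝒢.t h)
    (h1 : 𝒢.mul g h = 𝒢.u (𝒢.t g)) : h = 𝒢.inv g := by
  have h2 := congrArg (𝒢.mul (𝒢.inv g)) h1
  rw [← 𝒢.mul_assoc _ _ _ (𝒢.s_inv g) hgh, 𝒢.inv_mul, hgh, 𝒢.u_mul] at h2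
  rw [h2]
  have := 𝒢.mul_u (𝒢.inv g)
  rwa [𝒢.s_inv] at this

theorem LieGroupoid.inv_mul_inv {g h : G} (hgh : 𝒢.s g = 𝒢.s h) :
    𝒢.inv (𝒢.mul h (𝒢.inv g)) = 𝒢.mul g (𝒢.inv h) := by
  have hc : 𝒢.s h = 𝒢.t (𝒢.inv g) := by rw [𝒢.t_inv, hgh]
  have hc' : 𝒢.s g = 𝒢.t (𝒢.inv h) := by rw [𝒢.t_inv, hgh]
  refine (𝒢.eq_inv_of_mul_eq_u ?_ ?_).symm
  · rw [𝒢.s_mul _ _ hc, 𝒢.t_mul _ _ hc', 𝒢.s_inv]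
  · rw [𝒢.mul_assoc _ _ _ hc (by rw [𝒢.t_mul _ _ hc', 𝒢.s_inv]),
      ← 𝒢.mul_assoc _ _ _ (𝒢.s_inv g) hc', 𝒢.inv_mul, hc', 𝒢.u_mul, 𝒢.mul_inv, 𝒢.t_mul _ _ hc]

namespace LieGroupoid.UnitRetraction
variable {x : M} {r : M × G → G} (hr : 𝒢.UnitRetraction x r)
include hr

theorem apply_unit : r (x, 𝒢.u x) = 𝒢.u x := by
  have h := hr.eq_self.self_of_nhds; rwa [𝒢.s_u] at h

theorem fiber_mdifferentiableAt : MDifferentiableAt 𝓘(ℝ, EG) 𝓘(ℝ, EG) (fun h => r (x, h)) (𝒢.u x) :=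
  MDifferentiableAt.comp (𝒢.u x) (f := fun h => (x, h)) (g := r) hr.mdifferentiableAt
    ((mdifferentiableAt_const (c := x)).prodMk mdifferentiableAt_id)

theorem s_fiber : ∀ᶠ h in 𝓝 (𝒢.u x), 𝒢.s (r (x, h)) = x :=
  (Continuous.prodMk_right x).continuousAt.eventually (f := fun h => (x, h)) hr.s_eq

theorem fiber_deriv {v : EG}
    (hv : (mfderiv 𝓘(ℝ, EG) 𝓘(ℝ, EM) 𝒢.s (𝒢.u x) : EG →L[ℝ] EM) v = 0) :
    (mfderiv 𝓘(ℝ, EG) 𝓘(ℝ, EG) (fun h => r (x, h)) (𝒢.u x) : EG →L[ℝ] EG) v = v := by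
  have hs : MDifferentiableAt 𝓘(ℝ, EG) 𝓘(ℝ, EM) 𝒢.s (𝒢.u x) :=
    𝒢.smooth_s.mdifferentiableAt (by simp)
  have hr1 := hr.mdifferentiableAt
  have hpair : HasMFDerivAt 𝓘(ℝ, EG) (𝓘(ℝ, EM).prod 𝓘(ℝ, EG)) (fun h => (𝒢.s h, h)) (𝒢.u x) _ :=
    hs.hasMFDerivAt.prodMk (hasMFDerivAt_id (𝒢.u x))
  have hpair2 : HasMFDerivAt 𝓘(ℝ, EG) (𝓘(ℝ, EM).prod 𝓘(ℝ, EG)) (fun h => (x, h)) (𝒢.u x) _ :=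
    (hasMFDerivAt_const x (𝒢.u x)).prodMk (hasMFDerivAt_id (𝒢.u x))
  have h1 := mfderiv_comp_apply_eq (f := fun h => (𝒢.s h, h)) hr1 hpair.mdifferentiableAt
    (by rw [𝒢.s_u]) v
  have h2 := mfderiv_comp_apply_eq (f := fun h => (x, h)) hr1 hpair2.mdifferentiableAt rfl v
  have h3 : (mfderiv 𝓘(ℝ, EG) 𝓘(ℝ, EG) (fun h => r (𝒢.s h, h)) (𝒢.u x) : EG →L[ℝ] EG) v = v :=
    (mfderiv_congr_apply (f' := id) hr.eq_self v).trans
      (congrArg (fun L : EG →L[ℝ] EG => L v) mfderiv_id)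
  have e1 : (mfderiv 𝓘(ℝ, EG) (𝓘(ℝ, EM).prod 𝓘(ℝ, EG)) (fun h => (𝒢.s h, h)) (𝒢.u x) :
      EG →L[ℝ] EM × EG) v = (0, v) := by
    refine (congrArg (fun L : EG →L[ℝ] EM × EG => L v) hpair.mfderiv).trans ?_
    exact Prod.ext hv rfl
  have e2 : (mfderiv 𝓘(ℝ, EG) (𝓘(ℝ, EM).prod 𝓘(ℝ, EG)) (fun h => (x, h)) (𝒢.u x) :
      EG →L[ℝ] EM × EG) v = (0, v) :=
    congrArg (fun L : EG →L[ℝ] EM × EG => L v) hpair2.mfderiv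
  rw [e1, h3] at h1
  rw [e2] at h2
  exact h2.trans h1.symm

variable [IsManifold 𝓘(ℝ, EM) ∞ M] [IsManifold 𝓘(ℝ, EG) ∞ G]

/-- Right translations are differentiated along the local retraction. -/
theorem dR_apply {g : G} (hg : 𝒢.t g = x) :
    MDifferentiableAt 𝓘(ℝ, EG) 𝓘(ℝ, EG) (fun h => 𝒢.mul (r (x, h)) g) (𝒢.u x) ∧
    ∀ {v : EG}, (mfderiv 𝓘(ℝ, EG) 𝓘(ℝ, EM) 𝒢.s (𝒢.u x) : EG →L[ℝ] EM) v = 0 →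
      (mfderiv 𝓘(ℝ, EG) 𝓘(ℝ, EG) (fun h => 𝒢.mul (r (x, h)) g) (𝒢.u x) : EG →L[ℝ] EG) v =
        (𝒢.dR g : EG →ₗ[ℝ] EG) v := by
  subst hg
  have h1 : MDifferentiableWithinAt 𝓘(ℝ, EG) 𝓘(ℝ, EG) (fun h => 𝒢.mul h g) {h | 𝒢.s h = 𝒢.t g}
      (𝒢.u (𝒢.t g)) := by
    have h2 := (𝒢.smooth_mul (𝒢.u (𝒢.t g), g) (𝒢.s_u _)).mdifferentiableWithinAt (by simp)
    exact h2.comp (f := fun h => (h, g)) (s := {h | 𝒢.s h = 𝒢.t g}) (𝒢.u (𝒢.t g))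
      ((mdifferentiableAt_id.prodMk (mdifferentiableAt_const (c := g))).mdifferentiableWithinAt)
      (fun h hh => hh)
  obtain ⟨h3, h4⟩ := hasMFDerivAt_comp_mfderivWithin h1 hr.fiber_mdifferentiableAt hr.apply_unit
    hr.s_fiber
  refine ⟨h3, fun {v} hv => (h4 v).trans ?_⟩
  rw [hr.fiber_deriv hv]
  rfl

/-- Left translations, composed with the inversion, are differentiated along the local retraction. -/
theorem dL_apply {g : G} (hg : 𝒢.s g = x) :
    MDifferentiableAt 𝓘(ℝ, EG) 𝓘(ℝ, EG) (fun h => 𝒢.mul g (𝒢.inv (r (x, h)))) (𝒢.u x) ∧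
    ∀ {v : EG}, (mfderiv 𝓘(ℝ, EG) 𝓘(ℝ, EM) 𝒢.s (𝒢.u x) : EG →L[ℝ] EM) v = 0 →
      (mfderiv 𝓘(ℝ, EG) 𝓘(ℝ, EG) (fun h => 𝒢.mul g (𝒢.inv (r (x, h)))) (𝒢.u x) : EG →L[ℝ] EG) v =
        (𝒢.dL g : EG →ₗ[ℝ] EG) ((𝒢.dinv x : EG →ₗ[ℝ] EG) v) := by
  subst hg
  have h1 : MDifferentiableWithinAt 𝓘(ℝ, EG) 𝓘(ℝ, EG) (fun h => 𝒢.mul g h) {h | 𝒢.s g = 𝒢.t h}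
      (𝒢.u (𝒢.s g)) := by
    have h2 := (𝒢.smooth_mul (g, 𝒢.u (𝒢.s g)) (𝒢.t_u _).symm).mdifferentiableWithinAt (by simp)
    exact h2.comp (f := fun h => (g, h)) (s := {h | 𝒢.s g = 𝒢.t h}) (𝒢.u (𝒢.s g))
      (((mdifferentiableAt_const (c := g)).prodMk mdifferentiableAt_id).mdifferentiableWithinAt)
      (fun h hh => hh)
  have hi : MDifferentiableAt 𝓘(ℝ, EG) 𝓘(ℝ, EG) 𝒢.inv (𝒢.u (𝒢.s g)) :=
    𝒢.smooth_inv.mdifferentiableAt (by simp)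
  obtain ⟨h3, h4⟩ := hasMFDerivAt_comp_mfderivWithin h1
    (mdifferentiableAt_comp_eq hi hr.fiber_mdifferentiableAt hr.apply_unit)
    (by rw [hr.apply_unit, LieGroupoid.inv_u])
    (hr.s_fiber.mono fun h hh => by change _ = _; rw [𝒢.t_inv, hh])
  refine ⟨h3, fun {v} hv => (h4 v).trans ?_⟩
  rw [mfderiv_comp_apply_eq hi hr.fiber_mdifferentiableAt hr.apply_unit, hr.fiber_deriv hv]
  rfl

end LieGroupoid.UnitRetraction
end UnitRetraction

end

noncomputable section

open scoped Topology

theorem contMDiffAt_comp_contMDiffWithinAt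
    {E : Type*} [NormedAddCommGroup E] [NormedSpace ℝ E]
    {E' : Type*} [NormedAddCommGroup E'] [NormedSpace ℝ E']
    {E'' : Type*} [NormedAddCommGroup E''] [NormedSpace ℝ E'']
    {H : Type*} [TopologicalSpace H] {I : ModelWithCorners ℝ E H}
    {H' : Type*} [TopologicalSpace H'] {I' : ModelWithCorners ℝ E' H'}
    {H'' : Type*} [TopologicalSpace H''] {I'' : ModelWithCorners ℝ E'' H''}
    {N : Type*} [TopologicalSpace N] [ChartedSpace H N]
    {N' : Type*} [TopologicalSpace N'] [ChartedSpace H' N']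
    {N'' : Type*} [TopologicalSpace N''] [ChartedSpace H'' N'']
    {n : WithTop ℕ∞} {g : N' → N''} {s : Set N'} {f : N → N'} {x : N}
    (hg : ContMDiffOn I' I'' n g s) (hf : ContMDiffAt I I' n f x) (hs : ∀ᶠ z in 𝓝 x, f z ∈ s) :
    ContMDiffAt I I'' n (fun z => g (f z)) x :=
  ((hg _ hs.self_of_nhds).comp x (s := f ⁻¹' s) hf.contMDiffWithinAt
    (Set.Subset.refl _)).contMDiffAt hs

section Translations
variable {EM : Type*} [NormedAddCommGroup EM] [NormedSpace ℝ EM]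
  {M : Type*} [TopologicalSpace M] [ChartedSpace EM M]
  {EG : Type*} [NormedAddCommGroup EG] [NormedSpace ℝ EG]
  {G : Type*} [TopologicalSpace G] [ChartedSpace EG G]
  {𝒢 : LieGroupoid EM M EG G}

local notation "IG" => modelWithCornersSelf ℝ EG
local notation "IM" => modelWithCornersSelf ℝ EM

namespace LieGroupoid

theorem mdifferentiableAt_s (g : G) : MDifferentiableAt IG IM 𝒢.s g :=
  𝒢.smooth_s.mdifferentiableAt (by simp)

theorem mdifferentiableAt_t (g : G) : MDifferentiableAt IG IM 𝒢.t g :=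
  𝒢.smooth_t.mdifferentiableAt (by simp)

theorem mdifferentiableAt_u (x : M) : MDifferentiableAt IM IG 𝒢.u x :=
  𝒢.smooth_u.mdifferentiableAt (by simp)

theorem mdifferentiableAt_inv (g : G) : MDifferentiableAt IG IG 𝒢.inv g :=
  𝒢.smooth_inv.mdifferentiableAt (by simp)

theorem mfderiv_s_mfderiv_u (x : M) (X : EM) :
    (mfderiv IG IM 𝒢.s (𝒢.u x) : EG →L[ℝ] EM) ((mfderiv IM IG 𝒢.u x : EM →L[ℝ] EG) X) = X := by
  rw [← mfderiv_comp_apply_eq (mdifferentiableAt_s _) (mdifferentiableAt_u x) rfl,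
    mfderiv_congr_apply (f' := id) (Filter.Eventually.of_forall 𝒢.s_u)]
  exact congrArg (fun L : EM →L[ℝ] EM => L X) mfderiv_id

theorem mfderiv_t_mfderiv_u (x : M) (X : EM) :
    (mfderiv IG IM 𝒢.t (𝒢.u x) : EG →L[ℝ] EM) ((mfderiv IM IG 𝒢.u x : EM →L[ℝ] EG) X) = X := by
  rw [← mfderiv_comp_apply_eq (mdifferentiableAt_t _) (mdifferentiableAt_u x) rfl,
    mfderiv_congr_apply (f' := id) (Filter.Eventually.of_forall 𝒢.t_u)]
  exact congrArg (fun L : EM →L[ℝ] EM => L X) mfderiv_id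

end LieGroupoid

variable [FiniteDimensional ℝ EM] [FiniteDimensional ℝ EG]
  [IsManifold 𝓘(ℝ, EM) ∞ M] [IsManifold 𝓘(ℝ, EG) ∞ G]

namespace LieGroupoid

variable (𝒢) in
theorem exists_unitRetraction_at (x : M) : ∃ r,
    ContMDiffAt (𝓘(ℝ, EM).prod 𝓘(ℝ, EG)) 𝓘(ℝ, EG) ∞ r (x, 𝒢.u x) ∧ 𝒢.UnitRetraction x r := by
  obtain ⟨r, h1, h2⟩ := 𝒢.exists_unitRetraction x
  exact ⟨r, h1, h2.self_of_nhds⟩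

theorem mfderiv_s_dR {g : G} {x : M} (hx : 𝒢.t g = x) {v : EG}
    (hv : (mfderiv IG IM 𝒢.s (𝒢.u x) : EG →L[ℝ] EM) v = 0) :
    (mfderiv IG IM 𝒢.s g : EG →L[ℝ] EM) ((𝒢.dR g : EG →ₗ[ℝ] EG) v) = 0 := by
  obtain ⟨r, -, hr⟩ := 𝒢.exists_unitRetraction_at x
  obtain ⟨h1, h2⟩ := hr.dR_apply hx
  have h3 : 𝒢.mul (r (x, 𝒢.u x)) g = g := by rw [hr.apply_unit, ← hx, 𝒢.u_mul]
  rw [← h2 hv, ← mfderiv_comp_apply_eq (mdifferentiableAt_s g) h1 h3]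
  refine (mfderiv_congr_apply (I := IG) (I' := IM) (x := 𝒢.u x) (f' := fun _ => 𝒢.s g) ?_ v).trans
    (congrArg (fun L : EG →L[ℝ] EM => L v)
      (mfderiv_const (I := IG) (I' := IM) (c := 𝒢.s g) (x := 𝒢.u x)))
  filter_upwards [hr.s_fiber] with h hh
  rw [𝒢.s_mul _ _ (hh.trans hx.symm)]

theorem mfderiv_t_dR {g : G} {x : M} (hx : 𝒢.t g = x) {v : EG}
    (hv : (mfderiv IG IM 𝒢.s (𝒢.u x) : EG →L[ℝ] EM) v = 0) :
    (mfderiv IG IM 𝒢.t g : EG →L[ℝ] EM) ((𝒢.dR g : EG →ₗ[ℝ] EG) v) =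
      (mfderiv IG IM 𝒢.t (𝒢.u x) : EG →L[ℝ] EM) v := by
  obtain ⟨r, -, hr⟩ := 𝒢.exists_unitRetraction_at x
  obtain ⟨h1, h2⟩ := hr.dR_apply hx
  have h3 : 𝒢.mul (r (x, 𝒢.u x)) g = g := by rw [hr.apply_unit, ← hx, 𝒢.u_mul]
  rw [← h2 hv, ← mfderiv_comp_apply_eq (mdifferentiableAt_t g) h1 h3]
  refine (mfderiv_congr_apply (f' := fun h => 𝒢.t (r (x, h))) ?_ v).trans ?_
  · filter_upwards [hr.s_fiber] with h hh
    rw [𝒢.t_mul _ _ (hh.trans hx.symm)]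
  · rw [mfderiv_comp_apply_eq (mdifferentiableAt_t _) hr.fiber_mdifferentiableAt hr.apply_unit,
      hr.fiber_deriv hv]

theorem dR_unit {x : M} {v : EG} (hv : (mfderiv IG IM 𝒢.s (𝒢.u x) : EG →L[ℝ] EM) v = 0) :
    (𝒢.dR (𝒢.u x) : EG →ₗ[ℝ] EG) v = v := by
  obtain ⟨r, -, hr⟩ := 𝒢.exists_unitRetraction_at x
  obtain ⟨h1, h2⟩ := hr.dR_apply (𝒢.t_u x)
  rw [← h2 hv]
  refine (mfderiv_congr_apply (f' := fun h => r (x, h)) ?_ v).trans (hr.fiber_deriv hv)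
  filter_upwards [hr.s_fiber] with h hh
  conv_lhs => rw [← hh]
  rw [hh]
  have := 𝒢.mul_u (r (x, h))
  rwa [hh] at this

theorem dL_unit {x : M} {v : EG} (hv : (mfderiv IG IM 𝒢.s (𝒢.u x) : EG →L[ℝ] EM) v = 0) :
    (𝒢.dL (𝒢.u x) : EG →ₗ[ℝ] EG) ((𝒢.dinv x : EG →ₗ[ℝ] EG) v) = (𝒢.dinv x : EG →ₗ[ℝ] EG) v := by
  obtain ⟨r, -, hr⟩ := 𝒢.exists_unitRetraction_at x
  obtain ⟨h1, h2⟩ := hr.dL_apply (𝒢.s_u x)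
  rw [← h2 hv]
  refine (mfderiv_congr_apply (f' := fun h => 𝒢.inv (r (x, h))) ?_ v).trans ?_
  · filter_upwards [hr.s_fiber] with h hh
    have := 𝒢.u_mul (𝒢.inv (r (x, h)))
    rwa [𝒢.t_inv, hh] at this
  · rw [mfderiv_comp_apply_eq (mdifferentiableAt_inv _) hr.fiber_mdifferentiableAt hr.apply_unit,
      hr.fiber_deriv hv]
    rfl

theorem dL_eq {g : G} {x : M} (hx : 𝒢.s g = x) {v : EG}
    (hv : (mfderiv IG IM 𝒢.s (𝒢.u x) : EG →L[ℝ] EM) v = 0) :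
    (𝒢.dL g : EG →ₗ[ℝ] EG) ((𝒢.dinv x : EG →ₗ[ℝ] EG) v) =
      (mfderiv IG IG 𝒢.inv (𝒢.inv g) : EG →L[ℝ] EG) ((𝒢.dR (𝒢.inv g) : EG →ₗ[ℝ] EG) v) := by
  obtain ⟨r, -, hr⟩ := 𝒢.exists_unitRetraction_at x
  have ht : 𝒢.t (𝒢.inv g) = x := (𝒢.t_inv g).trans hx
  obtain ⟨h1, h2⟩ := hr.dL_apply hx
  obtain ⟨h3, h4⟩ := hr.dR_apply ht
  rw [← h2 hv, ← h4 hv, ← mfderiv_comp_apply_eq (mdifferentiableAt_inv _) h3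
    (by rw [hr.apply_unit, ← ht, 𝒢.u_mul])]
  refine mfderiv_congr_apply ?_ v
  filter_upwards [hr.s_fiber] with h hh
  exact (LieGroupoid.inv_mul_inv (hx.trans hh.symm)).symm

/-- The division map on the `s`-fibre of `x`, extended by the retraction. -/
theorem UnitRetraction.contMDiffAt_division {x : M} {r : M × G → G} (hr : 𝒢.UnitRetraction x r)
    (hsm : ContMDiffAt ((IM).prod IG) IG ∞ r (x, 𝒢.u x)) :
    ContMDiffAt ((IG).prod IG) IG ∞ (fun p : G × G => 𝒢.mul (r (x, p.1)) (𝒢.inv (r (x, p.2))))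
      (𝒢.u x, 𝒢.u x) := by
  have hf : ContMDiffAt IG IG ∞ (fun h => r (x, h)) (𝒢.u x) :=
    ContMDiffAt.comp (𝒢.u x) (f := fun h => (x, h)) (g := r) hsm
      (contMDiffAt_const.prodMk contMDiffAt_id)
  have h1 : ContMDiffAt ((IG).prod IG) IG ∞ (fun p : G × G => r (x, p.1)) (𝒢.u x, 𝒢.u x) :=
    ContMDiffAt.comp (f := Prod.fst) (𝒢.u x, 𝒢.u x) hf contMDiffAt_fst
  have h2 : ContMDiffAt ((IG).prod IG) IG ∞ (fun p : G × G => 𝒢.inv (r (x, p.2))) (𝒢.u x, 𝒢.u x) :=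
    ContMDiffAt.comp (f := fun p : G × G => r (x, p.2)) (𝒢.u x, 𝒢.u x)
      𝒢.smooth_inv.contMDiffAt (ContMDiffAt.comp (f := Prod.snd) (𝒢.u x, 𝒢.u x) hf contMDiffAt_snd)
  refine contMDiffAt_comp_contMDiffWithinAt 𝒢.smooth_mul (h1.prodMk h2) ?_
  filter_upwards [(continuousAt_fst (p := (𝒢.u x, 𝒢.u x))).eventually hr.s_fiber,
    (continuousAt_snd (p := (𝒢.u x, 𝒢.u x))).eventually hr.s_fiber] with p hp1 hp2
  change 𝒢.s (r (x, p.1)) = 𝒢.t (𝒢.inv (r (x, p.2)))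
  rw [𝒢.t_inv, hp1, hp2]

theorem UnitRetraction.division_left {x : M} {r : M × G → G} (hr : 𝒢.UnitRetraction x r) :
    ∀ᶠ h in 𝓝 (𝒢.u x), 𝒢.mul (r (x, h)) (𝒢.inv (r (x, 𝒢.u x))) = r (x, h) := by
  filter_upwards [hr.s_fiber] with h hh
  rw [hr.apply_unit, LieGroupoid.inv_u]
  have := 𝒢.mul_u (r (x, h))
  rwa [hh] at this

theorem UnitRetraction.division_right {x : M} {r : M × G → G} (hr : 𝒢.UnitRetraction x r) :
    ∀ᶠ h in 𝓝 (𝒢.u x), 𝒢.mul (r (x, 𝒢.u x)) (𝒢.inv (r (x, h))) = 𝒢.inv (r (x, h)) := by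
  filter_upwards [hr.s_fiber] with h hh
  rw [hr.apply_unit]
  have := 𝒢.u_mul (𝒢.inv (r (x, h)))
  rwa [𝒢.t_inv, hh] at this

/-- `v + di(v) = du(dt(v))` for `v ∈ ker ds` at a unit. -/
theorem add_dinv {x : M} {v : EG} (hv : (mfderiv IG IM 𝒢.s (𝒢.u x) : EG →L[ℝ] EM) v = 0) :
    HAdd.hAdd (α := EG) (β := EG) (γ := EG) v ((𝒢.dinv x : EG →ₗ[ℝ] EG) v) = (mfderiv IM IG 𝒢.u x : EM →L[ℝ] EG)
      ((mfderiv IG IM 𝒢.t (𝒢.u x) : EG →L[ℝ] EM) v) := by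
  obtain ⟨r, hsm, hr⟩ := 𝒢.exists_unitRetraction_at x
  have hΓ := (hr.contMDiffAt_division hsm).mdifferentiableAt (by simp)
  have p1 : HasMFDerivAt IG ((IG).prod IG) (fun h : G => (h, 𝒢.u x)) (𝒢.u x) _ :=
    (hasMFDerivAt_id (𝒢.u x)).prodMk (hasMFDerivAt_const (𝒢.u x) (𝒢.u x))
  have p2 : HasMFDerivAt IG ((IG).prod IG) (fun h : G => (𝒢.u x, h)) (𝒢.u x) _ :=
    (hasMFDerivAt_const (𝒢.u x) (𝒢.u x)).prodMk (hasMFDerivAt_id (𝒢.u x))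
  have p3 : HasMFDerivAt IG ((IG).prod IG) (fun h : G => (h, h)) (𝒢.u x) _ :=
    (hasMFDerivAt_id (𝒢.u x)).prodMk (hasMFDerivAt_id (𝒢.u x))
  have h1 := mfderiv_comp_apply_eq (f := fun h : G => (h, 𝒢.u x)) hΓ p1.mdifferentiableAt rfl v
  have h2 := mfderiv_comp_apply_eq (f := fun h : G => (𝒢.u x, h)) hΓ p2.mdifferentiableAt rfl v
  have h3 := mfderiv_comp_apply_eq (f := fun h : G => (h, h)) hΓ p3.mdifferentiableAt rfl v
  have e1 : (mfderiv IG ((IG).prod IG) (fun h : G => (h, 𝒢.u x)) (𝒢.u x) : EG →L[ℝ] EG × EG) v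
    = (v, 0) := congrArg (fun L : EG →L[ℝ] EG × EG => L v) p1.mfderiv
  have e2 : (mfderiv IG ((IG).prod IG) (fun h : G => (𝒢.u x, h)) (𝒢.u x) : EG →L[ℝ] EG × EG) v
    = (0, v) := congrArg (fun L : EG →L[ℝ] EG × EG => L v) p2.mfderiv
  have e3 : (mfderiv IG ((IG).prod IG) (fun h : G => (h, h)) (𝒢.u x) : EG →L[ℝ] EG × EG) v
    = (v, 0) + (0, v) := by
    refine (congrArg (fun L : EG →L[ℝ] EG × EG => L v) p3.mfderiv).trans ?_
    exact Prod.ext (add_zero v).symm (zero_add v).symm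
  have f1 := (mfderiv_congr_apply (I := IG) (I' := IG) hr.division_left v).trans (hr.fiber_deriv hv)
  have f2 := (mfderiv_congr_apply (I := IG) (I' := IG) hr.division_right v).trans
    (mfderiv_comp_apply_eq (mdifferentiableAt_inv _) hr.fiber_mdifferentiableAt hr.apply_unit v)
  rw [hr.fiber_deriv hv] at f2
  have f3 : (mfderiv IG IG (fun h => 𝒢.mul (r (x, h)) (𝒢.inv (r (x, h)))) (𝒢.u x) : EG →L[ℝ] EG) v =
      (mfderiv IM IG 𝒢.u x : EM →L[ℝ] EG) ((mfderiv IG IM 𝒢.t (𝒢.u x) : EG →L[ℝ] EM) v) := by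
    refine (mfderiv_congr_apply (I := IG) (I' := IG) (x := 𝒢.u x) (f' := fun h => 𝒢.u (𝒢.t (r (x, h))))
      (Filter.Eventually.of_forall fun h => 𝒢.mul_inv _) v).trans ?_
    have h5 := mdifferentiableAt_comp_eq (mdifferentiableAt_t (𝒢 := 𝒢) (𝒢.u x)) hr.fiber_mdifferentiableAt
      hr.apply_unit
    rw [mfderiv_comp_apply_eq (mdifferentiableAt_u x) h5 (by rw [hr.apply_unit, 𝒢.t_u]),
      mfderiv_comp_apply_eq (mdifferentiableAt_t (𝒢.u x)) hr.fiber_mdifferentiableAt hr.apply_unit,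
      hr.fiber_deriv hv]
  rw [e1] at h1
  rw [e2] at h2
  rw [e3] at h3
  have h4 := ContinuousLinearMap.map_add (mfderiv ((IG).prod IG) IG (fun p : G × G =>
    𝒢.mul (r (x, p.1)) (𝒢.inv (r (x, p.2)))) (𝒢.u x, 𝒢.u x) : EG × EG →L[ℝ] EG) (v, 0) (0, v)
  refine Eq.trans ?_ ((h3.trans h4).symm.trans f3)
  refine congrArg₂ (· + ·) (f1.symm.trans h1) (Eq.trans ?_ h2)
  exact f2.symm

end LieGroupoid
end Translations

end

noncomputable section

open scoped Topology
open VectorField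

section InvariantFields
variable {EM : Type*} [NormedAddCommGroup EM] [NormedSpace ℝ EM] [FiniteDimensional ℝ EM]
  {M : Type*} [TopologicalSpace M] [ChartedSpace EM M] [IsManifold 𝓘(ℝ, EM) ∞ M]
  {EG : Type*} [NormedAddCommGroup EG] [NormedSpace ℝ EG] [FiniteDimensional ℝ EG]
  {G : Type*} [TopologicalSpace G] [ChartedSpace EG G] [IsManifold 𝓘(ℝ, EG) ∞ G]
  {F : Type*} [NormedAddCommGroup F] [NormedSpace ℝ F]
  {A : M → Type*} [TopologicalSpace (TotalSpace F A)] [∀ x, TopologicalSpace (A x)]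
  [FiberBundle F A] [∀ x, AddCommGroup (A x)] [∀ x, Module ℝ (A x)] [VectorBundle ℝ F A]
  {𝒢 : LieGroupoid EM M EG G} {𝒜 : LieAlgebroid EM M F A} (Φ : 𝒢.Algebroid 𝒜)

local notation "Γ∞" => Cₛ^∞⟮𝓘(ℝ, EM); F, A⟯
local notation "IG" => modelWithCornersSelf ℝ EG
local notation "IM" => modelWithCornersSelf ℝ EM

namespace LieGroupoid.Algebroid

theorem ds_ι (x : M) (v : A x) :
    (mfderiv IG IM 𝒢.s (𝒢.u x) : EG →L[ℝ] EM) (Φ.ι x v) = 0 :=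
  (Set.ext_iff.1 (Φ.range x) (Φ.ι x v)).1 ⟨v, rfl⟩

/-- The right invariant vector field of a section. -/
def rightField (b : Γ∞) (g : G) : TangentSpace IG g := 𝒢.dR g (Φ.ι (𝒢.t g) (b (𝒢.t g)))

/-- The left invariant vector field of a section. -/
def leftField (b : Γ∞) (g : G) : TangentSpace IG g :=
  𝒢.dL g (𝒢.dinv (𝒢.s g) (Φ.ι (𝒢.s g) (b (𝒢.s g))))

theorem ds_rightField (b : Γ∞) (g : G) :
    (mfderiv IG IM 𝒢.s g : EG →L[ℝ] EM) (Φ.rightField b g) = 0 :=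
  LieGroupoid.mfderiv_s_dR rfl (Φ.ds_ι _ _)

theorem dt_rightField (b : Γ∞) (g : G) :
    (mfderiv IG IM 𝒢.t g : EG →L[ℝ] EM) (Φ.rightField b g) = 𝒜.anchor (𝒢.t g) (b (𝒢.t g)) :=
  (LieGroupoid.mfderiv_t_dR rfl (Φ.ds_ι _ _)).trans (Φ.anchor _ _).symm

theorem rightField_eq_of_t_eq (b : Γ∞) {g : G} {x : M} (hx : 𝒢.t g = x) :
    (Φ.rightField b g : EG) = (𝒢.dR g : EG →ₗ[ℝ] EG) (Φ.ι x (b x)) := by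
  subst hx; rfl

theorem rightField_unit (b : Γ∞) (x : M) : (Φ.rightField b (𝒢.u x) : EG) = Φ.ι x (b x) := by
  rw [Φ.rightField_eq_of_t_eq b (𝒢.t_u x)]
  exact LieGroupoid.dR_unit (Φ.ds_ι x _)

theorem leftField_eq_of_s_eq (b : Γ∞) {g : G} {x : M} (hx : 𝒢.s g = x) :
    (Φ.leftField b g : EG) =
      (𝒢.dL g : EG →ₗ[ℝ] EG) ((𝒢.dinv x : EG →ₗ[ℝ] EG) (Φ.ι x (b x))) := by
  subst hx; rfl

theorem leftField_unit (b : Γ∞) (x : M) :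
    (Φ.leftField b (𝒢.u x) : EG) = 𝒢.dinv x (Φ.ι x (b x)) :=
  (Φ.leftField_eq_of_s_eq b (𝒢.s_u x)).trans (LieGroupoid.dL_unit (Φ.ds_ι x _))

theorem leftField_eq (b : Γ∞) (g : G) :
    (Φ.leftField b g : EG) =
      (mfderiv IG IG 𝒢.inv (𝒢.inv g) : EG →L[ℝ] EG) (Φ.rightField b (𝒢.inv g)) := by
  rw [Φ.rightField_eq_of_t_eq b (𝒢.t_inv g)]
  exact LieGroupoid.dL_eq rfl (Φ.ds_ι _ _)

theorem contMDiff_rightField (b : Γ∞) :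
    ContMDiff IG (IG).tangent ∞ (fun g => (⟨g, Φ.rightField b g⟩ : TangentBundle IG G)) := by
  intro g₀
  obtain ⟨r, hsm, hr⟩ := 𝒢.exists_unitRetraction (𝒢.t g₀)
  let m : G → G → G := fun g h => 𝒢.mul (r (𝒢.t g, h)) g
  have ht : ContMDiffAt IG IM ∞ 𝒢.t g₀ := 𝒢.smooth_t.contMDiffAt
  have hut : ContMDiffAt IG IG ∞ (fun g => 𝒢.u (𝒢.t g)) g₀ :=
    𝒢.smooth_u.contMDiffAt.comp g₀ ht
  have hm : ContMDiffAt ((IG).prod IG) IG ∞ (Function.uncurry m) (g₀, 𝒢.u (𝒢.t g₀)) := by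
    have h1 : ContMDiffAt ((IG).prod IG) ((IM).prod IG) ∞
        (fun p : G × G => (𝒢.t p.1, p.2)) (g₀, 𝒢.u (𝒢.t g₀)) :=
      (ContMDiffAt.comp (f := Prod.fst) (g₀, 𝒢.u (𝒢.t g₀)) ht contMDiffAt_fst).prodMk contMDiffAt_snd
    have h2 : ContMDiffAt ((IG).prod IG) IG ∞
        (fun p : G × G => r (𝒢.t p.1, p.2)) (g₀, 𝒢.u (𝒢.t g₀)) :=
      ContMDiffAt.comp (g := r) (f := fun p : G × G => (𝒢.t p.1, p.2)) (g₀, 𝒢.u (𝒢.t g₀)) hsm h1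
    refine contMDiffAt_comp_contMDiffWithinAt (f := fun p : G × G => (r (𝒢.t p.1, p.2), p.1))
      𝒢.smooth_mul (h2.prodMk contMDiffAt_fst) ?_
    exact h1.continuousAt.eventually (f := fun p : G × G => (𝒢.t p.1, p.2)) hr.self_of_nhds.s_eq
  have hr' : ∀ᶠ g in 𝓝 g₀, 𝒢.UnitRetraction (𝒢.t g) r := ht.continuousAt.eventually hr
  have hm0 : ∀ᶠ g in 𝓝 g₀, m g (𝒢.u (𝒢.t g)) = g := by
    filter_upwards [hr'] with g hg
    change 𝒢.mul (r (𝒢.t g, 𝒢.u (𝒢.t g))) g = g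
    rw [hg.apply_unit, 𝒢.u_mul]
  have hD := ContMDiffAt.mfderiv (m := ∞) m (fun g => 𝒢.u (𝒢.t g)) hm hut le_rfl
  have hV : ContMDiffAt IG IG ∞ (fun g => (mfderiv IG 𝓘(ℝ, EG) (extChartAt IG (𝒢.u (𝒢.t g₀)))
      (𝒢.u (𝒢.t g)) : EG →L[ℝ] EG) (Φ.ι (𝒢.t g) (b (𝒢.t g)))) g₀ := by
    have h1 : ContMDiffAt IG (IG).tangent ∞ (fun g => (⟨𝒢.u (𝒢.t g), Φ.ι (𝒢.t g) (b (𝒢.t g))⟩ :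
        TangentBundle IG G)) g₀ :=
      ((Φ.smooth.comp b.contMDiff).comp 𝒢.smooth_t).contMDiffAt
    refine (contMDiffAt_totalSpace.1 h1).2.congr_of_eventuallyEq ?_
    filter_upwards [hut.continuousAt.eventually_mem (extChartAt_source_mem_nhds (I := IG) _)]
      with g hg
    exact mfderiv_extChartAt_apply hg _
  have hDV := hD.clm_apply hV
  rw [contMDiffAt_totalSpace]
  refine ⟨contMDiffAt_id, hDV.congr_of_eventuallyEq ?_⟩
  have hc : ContinuousAt (fun g => m g (𝒢.u (𝒢.t g))) g₀ :=
    ContinuousAt.comp (f := fun g => (g, 𝒢.u (𝒢.t g))) (g := Function.uncurry m)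
      hm.continuousAt (continuousAt_id.prodMk hut.continuousAt)
  filter_upwards [hr', hm0, hut.continuousAt.eventually_mem (extChartAt_source_mem_nhds (I := IG) _),
    extChartAt_source_mem_nhds (I := IG) g₀] with g h1 h2 h3 h4
  have h5 : m g₀ (𝒢.u (𝒢.t g₀)) = g₀ := hm0.self_of_nhds
  have h3' : 𝒢.u (𝒢.t g) ∈ (chartAt EG (𝒢.u (𝒢.t g₀))).source := by
    rwa [extChartAt_source] at h3
  have h4' : m g (𝒢.u (𝒢.t g)) ∈ (chartAt EG (m g₀ (𝒢.u (𝒢.t g₀)))).source := by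
    rw [h2, h5]; rwa [extChartAt_source] at h4
  have h6 := inTangentCoordinates_eq_mfderiv_comp (I := IG) (I' := IG)
    (f := fun g => 𝒢.u (𝒢.t g)) (g := fun g => m g (𝒢.u (𝒢.t g)))
    (ϕ := fun g => mfderiv IG IG (m g) (𝒢.u (𝒢.t g))) (x₀ := g₀) (x := g) h3' h4'
  have h7 := congrArg (fun L : EG →L[ℝ] EG =>
    L (mfderiv IG 𝓘(ℝ, EG) (extChartAt IG (𝒢.u (𝒢.t g₀)))
      (𝒢.u (𝒢.t g)) (Φ.ι (𝒢.t g) (b (𝒢.t g))))) h6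
  have h8 : ∀ v : EG, (mfderivWithin 𝓘(ℝ, EG) IG (extChartAt IG (𝒢.u (𝒢.t g₀))).symm (Set.range IG)
      (extChartAt IG (𝒢.u (𝒢.t g₀)) (𝒢.u (𝒢.t g))) : EG →L[ℝ] EG)
      ((mfderiv IG 𝓘(ℝ, EG) (extChartAt IG (𝒢.u (𝒢.t g₀))) (𝒢.u (𝒢.t g)) : EG →L[ℝ] EG) v) = v :=
    fun v => congrArg (fun L : EG →L[ℝ] EG => L v)
      (mfderivWithin_extChartAt_symm_comp_mfderiv_extChartAt' h3)
  have h9 : ∀ g' g'' : G, g' = g₀ → g'' = g → ∀ v : EG,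
      (mfderiv IG 𝓘(ℝ, EG) (extChartAt IG g') g'' : EG →L[ℝ] EG) v =
        (mfderiv IG 𝓘(ℝ, EG) (extChartAt IG g₀) g : EG →L[ℝ] EG) v := by
    rintro g' g'' rfl rfl v; rfl
  refine (mfderiv_extChartAt_apply h4 _).symm.trans ?_
  refine Eq.trans ?_ h7.symm
  refine Eq.trans ?_ (h9 _ _ h5 h2 _).symm
  refine congrArg (mfderiv IG 𝓘(ℝ, EG) (extChartAt IG g₀) g : EG →L[ℝ] EG) ?_
  refine ((h1.dR_apply rfl).2 (Φ.ds_ι _ _)).symm.trans ?_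
  exact congrArg (mfderiv IG IG (m g) (𝒢.u (𝒢.t g)) : EG →L[ℝ] EG) (h8 _).symm

theorem contMDiff_leftField (b : Γ∞) :
    ContMDiff IG (IG).tangent ∞ (fun g => (⟨g, Φ.leftField b g⟩ : TangentBundle IG G)) := by
  have h1 : ContMDiff (IG).tangent (IG).tangent ∞ (tangentMap IG IG 𝒢.inv) :=
    𝒢.smooth_inv.contMDiff_tangentMap (by simp)
  have h2 := h1.comp ((Φ.contMDiff_rightField b).comp 𝒢.smooth_inv)
  refine h2.congr fun g => ?_
  have key : ∀ (g' : G), g' = g → ∀ w : EG, (⟨g', w⟩ : TangentBundle IG G) = ⟨g, w⟩ := by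
    rintro g' rfl w; rfl
  refine Eq.trans ?_ (key _ (LieGroupoid.inv_inv g) _).symm
  exact congrArg (fun w : EG => (⟨g, w⟩ : TangentBundle IG G)) (Φ.leftField_eq b g)

end LieGroupoid.Algebroid
end InvariantFields

end

noncomputable section

open scoped Topology
open VectorField

/-- Two vector fields which are the partial derivatives of a map in two variables, along the other
variable, commute. -/
theorem fderiv_eq_of_partial_derivatives {E : Type*} [NormedAddCommGroup E] [NormedSpace ℝ E]
    {Γ : E × E → E} {e₀ : E} (hΓ : ContDiffAt ℝ ∞ Γ (e₀, e₀)) (hΓ0 : Γ (e₀, e₀) = e₀)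
    {P Q : E → E} (hP : DifferentiableAt ℝ P e₀) (hQ : DifferentiableAt ℝ Q e₀) {α β : E}
    (h1 : ∀ᶠ e in 𝓝 e₀, P (Γ (e₀, e)) = fderiv ℝ Γ (e₀, e) (α, 0))
    (h2 : ∀ᶠ e in 𝓝 e₀, Q (Γ (e, e₀)) = fderiv ℝ Γ (e, e₀) (0, β)) :
    fderiv ℝ P e₀ (Q e₀) = fderiv ℝ Q e₀ (P e₀) := by
  have h10 := h1.self_of_nhds
  have h20 := h2.self_of_nhds
  rw [hΓ0] at h10 h20
  have hd : HasFDerivAt Γ (fderiv ℝ Γ (e₀, e₀)) (e₀, e₀) :=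
    (hΓ.differentiableAt (by simp)).hasFDerivAt
  have hd2 : HasFDerivAt (fderiv ℝ Γ) (fderiv ℝ (fderiv ℝ Γ) (e₀, e₀)) (e₀, e₀) :=
    ((hΓ.fderiv_right (m := ∞) le_rfl).differentiableAt (by simp)).hasFDerivAt
  have hj1 : HasFDerivAt (fun e : E => (e₀, e)) (ContinuousLinearMap.inr ℝ E E) e₀ :=
    hasFDerivAt_prodMk_right e₀ e₀
  have hj2 : HasFDerivAt (fun e : E => (e, e₀)) (ContinuousLinearMap.inl ℝ E E) e₀ :=
    hasFDerivAt_prodMk_left e₀ e₀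
  have hP' : HasFDerivAt P (fderiv ℝ P e₀) (Γ (e₀, e₀)) := by rw [hΓ0]; exact hP.hasFDerivAt
  have hQ' : HasFDerivAt Q (fderiv ℝ Q e₀) (Γ (e₀, e₀)) := by rw [hΓ0]; exact hQ.hasFDerivAt
  have a1 := HasFDerivAt.comp e₀ (f := fun e => Γ (e₀, e)) hP' (HasFDerivAt.comp e₀ hd hj1)
  have a2 := ((HasFDerivAt.comp e₀ (g := fderiv ℝ Γ) (f := fun e => (e₀, e)) hd2 hj1).clm_apply
    (hasFDerivAt_const ((α, 0) : E × E) e₀)).congr_of_eventuallyEq h1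
  have b1 := HasFDerivAt.comp e₀ (f := fun e => Γ (e, e₀)) hQ' (HasFDerivAt.comp e₀ hd hj2)
  have b2 := ((HasFDerivAt.comp e₀ (g := fderiv ℝ Γ) (f := fun e => (e, e₀)) hd2 hj2).clm_apply
    (hasFDerivAt_const ((0, β) : E × E) e₀)).congr_of_eventuallyEq h2
  have a3 := congrArg (fun L : E →L[ℝ] E => L β) (a1.unique a2)
  have b3 := congrArg (fun L : E →L[ℝ] E => L α) (b1.unique b2)
  have hsymm := (hΓ.isSymmSndFDerivAt (by
    rw [minSmoothness_of_isRCLikeNormedField]; exact WithTop.coe_le_coe.2 le_top)).eq (0, β) (α, 0)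
  rw [h10, h20]
  simp only [ContinuousLinearMap.comp_apply, ContinuousLinearMap.inr_apply,
    ContinuousLinearMap.inl_apply, add_apply, zero_apply,
    ContinuousLinearMap.flip_apply, map_zero, zero_add, add_zero] at a3 b3
  rw [a3, b3, hsymm]

section Commute
variable {EM : Type*} [NormedAddCommGroup EM] [NormedSpace ℝ EM] [FiniteDimensional ℝ EM]
  {M : Type*} [TopologicalSpace M] [ChartedSpace EM M] [IsManifold 𝓘(ℝ, EM) ∞ M]
  {EG : Type*} [NormedAddCommGroup EG] [NormedSpace ℝ EG] [FiniteDimensional ℝ EG]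
  {G : Type*} [TopologicalSpace G] [ChartedSpace EG G] [IsManifold 𝓘(ℝ, EG) ∞ G]
  {F : Type*} [NormedAddCommGroup F] [NormedSpace ℝ F]
  {A : M → Type*} [TopologicalSpace (TotalSpace F A)] [∀ x, TopologicalSpace (A x)]
  [FiberBundle F A] [∀ x, AddCommGroup (A x)] [∀ x, Module ℝ (A x)] [VectorBundle ℝ F A]
  {𝒢 : LieGroupoid EM M EG G} {𝒜 : LieAlgebroid EM M F A} (Φ : 𝒢.Algebroid 𝒜)

local notation "Γ∞" => Cₛ^∞⟮𝓘(ℝ, EM); F, A⟯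
local notation "IG" => modelWithCornersSelf ℝ EG
local notation "IM" => modelWithCornersSelf ℝ EM

/-- The derivative of a map into a chart, computed in a chart. -/
theorem fderiv_chart_comp {g₀ k : G} {f : G → G} (hf : MDifferentiableAt IG IG f g₀)
    (hk : f g₀ = k) (hks : k ∈ (extChartAt IG g₀).source) (v : EG) :
    (mfderiv IG 𝓘(ℝ, EG) (extChartAt IG g₀) k : EG →L[ℝ] EG)
        ((mfderiv IG IG f g₀ : EG →L[ℝ] EG) v) =
      fderiv ℝ (fun e => extChartAt IG g₀ (f ((extChartAt IG g₀).symm e))) (extChartAt IG g₀ g₀) v := by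
  have h1 : MDifferentiableAt IG 𝓘(ℝ, EG) (extChartAt IG g₀) k :=
    mdifferentiableAt_extChartAt (by rwa [← extChartAt_source IG])
  rw [← mfderiv_comp_apply_eq h1 hf hk]
  refine (mfderiv_eq_fderiv_comp (mem_extChartAt_source g₀) (mdifferentiableAt_comp_eq h1 hf hk)
    v).trans ?_
  rw [mfderiv_extChartAt_self]
  rfl

namespace LieGroupoid.Algebroid

/-- Right and left invariant vector fields commute. -/
theorem fderiv_rightField_leftField (a b : Γ∞) (x : M) :
    fderiv ℝ (chartRep IG (𝒢.u x) (Φ.rightField a)) (extChartAt IG (𝒢.u x) (𝒢.u x))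
        (Φ.leftField b (𝒢.u x)) =
      fderiv ℝ (chartRep IG (𝒢.u x) (Φ.leftField b)) (extChartAt IG (𝒢.u x) (𝒢.u x))
        (Φ.rightField a (𝒢.u x)) := by
  obtain ⟨r, hsm, hr⟩ := 𝒢.exists_unitRetraction_at x
  set φ := extChartAt IG (𝒢.u x) with hφ
  set e₀ := φ (𝒢.u x) with he₀
  have hφ0 : φ.symm e₀ = 𝒢.u x := extChartAt_to_inv (𝒢.u x)
  let D : G × G → G := fun p => 𝒢.mul (r (x, p.1)) (𝒢.inv (r (x, p.2)))
  have hD : ContMDiffAt ((IG).prod IG) IG ∞ D (𝒢.u x, 𝒢.u x) := hr.contMDiffAt_division hsm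
  have hD0 : D (𝒢.u x, 𝒢.u x) = 𝒢.u x := hr.division_left.self_of_nhds.trans hr.apply_unit
  let Γ : EG × EG → EG := fun p => φ (D (φ.symm p.1, φ.symm p.2))
  have hsymm : ContMDiffAt IG IG ∞ φ.symm e₀ :=
    (contMDiffOn_extChartAt_symm (𝒢.u x)).contMDiffAt (extChartAt_target_mem_nhds (𝒢.u x))
  have hpair : ContMDiffAt 𝓘(ℝ, EG × EG) ((IG).prod IG) ∞
      (fun p : EG × EG => (φ.symm p.1, φ.symm p.2)) (e₀, e₀) :=
    (ContMDiffAt.comp (f := Prod.fst) (e₀, e₀) hsymm contDiff_fst.contMDiff.contMDiffAt).prodMk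
      (ContMDiffAt.comp (f := Prod.snd) (e₀, e₀) hsymm contDiff_snd.contMDiff.contMDiffAt)
  have hΓ : ContDiffAt ℝ ∞ Γ (e₀, e₀) := by
    refine ContMDiffAt.contDiffAt ?_
    have h1 : ContMDiffAt 𝓘(ℝ, EG × EG) IG ∞ (fun p : EG × EG => D (φ.symm p.1, φ.symm p.2))
        (e₀, e₀) := ContMDiffAt.comp_of_eq hD hpair (by rw [hφ0])
    exact ContMDiffAt.comp_of_eq (g := φ) contMDiffAt_extChartAt h1 (by rw [hφ0]; exact hD0)
  have hΓ0 : Γ (e₀, e₀) = e₀ := by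
    change φ (D (φ.symm e₀, φ.symm e₀)) = e₀
    rw [hφ0, hD0]
  have hev : ∀ᶠ e in 𝓝 e₀, 𝒢.s (r (x, φ.symm e)) = x := by
    have := hsymm.continuousAt
    unfold ContinuousAt at this
    rw [hφ0] at this
    exact this.eventually hr.s_fiber
  have hdiff : ∀ᶠ p in 𝓝 (e₀, e₀), DifferentiableAt ℝ Γ p := by
    have := (hΓ.of_le (m := 1) (by exact_mod_cast le_top)).eventually (by simp)
    exact this.mono fun p hp => hp.differentiableAt (by simp)
  have hj1 : ContinuousAt (fun e : EG => (e₀, e)) e₀ := (Continuous.prodMk_right e₀).continuousAt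
  have hj2 : ContinuousAt (fun e : EG => (e, e₀)) e₀ := (Continuous.prodMk_left e₀).continuousAt
  have hDc : ContinuousAt (fun p : EG × EG => D (φ.symm p.1, φ.symm p.2)) (e₀, e₀) :=
    ContinuousAt.comp_of_eq (g := D) hD.continuousAt hpair.continuousAt (by rw [hφ0])
  have hsrc : ∀ᶠ p : EG × EG in 𝓝 (e₀, e₀), D (φ.symm p.1, φ.symm p.2) ∈ φ.source := by
    refine hDc.eventually_mem ?_
    change _ ∈ 𝓝 (D (φ.symm e₀, φ.symm e₀))
    rw [hφ0, hD0]
    exact extChartAt_source_mem_nhds (𝒢.u x)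
  have hP : DifferentiableAt ℝ (chartRep IG (𝒢.u x) (Φ.rightField a)) e₀ :=
    (contDiffAt_chartRep (Φ.contMDiff_rightField a).contMDiffAt).differentiableAt (by simp)
  have hQ : DifferentiableAt ℝ (chartRep IG (𝒢.u x) (Φ.leftField b)) e₀ :=
    (contDiffAt_chartRep (Φ.contMDiff_leftField b).contMDiffAt).differentiableAt (by simp)
  have h1 : ∀ᶠ e in 𝓝 e₀, chartRep IG (𝒢.u x) (Φ.rightField a) (Γ (e₀, e)) =
      fderiv ℝ Γ (e₀, e) (Φ.ι x (a x), 0) := by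
    filter_upwards [hev, hj1.eventually hdiff, hj1.eventually hsrc] with e he1 he2 he3
    set k := 𝒢.inv (r (x, φ.symm e)) with hk
    have ht : 𝒢.t k = x := (𝒢.t_inv _).trans he1
    have hk0 : 𝒢.mul (r (x, 𝒢.u x)) k = k := by rw [hr.apply_unit, ← ht, 𝒢.u_mul]
    have hDk : D (φ.symm e₀, φ.symm e) = k := by rw [hφ0]; exact hk0
    change D (φ.symm e₀, φ.symm e) ∈ φ.source at he3
    rw [hDk] at he3
    change chartRep IG (𝒢.u x) (Φ.rightField a) (φ (D (φ.symm e₀, φ.symm e))) = _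
    obtain ⟨h3, h4⟩ := hr.dR_apply ht
    rw [hDk, chartRep_extChartAt he3, Φ.rightField_eq_of_t_eq a ht, ← h4 (Φ.ds_ι x _)]
    refine (fderiv_chart_comp h3 hk0 he3 _).trans ?_
    exact congrArg (fun L : EG →L[ℝ] EG => L (Φ.ι x (a x)))
      (HasFDerivAt.comp e₀ he2.hasFDerivAt (hasFDerivAt_prodMk_left e₀ e)).fderiv
  have h2 : ∀ᶠ e in 𝓝 e₀, chartRep IG (𝒢.u x) (Φ.leftField b) (Γ (e, e₀)) =
      fderiv ℝ Γ (e, e₀) (0, Φ.ι x (b x)) := by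
    filter_upwards [hev, hj2.eventually hdiff, hj2.eventually hsrc] with e he1 he2 he3
    set k := r (x, φ.symm e) with hk
    have hk0 : 𝒢.mul k (𝒢.inv (r (x, 𝒢.u x))) = k := by
      rw [hr.apply_unit, LieGroupoid.inv_u, ← he1, 𝒢.mul_u]
    have hDk : D (φ.symm e, φ.symm e₀) = k := by rw [hφ0]; exact hk0
    change D (φ.symm e, φ.symm e₀) ∈ φ.source at he3
    rw [hDk] at he3
    change chartRep IG (𝒢.u x) (Φ.leftField b) (φ (D (φ.symm e, φ.symm e₀))) = _
    obtain ⟨h3, h4⟩ := hr.dL_apply he1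
    rw [hDk, chartRep_extChartAt he3, Φ.leftField_eq_of_s_eq b he1, ← h4 (Φ.ds_ι x _)]
    refine (fderiv_chart_comp h3 hk0 he3 _).trans ?_
    exact congrArg (fun L : EG →L[ℝ] EG => L (Φ.ι x (b x)))
      (HasFDerivAt.comp e₀ he2.hasFDerivAt (hasFDerivAt_prodMk_right e e₀)).fderiv
  have := fderiv_eq_of_partial_derivatives hΓ hΓ0 hP hQ h1 h2
  rwa [chartRep_self, chartRep_self] at this

end LieGroupoid.Algebroid
end Commute

end

noncomputable section

open scoped Topology
open VectorField

section Normed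
variable {E : Type*} [NormedAddCommGroup E] [NormedSpace ℝ E]
  {E' : Type*} [NormedAddCommGroup E'] [NormedSpace ℝ E']
  {E'' : Type*} [NormedAddCommGroup E''] [NormedSpace ℝ E'']

/-- A family of linear maps out of a finite dimensional space which is smooth pointwise is smooth. -/
theorem exists_contDiffAt_clm [FiniteDimensional ℝ E'] (f : E' →ₗ[ℝ] E → E'') {e₀ : E}
    (hf : ∀ y, ContDiffAt ℝ ∞ (f y) e₀) :
    ∃ R : E → E' →L[ℝ] E'', ContDiffAt ℝ ∞ R e₀ ∧ ∀ e y, R e y = f y e := by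
  let b := Module.finBasis ℝ E'
  refine ⟨fun e => ∑ i, (b.coord i).toContinuousLinearMap.smulRight (f (b i) e), ?_, fun e y => ?_⟩
  · exact ContDiffAt.sum fun i _ => contDiffAt_const.smulRight (hf (b i))
  · rw [sum_apply]
    conv_rhs => rw [← b.sum_repr y, map_sum, Finset.sum_apply]
    refine Finset.sum_congr rfl fun i _ => ?_
    rw [map_smul]; rfl

/-- The map `(e, w) ↦ R(e)(dq(e) w)`. -/
def factorMap (q : E → E') (R : E → E' →L[ℝ] E'') (p : E × E) : E'' := R p.1 (fderiv ℝ q p.1 p.2)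

variable {q : E → E'} {R : E → E' →L[ℝ] E''} {e₀ : E}

theorem contDiffAt_factorMap (hq : ContDiffAt ℝ ∞ q e₀) (hR : ContDiffAt ℝ ∞ R e₀) (w₀ : E) :
    ContDiffAt ℝ ∞ (factorMap q R) (e₀, w₀) := by
  have h1 : ContDiffAt ℝ ∞ (fun p : E × E => R p.1) (e₀, w₀) :=
    ContDiffAt.comp (g := R) (e₀, w₀) hR contDiffAt_fst
  have h2 : ContDiffAt ℝ ∞ (fun p : E × E => fderiv ℝ q p.1) (e₀, w₀) :=
    ContDiffAt.comp (g := fderiv ℝ q) (e₀, w₀) (hq.fderiv_right (m := ∞) le_rfl) contDiffAt_fst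
  exact h1.clm_apply (h2.clm_apply contDiffAt_snd)

theorem fderiv_factorMap (hq : ContDiffAt ℝ ∞ q e₀) (hR : ContDiffAt ℝ ∞ R e₀) (w₀ v z : E) :
    fderiv ℝ (factorMap q R) (e₀, w₀) (v, z) =
      fderiv ℝ (fun e => R e (fderiv ℝ q e₀ w₀)) e₀ v +
        R e₀ (fderiv ℝ (fderiv ℝ q) e₀ v w₀ + fderiv ℝ q e₀ z) := by
  have hRd := (hR.differentiableAt (by simp)).hasFDerivAt
  have hqd := ((hq.fderiv_right (m := ∞) le_rfl).differentiableAt (by simp)).hasFDerivAt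
  have h1 : HasFDerivAt (fun p : E × E => R p.1) _ (e₀, w₀) :=
    HasFDerivAt.comp (g := R) (e₀, w₀) hRd hasFDerivAt_fst
  have h2 : HasFDerivAt (fun p : E × E => fderiv ℝ q p.1) _ (e₀, w₀) :=
    HasFDerivAt.comp (g := fderiv ℝ q) (e₀, w₀) hqd hasFDerivAt_fst
  have h3 := h1.clm_apply (h2.clm_apply hasFDerivAt_snd)
  have h4 := hRd.clm_apply (hasFDerivAt_const (fderiv ℝ q e₀ w₀) e₀)
  have e3 : fderiv ℝ (factorMap q R) (e₀, w₀) = _ := h3.fderiv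
  rw [e3, h4.fderiv]
  simp [add_comm]

/-- If `A` is `q`-related to `Θ`, then `D²q(A, w) + Dq(DA w) = DΘ(Dq w)`. -/
theorem fderiv_related (hq : ContDiffAt ℝ ∞ q e₀) {P : E → E} {Θ : E' → E'}
    (hP : DifferentiableAt ℝ P e₀) (hΘ : DifferentiableAt ℝ Θ (q e₀))
    (h : ∀ᶠ e in 𝓝 e₀, fderiv ℝ q e (P e) = Θ (q e)) (w : E) :
    fderiv ℝ (fderiv ℝ q) e₀ (P e₀) w + fderiv ℝ q e₀ (fderiv ℝ P e₀ w) =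
      fderiv ℝ Θ (q e₀) (fderiv ℝ q e₀ w) := by
  have hqd := ((hq.fderiv_right (m := ∞) le_rfl).differentiableAt (by simp)).hasFDerivAt
  have h1 := hqd.clm_apply hP.hasFDerivAt
  have h2 := (HasFDerivAt.comp e₀ hΘ.hasFDerivAt
    (hq.differentiableAt (by simp)).hasFDerivAt).congr_of_eventuallyEq h
  have h3 := congrArg (fun L : E →L[ℝ] E' => L w) (h1.unique h2)
  have hsymm := (hq.isSymmSndFDerivAt (by
    rw [minSmoothness_of_isRCLikeNormedField]; exact WithTop.coe_le_coe.2 le_top)).eq (P e₀) w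
  rw [hsymm, add_comm]
  simpa using h3

end Normed

section FactoredTensor
variable {EM : Type*} [NormedAddCommGroup EM] [NormedSpace ℝ EM] [FiniteDimensional ℝ EM]
  {M : Type*} [TopologicalSpace M] [ChartedSpace EM M] [IsManifold 𝓘(ℝ, EM) ∞ M]
  {EG : Type*} [NormedAddCommGroup EG] [NormedSpace ℝ EG] [FiniteDimensional ℝ EG]
  {G : Type*} [TopologicalSpace G] [ChartedSpace EG G] [IsManifold 𝓘(ℝ, EG) ∞ G]

local notation "IG" => modelWithCornersSelf ℝ EG
local notation "IM" => modelWithCornersSelf ℝ EM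

/-- The tensor `T` factors near `g₀` through `dq`, via the vector fields `V y`. -/
def FactorsNear (q : G → M) (V : EM →ₗ[ℝ] (∀ g : G, TangentSpace IG g)) (x : M) (g₀ : G)
    (T : ∀ g : G, TangentSpace IG g →ₗ[ℝ] TangentSpace IG g) : Prop :=
  ∀ᶠ g in 𝓝 g₀, ∀ w : TangentSpace IG g,
    T g w = V (trivializationAt EM (TangentSpace IM : M → Type _) x ⟨q g, mfderiv IG IM q g w⟩).2 g

/-- A map in the preferred charts at `g₀` and `x`. -/
def chartMap (q : G → M) (x : M) (g₀ : G) (e : EG) : EM :=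
  extChartAt IM x (q ((extChartAt IG g₀).symm e))

variable {q : G → M} {x : M} {g₀ : G}

omit [FiniteDimensional ℝ EM] [FiniteDimensional ℝ EG] in
theorem contDiffAt_chartMap (hq : ContMDiff IG IM ∞ q) (hx : q g₀ = x) :
    ContDiffAt ℝ ∞ (chartMap q x g₀ : EG → EM) (extChartAt IG g₀ g₀) := by
  subst hx
  have h1 : ContMDiffAt IM 𝓘(ℝ, EM) ∞ (extChartAt IM (q g₀)) (q g₀) := contMDiffAt_extChartAt
  exact contDiffAt_extChartAt_symm (V := EM) (f := fun g => extChartAt IM (q g₀) (q g))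
    (h1.comp g₀ hq.contMDiffAt)

omit [FiniteDimensional ℝ EM] [FiniteDimensional ℝ EG] in
theorem fderiv_chartMap (hq : ContMDiff IG IM ∞ q) {g : G} (hg : g ∈ (extChartAt IG g₀).source)
    (hqg : q g ∈ (extChartAt IM x).source) (w : TangentSpace IG g) :
    (trivializationAt EM (TangentSpace IM : M → Type _) x ⟨q g, mfderiv IG IM q g w⟩).2 =
      fderiv ℝ (chartMap q x g₀) (extChartAt IG g₀ g)
        (trivializationAt EG (TangentSpace IG : G → Type _) g₀ ⟨g, w⟩).2 := by
  have h1 : MDifferentiableAt IM 𝓘(ℝ, EM) (extChartAt IM x) (q g) :=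
    mdifferentiableAt_extChartAt (by rwa [← extChartAt_source IM])
  have h2 : MDifferentiableAt IG IM q g := hq.mdifferentiableAt (by simp)
  rw [← mfderiv_extChartAt_apply hqg, ← mfderiv_extChartAt_apply hg]
  refine (mfderiv_comp_apply_eq h1 h2 rfl w).symm.trans ?_
  exact mfderiv_eq_fderiv_comp hg (h1.comp g h2) w

theorem trivializationAt_self_tangent (g : G) (w : TangentSpace IG g) :
    (trivializationAt EG (TangentSpace IG : G → Type _) g ⟨g, w⟩).2 = w := by
  rw [← mfderiv_extChartAt_apply (mem_extChartAt_source g)]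
  exact congrArg (fun L : EG →L[ℝ] EG => L w) mfderiv_extChartAt_self

/-- A factored tensor in charts. -/
theorem FactorsNear.exists_chart {V : EM →ₗ[ℝ] (∀ g : G, TangentSpace IG g)}
    {T : ∀ g : G, TangentSpace IG g →ₗ[ℝ] TangentSpace IG g}
    (hT : FactorsNear q V x g₀ T) (hq : ContMDiff IG IM ∞ q) (hx : q g₀ = x)
    (hV : ∀ y, ContMDiff IG (IG).tangent ∞ (fun g => (⟨g, V y g⟩ : TangentBundle IG G))) :
    ∃ R : EG → EM →L[ℝ] EG, ContDiffAt ℝ ∞ R (extChartAt IG g₀ g₀) ∧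
      (∀ e y, R e y = chartRep IG g₀ (V y) e) ∧
      ∀ w₀ : TangentSpace IG g₀, ∀ᶠ P in 𝓝 (⟨g₀, w₀⟩ : TangentBundle IG G),
        (trivializationAt EG (TangentSpace IG : G → Type _) g₀ (tensorMap T P)).2 =
          factorMap (chartMap q x g₀) R
            (extChartAt (IG).tangent (⟨g₀, w₀⟩ : TangentBundle IG G) P) := by
  let f : EM →ₗ[ℝ] EG → EG :=
    { toFun := fun y => chartRep IG g₀ (V y)
      map_add' := fun y y' => by
        rw [map_add]; exact funext fun e => map_add (mfderiv IG 𝓘(ℝ, EG) (extChartAt IG g₀) _) _ _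
      map_smul' := fun r y => by
        rw [map_smul]; exact funext fun e => map_smul (mfderiv IG 𝓘(ℝ, EG) (extChartAt IG g₀) _) _ _ }
  obtain ⟨R, hR1, hR2⟩ := exists_contDiffAt_clm f (e₀ := extChartAt IG g₀ g₀)
    fun y => contDiffAt_chartRep (hV y).contMDiffAt
  refine ⟨R, hR1, hR2, fun w₀ => ?_⟩
  have hproj : ContinuousAt (TotalSpace.proj : TangentBundle IG G → G) ⟨g₀, w₀⟩ :=
    (FiberBundle.continuous_proj EG _).continuousAt
  have hqs : ∀ᶠ g in 𝓝 g₀, q g ∈ (extChartAt IM x).source :=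
    hq.continuous.continuousAt.eventually_mem (by rw [hx]; exact extChartAt_source_mem_nhds x)
  filter_upwards [hproj.eventually hT, hproj.eventually_mem (extChartAt_source_mem_nhds (I := IG) g₀),
    hproj.eventually hqs] with P h1 h2 h3
  obtain ⟨g, w⟩ := P
  change g ∈ (extChartAt IG g₀).source at h2
  have h4 : extChartAt (IG).tangent (⟨g₀, w₀⟩ : TangentBundle IG G) ⟨g, w⟩ =
      ((extChartAt IG g₀ g, (trivializationAt EG (TangentSpace IG : G → Type _) g₀ ⟨g, w⟩).2) :
        EG × EG) := by
    rw [FiberBundle.extChartAt]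
    change ((extChartAt IG g₀ (trivializationAt EG (TangentSpace IG : G → Type _) g₀ ⟨g, w⟩).1, _)
      : EG × EG) = _
    rw [(trivializationAt EG (TangentSpace IG : G → Type _) g₀).coe_fst' (by
      rw [extChartAt_source] at h2; simpa using h2)]
    rfl
  rw [h4]
  unfold factorMap
  rw [hR2, ← fderiv_chartMap hq h2 h3]
  change (trivializationAt EG (TangentSpace IG : G → Type _) g₀ ⟨g, T g w⟩).2 = _
  have h5 := h1 w
  exact (mfderiv_extChartAt_apply h2 _).symm.trans
    ((congrArg (mfderiv IG 𝓘(ℝ, EG) (extChartAt IG g₀) g) h5).trans (chartRep_extChartAt h2 _).symm)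

end FactoredTensor

end

noncomputable section

open scoped Topology
open VectorField

section DeltaSmooth
variable {EM : Type*} [NormedAddCommGroup EM] [NormedSpace ℝ EM] [FiniteDimensional ℝ EM]
  {M : Type*} [TopologicalSpace M] [ChartedSpace EM M] [IsManifold 𝓘(ℝ, EM) ∞ M]
  {EG : Type*} [NormedAddCommGroup EG] [NormedSpace ℝ EG] [FiniteDimensional ℝ EG]
  {G : Type*} [TopologicalSpace G] [ChartedSpace EG G] [IsManifold 𝓘(ℝ, EG) ∞ G]
  {F : Type*} [NormedAddCommGroup F] [NormedSpace ℝ F]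
  {A : M → Type*} [TopologicalSpace (TotalSpace F A)] [∀ x, TopologicalSpace (A x)]
  [FiberBundle F A] [∀ x, AddCommGroup (A x)] [∀ x, Module ℝ (A x)] [VectorBundle ℝ F A]
  {𝒢 : LieGroupoid EM M EG G} {𝒜 : LieAlgebroid EM M F A} (Φ : 𝒢.Algebroid 𝒜)
  (U : BundleMap 𝓘(ℝ, EM) EM (TangentSpace 𝓘(ℝ, EM) : M → Type _) F A)

local notation "Γ∞" => Cₛ^∞⟮𝓘(ℝ, EM); F, A⟯
local notation "IG" => modelWithCornersSelf ℝ EG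
local notation "IM" => modelWithCornersSelf ℝ EM

theorem extChartAt_tangent_self (g : G) (w : TangentSpace IG g) :
    extChartAt (IG).tangent (⟨g, w⟩ : TangentBundle IG G) ⟨g, w⟩ = ((extChartAt IG g g, w) : EG × EG) := by
  have h := mem_extChartAt_source (I := IG) g
  rw [FiberBundle.extChartAt]
  refine Prod.ext ?_ (trivializationAt_self_tangent g w)
  change extChartAt IG g (trivializationAt EG (TangentSpace IG : G → Type _) g ⟨g, w⟩).1 = _
  rw [(trivializationAt EG (TangentSpace IG : G → Type _) g).coe_fst' (mem_baseSet_trivializationAt EG _ g)]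

namespace LieGroupoid.Algebroid

theorem rightField_add_smul (a b : Γ∞) (r : ℝ) (g : G) :
    Φ.rightField (a + r • b) g = Φ.rightField a g + r • Φ.rightField b g := by
  have h : (a + r • b) (𝒢.t g) = a (𝒢.t g) + r • b (𝒢.t g) := rfl
  unfold rightField
  rw [h, map_add, map_smul, map_add, map_smul]

theorem leftField_add_smul (a b : Γ∞) (r : ℝ) (g : G) :
    Φ.leftField (a + r • b) g = Φ.leftField a g + r • Φ.leftField b g := by
  have h : (a + r • b) (𝒢.s g) = a (𝒢.s g) + r • b (𝒢.s g) := rfl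
  unfold leftField
  rw [h, map_add, map_smul, map_add, map_smul, map_add, map_smul]

theorem _root_.BundleMap.onSection_add_smul (σ σ' : VectorFields IM M) (r : ℝ) :
    U.onSection (σ + r • σ') = U.onSection σ + r • U.onSection σ' := by
  ext x
  exact ((U x).map_add _ _).trans (congrArg _ ((U x).map_smul _ _))

end LieGroupoid.Algebroid

/-- A linear map from the two linearity identities at once. -/
def LinearMap.ofAddSMul {V W : Type*} [AddCommGroup V] [Module ℝ V] [AddCommGroup W] [Module ℝ W]
    (f : V → W) (h : ∀ x y (r : ℝ), f (x + r • y) = f x + r • f y) : V →ₗ[ℝ] W where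
  toFun := f
  map_add' x y := by simpa using h x y 1
  map_smul' r y := by
    have h0 : f 0 = 0 := by simpa using h 0 0 1
    simpa [h0] using h 0 y r

namespace LieGroupoid.Algebroid

/-- The right invariant vector fields of `U` applied to a family of vector fields. -/
def rightFamily (c : EM →ₗ[ℝ] VectorFields IM M) : EM →ₗ[ℝ] (∀ g : G, TangentSpace IG g) :=
  LinearMap.ofAddSMul (fun y => Φ.rightField (U.onSection (c y))) fun y y' r => by
    rw [map_add, map_smul, U.onSection_add_smul]
    exact funext fun g => Φ.rightField_add_smul _ _ r g

/-- The left invariant vector fields of `U` applied to a family of vector fields. -/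
def leftFamily (c : EM →ₗ[ℝ] VectorFields IM M) : EM →ₗ[ℝ] (∀ g : G, TangentSpace IG g) :=
  LinearMap.ofAddSMul (fun y => Φ.leftField (U.onSection (c y))) fun y y' r => by
    rw [map_add, map_smul, U.onSection_add_smul]
    exact funext fun g => Φ.leftField_add_smul _ _ r g

/-- `c` is the family of constant vector fields in the chart at `x`. -/
def _root_.IsFrameNear (x : M) (c : EM →ₗ[ℝ] VectorFields IM M) : Prop :=
  ∀ᶠ y in 𝓝 x, ∀ w : EM, c w y = (trivializationAt EM (TangentSpace IM : M → Type _) x).symm y w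

theorem _root_.IsFrameNear.eventually_eq {x : M} {c : EM →ₗ[ℝ] VectorFields IM M}
    (hc : IsFrameNear x c) : ∀ᶠ y in 𝓝 x, ∀ w : TangentSpace IM y,
      c (trivializationAt EM (TangentSpace IM : M → Type _) x ⟨y, w⟩).2 y = w := by
  filter_upwards [hc, (trivializationAt EM (TangentSpace IM : M → Type _) x).open_baseSet.mem_nhds
    (mem_baseSet_trivializationAt EM _ x)] with y h1 h2 w
  exact (h1 _).trans ((trivializationAt EM (TangentSpace IM : M → Type _) x).symm_apply_apply_mk h2 w)

theorem factorsNear_rightLift {x : M} {g₀ : G} {c : EM →ₗ[ℝ] VectorFields IM M}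
    (hc : IsFrameNear x c) (hx : 𝒢.t g₀ = x) :
    FactorsNear 𝒢.t (Φ.rightFamily U c) x g₀ (Φ.rightLift U) := by
  have ht := 𝒢.smooth_t.continuous.continuousAt (x := g₀)
  unfold ContinuousAt at ht
  rw [hx] at ht
  filter_upwards [ht.eventually hc.eventually_eq] with g hg w
  exact congrArg (fun v => 𝒢.dR g (Φ.ι (𝒢.t g) (U (𝒢.t g) v))) (hg _).symm

theorem factorsNear_leftLift {x : M} {g₀ : G} {c : EM →ₗ[ℝ] VectorFields IM M}
    (hc : IsFrameNear x c) (hx : 𝒢.s g₀ = x) :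
    FactorsNear 𝒢.s (Φ.leftFamily U c) x g₀ (Φ.leftLift U) := by
  have hs := 𝒢.smooth_s.continuous.continuousAt (x := g₀)
  unfold ContinuousAt at hs
  rw [hx] at hs
  filter_upwards [hs.eventually hc.eventually_eq] with g hg w
  exact congrArg (fun v => 𝒢.dL g (𝒢.dinv (𝒢.s g) (Φ.ι (𝒢.s g) (U (𝒢.s g) v)))) (hg _).symm

/-- The tensor `δU` in the charts at `g₀`. -/
theorem exists_delta_chart {x y : M} {g₀ : G} {c d : EM →ₗ[ℝ] VectorFields IM M}
    (hc : IsFrameNear x c) (hd : IsFrameNear y d) (hx : 𝒢.t g₀ = x) (hy : 𝒢.s g₀ = y) :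
    ∃ R S : EG → EM →L[ℝ] EG, ContDiffAt ℝ ∞ R (extChartAt IG g₀ g₀) ∧
      ContDiffAt ℝ ∞ S (extChartAt IG g₀ g₀) ∧
      (∀ e w, R e w = chartRep IG g₀ (Φ.rightField (U.onSection (c w))) e) ∧
      (∀ e w, S e w = chartRep IG g₀ (Φ.leftField (U.onSection (d w))) e) ∧
      ∀ w₀ : TangentSpace IG g₀, ∀ᶠ P in 𝓝 (⟨g₀, w₀⟩ : TangentBundle IG G),
        (trivializationAt EG (TangentSpace IG : G → Type _) g₀ (tensorMap (Φ.delta U) P)).2 =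
          (factorMap (chartMap 𝒢.t x g₀) R + factorMap (chartMap 𝒢.s y g₀) S)
            (extChartAt (IG).tangent (⟨g₀, w₀⟩ : TangentBundle IG G) P) := by
  obtain ⟨R, h1, h2, h3⟩ := (Φ.factorsNear_rightLift U hc hx).exists_chart 𝒢.smooth_t hx
    fun w => Φ.contMDiff_rightField _
  obtain ⟨S, k1, k2, k3⟩ := (Φ.factorsNear_leftLift U hd hy).exists_chart 𝒢.smooth_s hy
    fun w => Φ.contMDiff_leftField _
  refine ⟨R, S, h1, k1, h2, k2, fun w₀ => ?_⟩
  have hproj : ContinuousAt (TotalSpace.proj : TangentBundle IG G → G) ⟨g₀, w₀⟩ :=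
    (FiberBundle.continuous_proj EG _).continuousAt
  filter_upwards [h3 w₀, k3 w₀, hproj.eventually_mem
    ((trivializationAt EG (TangentSpace IG : G → Type _) g₀).open_baseSet.mem_nhds
      (mem_baseSet_trivializationAt EG _ g₀))] with P h k hP
  rw [Pi.add_apply, ← h, ← k]
  exact ((trivializationAt EG (TangentSpace IG : G → Type _) g₀).linear ℝ hP).map_add _ _

variable [T2Space M]

theorem _root_.exists_isFrameNear (x : M) : ∃ c : EM →ₗ[ℝ] VectorFields IM M, IsFrameNear x c ∧
    ∀ w, c w x = w := by
  obtain ⟨c, hc⟩ := exists_frameSection (EM := EM) (F := EM) (A := (TangentSpace IM : M → Type _)) x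
  have hc' : IsFrameNear x c := hc.mono fun y hy w => (hy w).1
  refine ⟨c, hc', fun w => ?_⟩
  exact (congrArg (fun v : EM => c v x) (trivializationAt_self_tangent (EG := EM) x w)).symm.trans
    (hc'.eventually_eq.self_of_nhds w)

theorem contMDiff_delta : ContMDiff (IG).tangent (IG).tangent ∞ (tensorMap (Φ.delta U)) := by
  rintro ⟨g₀, w₀⟩
  obtain ⟨c, hc, -⟩ := exists_isFrameNear (EM := EM) (𝒢.t g₀)
  obtain ⟨d, hd, -⟩ := exists_isFrameNear (EM := EM) (𝒢.s g₀)
  obtain ⟨R, S, h1, h2, -, -, h3⟩ := Φ.exists_delta_chart U hc hd rfl rfl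
  rw [contMDiffAt_totalSpace]
  refine ⟨(contMDiff_proj (TangentSpace IG : G → Type _)).contMDiffAt, ?_⟩
  have hd1 := contDiffAt_factorMap (contDiffAt_chartMap 𝒢.smooth_t rfl) h1 (w₀ : EG)
  have hd2 := contDiffAt_factorMap (contDiffAt_chartMap 𝒢.smooth_s rfl) h2 (w₀ : EG)
  have hd3 := (hd1.add hd2).contMDiffAt
  have h4 : ContMDiffAt (IG).tangent 𝓘(ℝ, EG × EG) ∞
    (extChartAt (IG).tangent (⟨g₀, w₀⟩ : TangentBundle IG G)) ⟨g₀, w₀⟩ := contMDiffAt_extChartAt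
  refine ContMDiffAt.congr_of_eventuallyEq ?_ (h3 w₀)
  exact hd3.comp_of_eq h4 (extChartAt_tangent_self g₀ w₀)

end LieGroupoid.Algebroid
end DeltaSmooth

end

noncomputable section

open scoped Topology
open VectorField

section TensorMapDeriv
variable {EG : Type*} [NormedAddCommGroup EG] [NormedSpace ℝ EG] [FiniteDimensional ℝ EG]
  {G : Type*} [TopologicalSpace G] [ChartedSpace EG G] [IsManifold 𝓘(ℝ, EG) ∞ G]

local notation "IG" => modelWithCornersSelf ℝ EG

/-- The derivative of a tensor, as a map of the tangent bundle, in terms of its representation `N` in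
the chart. -/
theorem mfderiv_tensorMap {T : ∀ g : G, TangentSpace IG g →ₗ[ℝ] TangentSpace IG g}
    (hT : ContMDiff (IG).tangent (IG).tangent ∞ (tensorMap T)) {g₀ : G} {w₀ : TangentSpace IG g₀}
    {N : EG × EG → EG} (hN : ContDiffAt ℝ ∞ N (extChartAt IG g₀ g₀, (w₀ : EG)))
    (h : ∀ᶠ P in 𝓝 (⟨g₀, w₀⟩ : TangentBundle IG G),
      (trivializationAt EG (TangentSpace IG : G → Type _) g₀ (tensorMap T P)).2 =
        N (extChartAt (IG).tangent (⟨g₀, w₀⟩ : TangentBundle IG G) P)) (ζ : EG × EG) :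
    (mfderiv (IG).tangent (IG).tangent (tensorMap T) ⟨g₀, w₀⟩ : EG × EG →L[ℝ] EG × EG) ζ =
      (ζ.1, fderiv ℝ N (extChartAt IG g₀ g₀, (w₀ : EG)) ζ) := by
  have hTd : MDifferentiableAt (IG).tangent (IG).tangent (tensorMap T) ⟨g₀, w₀⟩ :=
    hT.mdifferentiableAt (by simp)
  have hπ : ∀ P : TangentBundle IG G, MDifferentiableAt (IG).tangent IG
      (TotalSpace.proj : TangentBundle IG G → G) P := fun P =>
    (contMDiff_proj (TangentSpace IG : G → Type _) (n := ∞)).mdifferentiableAt (by simp)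
  refine (eq_projDeriv_fiberDeriv (M := G) (F := EG) (A := (TangentSpace IG : G → Type _))
    (tensorMap T ⟨g₀, w₀⟩) _).trans (Prod.ext ?_ ?_)
  · refine (mfderiv_comp_apply_eq (I := (IG).tangent) (I' := (IG).tangent) (I'' := IG)
      (hπ _) hTd rfl ζ).symm.trans ?_
    exact (congrArg Prod.fst (eq_projDeriv_fiberDeriv (M := G) (F := EG)
      (A := (TangentSpace IG : G → Type _)) ⟨g₀, w₀⟩ ζ)).symm
  · have h1 : MDifferentiableAt (IG).tangent 𝓘(ℝ, EG) (fun q : TangentBundle IG G =>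
        (trivializationAt EG (TangentSpace IG : G → Type _) g₀ q).2) (tensorMap T ⟨g₀, w₀⟩) :=
      (contMDiffAt_trivializationAt_totalSpace (EM := EG) (M := G) (F := EG)
        (A := (TangentSpace IG : G → Type _)) (mem_baseSet_trivializationAt EG _ g₀)).mdifferentiableAt
        (by simp)
    refine (mfderiv_comp_apply_eq (I := (IG).tangent) (I' := (IG).tangent) (I'' := 𝓘(ℝ, EG))
      h1 hTd rfl ζ).symm.trans ?_
    refine (mfderiv_congr_apply (I := (IG).tangent) (I' := 𝓘(ℝ, EG)) h ζ).trans ?_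
    have h2 : MDifferentiableAt 𝓘(ℝ, EG × EG) 𝓘(ℝ, EG) N (extChartAt IG g₀ g₀, (w₀ : EG)) :=
      (hN.differentiableAt (by simp)).mdifferentiableAt
    have h3 : MDifferentiableAt (IG).tangent 𝓘(ℝ, EG × EG)
        (extChartAt (IG).tangent (⟨g₀, w₀⟩ : TangentBundle IG G)) ⟨g₀, w₀⟩ :=
      mdifferentiableAt_extChartAt (mem_chart_source _ _)
    refine (mfderiv_comp_apply_eq (I := (IG).tangent) (I' := 𝓘(ℝ, EG × EG)) (I'' := 𝓘(ℝ, EG))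
      h2 h3 (extChartAt_tangent_self g₀ w₀) ζ).trans ?_
    rw [mfderiv_eq_fderiv]
    exact congrArg _ (congrArg (fun L : EG × EG →L[ℝ] EG × EG => L ζ) mfderiv_extChartAt_self)

end TensorMapDeriv

section ToTangentDeriv
variable {EM : Type*} [NormedAddCommGroup EM] [NormedSpace ℝ EM] [FiniteDimensional ℝ EM]
  {M : Type*} [TopologicalSpace M] [ChartedSpace EM M] [IsManifold 𝓘(ℝ, EM) ∞ M]
  {EG : Type*} [NormedAddCommGroup EG] [NormedSpace ℝ EG] [FiniteDimensional ℝ EG]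
  {G : Type*} [TopologicalSpace G] [ChartedSpace EG G] [IsManifold 𝓘(ℝ, EG) ∞ G]
  {F : Type*} [NormedAddCommGroup F] [NormedSpace ℝ F]
  {A : M → Type*} [TopologicalSpace (TotalSpace F A)] [∀ x, TopologicalSpace (A x)]
  [FiberBundle F A] [∀ x, AddCommGroup (A x)] [∀ x, Module ℝ (A x)] [VectorBundle ℝ F A]
  [ContMDiffVectorBundle ∞ F A 𝓘(ℝ, EM)]
  {𝒢 : LieGroupoid EM M EG G} {𝒜 : LieAlgebroid EM M F A} (Φ : 𝒢.Algebroid 𝒜)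

local notation "Γ∞" => Cₛ^∞⟮𝓘(ℝ, EM); F, A⟯
local notation "IG" => modelWithCornersSelf ℝ EG
local notation "IM" => modelWithCornersSelf ℝ EM
local notation "IA" => ModelWithCorners.prod 𝓘(ℝ, EM) 𝓘(ℝ, F)

namespace LieGroupoid.Algebroid

/-- The differential of `A → TG`, in the coordinates of `TTG`. -/
def toTangentDeriv (p : TotalSpace F A) : EM × F →L[ℝ] EG × EG :=
  mfderiv IA (IG).tangent Φ.toTangent p

theorem mdifferentiableAt_toTangent (p : TotalSpace F A) :
    MDifferentiableAt IA (IG).tangent Φ.toTangent p :=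
  Φ.smooth.mdifferentiableAt (by simp)

theorem toTangentDeriv_fst (p : TotalSpace F A) (ξ : TangentSpace IA p) :
    (Φ.toTangentDeriv p ξ).1 =
      (mfderiv IM IG 𝒢.u p.proj : EM →L[ℝ] EG) (projDeriv p ξ) := by
  have hπ : MDifferentiableAt (IG).tangent IG
      (TotalSpace.proj : TangentBundle IG G → G) (Φ.toTangent p) :=
    (contMDiff_proj (TangentSpace IG : G → Type _) (n := ∞)).mdifferentiableAt (by simp)
  have hπ' : MDifferentiableAt IA IM (TotalSpace.proj : TotalSpace F A → M) p :=
    (contMDiff_proj A (n := ∞)).mdifferentiableAt (by simp)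
  refine (congrArg Prod.fst (eq_projDeriv_fiberDeriv (M := G) (F := EG)
    (A := (TangentSpace IG : G → Type _)) (Φ.toTangent p) (Φ.toTangentDeriv p ξ))).trans ?_
  refine (mfderiv_comp_apply_eq (I := IA) (I' := (IG).tangent) (I'' := IG)
      hπ (Φ.mdifferentiableAt_toTangent p) rfl ξ).symm.trans ?_
  exact mfderiv_comp_apply_eq (I := IA) (I' := IM) (I'' := IG)
    (LieGroupoid.mdifferentiableAt_u (𝒢 := 𝒢) p.proj) hπ' rfl ξ

/-- The fibre coordinate of `A → TG` in the chart at `g₀`. -/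
def toTangentCoord (g₀ : G) (q : TotalSpace F A) : EG :=
  (trivializationAt EG (TangentSpace IG : G → Type _) g₀ (Φ.toTangent q)).2

theorem mdifferentiableAt_trivializationAt_tangent (P : TangentBundle IG G) :
    MDifferentiableAt (IG).tangent 𝓘(ℝ, EG) (fun q : TangentBundle IG G =>
      (trivializationAt EG (TangentSpace IG : G → Type _) P.1 q).2) P :=
  (contMDiffAt_trivializationAt_totalSpace (EM := EG) (M := G) (F := EG)
    (A := (TangentSpace IG : G → Type _)) (mem_baseSet_trivializationAt EG _ P.1)).mdifferentiableAt
    (by simp)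

theorem mdifferentiableAt_toTangentCoord (p : TotalSpace F A) :
    MDifferentiableAt IA 𝓘(ℝ, EG) (Φ.toTangentCoord (𝒢.u p.proj)) p :=
  mdifferentiableAt_comp_eq (I := IA) (I' := (IG).tangent) (I'' := 𝓘(ℝ, EG))
    (f := Φ.toTangent) (g := fun q : TangentBundle IG G =>
      (trivializationAt EG (TangentSpace IG : G → Type _) (𝒢.u p.proj) q).2)
    (mdifferentiableAt_trivializationAt_tangent (Φ.toTangent p)) (Φ.mdifferentiableAt_toTangent p) rfl

theorem toTangentDeriv_snd (p : TotalSpace F A) (ξ : TangentSpace IA p) :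
    (Φ.toTangentDeriv p ξ).2 =
      (mfderiv IA 𝓘(ℝ, EG) (Φ.toTangentCoord (𝒢.u p.proj)) p : EM × F →L[ℝ] EG) ξ := by
  refine (congrArg Prod.snd (eq_projDeriv_fiberDeriv (M := G) (F := EG)
    (A := (TangentSpace IG : G → Type _)) (Φ.toTangent p) (Φ.toTangentDeriv p ξ))).trans ?_
  exact (mfderiv_comp_apply_eq (I := IA) (I' := (IG).tangent) (I'' := 𝓘(ℝ, EG))
    (mdifferentiableAt_trivializationAt_tangent (Φ.toTangent p)) (Φ.mdifferentiableAt_toTangent p)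
    rfl ξ).symm

theorem toTangentDeriv_verticalLift (p : TotalSpace F A) (b : A p.proj) :
    Φ.toTangentDeriv p (verticalLift (EM := EM) p b) = (0, Φ.ι p.proj b) := by
  refine Prod.ext ?_ ?_
  · rw [toTangentDeriv_fst, projDeriv_verticalLift]
    exact map_zero _
  · rw [toTangentDeriv_snd]
    refine (mfderiv_fiberLine p b (fiberLine_zero p b) (Φ.mdifferentiableAt_toTangentCoord p)).trans ?_
    have h : (fun τ : ℝ => Φ.toTangentCoord (𝒢.u p.proj) (fiberLine p b τ)) =
        fun τ : ℝ => HAdd.hAdd (α := EG) (β := EG) (γ := EG) (Φ.ι p.proj p.2)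
          (HSMul.hSMul (α := ℝ) (β := EG) (γ := EG) τ (Φ.ι p.proj b)) := by
      funext τ
      refine (trivializationAt_self_tangent (𝒢.u p.proj) (Φ.ι p.proj (p.2 + τ • b))).trans ?_
      exact ((Φ.ι p.proj).map_add _ _).trans (congrArg _ ((Φ.ι p.proj).map_smul _ _))
    rw [h]
    have h2 : HasDerivAt (fun τ : ℝ => HAdd.hAdd (α := EG) (β := EG) (γ := EG) (Φ.ι p.proj p.2)
          (HSMul.hSMul (α := ℝ) (β := EG) (γ := EG) τ (Φ.ι p.proj b)))
          (HSMul.hSMul (α := ℝ) (β := EG) (γ := EG) (1 : ℝ) (Φ.ι p.proj b)) 0 :=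
      ((hasDerivAt_id (0 : ℝ)).smul_const _).const_add _
    exact h2.deriv.trans (one_smul ℝ _)

/-- The representation of a right invariant vector field in the chart at the unit `u x`. -/
def unitRep (a : Γ∞) (x : M) : EG → EG := chartRep IG (𝒢.u x) (Φ.rightField a)

theorem contDiffAt_unitRep (a : Γ∞) (x : M) :
    ContDiffAt ℝ ∞ (Φ.unitRep a x) (extChartAt IG (𝒢.u x) (𝒢.u x)) :=
  contDiffAt_chartRep (Φ.contMDiff_rightField a).contMDiffAt

theorem toTangentDeriv_sectionDeriv (a : Γ∞) (x : M) (X : TangentSpace IM x) :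
    Φ.toTangentDeriv ⟨x, a x⟩ (sectionDeriv a x X) =
      ((mfderiv IM IG 𝒢.u x : EM →L[ℝ] EG) X,
        fderiv ℝ (Φ.unitRep a x) (extChartAt IG (𝒢.u x) (𝒢.u x))
          ((mfderiv IM IG 𝒢.u x : EM →L[ℝ] EG) X)) := by
  refine Prod.ext ?_ ?_
  · rw [toTangentDeriv_fst, projDeriv_sectionDeriv]
  · rw [toTangentDeriv_snd]
    have hsec : MDifferentiableAt IM IA (fun y => (⟨y, a y⟩ : TotalSpace F A)) x :=
      a.contMDiff.mdifferentiableAt (by simp)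
    refine (mfderiv_comp_apply_eq (I := IM) (I' := IA) (I'' := 𝓘(ℝ, EG))
      (Φ.mdifferentiableAt_toTangentCoord ⟨x, a x⟩) hsec rfl X).symm.trans ?_
    have hu := 𝒢.smooth_u.continuous.continuousAt (x := x)
    have h1 : (fun y => Φ.toTangentCoord (𝒢.u x) ⟨y, a y⟩) =ᶠ[𝓝 x]
        fun y => (fun g => Φ.unitRep a x (extChartAt IG (𝒢.u x) g)) (𝒢.u y) := by
      filter_upwards [hu.eventually_mem (extChartAt_source_mem_nhds (I := IG) (𝒢.u x))] with y hy
      refine Eq.trans ?_ (chartRep_extChartAt hy (Φ.rightField a)).symm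
      rw [mfderiv_extChartAt_apply hy]
      exact congrArg (fun v : EG => (trivializationAt EG (TangentSpace IG : G → Type _) (𝒢.u x)
        ⟨𝒢.u y, v⟩).2) (Φ.rightField_unit a y).symm
    have h2 : MDifferentiableAt 𝓘(ℝ, EG) 𝓘(ℝ, EG) (Φ.unitRep a x)
        (extChartAt IG (𝒢.u x) (𝒢.u x)) :=
      ((Φ.contDiffAt_unitRep a x).differentiableAt (by simp)).mdifferentiableAt
    have h3 : MDifferentiableAt IG 𝓘(ℝ, EG) (extChartAt IG (𝒢.u x)) (𝒢.u x) :=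
      mdifferentiableAt_extChartAt (mem_chart_source _ _)
    refine (mfderiv_congr_apply (I := IM) (I' := 𝓘(ℝ, EG)) h1 X).trans ?_
    refine (mfderiv_comp_apply_eq (I := IM) (I' := IG) (I'' := 𝓘(ℝ, EG))
      (g := fun g => Φ.unitRep a x (extChartAt IG (𝒢.u x) g))
      (mdifferentiableAt_comp_eq (I := IG) (I' := 𝓘(ℝ, EG)) (I'' := 𝓘(ℝ, EG)) h2 h3 rfl)
      (LieGroupoid.mdifferentiableAt_u (𝒢 := 𝒢) x) rfl X).trans ?_
    refine (mfderiv_comp_apply_eq (I := IG) (I' := 𝓘(ℝ, EG)) (I'' := 𝓘(ℝ, EG)) h2 h3 rfl _).trans ?_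
    rw [mfderiv_eq_fderiv]
    exact congrArg _ (congrArg (fun L : EG →L[ℝ] EG => L _) mfderiv_extChartAt_self)

end LieGroupoid.Algebroid
end ToTangentDeriv

end

noncomputable section

open scoped Topology
open VectorField

section RelatedFields
variable {EM : Type*} [NormedAddCommGroup EM] [NormedSpace ℝ EM] [FiniteDimensional ℝ EM]
  {M : Type*} [TopologicalSpace M] [ChartedSpace EM M] [IsManifold 𝓘(ℝ, EM) ∞ M]
  {EG : Type*} [NormedAddCommGroup EG] [NormedSpace ℝ EG] [FiniteDimensional ℝ EG]
  {G : Type*} [TopologicalSpace G] [ChartedSpace EG G] [IsManifold 𝓘(ℝ, EG) ∞ G]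

local notation "IG" => modelWithCornersSelf ℝ EG
local notation "IM" => modelWithCornersSelf ℝ EM

variable {q : G → M} {x : M} {g₀ : G}

theorem fderiv_chartMap_self (hq : ContMDiff IG IM ∞ q) (hx : q g₀ = x) (w : EG) :
    fderiv ℝ (chartMap q x g₀ : EG → EM) (extChartAt IG g₀ g₀) w =
      (mfderiv IG IM q g₀ : EG →L[ℝ] EM) w := by
  subst hx
  have h := fderiv_chartMap hq (mem_extChartAt_source g₀) (mem_extChartAt_source (I := IM) (q g₀)) w
  refine Eq.trans ?_ (h.symm.trans (trivializationAt_self_tangent (EG := EM) (q g₀) _))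
  exact congrArg _ (trivializationAt_self_tangent (EG := EG) g₀ w).symm

theorem fderiv_chartMap_related (hq : ContMDiff IG IM ∞ q) (hx : q g₀ = x)
    {V : ∀ g : G, TangentSpace IG g} {W : ∀ y : M, TangentSpace IM y}
    (h : ∀ g, (mfderiv IG IM q g : EG →L[ℝ] EM) (V g) = W (q g)) :
    ∀ᶠ e in 𝓝 (extChartAt IG g₀ g₀), fderiv ℝ (chartMap q x g₀ : EG → EM) e (chartRep IG g₀ V e) =
      chartRep IM x W (chartMap q x g₀ e) := by
  have hφ : ContinuousAt (fun e => q ((extChartAt IG g₀).symm e)) (extChartAt IG g₀ g₀) :=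
    hq.continuous.continuousAt.comp (continuousAt_extChartAt_symm g₀)
  have hφ0 : q ((extChartAt IG g₀).symm (extChartAt IG g₀ g₀)) = x := by
    rw [extChartAt_to_inv, hx]
  filter_upwards [extChartAt_target_mem_nhds (I := IG) g₀, hφ.eventually_mem
    (by rw [hφ0]; exact extChartAt_source_mem_nhds (I := IM) x)] with e he1 he2
  have hs := (extChartAt IG g₀).map_target he1
  have h1 := fderiv_chartMap hq hs he2 (V ((extChartAt IG g₀).symm e))
  rw [(extChartAt IG g₀).right_inv he1] at h1
  refine Eq.trans ?_ (h1.symm.trans ?_)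
  · exact congrArg _ (mfderiv_extChartAt_apply hs _)
  · refine Eq.trans ?_ (chartRep_extChartAt he2 W).symm
    rw [mfderiv_extChartAt_apply he2]
    exact congrArg (fun v : EM => (trivializationAt EM (TangentSpace IM : M → Type _) x ⟨_, v⟩).2)
      (h _)

/-- The second order identity satisfied by related vector fields. -/
theorem fderiv_fderiv_chartMap (hq : ContMDiff IG IM ∞ q) (hx : q g₀ = x)
    {V : ∀ g : G, TangentSpace IG g} {W : ∀ y : M, TangentSpace IM y}
    (hV : ContMDiff IG (IG).tangent ∞ (fun g => (⟨g, V g⟩ : TangentBundle IG G)))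
    (hW : ContMDiff IM (IM).tangent ∞ (fun y => (⟨y, W y⟩ : TangentBundle IM M)))
    (h : ∀ g, (mfderiv IG IM q g : EG →L[ℝ] EM) (V g) = W (q g)) (w : EG) :
    fderiv ℝ (fderiv ℝ (chartMap q x g₀ : EG → EM)) (extChartAt IG g₀ g₀) (V g₀) w +
        fderiv ℝ (chartMap q x g₀ : EG → EM) (extChartAt IG g₀ g₀)
          (fderiv ℝ (chartRep IG g₀ V) (extChartAt IG g₀ g₀) w) =
      fderiv ℝ (chartRep IM x W) (extChartAt IM x x) ((mfderiv IG IM q g₀ : EG →L[ℝ] EM) w) := by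
  have h0 : (chartMap q x g₀ : EG → EM) (extChartAt IG g₀ g₀) = extChartAt IM x x := by
    unfold chartMap; rw [extChartAt_to_inv, hx]
  have h1 := fderiv_related (contDiffAt_chartMap hq hx)
    (P := chartRep IG g₀ V) (Θ := chartRep IM x W)
    ((contDiffAt_chartRep hV.contMDiffAt).differentiableAt (by simp))
    (by rw [h0]; exact (contDiffAt_chartRep hW.contMDiffAt).differentiableAt (by simp))
    (fderiv_chartMap_related hq hx h) w
  rw [h0, chartRep_self] at h1
  exact h1.trans (congrArg _ (fderiv_chartMap_self hq hx w))

end RelatedFields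

section DeltaDeriv
variable {EM : Type*} [NormedAddCommGroup EM] [NormedSpace ℝ EM] [FiniteDimensional ℝ EM]
  {M : Type*} [TopologicalSpace M] [T2Space M] [ChartedSpace EM M] [IsManifold 𝓘(ℝ, EM) ∞ M]
  {EG : Type*} [NormedAddCommGroup EG] [NormedSpace ℝ EG] [FiniteDimensional ℝ EG]
  {G : Type*} [TopologicalSpace G] [ChartedSpace EG G] [IsManifold 𝓘(ℝ, EG) ∞ G]
  {F : Type*} [NormedAddCommGroup F] [NormedSpace ℝ F] [FiniteDimensional ℝ F]
  {A : M → Type*} [TopologicalSpace (TotalSpace F A)] [∀ x, TopologicalSpace (A x)]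
  [FiberBundle F A] [∀ x, AddCommGroup (A x)] [∀ x, Module ℝ (A x)] [VectorBundle ℝ F A]
  [ContMDiffVectorBundle ∞ F A 𝓘(ℝ, EM)]
  {𝒢 : LieGroupoid EM M EG G} {𝒜 : LieAlgebroid EM M F A} (Φ : 𝒢.Algebroid 𝒜)
  (U : BundleMap 𝓘(ℝ, EM) EM (TangentSpace 𝓘(ℝ, EM) : M → Type _) F A)

local notation "Γ∞" => Cₛ^∞⟮𝓘(ℝ, EM); F, A⟯
local notation "IG" => modelWithCornersSelf ℝ EG
local notation "IM" => modelWithCornersSelf ℝ EM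
local notation "IA" => ModelWithCorners.prod 𝓘(ℝ, EM) 𝓘(ℝ, F)

omit [FiniteDimensional ℝ EM] [T2Space M] in
/-- A bracket with a vector field which is constant in the chart. -/
theorem mlieBracket_isFrameNear {x : M} {c : EM →ₗ[ℝ] VectorFields IM M} (hc : IsFrameNear x c)
    (V : ∀ y : M, TangentSpace IM y) (w : EM) :
    (mlieBracket IM V (c w) x : EM) = -fderiv ℝ (chartRep IM x V) (extChartAt IM x x) w := by
  have h1 : chartRep IM x (c w) =ᶠ[𝓝 (extChartAt IM x x)] fun _ => w := by
    have hφ : ContinuousAt (extChartAt IM x).symm (extChartAt IM x x) :=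
      continuousAt_extChartAt_symm x
    unfold ContinuousAt at hφ
    rw [extChartAt_to_inv] at hφ
    filter_upwards [extChartAt_target_mem_nhds (I := IM) x, hφ.eventually hc] with e he1 he2
    have hs := (extChartAt IM x).map_target he1
    have hb : (extChartAt IM x).symm e ∈
        (trivializationAt EM (TangentSpace IM : M → Type _) x).baseSet := by
      rw [extChartAt_source] at hs; simpa using hs
    refine (mfderiv_extChartAt_apply hs _).trans ?_
    rw [he2 w, Trivialization.apply_mk_symm _ hb]
  refine (mlieBracket_eq_lieBracket x V (c w)).trans ?_
  rw [lieBracket, h1.fderiv_eq, h1.self_of_nhds]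
  simp
  rfl

namespace LieGroupoid.Algebroid

omit [FiniteDimensional ℝ EM] [FiniteDimensional ℝ EG] [T2Space M] [FiniteDimensional ℝ F] in
theorem dt_ι (x : M) (v : A x) :
    (mfderiv IG IM 𝒢.t (𝒢.u x) : EG →L[ℝ] EM) (Φ.ι x v) = 𝒜.anchor x v :=
  (Φ.anchor x v).symm

omit [T2Space M] [FiniteDimensional ℝ F] in
theorem ι_add_dinv (x : M) (v : A x) :
    HAdd.hAdd (α := EG) (β := EG) (γ := EG) (Φ.ι x v) (𝒢.dinv x (Φ.ι x v)) =
      (mfderiv IM IG 𝒢.u x : EM →L[ℝ] EG) (𝒜.anchor x v) :=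
  (LieGroupoid.add_dinv (Φ.ds_ι x v)).trans (congrArg _ (Φ.dt_ι x v))

/-- `δU` on the vectors tangent to the units. -/
theorem delta_unit (x : M) (X : TangentSpace IM x) :
    (Φ.delta U (𝒢.u x) ((mfderiv IM IG 𝒢.u x : EM →L[ℝ] EG) X) : EG) =
      (mfderiv IM IG 𝒢.u x : EM →L[ℝ] EG) (𝒜.anchor x (U x X)) := by
  obtain ⟨c, hc, hcx⟩ := exists_isFrameNear (EM := EM) x
  have h1 := (Φ.factorsNear_rightLift U hc (𝒢.t_u x)).self_of_nhds
    ((mfderiv IM IG 𝒢.u x : EM →L[ℝ] EG) X)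
  have h2 := (Φ.factorsNear_leftLift U hc (𝒢.s_u x)).self_of_nhds
    ((mfderiv IM IG 𝒢.u x : EM →L[ℝ] EG) X)
  have key : ∀ (y : M) (Y : EM), y = x → Y = X →
      (trivializationAt EM (TangentSpace IM : M → Type _) x ⟨y, Y⟩).2 = X := by
    rintro y Y rfl rfl; exact trivializationAt_self_tangent (EG := EM) y _
  have k1 := key _ _ (𝒢.t_u x) (LieGroupoid.mfderiv_t_mfderiv_u (𝒢 := 𝒢) x X)
  have k2 := key _ _ (𝒢.s_u x) (LieGroupoid.mfderiv_s_mfderiv_u (𝒢 := 𝒢) x X)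
  have e1 : (Φ.rightLift U (𝒢.u x) ((mfderiv IM IG 𝒢.u x : EM →L[ℝ] EG) X) : EG) = Φ.ι x (U x X) :=
    h1.trans ((congrArg (fun w : EM => (Φ.rightFamily U c w (𝒢.u x) : EG)) k1).trans
      ((Φ.rightField_unit _ x).trans (congrArg (fun v => (Φ.ι x (U x v) : EG)) (hcx X))))
  have e2 : (Φ.leftLift U (𝒢.u x) ((mfderiv IM IG 𝒢.u x : EM →L[ℝ] EG) X) : EG) =
      𝒢.dinv x (Φ.ι x (U x X)) :=
    h2.trans ((congrArg (fun w : EM => (Φ.leftFamily U c w (𝒢.u x) : EG)) k2).trans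
      ((Φ.leftField_unit _ x).trans (congrArg (fun v => (𝒢.dinv x (Φ.ι x (U x v)) : EG)) (hcx X))))
  exact (congrArg₂ (fun v w : EG => v + w) e1 e2).trans (Φ.ι_add_dinv x _)

/-- The bracket of right invariant vector fields at a unit, in the chart. -/
theorem fderiv_unitRep (a b : Γ∞) (x : M) :
    fderiv ℝ (Φ.unitRep b x) (extChartAt IG (𝒢.u x) (𝒢.u x)) (Φ.ι x (a x)) =
      HAdd.hAdd (α := EG) (β := EG) (γ := EG) (Φ.ι x (𝒜.bracket a b x))
        (fderiv ℝ (Φ.unitRep a x) (extChartAt IG (𝒢.u x) (𝒢.u x)) (Φ.ι x (b x))) := by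
  have h1 := Φ.bracket a b (𝒢.u x)
  have h2 : (Φ.rightField (𝒜.bracket a b) (𝒢.u x) : EG) =
      mlieBracket IG (Φ.rightField a) (Φ.rightField b) (𝒢.u x) := h1
  have h3 := (Φ.rightField_unit _ x).symm.trans (h2.trans (mlieBracket_eq_lieBracket _ _ _))
  have h4 : Φ.unitRep a x (extChartAt IG (𝒢.u x) (𝒢.u x)) = Φ.ι x (a x) :=
    (chartRep_self _ _).trans (Φ.rightField_unit a x)
  have h5 : Φ.unitRep b x (extChartAt IG (𝒢.u x) (𝒢.u x)) = Φ.ι x (b x) :=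
    (chartRep_self _ _).trans (Φ.rightField_unit b x)
  rw [← h4, ← h5]
  exact (sub_eq_iff_eq_add.1 h3.symm)

end LieGroupoid.Algebroid
end DeltaDeriv

end

noncomputable section

open scoped Topology
open VectorField

theorem fderiv_factorMap_add {E : Type*} [NormedAddCommGroup E] [NormedSpace ℝ E]
    {E' : Type*} [NormedAddCommGroup E'] [NormedSpace ℝ E']
    {E'' : Type*} [NormedAddCommGroup E''] [NormedSpace ℝ E'']
    {q : E → E'} {R : E → E' →L[ℝ] E''} {e₀ : E} (hq : ContDiffAt ℝ ∞ q e₀)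
    (hR : ContDiffAt ℝ ∞ R e₀) {w₀ z β : E} (α : E) {X Y Z : E'} (hX : fderiv ℝ q e₀ w₀ = X)
    (hY : fderiv ℝ (fderiv ℝ q) e₀ α w₀ + fderiv ℝ q e₀ z = Y) (hZ : fderiv ℝ q e₀ β = Z) :
    fderiv ℝ (factorMap q R) (e₀, w₀) (α, z + β) =
      fderiv ℝ (fun e => R e X) e₀ α + R e₀ (Y + Z) := by
  rw [fderiv_factorMap hq hR, hX, map_add (fderiv ℝ q e₀), ← add_assoc, hY, hZ]

section DeltaTriple
variable {EM : Type*} [NormedAddCommGroup EM] [NormedSpace ℝ EM] [FiniteDimensional ℝ EM]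
  {M : Type*} [TopologicalSpace M] [T2Space M] [ChartedSpace EM M] [IsManifold 𝓘(ℝ, EM) ∞ M]
  {EG : Type*} [NormedAddCommGroup EG] [NormedSpace ℝ EG] [FiniteDimensional ℝ EG]
  {G : Type*} [TopologicalSpace G] [ChartedSpace EG G] [IsManifold 𝓘(ℝ, EG) ∞ G]
  {F : Type*} [NormedAddCommGroup F] [NormedSpace ℝ F] [FiniteDimensional ℝ F]
  {A : M → Type*} [TopologicalSpace (TotalSpace F A)] [∀ x, TopologicalSpace (A x)]
  [FiberBundle F A] [∀ x, AddCommGroup (A x)] [∀ x, Module ℝ (A x)] [VectorBundle ℝ F A]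
  [ContMDiffVectorBundle ∞ F A 𝓘(ℝ, EM)]
  {𝒢 : LieGroupoid EM M EG G} {𝒜 : LieAlgebroid EM M F A} (Φ : 𝒢.Algebroid 𝒜)
  (U : BundleMap 𝓘(ℝ, EM) EM (TangentSpace 𝓘(ℝ, EM) : M → Type _) F A)

local notation "Γ∞" => Cₛ^∞⟮𝓘(ℝ, EM); F, A⟯
local notation "IG" => modelWithCornersSelf ℝ EG
local notation "IM" => modelWithCornersSelf ℝ EM
local notation "IA" => ModelWithCorners.prod 𝓘(ℝ, EM) 𝓘(ℝ, F)

namespace LieGroupoid.Algebroid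

/-- The inclusion `A_x → T_{u x} G`, with values in the model space. -/
def ιE (x : M) : A x →ₗ[ℝ] EG := Φ.ι x

/-- The derivative of the unit map at `x`, as a map of the model spaces. -/
def du (_ : 𝒢.Algebroid 𝒜) (x : M) : EM →L[ℝ] EG := mfderiv IM IG 𝒢.u x

/-- The derivative of `δU : TG → TG` on the vectors tangent to the Lie algebroid of `TG`. -/
theorem mfderiv_delta (a : Γ∞) (x : M) (X : TangentSpace IM x) (b : A x) :
    (mfderiv (IG).tangent (IG).tangent (tensorMap (Φ.delta U)) ⟨𝒢.u x, Φ.du x X⟩ :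
        EG × EG →L[ℝ] EG × EG)
      (Φ.ιE x (a x), fderiv ℝ (Φ.unitRep a x) (extChartAt IG (𝒢.u x) (𝒢.u x)) (Φ.du x X) + Φ.ιE x b) =
    (Φ.ιE x (a x), fderiv ℝ (Φ.unitRep a x) (extChartAt IG (𝒢.u x) (𝒢.u x))
        (Φ.du x (𝒜.anchor x (U x X))) +
      Φ.ιE x ((lieTriple 𝒜 U).D a x X + U x (𝒜.anchor x b))) := by
  obtain ⟨c, hc, hcx⟩ := exists_isFrameNear (EM := EM) x
  obtain ⟨R, S, hR, hS, hR2, hS2, h⟩ := Φ.exists_delta_chart U hc hc (𝒢.t_u x) (𝒢.s_u x)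
  set e₀ := extChartAt IG (𝒢.u x) (𝒢.u x) with he₀
  have ht := contDiffAt_chartMap 𝒢.smooth_t (𝒢.t_u x)
  have hs := contDiffAt_chartMap 𝒢.smooth_s (𝒢.s_u x)
  have hNt := contDiffAt_factorMap ht hR (Φ.du x X)
  have hNs := contDiffAt_factorMap hs hS (Φ.du x X)
  refine (mfderiv_tensorMap (Φ.contMDiff_delta U) (hNt.add hNs) (h (Φ.du x X)) _).trans ?_
  refine Prod.ext rfl ?_
  set z := fderiv ℝ (Φ.unitRep a x) e₀ (Φ.du x X) with hz
  set α := Φ.ιE x (a x) with hα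
  change fderiv ℝ (factorMap (chartMap 𝒢.t x (𝒢.u x)) R + factorMap (chartMap 𝒢.s x (𝒢.u x)) S)
    (e₀, Φ.du x X) (α, z + Φ.ιE x b) = _
  have hdt : ∀ w : EG, fderiv ℝ (chartMap 𝒢.t x (𝒢.u x) : EG → EM) e₀ w =
      (mfderiv IG IM 𝒢.t (𝒢.u x) : EG →L[ℝ] EM) w :=
    fderiv_chartMap_self 𝒢.smooth_t (𝒢.t_u x)
  have hds : ∀ w : EG, fderiv ℝ (chartMap 𝒢.s x (𝒢.u x) : EG → EM) e₀ w =
      (mfderiv IG IM 𝒢.s (𝒢.u x) : EG →L[ℝ] EM) w :=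
    fderiv_chartMap_self 𝒢.smooth_s (𝒢.s_u x)
  have hdtu : fderiv ℝ (chartMap 𝒢.t x (𝒢.u x) : EG → EM) e₀ (Φ.du x X) = X :=
    (hdt _).trans (LieGroupoid.mfderiv_t_mfderiv_u (𝒢 := 𝒢) x X)
  have hdsu : fderiv ℝ (chartMap 𝒢.s x (𝒢.u x) : EG → EM) e₀ (Φ.du x X) = X :=
    (hds _).trans (LieGroupoid.mfderiv_s_mfderiv_u (𝒢 := 𝒢) x X)
  have hdtι : fderiv ℝ (chartMap 𝒢.t x (𝒢.u x) : EG → EM) e₀ (Φ.ιE x b) = 𝒜.anchor x b :=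
    (hdt _).trans (Φ.dt_ι x b)
  have hdsι : fderiv ℝ (chartMap 𝒢.s x (𝒢.u x) : EG → EM) e₀ (Φ.ιE x b) = 0 :=
    (hds _).trans (Φ.ds_ι x b)
  have hα' : Φ.rightField a (𝒢.u x) = α := Φ.rightField_unit a x
  set Θ := fderiv ℝ (chartRep IM x (𝒜.anchor.onSection a)) (extChartAt IM x x) with hΘ
  have h2t : fderiv ℝ (fderiv ℝ (chartMap 𝒢.t x (𝒢.u x) : EG → EM)) e₀ α (Φ.du x X) +
      fderiv ℝ (chartMap 𝒢.t x (𝒢.u x) : EG → EM) e₀ z = Θ X := by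
    have := fderiv_fderiv_chartMap 𝒢.smooth_t (𝒢.t_u x) (Φ.contMDiff_rightField a)
      (𝒜.anchor.onSection a).contMDiff (Φ.dt_rightField a) (Φ.du x X)
    refine Eq.trans ?_ (this.trans (congrArg _
      (LieGroupoid.mfderiv_t_mfderiv_u (𝒢 := 𝒢) x X)))
    exact congrArg (fun v : EG => fderiv ℝ (fderiv ℝ (chartMap 𝒢.t x (𝒢.u x) : EG → EM)) e₀ v
      (Φ.du x X) + fderiv ℝ (chartMap 𝒢.t x (𝒢.u x) : EG → EM) e₀ z) hα'.symm
  have h2s : fderiv ℝ (fderiv ℝ (chartMap 𝒢.s x (𝒢.u x) : EG → EM)) e₀ α (Φ.du x X) +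
      fderiv ℝ (chartMap 𝒢.s x (𝒢.u x) : EG → EM) e₀ z = 0 := by
    have := fderiv_fderiv_chartMap 𝒢.smooth_s (𝒢.s_u x) (Φ.contMDiff_rightField a)
      (0 : VectorFields IM M).contMDiff (Φ.ds_rightField a) (Φ.du x X)
    have h0 : chartRep IM x (0 : VectorFields IM M) = fun _ => 0 := funext fun e => map_zero _
    rw [h0, fderiv_const_apply] at this
    refine Eq.trans ?_ this
    exact congrArg (fun v : EG => fderiv ℝ (fderiv ℝ (chartMap 𝒢.s x (𝒢.u x) : EG → EM)) e₀ v
      (Φ.du x X) + fderiv ℝ (chartMap 𝒢.s x (𝒢.u x) : EG → EM) e₀ z) hα'.symm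
  have hRe : ∀ w : EM, R e₀ w = Φ.ιE x (U x w) := fun w =>
    (hR2 e₀ w).trans ((chartRep_self _ _).trans ((Φ.rightField_unit _ x).trans
      (congrArg (fun v => Φ.ιE x (U x v)) (hcx w))))
  have hR1 : fderiv ℝ (fun e => R e X) e₀ α = fderiv ℝ (Φ.unitRep (U.onSection (c X)) x) e₀ α := by
    congr 1
    exact congrArg (fun f => fderiv ℝ f e₀) (funext fun e => hR2 e X)
  have hS1 : fderiv ℝ (fun e => S e X) e₀ α =
      fderiv ℝ (chartRep IG (𝒢.u x) (Φ.leftField (U.onSection (c X)))) e₀ α := by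
    congr 1
    exact congrArg (fun f => fderiv ℝ f e₀) (funext fun e => hS2 e X)
  have hUX : U.onSection (c X) x = U x X := congrArg (U x) (hcx X)
  have hR3 : fderiv ℝ (Φ.unitRep (U.onSection (c X)) x) e₀ α =
      Φ.ιE x (𝒜.bracket a (U.onSection (c X)) x) + fderiv ℝ (Φ.unitRep a x) e₀ (Φ.ιE x (U x X)) := by
    have := Φ.fderiv_unitRep a (U.onSection (c X)) x
    rw [hUX] at this
    exact this
  have hS3 : fderiv ℝ (chartRep IG (𝒢.u x) (Φ.leftField (U.onSection (c X)))) e₀ α =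
      fderiv ℝ (Φ.unitRep a x) e₀ (𝒢.dinv x (Φ.ι x (U x X))) := by
    have h1 := Φ.fderiv_rightField_leftField a (U.onSection (c X)) x
    have h2 := Φ.leftField_unit (U.onSection (c X)) x
    rw [hUX] at h2
    exact (congrArg _ hα').symm.trans (h1.symm.trans (congrArg _ h2))
  have hD : (lieTriple 𝒜 U).D a x X = 𝒜.bracket a (U.onSection (c X)) x + U x (Θ X) := by
    have h1 := lieTriple_D 𝒜 U a (c X) x
    have h2 : mlieBracket IM (𝒜.anchor.onSection a) (c X) x = -Θ X :=
      mlieBracket_isFrameNear hc _ X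
    have h3 : U x (mlieBracket IM (𝒜.anchor.onSection a) (c X) x) = -U x (Θ X) :=
      (congrArg (U x) h2).trans ((U x).map_neg _)
    rw [h3, sub_neg_eq_add] at h1
    exact (congrArg ((lieTriple 𝒜 U).D a x) (hcx X)).symm.trans h1
  have hι := Φ.ι_add_dinv x (U x X)
  have e1 : fderiv ℝ (factorMap (chartMap 𝒢.t x (𝒢.u x)) R + factorMap (chartMap 𝒢.s x (𝒢.u x)) S)
      (e₀, Φ.du x X) = fderiv ℝ (factorMap (chartMap 𝒢.t x (𝒢.u x)) R) (e₀, Φ.du x X) +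
        fderiv ℝ (factorMap (chartMap 𝒢.s x (𝒢.u x)) S) (e₀, Φ.du x X) :=
    fderiv_add (hNt.differentiableAt (by simp)) (hNs.differentiableAt (by simp))
  have et := fderiv_factorMap_add ht hR α hdtu h2t hdtι
  have es := fderiv_factorMap_add hs hS α hdsu h2s hdsι
  rw [e1, add_apply]
  refine (congrArg₂ (fun v w : EG => v + w) et es).trans ?_
  have h3 : S e₀ (0 + 0) = 0 := by rw [add_zero, map_zero]
  have h4 : R e₀ (HAdd.hAdd (α := EM) (β := EM) (γ := EM) (Θ X) (𝒜.anchor x b)) = Φ.ιE x (U x (Θ X)) + Φ.ιE x (U x (𝒜.anchor x b)) :=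
    (map_add _ _ _).trans (congrArg₂ (fun v w : EG => v + w) (hRe _) (hRe _))
  have h5 : fderiv ℝ (Φ.unitRep a x) e₀ (Φ.du x (𝒜.anchor x (U x X))) =
      fderiv ℝ (Φ.unitRep a x) e₀ (Φ.ιE x (U x X)) +
        fderiv ℝ (Φ.unitRep a x) e₀ (𝒢.dinv x (Φ.ι x (U x X))) :=
    (congrArg _ hι.symm).trans (map_add _ _ _)
  change _ = fderiv ℝ (Φ.unitRep a x) e₀ (Φ.du x (𝒜.anchor x (U x X))) + _
  rw [h5, hD, hR1, hR3, hS1, hS3, h4, h3, map_add, map_add]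
  abel

end LieGroupoid.Algebroid
end DeltaTriple

end

noncomputable section

open scoped Topology
open VectorField

section Derivative
variable {EM : Type*} [NormedAddCommGroup EM] [NormedSpace ℝ EM] [FiniteDimensional ℝ EM]
  {M : Type*} [TopologicalSpace M] [T2Space M] [ChartedSpace EM M] [IsManifold 𝓘(ℝ, EM) ∞ M]
  {EG : Type*} [NormedAddCommGroup EG] [NormedSpace ℝ EG] [FiniteDimensional ℝ EG]
  {G : Type*} [TopologicalSpace G] [ChartedSpace EG G] [IsManifold 𝓘(ℝ, EG) ∞ G]
  {F : Type*} [NormedAddCommGroup F] [NormedSpace ℝ F] [FiniteDimensional ℝ F]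
  {A : M → Type*} [TopologicalSpace (TotalSpace F A)] [∀ x, TopologicalSpace (A x)]
  [FiberBundle F A] [∀ x, AddCommGroup (A x)] [∀ x, Module ℝ (A x)] [VectorBundle ℝ F A]
  [ContMDiffVectorBundle ∞ F A 𝓘(ℝ, EM)]
  {𝒢 : LieGroupoid EM M EG G} {𝒜 : LieAlgebroid EM M F A} (Φ : 𝒢.Algebroid 𝒜)
  (U : BundleMap 𝓘(ℝ, EM) EM (TangentSpace 𝓘(ℝ, EM) : M → Type _) F A)

local notation "Γ∞" => Cₛ^∞⟮𝓘(ℝ, EM); F, A⟯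
local notation "IG" => modelWithCornersSelf ℝ EG
local notation "IM" => modelWithCornersSelf ℝ EM
local notation "IA" => ModelWithCorners.prod 𝓘(ℝ, EM) 𝓘(ℝ, F)

omit [FiniteDimensional ℝ EM] [T2Space M] [FiniteDimensional ℝ F] in
/-- The vertical lift at a point is linear. -/
theorem exists_verticalLift_linear (p : TotalSpace F A) :
    ∃ L : A p.proj →ₗ[ℝ] TangentSpace IA p, ∀ b, L b = verticalLift (EM := EM) p b := by
  have hp1 := mem_baseSet_trivializationAt F A p.proj
  have hp2 := mem_extChartAt_source (I := IM) p.proj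
  have hlin := (trivializationAt F A p.proj).linear ℝ hp1
  refine ⟨LinearMap.ofAddSMul (verticalLift (EM := EM) p) fun b b' r => ?_, fun b => rfl⟩
  refine tangent_totalSpace_ext (x₀ := p.proj) hp1 hp2 ?_ ?_
  · rw [map_add, map_smul, projDeriv_verticalLift, projDeriv_verticalLift, projDeriv_verticalLift,
      smul_zero, add_zero]
  · rw [map_add, map_smul, fiberDeriv_verticalLift hp1, fiberDeriv_verticalLift hp1,
      fiberDeriv_verticalLift hp1]
    exact (hlin.map_add _ _).trans (congrArg _ (hlin.map_smul _ _))

omit [FiniteDimensional ℝ EM] [T2Space M] [FiniteDimensional ℝ F] in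
/-- The decomposition of the tangent vectors of `A` given by a section is linear. -/
theorem exists_vertical_part (c : Γ∞) (x : M) :
    ∃ β : TangentSpace IA (⟨x, c x⟩ : TotalSpace F A) →ₗ[ℝ] A x, ∀ ξ,
      ξ = sectionDeriv c x (projDeriv (EM := EM) (⟨x, c x⟩ : TotalSpace F A) ξ) +
        verticalLift (EM := EM) (⟨x, c x⟩ : TotalSpace F A) (β ξ) := by
  have hp1 := mem_baseSet_trivializationAt F A x
  have hp2 := mem_extChartAt_source (I := IM) x
  refine ⟨((trivializationAt F A x).symmₗ ℝ x) ∘ₗ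
    ((fiberDeriv (EM := EM) x (⟨x, c x⟩ : TotalSpace F A)).toLinearMap -
      (sectionCoordDeriv x c x).toLinearMap ∘ₗ projDeriv (EM := EM) (⟨x, c x⟩ : TotalSpace F A)),
    fun ξ => eq_sectionDeriv_add_verticalLift hp1 hp2 ?_⟩
  refine eq_add_of_sub_eq' (Eq.symm ?_)
  exact (congrArg (fun b => (trivializationAt F A x ⟨x, b⟩).2)
    (congrFun ((trivializationAt F A x).coe_symmₗ (R := ℝ) hp1) _)).trans
      (congrArg Prod.snd (Trivialization.apply_mk_symm _ hp1 _))

namespace LieGroupoid.Algebroid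

omit [T2Space M] [FiniteDimensional ℝ F] in
theorem toTangentDeriv_add (c : Γ∞) (x : M) (X : TangentSpace IM x) (b : A x) :
    Φ.toTangentDeriv ⟨x, c x⟩ (sectionDeriv c x X +
        verticalLift (EM := EM) (⟨x, c x⟩ : TotalSpace F A) b) =
      (Φ.du x X, fderiv ℝ (Φ.unitRep c x) (extChartAt IG (𝒢.u x) (𝒢.u x)) (Φ.du x X) + Φ.ιE x b) := by
  refine ((Φ.toTangentDeriv ⟨x, c x⟩).map_add _ _).trans ?_
  refine (congrArg₂ (fun v w : EG × EG => v + w) (Φ.toTangentDeriv_sectionDeriv c x X)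
    (Φ.toTangentDeriv_verticalLift ⟨x, c x⟩ b)).trans ?_
  exact Prod.ext (add_zero _) rfl

theorem toTangentDeriv_injective (p : TotalSpace F A) : Function.Injective (Φ.toTangentDeriv p) := by
  obtain ⟨x, v⟩ := p
  obtain ⟨c, hc⟩ := exists_section_apply_eq (IB := 𝓘(ℝ, EM)) (F := F) x v
  subst hc
  obtain ⟨β, hβ⟩ := exists_vertical_part (EM := EM) c x
  intro ξ ξ' h
  have h1 := (Φ.toTangentDeriv_add c x _ _).symm.trans (((congrArg (Φ.toTangentDeriv ⟨x, c x⟩)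
    (hβ ξ)).symm.trans (h.trans (congrArg (Φ.toTangentDeriv ⟨x, c x⟩) (hβ ξ')))).trans
    (Φ.toTangentDeriv_add c x _ _))
  have h2 := congrArg Prod.fst h1
  have h3 : projDeriv (EM := EM) (⟨x, c x⟩ : TotalSpace F A) ξ =
      projDeriv (EM := EM) (⟨x, c x⟩ : TotalSpace F A) ξ' :=
    (LieGroupoid.mfderiv_s_mfderiv_u (𝒢 := 𝒢) x _).symm.trans
      ((congrArg (mfderiv IG IM 𝒢.s (𝒢.u x) : EG →L[ℝ] EM) h2).trans
        (LieGroupoid.mfderiv_s_mfderiv_u (𝒢 := 𝒢) x _))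
  have h4 := congrArg Prod.snd h1
  rw [h3] at h4
  have h5 : β ξ = β ξ' := Φ.injective x (add_left_cancel (G := EG) h4)
  refine (hβ ξ).trans (Eq.trans ?_ (hβ ξ').symm)
  rw [h3, h5]

/-- The flipped derivative of `δU` on the image of `TA`. -/
theorem flip_tangentMap_delta (c : Γ∞) (x : M) (X : TangentSpace IM x) (b : A x) :
    canonicalFlip (tangentMap (IG).tangent (IG).tangent (tensorMap (Φ.delta U))
      (canonicalFlip (tangentMap IA (IG).tangent Φ.toTangent
        ⟨⟨x, c x⟩, sectionDeriv c x X + verticalLift (EM := EM) (⟨x, c x⟩ : TotalSpace F A) b⟩))) =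
    tangentMap IA (IG).tangent Φ.toTangent
      ⟨⟨x, c x⟩, sectionDeriv c x ((lieTriple 𝒜 U).TM x X) +
        verticalLift (EM := EM) (⟨x, c x⟩ : TotalSpace F A)
          ((lieTriple 𝒜 U).D c x X + (lieTriple 𝒜 U).ℓ x b)⟩ := by
  have h1 := Φ.toTangentDeriv_add c x X b
  have h2 := Φ.toTangentDeriv_add c x ((lieTriple 𝒜 U).TM x X)
    ((lieTriple 𝒜 U).D c x X + (lieTriple 𝒜 U).ℓ x b)
  have h3 : canonicalFlip (tangentMap IA (IG).tangent Φ.toTangent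
        ⟨⟨x, c x⟩, sectionDeriv c x X + verticalLift (EM := EM) (⟨x, c x⟩ : TotalSpace F A) b⟩) =
      (⟨⟨𝒢.u x, Φ.du x X⟩, (Φ.ιE x (c x),
        fderiv ℝ (Φ.unitRep c x) (extChartAt IG (𝒢.u x) (𝒢.u x)) (Φ.du x X) + Φ.ιE x b)⟩ :
        TangentBundle (IG).tangent (TangentBundle IG G)) :=
    congrArg (fun w : EG × EG => canonicalFlip
      (⟨Φ.toTangent ⟨x, c x⟩, w⟩ : TangentBundle (IG).tangent (TangentBundle IG G))) h1
  rw [h3]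
  have h4 := Φ.mfderiv_delta U c x X b
  refine (congrArg (fun w : EG × EG => canonicalFlip
      (⟨tensorMap (Φ.delta U) ⟨𝒢.u x, Φ.du x X⟩, w⟩ :
        TangentBundle (IG).tangent (TangentBundle IG G))) h4).trans ?_
  refine Eq.trans ?_ (congrArg (fun w : EG × EG =>
      (⟨Φ.toTangent ⟨x, c x⟩, w⟩ : TangentBundle (IG).tangent (TangentBundle IG G))) h2).symm
  exact congrArg (fun w : EG => (⟨Φ.toTangent ⟨x, c x⟩, (w, _)⟩ :
    TangentBundle (IG).tangent (TangentBundle IG G))) (Φ.delta_unit U x X)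

theorem tangentMap_toTangent_injective (p : TotalSpace F A) {ξ ξ' : TangentSpace IA p}
    (h : tangentMap IA (IG).tangent Φ.toTangent ⟨p, ξ⟩ =
      tangentMap IA (IG).tangent Φ.toTangent ⟨p, ξ'⟩) : ξ = ξ' :=
  Φ.toTangentDeriv_injective p (TotalSpace.mk_injective (F := EG × EG)
    (E := (TangentSpace (IG).tangent : TangentBundle IG G → Type _)) (Φ.toTangent p) h)

/-- `K` is the derivative of `δU`. -/
def IsDeltaDerivative (K : ∀ p : TotalSpace F A, TangentSpace IA p →ₗ[ℝ] TangentSpace IA p) : Prop :=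
  ∀ (p : TotalSpace F A) (ξ : TangentSpace IA p),
    tangentMap IA (IG).tangent Φ.toTangent ⟨p, K p ξ⟩ =
      canonicalFlip (tangentMap (IG).tangent (IG).tangent (tensorMap (Φ.delta U))
        (canonicalFlip (tangentMap IA (IG).tangent Φ.toTangent ⟨p, ξ⟩)))

theorem IsDeltaDerivative.isAdapted
    {K : ∀ p : TotalSpace F A, TangentSpace IA p →ₗ[ℝ] TangentSpace IA p}
    (hK : Φ.IsDeltaDerivative U K) : IsAdapted K (lieTriple 𝒜 U) := fun c x X b =>
  Φ.tangentMap_toTangent_injective _ ((hK _ _).trans (Φ.flip_tangentMap_delta U c x X b))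

theorem exists_isDeltaDerivative :
    ∃ K : ∀ p : TotalSpace F A, TangentSpace IA p →ₗ[ℝ] TangentSpace IA p,
      Φ.IsDeltaDerivative U K := by
  suffices h : ∀ p : TotalSpace F A, ∃ K : TangentSpace IA p →ₗ[ℝ] TangentSpace IA p,
      ∀ ξ : TangentSpace IA p, tangentMap IA (IG).tangent Φ.toTangent ⟨p, K ξ⟩ =
        canonicalFlip (tangentMap (IG).tangent (IG).tangent (tensorMap (Φ.delta U))
          (canonicalFlip (tangentMap IA (IG).tangent Φ.toTangent ⟨p, ξ⟩))) by
    choose K hK using h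
    exact ⟨K, hK⟩
  intro p
  obtain ⟨x, v⟩ := p
  obtain ⟨c, hc⟩ := exists_section_apply_eq (IB := 𝓘(ℝ, EM)) (F := F) x v
  subst hc
  obtain ⟨β, hβ⟩ := exists_vertical_part (EM := EM) c x
  obtain ⟨L, hL⟩ := exists_verticalLift_linear (EM := EM) (⟨x, c x⟩ : TotalSpace F A)
  refine ⟨(sectionDeriv c x).toLinearMap ∘ₗ (lieTriple 𝒜 U).TM x ∘ₗ projDeriv _ +
    L ∘ₗ ((lieTriple 𝒜 U).D c x ∘ₗ projDeriv _ + (lieTriple 𝒜 U).ℓ x ∘ₗ β), fun ξ => ?_⟩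
  have h := (Φ.flip_tangentMap_delta U c x (projDeriv _ ξ) (β ξ)).symm
  rw [← hβ ξ, ← hL] at h
  exact h

theorem existsUnique_isDerivative :
    ∃! T : Tensor11 IA (TotalSpace F A), Φ.IsDerivative (Φ.delta U) T := by
  obtain ⟨K, hK⟩ := Φ.exists_isDeltaDerivative U
  refine ⟨⟨K, (IsDeltaDerivative.isAdapted Φ U hK).contMDiff⟩, hK, fun T hT => ?_⟩
  refine BundleMap.ext' fun p ξ => ?_
  exact Φ.tangentMap_toTangent_injective p ((hT p ξ).trans (hK p ξ).symm)

end LieGroupoid.Algebroid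
end Derivative

end

theorem mainTheorem4
    {EM : Type*} [NormedAddCommGroup EM] [NormedSpace ℝ EM] [FiniteDimensional ℝ EM]
    {M : Type*} [TopologicalSpace M] [T2Space M] [SecondCountableTopology M]
    [ChartedSpace EM M] [IsManifold 𝓘(ℝ, EM) ∞ M]
    {EG : Type*} [NormedAddCommGroup EG] [NormedSpace ℝ EG] [FiniteDimensional ℝ EG]
    {G : Type*} [TopologicalSpace G] [ChartedSpace EG G] [IsManifold 𝓘(ℝ, EG) ∞ G]
    {F : Type*} [NormedAddCommGroup F] [NormedSpace ℝ F] [FiniteDimensional ℝ F]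
    {A : M → Type*} [TopologicalSpace (TotalSpace F A)] [∀ x, TopologicalSpace (A x)]
    [FiberBundle F A] [∀ x, AddCommGroup (A x)] [∀ x, Module ℝ (A x)] [VectorBundle ℝ F A]
    [ContMDiffVectorBundle ∞ F A 𝓘(ℝ, EM)]
    (𝒢 : LieGroupoid EM M EG G) (𝒜 : LieAlgebroid EM M F A) (Φ : 𝒢.Algebroid 𝒜)
    (U : BundleMap 𝓘(ℝ, EM) EM (TangentSpace 𝓘(ℝ, EM) : M → Type _) F A) :
    -- `δU` is a smooth tensor, it has a well defined derivative, and `U^↑` is well defined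
    ContMDiff 𝓘(ℝ, EG).tangent 𝓘(ℝ, EG).tangent ∞ (tensorMap (Φ.delta U)) ∧
    (∃! T : Tensor11 (𝓘(ℝ, EM).prod 𝓘(ℝ, F)) (TotalSpace F A), Φ.IsDerivative (Φ.delta U) T) ∧
    (∃! V : ShiftedTensor EM M F A (-1), IsCoreLift U V) ∧
    -- the triple `(𝒟(a) = L^A_a U, ℓ = U ∘ ρ, T^M = ρ ∘ U)`
    ∃ τ : LinearTriple EM M F A,
      (∀ (a : Cₛ^∞⟮𝓘(ℝ, EM); F, A⟯) (X : VectorFields 𝓘(ℝ, EM) M) (x : M),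
        τ.D a x (X x) = 𝒜.bracket a (U.onSection X) x
          - U x (VectorField.mlieBracket 𝓘(ℝ, EM) (𝒜.anchor.onSection a) X x)) ∧
      τ.ℓ = U.comp 𝒜.anchor ∧
      τ.TM = 𝒜.anchor.comp U ∧
      ∀ (T : Tensor11 (𝓘(ℝ, EM).prod 𝓘(ℝ, F)) (TotalSpace F A))
        (V : ShiftedTensor EM M F A (-1)),
        Φ.IsDerivative (Φ.delta U) T → IsCoreLift U V →
          HasTriple T τ ∧
          HasShiftedTriple (V.lie 𝒜.toLieRinehart.d) τ ∧
          ∀ S : ShiftedTensor EM M F A 0, IsShift T S ↔ S = V.lie 𝒜.toLieRinehart.d := by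
  refine ⟨Φ.contMDiff_delta U, Φ.existsUnique_isDerivative U, existsUnique_isCoreLift U,
    lieTriple 𝒜 U, lieTriple_D 𝒜 U, rfl, rfl, fun T V hT hV => ?_⟩
  have h : HasTriple T (lieTriple 𝒜 U) :=
    IsAdapted.hasTriple (LieGroupoid.Algebroid.IsDeltaDerivative.isAdapted Φ U hT)
  exact ⟨h, hasShiftedTriple_lie hV, fun S => isShift_iff h hV S⟩
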